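/- Let $k$ be a field of characteristic $0$, let $Q$ be an essentially smooth $k$-algebra, let $f \in Q$, and let $Z = V(g_1,\dots,g_m)$ be a closed subset of $\operatorname{Spec}(Q)$. Let $mf(Q,f)$ be the $\mathbb{Z}/2$-graded dg-category of matrix factorizations of $f$: its objects are pairs $(P,\delta_P)$ of a finitely generated projective $\mathbb{Z}/2$-graded $Q$-module $P$ and an odd endomorphism $\delta_P$ with $\delta_P^2=f$, its morphism complexes are $\operatorname{Hom}_Q(P,P')$ with differential $\partial\alpha=\delta_{P'}\alpha-(-1)^{|\alpha|}\alpha\delta_P$. Let $mf^Z(Q,f)$ be the full subcategory of those objects $X$ such that $X_{\mathfrak p}$ is contractible for all $\mathfrak p\notin Z$. Its Hochschild complex $HH(mf^Z(Q,f))$, formed with a set of objects that contains a representative of each isomorphism class, is the $\mathbb{Z}/2$-graded complex of $Q$-modules spanned by the elements $\alpha_0[\alpha_1|\cdots|\alpha_n]$ with $\alpha_i\in\operatorname{Hom}(X_{i+1},X_i)$, $X_{n+1}=X_0$, where $Q$ acts through $\alpha_0$. Let $\Psi: HH(mf^Z(Q,f))\to HH(mf^Z(Q,-f))$ be the map induced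 by the duality functor $(P,\delta_P)\mapsto(P^*,-\delta_P^*)$, $\alpha\mapsto\alpha^*$, where $P^*=\operatorname{Hom}_Q(P,Q)$ and $\alpha^*(\gamma)=(-1)^{|\alpha||\gamma|}\gamma\circ\alpha$; explicitly, $$\Psi(\alpha_0[\alpha_1|\cdots|\alpha_n])=(-1)^{n+\sum_{1\le i<j\le n}(|\alpha_i|-1)(|\alpha_j|-1)}\,\alpha_0^*[\alpha_n^*|\cdots|\alpha_1^*].$$ Choose for each object $X_i = (P_i,\delta_i)$ a connection $\nabla_i:P_i\to\Omega^1_{Q/k}\otimes_Q P_i$ that preserves the grading of $P_i$ (so that it has odd degree, $\Omega^1$ being odd). For $\alpha: X_j \to X_i$ put $\alpha'=\nabla_i\alpha-(-1)^{|\alpha|}\alpha\nabla_j$, and put $\delta_i'=\nabla_i\delta_i+\delta_i\nabla_i$. The HKR map $\varepsilon_{Q,f}:HH(mf^Z(Q,f))\to(\Omega^\bullet_{Q/k},-df)$ is $$\varepsilon_{Q,f}(\alpha_0[\alpha_1|\cdots|\alpha_n])=\sum_{e_0,\dots,e_n\ge0}\frac{(-1)^{e_0+\cdots+e_n}}{(n+e_0+\cdots+e_n)!}\operatorname{str}\bigl(\alpha_0(\delta_1')^{e_0}\alpha_1'(\delta_2')^{e_1}\cdots(\delta_n')^{e_{n-1}}\alpha_n'(\delta_0')^{e_n}\bigr),$$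 where $\operatorname{str}$ is the supertrace and $(\Omega^\bullet_{Q/k},-df)$ is the $\mathbb{Z}/2$-folded module of differential forms with left multiplication by $-df$ as differential. Let $D(Q)$ be the derived category of $\mathbb{Z}/2$-graded complexes of $Q$-modules, and let $\mathbb{R}\Gamma_Z$ be given by $\mathcal{C}\otimes_Q-$, where $\mathcal{C}=\bigotimes_i(Q\to Q[1/g_i])$ is the augmented Čech complex. The HKR map with supports $\varepsilon_{Q,f,Z}:HH(mf^Z(Q,f))\to\mathbb{R}\Gamma_Z(\Omega^\bullet_{Q/k},-df)$ is the morphism of $D(Q)$ represented by $$HH(mf^Z(Q,f))\xleftarrow{\ \simeq\ }\mathcal{C}\otimes_QHH(mf^Z(Q,f))\xrightarrow{\mathcal{C}\otimes\varepsilon_{Q,f}}\mathcal{C}\otimes_Q(\Omega^\bullet_{Q/k},-df),$$ where the left arrow is the augmentation. Then all of this is well defined (the Hochschild complexes are complexes of $Q$-modules, $\Psi$, $\varepsilon_{Q,f}$ and $\varepsilon_{Q,-f}$ are $Q$-linear chain maps, and the augmentations are quasi-isomorphisms), and for every choice of connections the diagram $$\begin{array}{ccc}HH(mf^Z(Q,f))&\xrightarrow{\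 \varepsilon_{Q,f,Z}\ }&\mathbb{R}\Gamma_Z(\Omega^\bullet_{Q/k},-df)\\ {\scriptstyle\Psi}\downarrow&&\downarrow{\scriptstyle\gamma}\\ HH(mf^Z(Q,-f))&\xrightarrow{\ \varepsilon_{Q,-f,Z}\ }&\mathbb{R}\Gamma_Z(\Omega^\bullet_{Q/k},df)\end{array}$$ commutes in $D(Q)$, where $\gamma$ is $\mathbb{R}\Gamma_Z$ applied to the map that is multiplication by $(-1)^j$ on $\Omega^j_{Q/k}$ for all $j$. -/

import Mathlib

open CategoryTheory TensorProduct

universe u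

noncomputable section

namespace HKR

/-! ### Signs, and `ℤ/2`-graded complexes of modules -/

/-- The sign `(-1)^p` of a parity `p`. -/
def sgn (p : ZMod 2) : ℤ := if p = 0 then 1 else -1

/-- The category of `ℤ/2`-graded complexes of `Q`-modules. -/
abbrev Cplx (Q : Type u) [CommRing Q] : Type (u + 1) :=
  HomologicalComplex (ModuleCat.{u} Q) (ComplexShape.up (ZMod 2))

/-- Every class of morphisms admits a localized category, in a large enough universe; it is used
for the class of quasi-isomorphisms of `ℤ/2`-graded complexes. -/
instance (Q : Type u) [CommRing Q] :
    (HomologicalComplex.quasiIso (ModuleCat.{u} Q)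
      (ComplexShape.up (ZMod 2))).HasLocalization :=
  MorphismProperty.HasLocalization.standard _

/-- The derived category `D(Q) = D_{ℤ/2}(Q)` of `ℤ/2`-graded complexes of `Q`-modules: the
localization of the category of complexes at the quasi-isomorphisms. -/
abbrev DCat (Q : Type u) [CommRing Q] :=
  HomologicalComplexUpToQuasiIso (ModuleCat.{u} Q) (ComplexShape.up (ZMod 2))

/-- The localization functor from complexes to `D(Q)`. -/
abbrev toD (Q : Type u) [CommRing Q] : Cplx Q ⥤ DCat Q := HomologicalComplexUpToQuasiIso.Q

section Internal

variable {k Q : Type u} [CommRing k] [CommRing Q]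
variable {M : Type u} [AddCommGroup M] [Module k M] [Module Q M]
variable {N : Type u} [AddCommGroup N] [Module k N] [Module Q N]

/-- `d` restricts to a `Q`-linear differential of odd degree on the family `(𝓜 0, 𝓜 1)` of
submodules of `M`, that is, `(𝓜, d)` is a `ℤ/2`-graded complex of `Q`-modules. -/
def IsDifferential (𝓜 : ZMod 2 → Submodule Q M) (d : M →ₗ[k] M) : Prop :=
  ∀ j, ∀ x ∈ 𝓜 j, d x ∈ 𝓜 (j + 1) ∧ d (d x) = 0 ∧ ∀ q : Q, d (q • x) = q • d x

/-- `φ` restricts to a `Q`-linear chain map of even degree from `(𝓜, d)` to `(𝓝, d')`. -/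
def IsChainMap (𝓜 : ZMod 2 → Submodule Q M) (d : M →ₗ[k] M)
    (𝓝 : ZMod 2 → Submodule Q N) (d' : N →ₗ[k] N) (φ : M →ₗ[k] N) : Prop :=
  ∀ j, ∀ x ∈ 𝓜 j, φ x ∈ 𝓝 j ∧ φ (d x) = d' (φ x) ∧ ∀ q : Q, φ (q • x) = q • φ x

/-- The `ℤ/2`-graded complex `𝓜 0 ⇄ 𝓜 1` with differential `d`. -/
def cplx (𝓜 : ZMod 2 → Submodule Q M) (d : M →ₗ[k] M) (h : IsDifferential 𝓜 d) : Cplx Q :=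
  CochainComplex.of (fun j => ModuleCat.of Q (𝓜 j))
    (fun j => ModuleCat.ofHom
      { toFun := fun x => ⟨d x.1, (h j x.1 x.2).1⟩
        map_add' := fun x y => Subtype.ext (d.map_add x.1 y.1)
        map_smul' := fun q x => Subtype.ext ((h j x.1 x.2).2.2 q) })
    (fun j => by
      ext x
      exact (h j x.1 x.2).2.1)

/-- The map of `ℤ/2`-graded complexes given by `φ`. -/
def cplxMap {𝓜 : ZMod 2 → Submodule Q M} {d : M →ₗ[k] M} (h : IsDifferential 𝓜 d)
    {𝓝 : ZMod 2 → Submodule Q N} {d' : N →ₗ[k] N} (h' : IsDifferential 𝓝 d')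
    (φ : M →ₗ[k] N) (hφ : IsChainMap 𝓜 d 𝓝 d' φ) : cplx 𝓜 d h ⟶ cplx 𝓝 d' h' :=
  CochainComplex.ofHom
    (fun j => ModuleCat.ofHom
      { toFun := fun x => ⟨φ x.1, (hφ j x.1 x.2).1⟩
        map_add' := fun x y => Subtype.ext (φ.map_add x.1 y.1)
        map_smul' := fun q x => Subtype.ext ((hφ j x.1 x.2).2.2 q) })
    (fun j => by
      ext x
      simp only [cplx, CochainComplex.of_d]
      exact Subtype.ext (hφ j x.1 x.2).2.1.symm)

end Internal

/-! ### The Čech model of local cohomology -/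

section Cech

variable {Q : Type u} [CommRing Q]

/-- The map `K → Q[1/g] ⊗ K`, `x ↦ 1 ⊗ x`. -/
def toLoc (g : Q) (K : ModuleCat.{u} Q) :
    K ⟶ ModuleCat.of Q (Localization.Away g ⊗[Q] K) :=
  ModuleCat.ofHom (TensorProduct.mk Q (Localization.Away g) K 1)

/-- The map `Q[1/g] ⊗ K → Q[1/g] ⊗ L` induced by `K → L`. -/
def locMap (g : Q) {K L : ModuleCat.{u} Q} (φ : K ⟶ L) :
    ModuleCat.of Q (Localization.Away g ⊗[Q] K) ⟶
      ModuleCat.of Q (Localization.Away g ⊗[Q] L) :=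
  ModuleCat.ofHom (LinearMap.lTensor _ φ.hom)

/-- The differential `(x, y) ↦ (d x, 1 ⊗ x - (id ⊗ d) y)` of the complex `(Q → Q[1/g]) ⊗ K`,
whose part of degree `j` is `K_j ⊕ Q[1/g] ⊗ K_{j-1}`; here `j + 1` is written for `j - 1`. -/
def cechD (g : Q) (K : Cplx Q) (j : ZMod 2) :
    ModuleCat.of Q (K.X j × (Localization.Away g ⊗[Q] K.X (j + 1))) ⟶
    ModuleCat.of Q (K.X (j + 1) × (Localization.Away g ⊗[Q] K.X (j + 1 + 1))) :=
  ModuleCat.ofHom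
    (LinearMap.prod
      ((K.d j (j + 1)).hom ∘ₗ LinearMap.fst Q _ _)
      (((K.XIsoOfEq (show j = j + 1 + 1 by
          rw [add_assoc, CharTwo.add_self_eq_zero, add_zero])).hom ≫
          toLoc g (K.X (j + 1 + 1))).hom ∘ₗ LinearMap.fst Q _ _ -
        (locMap g (K.d (j + 1) (j + 1 + 1))).hom ∘ₗ LinearMap.snd Q _ _))

lemma cechD_fst (g : Q) (K : Cplx Q) (j : ZMod 2)
    (x : K.X j × (Localization.Away g ⊗[Q] K.X (j + 1))) :
    ((cechD g K j).hom x).1 = (K.d j (j + 1)).hom x.1 := rfl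

lemma cechD_snd (g : Q) (K : Cplx Q) (j : ZMod 2) (h : j = j + 1 + 1)
    (x : K.X j × (Localization.Away g ⊗[Q] K.X (j + 1))) :
    ((cechD g K j).hom x).2 =
      (1 : Localization.Away g) ⊗ₜ[Q] (K.XIsoOfEq h).hom.hom x.1 -
        LinearMap.lTensor _ (K.d (j + 1) (j + 1 + 1)).hom x.2 := rfl

lemma cechD_sq (g : Q) (K : Cplx Q) (j : ZMod 2) : cechD g K j ≫ cechD g K (j + 1) = 0 := by
  have e : ∀ i : ZMod 2, i = i + 1 + 1 := fun i => by
    rw [add_assoc, CharTwo.add_self_eq_zero, add_zero]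
  refine ModuleCat.hom_ext (LinearMap.ext fun x => Prod.ext ?_ ?_)
  · rw [ModuleCat.hom_comp, LinearMap.comp_apply, cechD_fst, cechD_fst, ← LinearMap.comp_apply,
      ← ModuleCat.hom_comp, K.d_comp_d]
    rfl
  · rw [ModuleCat.hom_comp, LinearMap.comp_apply, cechD_snd g K (j + 1) (e _), cechD_fst,
      cechD_snd g K j (e _), map_sub, LinearMap.lTensor_tmul, ← LinearMap.comp_apply,
      ← LinearMap.comp_apply, ← ModuleCat.hom_comp, ← ModuleCat.hom_comp,
      K.d_comp_XIsoOfEq_hom, K.XIsoOfEq_hom_comp_d, ← LinearMap.comp_apply,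
      ← LinearMap.lTensor_comp, ← ModuleCat.hom_comp, K.d_comp_d, ModuleCat.hom_zero,
      LinearMap.lTensor_zero, LinearMap.zero_apply, sub_zero, sub_self]
    rfl

/-- The complex `(Q → Q[1/g]) ⊗_Q K`. -/
def cechOneObj (g : Q) (K : Cplx Q) : Cplx Q :=
  CochainComplex.of (fun j => ModuleCat.of Q (K.X j × (Localization.Away g ⊗[Q] K.X (j + 1))))
    (cechD g K) (cechD_sq g K)

/-- The functor `(Q → Q[1/g]) ⊗_Q -` on complexes. -/
def cechOne (g : Q) : Cplx Q ⥤ Cplx Q where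
  obj := cechOneObj g
  map {K L} φ := CochainComplex.ofHom
    (fun j => ModuleCat.ofHom
      (LinearMap.prodMap (φ.f j).hom (locMap g (φ.f (j + 1))).hom))
    (fun j => by
      have e : ∀ i : ZMod 2, i = i + 1 + 1 := fun i => by
        rw [add_assoc, CharTwo.add_self_eq_zero, add_zero]
      simp only [cechOneObj, CochainComplex.of_d]
      refine ModuleCat.hom_ext (LinearMap.ext fun x => Prod.ext ?_ ?_)
      · exact congrArg (fun F => ModuleCat.Hom.hom F x.1) (φ.comm j (j + 1))
      · have h1 : (L.XIsoOfEq (e j)).hom.hom ((φ.f j).hom x.1) =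
            (φ.f (j + 1 + 1)).hom ((K.XIsoOfEq (e j)).hom.hom x.1) :=
          congrArg (fun F => ModuleCat.Hom.hom F x.1)
            (HomologicalComplex.XIsoOfEq_hom_naturality φ (e j))
        have h2 : (L.d (j + 1) (j + 1 + 1)).hom ∘ₗ (φ.f (j + 1)).hom =
            (φ.f (j + 1 + 1)).hom ∘ₗ (K.d (j + 1) (j + 1 + 1)).hom :=
          congrArg ModuleCat.Hom.hom (φ.comm (j + 1) (j + 1 + 1))
        change (1 : Localization.Away g) ⊗ₜ[Q] (L.XIsoOfEq (e j)).hom.hom ((φ.f j).hom x.1) -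
            LinearMap.lTensor _ (L.d (j + 1) (j + 1 + 1)).hom
              (LinearMap.lTensor _ (φ.f (j + 1)).hom x.2) =
          LinearMap.lTensor _ (φ.f (j + 1 + 1)).hom
            ((1 : Localization.Away g) ⊗ₜ[Q] (K.XIsoOfEq (e j)).hom.hom x.1 -
              LinearMap.lTensor _ (K.d (j + 1) (j + 1 + 1)).hom x.2)
        rw [map_sub, LinearMap.lTensor_tmul, h1, ← LinearMap.comp_apply (LinearMap.lTensor _ _),
          ← LinearMap.comp_apply (LinearMap.lTensor _ _), ← LinearMap.lTensor_comp,
          ← LinearMap.lTensor_comp, h2])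
  map_id K := by
    ext j x
    refine Prod.ext rfl ?_
    exact LinearMap.lTensor_id_apply _ _ x.2
  map_comp {K L M} φ ψ := by
    ext j x
    refine Prod.ext rfl ?_
    exact LinearMap.lTensor_comp_apply _ _ _ x.2

/-- The augmentation `(Q → Q[1/g]) ⊗_Q K → K`. -/
def cechOneAug (g : Q) (K : Cplx Q) : (cechOne g).obj K ⟶ K :=
  CochainComplex.ofHom
    (fun j => ModuleCat.ofHom (LinearMap.fst Q (K.X j) (Localization.Away g ⊗[Q] K.X (j + 1))))
    (fun j => by
      dsimp only [cechOne, cechOneObj]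
      rw [CochainComplex.of_d]
      rfl)

/-- The functor `𝒞(g₁, …, g_m) ⊗_Q -`, where `𝒞(g₁, …, g_m) = ⨂_i (Q → Q[1/g_i])` is the augmented
Čech complex. It is a model of `ℝΓ_Z` for `Z = V(g₁, …, g_m)`. -/
def cech : List Q → (Cplx Q ⥤ Cplx Q)
  | [] => 𝟭 _
  | g :: gs => cech gs ⋙ cechOne g

/-- The augmentation `𝒞(g₁, …, g_m) ⊗_Q K → K`. -/
def cechAug : (gs : List Q) → (K : Cplx Q) → ((cech gs).obj K ⟶ K)
  | [], K => 𝟙 K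
  | g :: gs, K => cechOneAug g ((cech gs).obj K) ≫ cechAug gs K

end Cech

/-! ### Matrix factorizations -/

/-- A matrix factorization of `f ∈ Q`: a finitely generated projective `ℤ/2`-graded `Q`-module
`P = gr 0 ⊕ gr 1` with an odd endomorphism `δ` such that `δ² = f`. (The structure of a `k`-module
on `P` is the one given by `k → Q`.) -/
structure MatFac (k : Type u) {Q : Type u} [Field k] [CommRing Q] [Algebra k Q] (f : Q) where
  /-- The underlying module. -/
  P : Type u
  [addCommGroup : AddCommGroup P]
  [module : Module Q P]
  [kmodule : Module k P]
  [tower : IsScalarTower k Q P]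
  [finite : Module.Finite Q P]
  [projective : Module.Projective Q P]
  /-- The homogeneous parts. -/
  gr : ZMod 2 → Submodule Q P
  isCompl : IsCompl (gr 0) (gr 1)
  /-- The twisted differential. -/
  δ : P →ₗ[Q] P
  δ_odd : ∀ s, ∀ x ∈ gr s, δ x ∈ gr (s + 1)
  δ_sq : ∀ x, δ (δ x) = f • x

attribute [instance] MatFac.addCommGroup MatFac.module MatFac.kmodule MatFac.tower
  MatFac.finite MatFac.projective

variable {k Q : Type u} [Field k] [CommRing Q] [Algebra k Q]

namespace MatFac

section

variable {f f' : Q}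

lemma isCompl' (X : MatFac k f) (s : ZMod 2) : IsCompl (X.gr s) (X.gr (s + 1)) := by
  fin_cases s
  · exact X.isCompl
  · exact X.isCompl.symm

/-- The projection of `P` onto its homogeneous part of parity `s`. -/
def proj (X : MatFac k f) (s : ZMod 2) : X.P →ₗ[Q] X.P :=
  (X.gr s).projection (X.gr (s + 1)) (X.isCompl' s)

/-- The `Q`-linear map `α` is homogeneous of parity `p`. -/
def IsHomog (X Y : MatFac k f) (p : ZMod 2) (α : X.P →ₗ[Q] Y.P) : Prop :=
  ∀ s, ∀ x ∈ X.gr s, α x ∈ Y.gr (s + p)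

/-- The homogeneous part of parity `p` of a `Q`-linear map. -/
def homPart (X Y : MatFac k f) (p : ZMod 2) : (X.P →ₗ[Q] Y.P) →ₗ[k] (X.P →ₗ[Q] Y.P) where
  toFun α := ∑ s : ZMod 2, Y.proj (s + p) ∘ₗ α ∘ₗ X.proj s
  map_add' α β := by
    simp only [LinearMap.add_comp, LinearMap.comp_add, Finset.sum_add_distrib]
  map_smul' c α := by
    simp only [LinearMap.smul_comp, LinearMap.comp_smul, Finset.smul_sum, RingHom.id_apply]

/-- The differential `∂α = δ α - (-1)^{|α|} α δ` of `Hom(X, Y)`. -/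
def homD (X Y : MatFac k f) : (X.P →ₗ[Q] Y.P) →ₗ[k] (X.P →ₗ[Q] Y.P) where
  toFun α := Y.δ ∘ₗ α - ∑ p : ZMod 2, sgn p • (homPart X Y p α ∘ₗ X.δ)
  map_add' α β := by
    simp only [LinearMap.add_comp, LinearMap.comp_add, Finset.sum_add_distrib, map_add, smul_add]
    abel
  map_smul' c α := by
    simp only [LinearMap.smul_comp, LinearMap.comp_smul, Finset.smul_sum, RingHom.id_apply,
      map_smul, smul_sub, smul_comm c (sgn _)]

lemma proj_of_mem (X : MatFac k f) {s : ZMod 2} {x : X.P} (hx : x ∈ X.gr s) (t : ZMod 2) :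
    X.proj t x = if t = s then x else 0 := by
  split_ifs with h
  · subst h
    exact Submodule.projection_apply_of_mem_left _ hx
  · have hs : s = t + 1 := by
      have key : ∀ s t : ZMod 2, ¬ t = s → s = t + 1 := by decide
      exact key s t h
    subst hs
    exact Submodule.projection_apply_of_mem_right _ hx

lemma proj_mem (X : MatFac k f) (s : ZMod 2) (x : X.P) : X.proj s x ∈ X.gr s :=
  Submodule.projection_apply_mem _ x

lemma sum_proj (X : MatFac k f) (x : X.P) : X.proj 0 x + X.proj 1 x = x := by
  obtain ⟨y, hy, z, hz, rfl⟩ : ∃ y ∈ X.gr 0, ∃ z ∈ X.gr 1, y + z = x := by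
    rw [← Submodule.mem_sup, X.isCompl.sup_eq_top]
    trivial
  simp [proj_of_mem X hy, proj_of_mem X hz]

lemma homPart_of_isHomog (X Y : MatFac k f) {p : ZMod 2} {α : X.P →ₗ[Q] Y.P}
    (h : IsHomog X Y p α) (t : ZMod 2) : homPart X Y t α = if t = p then α else 0 := by
  have key : ∀ s, Y.proj (s + t) ∘ₗ α ∘ₗ X.proj s = if t = p then α ∘ₗ X.proj s else 0 := by
    intro s
    ext x
    have := proj_of_mem Y (h s _ (X.proj_mem s x)) (s + t)
    simp only [LinearMap.comp_apply, this, add_right_inj]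
    split_ifs <;> rfl
  change ∑ s : ZMod 2, Y.proj (s + t) ∘ₗ α ∘ₗ X.proj s = _
  simp only [key]
  split_ifs
  · ext x
    have h2 : (Finset.univ : Finset (ZMod 2)) = {0, 1} := rfl
    rw [h2, Finset.sum_pair zero_ne_one]
    simp [← map_add, sum_proj]
  · simp

/-- The dual `α^* : Y^* → X^*` of `α : X → Y`, with `α^*(γ) = (-1)^{|α||γ|} γ ∘ α` for homogeneous
`α` and `γ`. -/
def homDual (X Y : MatFac k f) :
    (X.P →ₗ[Q] Y.P) →ₗ[k] (Module.Dual Q Y.P →ₗ[Q] Module.Dual Q X.P) where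
  toFun α := ∑ p : ZMod 2, ∑ s : ZMod 2, sgn (p * s) • (Y.proj s ∘ₗ homPart X Y p α).dualMap
  map_add' α β := by
    simp only [← Finset.sum_add_distrib, ← smul_add]
    congr! 4
    ext γ x
    simp
  map_smul' c α := by
    simp only [Finset.smul_sum, RingHom.id_apply, smul_comm c (sgn _)]
    congr! 4
    ext γ x
    simp

lemma homDual_odd_apply (X : MatFac k f) {α : X.P →ₗ[Q] X.P} (h : IsHomog X X 1 α)
    (γ : Module.Dual Q X.P) (x : X.P) :
    homDual X X α γ x = γ (X.proj 0 (α x)) - γ (X.proj 1 (α x)) := by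
  have h2 : (Finset.univ : Finset (ZMod 2)) = {0, 1} := rfl
  change (∑ p : ZMod 2, ∑ s : ZMod 2, sgn (p * s) • (X.proj s ∘ₗ homPart X X p α).dualMap) γ x = _
  simp only [homPart_of_isHomog X X h]
  rw [h2, Finset.sum_pair zero_ne_one, Finset.sum_pair zero_ne_one, Finset.sum_pair zero_ne_one]
  simp [sgn, sub_eq_add_neg]

/-- The dual `D(X) = (P^*, -δ^*)` of a matrix factorization `X = (P, δ)` of `f`, a matrix
factorization of `-f`. Here `P^* = Hom_Q(P, Q)`, where `γ` is homogeneous of parity `s` if it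
vanishes on the elements of parity `s + 1`. -/
def dual (X : MatFac k f) : MatFac k (-f) where
  P := Module.Dual Q X.P
  gr s := (X.gr (s + 1)).dualAnnihilator
  isCompl := by
    have h10 : (1 : ZMod 2) + 1 = 0 := rfl
    rw [zero_add, h10]
    refine IsCompl.of_eq ?_ ?_
    · rw [eq_bot_iff]
      rintro γ ⟨h1, h0⟩
      rw [SetLike.mem_coe, Submodule.mem_dualAnnihilator] at h0 h1
      ext x
      rw [← X.sum_proj x, map_add, h0 _ (X.proj_mem 0 x), h1 _ (X.proj_mem 1 x)]
      simp
    · rw [eq_top_iff]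
      rintro γ -
      rw [Submodule.mem_sup]
      refine ⟨γ ∘ₗ X.proj 0, ?_, γ ∘ₗ X.proj 1, ?_, ?_⟩
      · rw [Submodule.mem_dualAnnihilator]
        intro x hx
        simp [X.proj_of_mem hx]
      · rw [Submodule.mem_dualAnnihilator]
        intro x hx
        simp [X.proj_of_mem hx]
      · ext x
        simp [← map_add, X.sum_proj]
  δ := -homDual X X X.δ
  δ_odd := by
    intro s γ hγ
    rw [Submodule.mem_dualAnnihilator] at hγ ⊢
    intro x hx
    have hx' := X.δ_odd _ x hx
    rw [LinearMap.neg_apply, LinearMap.neg_apply, homDual_odd_apply X X.δ_odd,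
      X.proj_of_mem hx', X.proj_of_mem hx']
    have e : s + 1 + 1 + 1 = s + 1 := by
      rw [add_assoc (s + 1), CharTwo.add_self_eq_zero, add_zero]
    rw [e] at hx' ⊢
    have := hγ _ hx'
    split_ifs <;> simp [this]
  δ_sq := by
    intro γ
    have key : ∀ x s, x ∈ X.gr s →
        (-homDual X X X.δ) ((-homDual X X X.δ) γ) x = ((-f) • γ) x := by
      intro x s hx
      have h1 := X.δ_odd _ x hx
      have h2 := X.δ_odd _ _ h1
      have h3 : X.δ (X.δ x) = f • x := X.δ_sq x
      have e : s + 1 + 1 = s := by rw [add_assoc, CharTwo.add_self_eq_zero, add_zero]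
      rw [e] at h2
      have e0 : ∀ s : ZMod 2, s = 0 ∨ s = 1 := by decide
      simp only [LinearMap.neg_apply, map_neg, neg_neg, homDual_odd_apply X X.δ_odd]
      obtain rfl | rfl := e0 s
      · rw [zero_add] at h1
        simp only [X.proj_of_mem h1, zero_ne_one, if_false, if_true, map_zero,
          h3]
        simp [X.proj_of_mem hx]
      · rw [show (1 : ZMod 2) + 1 = 0 from rfl] at h1
        simp only [X.proj_of_mem h1, if_false, if_true, map_zero,
          one_ne_zero, h3]
        simp [X.proj_of_mem hx]
    ext x
    rw [← X.sum_proj x, map_add, map_add, key _ 0 (X.proj_mem 0 x), key _ 1 (X.proj_mem 1 x)]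

/-- The dualization functor on morphisms, `α ↦ α^*`, as a map `Hom(X, Y) → Hom(D(Y), D(X))`. -/
def dualHom (X Y : MatFac k f) : (X.P →ₗ[Q] Y.P) →ₗ[k] (Y.dual.P →ₗ[Q] X.dual.P) :=
  homDual X Y

/-- An isomorphism of matrix factorizations: an even `Q`-linear isomorphism that commutes with the
twisted differentials. -/
structure Iso (X Y : MatFac k f) where
  /-- The underlying linear isomorphism. -/
  e : X.P ≃ₗ[Q] Y.P
  even : ∀ s, ∀ x ∈ X.gr s, e x ∈ Y.gr s
  comm : ∀ x, e (X.δ x) = Y.δ (e x)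

/-- The localization `X_𝔭` is a contractible matrix factorization over `Q_𝔭`: there is an odd
endomorphism `h` with `h δ + δ h = id`. -/
def ContractibleAt (X : MatFac k f) (p : PrimeSpectrum Q) : Prop :=
  ∃ h : LocalizedModule p.asIdeal.primeCompl X.P →ₗ[Localization p.asIdeal.primeCompl]
      LocalizedModule p.asIdeal.primeCompl X.P,
    (∀ s, ∀ x ∈ (X.gr s).localized p.asIdeal.primeCompl,
      h x ∈ (X.gr (s + 1)).localized p.asIdeal.primeCompl) ∧
    ∀ x, h (LocalizedModule.map p.asIdeal.primeCompl X.δ x) +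
      LocalizedModule.map p.asIdeal.primeCompl X.δ (h x) = x

/-- The support of a matrix factorization. -/
def supp (X : MatFac k f) : Set (PrimeSpectrum Q) := {p | ¬ X.ContractibleAt p}

/-- A connection on (the graded module underlying) `X`: a `k`-linear map `∇ : P → Ω¹ ⊗ P` which
satisfies the Leibniz rule and has odd degree, `Ω¹` being placed in odd degree. -/
structure Connection (X : MatFac k f) where
  /-- The underlying map. -/
  D : X.P →ₗ[k] Ω[Q⁄k] ⊗[Q] X.P
  leibniz : ∀ (q : Q) (x : X.P), D (q • x) = KaehlerDifferential.D k Q q ⊗ₜ x + q • D x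
  odd : ∀ s, ∀ x ∈ X.gr s, D x ∈ LinearMap.range (LinearMap.lTensor Ω[Q⁄k] (X.gr s).subtype)

end

end MatFac

/-! ### The category algebra, words, and multilinear algebra -/

section Arrows

open Classical in
/-- The direct sum of all `Hom_Q(M_j, M_i)`, where the summand of index `(i, j)` consists of the
arrows from `M_j` to `M_i`. -/
abbrev Arr (Q : Type u) [CommRing Q] {I : Type u} (M : I → Type u) [∀ i, AddCommGroup (M i)]
    [∀ i, Module Q (M i)] : Type u :=
  Π₀ e : I × I, (M e.2 →ₗ[Q] M e.1)

variable {I : Type u} (M : I → Type u) [∀ i, AddCommGroup (M i)] [∀ i, Module Q (M i)]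
  [∀ i, Module k (M i)] [∀ i, IsScalarTower k Q (M i)]

open Classical in
/-- The arrow `α : M_j → M_i`, as an element of the direct sum of all arrows. -/
def arr (i j : I) (α : M j →ₗ[Q] M i) : Arr Q M :=
  DFinsupp.single (β := fun e : I × I => M e.2 →ₗ[Q] M e.1) (i, j) α

open Classical in
lemma arr_add (i j : I) (α β : M j →ₗ[Q] M i) : arr M i j (α + β) = arr M i j α + arr M i j β :=
  DFinsupp.single_add _ _ _

open Classical in
lemma arr_smul (i j : I) (c : k) (α : M j →ₗ[Q] M i) : arr M i j (c • α) = c • arr M i j α :=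
  DFinsupp.single_smul _ _

open Classical in
/-- The identity `M_i → M_j` if `i = j`, and zero otherwise. -/
def transport (i j : I) : M i →ₗ[Q] M j :=
  DFinsupp.lapply (R := Q) (M := M) j ∘ₗ DFinsupp.lsingle (R := Q) (M := M) i

variable (k) in
open Classical in
/-- Composition of arrows, extended by zero to pairs of arrows that are not composable. -/
def arrMul : Arr Q M →ₗ[k] Arr Q M →ₗ[k] Arr Q M :=
  DFinsupp.lsum (R := k) k fun e : I × I =>
    LinearMap.flip (DFinsupp.lsum (R := k) k fun e' : I × I =>
      LinearMap.flip (LinearMap.mk₂ k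
        (fun (α : M e.2 →ₗ[Q] M e.1) (β : M e'.2 →ₗ[Q] M e'.1) =>
          arr M e.1 e'.2 (α ∘ₗ transport M e'.1 e.2 ∘ₗ β))
        (fun α α' β => by rw [LinearMap.add_comp, arr_add])
        (fun c α β => by rw [LinearMap.smul_comp, arr_smul])
        (fun α β β' => by rw [LinearMap.comp_add, LinearMap.comp_add, arr_add])
        (fun c α β => by rw [LinearMap.comp_smul, LinearMap.comp_smul, arr_smul])))

variable (k) in
/-- The product `a₀ a₁ ⋯ a_n` of `n + 1` arrows. -/
def arrProd : (n : ℕ) → MultilinearMap k (fun _ : Fin (n + 1) => Arr Q M) (Arr Q M)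
  | 0 => MultilinearMap.ofSubsingleton k (Arr Q M) (Arr Q M) (0 : Fin 1) LinearMap.id
  | n + 1 => LinearMap.uncurryLeft
      { toFun := fun a => (arrMul k M a).compMultilinearMap (arrProd n)
        map_add' := fun a b => by ext; simp
        map_smul' := fun c a => by ext; simp }

end Arrows

section Words

variable {H : Type u} [AddCommGroup H] [Module k H] [Module Q H] [SMulCommClass k Q H]
variable {N : Type u} [AddCommGroup N] [Module k N]

variable (k H) in
/-- The words `a₀[a₁|⋯|a_n]` of length `n + 1`: the module `H ⊗ H^{⊗ n}`, on which `Q` acts through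
the factor `a₀`. -/
abbrev Words (n : ℕ) : Type u := H ⊗[k] (⨂[k]^n H)

variable (k H) in
/-- The word `a₀[a₁|⋯|a_n]`, as a multilinear function of `(a₀, …, a_n)`. -/
def word (n : ℕ) : MultilinearMap k (fun _ : Fin (n + 1) => H) (Words k H n) :=
  LinearMap.uncurryLeft
    { toFun := fun a => (TensorProduct.mk k H (⨂[k]^n H) a).compMultilinearMap
        (PiTensorProduct.tprod k)
      map_add' := fun a b => by ext; simp
      map_smul' := fun c a => by ext; simp }

/-- The linear map on words given by a multilinear function of `(a₀, …, a_n)`. -/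
def ofMulti {n : ℕ} (m : MultilinearMap k (fun _ : Fin (n + 1) => H) N) : Words k H n →ₗ[k] N :=
  TensorProduct.lift ((PiTensorProduct.lift : _ ≃ₗ[k] _).toLinearMap ∘ₗ m.curryLeft)

lemma contractNth_update (mul : H →ₗ[k] H →ₗ[k] H) (m : ℕ) (i : Fin (m + 1)) (a : Fin (m + 2) → H)
    (j : Fin (m + 2)) : ∃ (l : Fin (m + 1)) (L : H →ₗ[k] H), ∀ x,
      i.castSucc.contractNth (fun x y => mul x y) (Function.update a j x) =
        Function.update (i.castSucc.contractNth (fun x y => mul x y) a) l (L x) := by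
  rcases lt_trichotomy (j : ℕ) i with h | h | h
  · refine ⟨⟨j, by omega⟩, LinearMap.id, fun x => funext fun t => ?_⟩
    simp only [Fin.contractNth, Function.update_apply, Fin.ext_iff, Fin.val_castSucc, Fin.val_succ,
      LinearMap.id_apply]
    split_ifs <;> first | rfl | omega
  · refine ⟨⟨j, by omega⟩, mul.flip (a i.succ), fun x => funext fun t => ?_⟩
    by_cases ht : (t : ℕ) = i
    · obtain rfl : t = i := Fin.ext ht
      simp [Fin.contractNth, Function.update_apply, Fin.ext_iff, h]
    · simp only [Fin.contractNth, Function.update_apply, Fin.ext_iff, Fin.val_castSucc,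
        Fin.val_succ]
      split_ifs <;> first | rfl | omega
  · by_cases h' : (j : ℕ) = i + 1
    · refine ⟨i, mul (a i.castSucc), fun x => funext fun t => ?_⟩
      by_cases ht : (t : ℕ) = i
      · obtain rfl : t = i := Fin.ext ht
        simp [Fin.contractNth, Function.update_apply, Fin.ext_iff, h']
      · simp only [Fin.contractNth, Function.update_apply, Fin.ext_iff, Fin.val_castSucc,
          Fin.val_succ]
        split_ifs <;> first | rfl | omega
    · refine ⟨⟨j - 1, by omega⟩, LinearMap.id, fun x => funext fun t => ?_⟩
      simp only [Fin.contractNth, Function.update_apply, Fin.ext_iff, Fin.val_castSucc,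
        Fin.val_succ, LinearMap.id_apply]
      split_ifs <;> first | rfl | omega

/-- The function `(a₀, …, a_{m+1}) ↦ a₀[a₁|⋯|a_i a_{i+1}|⋯|a_{m+1}]`. -/
def wordContract (mul : H →ₗ[k] H →ₗ[k] H) (m : ℕ) (i : Fin (m + 1)) :
    MultilinearMap k (fun _ : Fin (m + 2) => H) (Words k H m) where
  toFun a := word k H m (i.castSucc.contractNth (fun x y => mul x y) a)
  map_update_add' {inst} a j x y := by
    obtain rfl : inst = instDecidableEqFin (m + 2) := Subsingleton.elim _ _
    obtain ⟨l, L, h⟩ := contractNth_update mul m i a j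
    rw [h, h, h, map_add, MultilinearMap.map_update_add]
  map_update_smul' {inst} a j c x := by
    obtain rfl : inst = instDecidableEqFin (m + 2) := Subsingleton.elim _ _
    obtain ⟨l, L, h⟩ := contractNth_update mul m i a j
    rw [h, h, map_smul, MultilinearMap.map_update_smul]

lemma ofMulti_word {n : ℕ} (m : MultilinearMap k (fun _ : Fin (n + 1) => H) N) (a : Fin (n + 1) → H) :
    ofMulti m (word k H n a) = m a := by
  simp [ofMulti, word]

variable (k H) in
/-- The module of all words. -/
abbrev AllWords : Type u := DirectSum ℕ (Words k H)

/-- The word `a₀[a₁|⋯|a_n]` in the module of all words. -/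
def allWord (n : ℕ) : MultilinearMap k (fun _ : Fin (n + 1) => H) (AllWords k H) :=
  (DirectSum.lof k ℕ (Words k H) n).compMultilinearMap (word k H n)

/-- The Hochschild differential `b₁` induced by a differential `d`: for homogeneous `a_i`,
`b₁(a₀[a₁|⋯|a_n]) = ∑_i (-1)^{|a₀| + ⋯ + |a_{i-1}| - i} a₀[a₁|⋯|d a_i|⋯|a_n]`. Here `part p` is the
projection onto the part of parity `p`. -/
def wordB1 (part : ZMod 2 → H →ₗ[k] H) (d : H →ₗ[k] H) (n : ℕ) : Words k H n →ₗ[k] Words k H n :=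
  ofMulti (∑ p : Fin (n + 1) → ZMod 2, ∑ i : Fin (n + 1),
    sgn (∑ l ∈ Finset.Iio i, p l - ((i : ℕ) : ZMod 2)) •
      (word k H n).compLinearMap (fun l => if l = i then d ∘ₗ part (p l) else part (p l)))

/-- The Hochschild differential `b₂` on words with `n + 1 ≥ 2` letters, for `n = m + 1`: for
homogeneous `a_i`,
`b₂(a₀[a₁|⋯|a_n]) = ∑_{i<n} (-1)^{|a₀| + ⋯ + |a_i| - i} a₀[a₁|⋯|a_i a_{i+1}|⋯|a_n]
  - (-1)^{(|a_n| - 1)(|a₀| + ⋯ + |a_{n-1}| - (n - 1))} a_n a₀[a₁|⋯|a_{n-1}]`. -/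
def wordB2 (part : ZMod 2 → H →ₗ[k] H) (mul : H →ₗ[k] H →ₗ[k] H) (m : ℕ) :
    Words k H (m + 1) →ₗ[k] Words k H m :=
  ofMulti (∑ p : Fin (m + 2) → ZMod 2,
    ((∑ i : Fin (m + 1), sgn (∑ l ∈ Finset.Iic i.castSucc, p l - ((i : ℕ) : ZMod 2)) •
        wordContract mul m i) -
      sgn ((p (Fin.last (m + 1)) - 1) *
          (∑ l ∈ Finset.Iio (Fin.last (m + 1)), p l - (m : ZMod 2))) •
        (wordContract mul m 0).domDomCongr (finRotate (m + 2)).symm).compLinearMap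
      fun l => part (p l))

/-- The Hochschild differential `b = b₂ + b₁`. -/
def wordB (part : ZMod 2 → H →ₗ[k] H) (mul : H →ₗ[k] H →ₗ[k] H) (d : H →ₗ[k] H) :
    AllWords k H →ₗ[k] AllWords k H :=
  DirectSum.toModule k ℕ _ fun
    | 0 => DirectSum.lof k ℕ (Words k H) 0 ∘ₗ wordB1 part d 0
    | m + 1 => DirectSum.lof k ℕ (Words k H) m ∘ₗ wordB2 part mul m +
        DirectSum.lof k ℕ (Words k H) (m + 1) ∘ₗ wordB1 part d (m + 1)

/-- The map induced by an operation `a ↦ a^*`: for homogeneous `a_i`, `a₀[a₁|⋯|a_n]` is sent to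
`(-1)^{n + ∑_{1 ≤ i < j ≤ n} (|a_i| - 1)(|a_j| - 1)} a₀^*[a_n^*|⋯|a₁^*]`. -/
def wordReverse {H' : Type u} [AddCommGroup H'] [Module k H'] (part : ZMod 2 → H →ₗ[k] H)
    (star : H →ₗ[k] H') (n : ℕ) : Words k H n →ₗ[k] Words k H' n :=
  ofMulti (∑ p : Fin (n + 1) → ZMod 2,
    sgn ((n : ZMod 2) + ∑ j : Fin (n + 1), ∑ i ∈ Finset.Ioo 0 j, (p i - 1) * (p j - 1)) •
      ((word k H' n).domDomCongr (Equiv.neg (Fin (n + 1)))).compLinearMap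
        fun l => star ∘ₗ part (p l))

end Words

/-! ### Hochschild complexes of categories of matrix factorizations -/

section Hochschild

variable {f : Q} {I : Type u} (X : I → MatFac k f)

/-- The category algebra of the full subcategory on the objects `X i`. -/
abbrev HArr : Type u := Arr Q fun i => (X i).P

/-- The homogeneous part of parity `p` of an element of the category algebra. -/
def arrPart (p : ZMod 2) : HArr X →ₗ[k] HArr X :=
  DFinsupp.mapRange.linearMap fun e => MatFac.homPart (X e.2) (X e.1) p

/-- The differential of the category algebra. -/
def arrD : HArr X →ₗ[k] HArr X :=
  DFinsupp.mapRange.linearMap fun e => MatFac.homD (X e.2) (X e.1)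

/-- The underlying module of the Hochschild complex in degree `j`: it is spanned by the words
`α₀[α₁|⋯|α_n]` of homogeneous maps `α_i : X_{i+1} → X_i` (indices modulo `n + 1`) with
`|α₀| + ⋯ + |α_n| - n = j`. Since `k` is a field, this is the direct sum over all `n` and all
`(X_0, …, X_n)` of the parts of degree `j` of
`Hom(X_1, X_0) ⊗ Σ Hom(X_2, X_1) ⊗ ⋯ ⊗ Σ Hom(X_0, X_n)`. -/
def hochGr (j : ZMod 2) : Submodule Q (AllWords k (HArr X)) :=
  Submodule.span Q
    {w | ∃ (n : ℕ) (x : Fin (n + 1) → I) (p : Fin (n + 1) → ZMod 2)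
      (α : ∀ i : Fin (n + 1), (X (x (i + 1))).P →ₗ[Q] (X (x i)).P),
      (∀ i, MatFac.IsHomog (X (x (i + 1))) (X (x i)) (p i) (α i)) ∧
      ∑ i, p i - (n : ZMod 2) = j ∧
      w = allWord n fun i => arr (fun i => (X i).P) (x i) (x (i + 1)) (α i)}

/-- The Hochschild differential of the full subcategory on the objects `X i` (the curvature is
zero, so that there is no component `b₀`). -/
def hochB : AllWords k (HArr X) →ₗ[k] AllWords k (HArr X) :=
  wordB (arrPart X) (arrMul k fun i => (X i).P) (arrD X)

/-- The Hochschild complex of the full subcategory on the objects `X i`, as a `ℤ/2`-graded complex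
of `Q`-modules. -/
def HH (h : IsDifferential (hochGr X) (hochB X)) : Cplx Q := cplx (hochGr X) (hochB X) h

end Hochschild

/-! ### The duality map -/

section Duality

variable {f : Q} {I J : Type u} (X : I → MatFac k f) (Y : J → MatFac k (-f)) (σ : I → J)
  (u : ∀ i, MatFac.Iso (X i).dual (Y (σ i)))

open Classical in
/-- The map that sends `α : X_j → X_i` to `α^* : D(X_i) → D(X_j)`, where `D(X_i)` is identified with
`Y_{σ(i)}` through `u_i`. -/
def arrDual : HArr X →ₗ[k] HArr Y :=
  DFinsupp.lsum (R := k) k fun e : I × I =>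
    { toFun := fun α => arr (fun j => (Y j).P) (σ e.2) (σ e.1)
        ((u e.2).e.toLinearMap ∘ₗ MatFac.dualHom (X e.2) (X e.1) α ∘ₗ (u e.1).e.symm.toLinearMap)
      map_add' := fun α β => by
        rw [map_add, LinearMap.add_comp, LinearMap.comp_add, arr_add]
      map_smul' := fun c α => by
        rw [map_smul, LinearMap.smul_comp, LinearMap.comp_smul, arr_smul, RingHom.id_apply] }

/-- The map `Ψ`: for homogeneous `a_i`, `Ψ(a₀[a₁|⋯|a_n]) =
(-1)^{n + ∑_{1 ≤ i < j ≤ n} (|a_i| - 1)(|a_j| - 1)} a₀^*[a_n^*|⋯|a₁^*]`. -/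
def psi : AllWords k (HArr X) →ₗ[k] AllWords k (HArr Y) :=
  DirectSum.toModule k ℕ _ fun n =>
    DirectSum.lof k ℕ (Words k (HArr Y)) n ∘ₗ wordReverse (arrPart X) (arrDual X Y σ u) n

end Duality

/-! ### Differential forms and the HKR map -/

section Forms

variable (k Q) in
/-- The algebra `Ω^• = ⨁_j Ω^j` of differential forms. -/
abbrev Forms : Type u := ExteriorAlgebra Q Ω[Q⁄k]

variable (k Q) in
/-- The `ℤ/2`-folding: `⨁_j Ω^{2j}` and `⨁_j Ω^{2j+1}`. -/
def formsGr (s : ZMod 2) : Submodule Q (Forms k Q) :=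
  CliffordAlgebra.evenOdd (0 : QuadraticForm Q Ω[Q⁄k]) s

/-- Left multiplication by the one-form `dq` on differential forms. -/
def formsD (q : Q) : Forms k Q →ₗ[k] Forms k Q :=
  (LinearMap.mulLeft Q (ExteriorAlgebra.ι Q (KaehlerDifferential.D k Q q))).restrictScalars k

lemma formsD_isDifferential (q : Q) : IsDifferential (formsGr k Q) (formsD (k := k) q) := by
  intro j x hx
  refine ⟨?_, ?_, ?_⟩
  · rw [add_comm]
    exact CliffordAlgebra.evenOdd_mul_le _ 1 j
      (Submodule.mul_mem_mul (CliffordAlgebra.ι_mem_evenOdd_one _ _) hx)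
  · change ExteriorAlgebra.ι Q _ * (ExteriorAlgebra.ι Q _ * x) = 0
    rw [← mul_assoc, ExteriorAlgebra.ι_sq_zero, zero_mul]
  · intro r
    exact (LinearMap.mulLeft Q (ExteriorAlgebra.ι Q (KaehlerDifferential.D k Q q))).map_smul r x

variable (k) in
/-- The complex `(Ω^•, dq)`. -/
def formsCplx (q : Q) : Cplx Q := cplx (formsGr k Q) (formsD (k := k) q) (formsD_isDifferential q)

variable (k Q) in
/-- The `Q`-algebra automorphism of `Ω^•` that is multiplication by `-1` on `Ω¹`. -/
def gammaHom : Forms k Q →ₐ[Q] Forms k Q := CliffordAlgebra.involute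

/-- On `Ω^j`, the map `gammaHom` is multiplication by `(-1)^j`. -/
lemma gammaHom_apply (j : ℕ) (x : Forms k Q) (hx : x ∈ ⋀[Q]^j Ω[Q⁄k]) :
    gammaHom k Q x = (-1 : Q) ^ j • x := by
  rw [← ExteriorAlgebra.ιMulti_span_fixedDegree] at hx
  induction hx using Submodule.span_induction with
  | mem y hy =>
    obtain ⟨v, rfl⟩ := hy
    rw [ExteriorAlgebra.ιMulti_apply]
    have := CliffordAlgebra.involute_prod_map_ι (Q := (0 : QuadraticForm Q Ω[Q⁄k])) (List.ofFn v)
    simpa [List.map_ofFn, gammaHom, Function.comp_def] using this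
  | zero => simp
  | add y z _ _ hy hz => rw [map_add, hy, hz, smul_add]
  | smul r y _ hy => rw [map_smul, hy, smul_comm]

lemma gammaHom_isChainMap (q : Q) : IsChainMap (formsGr k Q) (formsD (k := k) q) (formsGr k Q)
    (formsD (k := k) (-q)) ((gammaHom k Q).toLinearMap.restrictScalars k) := by
  intro j x hx
  refine ⟨?_, ?_, ?_⟩
  · have := CliffordAlgebra.evenOdd_map_involute (0 : QuadraticForm Q Ω[Q⁄k]) j
    rw [formsGr, ← this]
    exact Submodule.mem_map_of_mem hx
  · change gammaHom k Q (ExteriorAlgebra.ι Q (KaehlerDifferential.D k Q q) * x) =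
      ExteriorAlgebra.ι Q (KaehlerDifferential.D k Q (-q)) * gammaHom k Q x
    have : gammaHom k Q (ExteriorAlgebra.ι Q (KaehlerDifferential.D k Q q)) =
        ExteriorAlgebra.ι Q (KaehlerDifferential.D k Q (-q)) := by
      refine (CliffordAlgebra.involute_ι _).trans ?_
      rw [map_neg, map_neg]
    rw [map_mul, this]
  · intro r
    exact map_smul (gammaHom k Q) r x

variable (k) in
/-- The map of complexes `γ : (Ω^•, dq) → (Ω^•, -dq)` that is multiplication by `(-1)^j` on `Ω^j`. -/
def gamma (q : Q) : formsCplx k q ⟶ formsCplx k (-q) :=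
  cplxMap _ _ _ (gammaHom_isChainMap q)

end Forms

section HKRMap

variable {P : Type u} [AddCommGroup P] [Module Q P]
variable {P' : Type u} [AddCommGroup P'] [Module Q P']

/-- For `φ : P → Ω^• ⊗ P'` of total parity `s`, the `Ω^•`-linear extension
`Ω^• ⊗ P → Ω^• ⊗ P'`, `ω ⊗ x ↦ (-1)^{s|ω|} ω φ(x)`. -/
def extend [Module k P'] [IsScalarTower k Q P'] (s : ZMod 2) :
    (P →ₗ[Q] Forms k Q ⊗[Q] P') →ₗ[k] (Forms k Q ⊗[Q] P →ₗ[Q] Forms k Q ⊗[Q] P') where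
  toFun φ := (LinearMap.mul' Q (Forms k Q)).rTensor P' ∘ₗ
    (TensorProduct.assoc Q (Forms k Q) (Forms k Q) P').symm.toLinearMap ∘ₗ
    TensorProduct.map (if s = 0 then LinearMap.id else (gammaHom k Q).toLinearMap) φ
  map_add' φ ψ := by
    simp only [TensorProduct.map_add_right, LinearMap.comp_add]
  map_smul' c φ := by
    rw [← algebraMap_smul Q c φ, TensorProduct.map_smul_right, LinearMap.comp_smul,
      LinearMap.comp_smul, algebraMap_smul, RingHom.id_apply]

/-- The trace `Hom_Q(P, Ω^• ⊗ P) ≅ P^* ⊗ (Ω^• ⊗ P) → Ω^•`, `γ ⊗ (ω ⊗ x) ↦ γ(x) ω`, for a finitely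
generated projective module `P`. -/
def traceForms [Module.Finite Q P] [Module.Projective Q P] :
    (P →ₗ[Q] Forms k Q ⊗[Q] P) →ₗ[Q] Forms k Q :=
  TensorProduct.lift
      (LinearMap.compRight Q (TensorProduct.rid Q (Forms k Q)).toLinearMap ∘ₗ
        LinearMap.lTensorHom (R := Q) (N := P) (P := Q) (Forms k Q)) ∘ₗ
    (LinearEquiv.ofBijective (dualTensorHom Q P (Forms k Q ⊗[Q] P))
      dualTensorHom_bijective).symm.toLinearMap

namespace MatFac

variable {f : Q} (X Y : MatFac k f) (cX : X.Connection) (cY : Y.Connection)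

/-- The commutator `α' = ∇_Y α - (-1)^{|α|} α ∇_X : P_X → Ω¹ ⊗ P_Y ⊆ Ω^• ⊗ P_Y`, where a homogeneous
`α` acts on `Ω¹ ⊗ P_X` by `ω ⊗ x ↦ (-1)^{|α|} ω ⊗ α(x)`, so that `(-1)^{|α|} α ∇_X = (id ⊗ α) ∇_X`. -/
def deriv : (X.P →ₗ[Q] Y.P) →ₗ[k] (X.P →ₗ[Q] Forms k Q ⊗[Q] Y.P) where
  toFun α := (ExteriorAlgebra.ι Q).rTensor Y.P ∘ₗ
    { toFun := fun x => cY.D (α x) - α.lTensor Ω[Q⁄k] (cX.D x)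
      map_add' := fun x y => by simp only [map_add]; abel
      map_smul' := fun q x => by
        simp [cX.leibniz, cY.leibniz, smul_sub] }
  map_add' α β := by
    rw [← LinearMap.comp_add]
    congr 1
    ext x
    simp only [LinearMap.coe_mk, AddHom.coe_mk, LinearMap.add_apply, map_add,
      LinearMap.lTensor_add]
    abel
  map_smul' c α := by
    rw [RingHom.id_apply, ← LinearMap.comp_smul]
    congr 1
    ext x
    have h : (c • α).lTensor Ω[Q⁄k] = c • α.lTensor Ω[Q⁄k] := by
      rw [← algebraMap_smul Q c α, LinearMap.lTensor_smul, algebraMap_smul]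
    simp [smul_sub, h]

/-- The operator `ω ⊗ x ↦ (-1)^{|α||ω|} ω ⊗ α(x)` on differential forms given by `α`. -/
def opForms : (X.P →ₗ[Q] Y.P) →ₗ[k] (Forms k Q ⊗[Q] X.P →ₗ[Q] Forms k Q ⊗[Q] Y.P) where
  toFun α := ∑ p : ZMod 2, extend p (TensorProduct.mk Q (Forms k Q) Y.P 1 ∘ₗ homPart X Y p α)
  map_add' α β := by
    simp only [map_add, LinearMap.comp_add, Finset.sum_add_distrib]
  map_smul' c α := by
    simp only [map_smul, Finset.smul_sum, RingHom.id_apply, LinearMap.comp_smul]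

/-- The operator on differential forms given by `α'`. -/
def opDeriv : (X.P →ₗ[Q] Y.P) →ₗ[k] (Forms k Q ⊗[Q] X.P →ₗ[Q] Forms k Q ⊗[Q] Y.P) :=
  ∑ p : ZMod 2, extend (p + 1) ∘ₗ deriv X Y cX cY ∘ₗ homPart X Y p

/-- The supertrace of an operator `Φ` on `Ω^• ⊗ P`: on `ω ⊗ α` it is `str(α) ω`, where
`str(α) = tr(α|_{P_0}) - tr(α|_{P_1})` for even `α`, and `str(α) = 0` for odd `α`. -/
def str (Φ : Forms k Q ⊗[Q] X.P →ₗ[Q] Forms k Q ⊗[Q] X.P) : Forms k Q :=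
  traceForms (Φ ∘ₗ TensorProduct.mk Q (Forms k Q) X.P 1 ∘ₗ X.proj 0) -
    traceForms (Φ ∘ₗ TensorProduct.mk Q (Forms k Q) X.P 1 ∘ₗ X.proj 1)

end MatFac

variable {f : Q} {I : Type u} (X : I → MatFac k f) (c : ∀ i, (X i).Connection)

/-- The category algebra of the modules `Ω^• ⊗ P_i`. -/
abbrev FArr : Type u := Arr Q fun i => Forms k Q ⊗[Q] (X i).P

/-- The operator `δ_i' = [∇_i, δ_i]` on `Ω^• ⊗ P_i`. -/
def deltaPrime (i : I) : Module.End Q (Forms k Q ⊗[Q] (X i).P) :=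
  MatFac.opDeriv (X i) (X i) (c i) (c i) (X i).δ

/-- The factor `α₀ (δ')^e` (for `l = 0`) or `α_l' (δ')^e` (for `l ≠ 0`), where `δ'` belongs to the
source of `α_l`. -/
def factor {n : ℕ} (l : Fin (n + 1)) (e : ℕ) : HArr X →ₗ[k] FArr X :=
  DFinsupp.mapRange.linearMap fun a =>
    LinearMap.lcomp k _ (deltaPrime X c a.2 ^ e) ∘ₗ
      (if l = 0 then MatFac.opForms (X a.2) (X a.1)
        else MatFac.opDeriv (X a.2) (X a.1) (c a.2) (c a.1))

open Classical in
/-- The supertrace on the category algebra: it is `str` on endomorphisms, and zero on the arrows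
between different objects. -/
def arrStr : FArr X →ₗ[k] Forms k Q :=
  DFinsupp.lsum (R := k) k fun a =>
    { toFun := fun Φ => MatFac.str (X a.1) (Φ ∘ₗ transport (fun i => Forms k Q ⊗[Q] (X i).P) a.1 a.2)
      map_add' := fun Φ Φ' => by
        simp only [MatFac.str, LinearMap.add_comp, map_add]
        abel
      map_smul' := fun r Φ => by
        simp only [MatFac.str, LinearMap.smul_comp, RingHom.id_apply, smul_sub]
        rw [← algebraMap_smul Q r, ← algebraMap_smul Q r, map_smul, map_smul,
          algebraMap_smul, algebraMap_smul] }

/-- The HKR map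
`α₀[α₁|⋯|α_n] ↦ ∑_{e₀, …, e_n ≥ 0} (-1)^{e₀ + ⋯ + e_n} / (n + e₀ + ⋯ + e_n)! ·
  str(α₀ (δ₁')^{e₀} α₁' (δ₂')^{e₁} α₂' ⋯ (δ_n')^{e_{n-1}} α_n' (δ₀')^{e_n})`, where
`α_i : X_{i+1} → X_i`. Only finitely many terms of the sum are nonzero, since `Ω^j = 0` for
large `j`. -/
def hkr : AllWords k (HArr X) →ₗ[k] Forms k Q :=
  DirectSum.toModule k ℕ _ fun n => ofMulti (∑ᶠ e : Fin (n + 1) → ℕ,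
    ((-1 : k) ^ (∑ i, e i) * ((n + ∑ i, e i).factorial : k)⁻¹) •
      (arrStr X).compMultilinearMap
        ((arrProd k (fun i => Forms k Q ⊗[Q] (X i).P) n).compLinearMap
          fun l => factor X c l (e l)))

end HKRMap

/-! ### The HKR map with supports -/

section Supports

variable {f : Q} {I : Type u}

/-- The objects `X i` form a small model of `mf^Z(Q, f)`: they are supported in `Z`, and every matrix
factorization of `f` that is supported in `Z` is isomorphic to at least one of them. (In particular,
one may take exactly one object from each isomorphism class.) -/
structure IsModel (Z : Set (PrimeSpectrum Q)) (X : I → MatFac k f) : Prop where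
  supp_subset : ∀ i, (X i).supp ⊆ Z
  complete : ∀ M : MatFac k f, M.supp ⊆ Z → ∃ i, Nonempty (MatFac.Iso M (X i))

variable (X : I → MatFac k f) (c : ∀ i, (X i).Connection)

/-- `ε` is a map of complexes from the Hochschild complex to `(Ω^•, -df)`. -/
def IsHKRChainMap : Prop :=
  IsChainMap (hochGr X) (hochB X) (formsGr k Q) (formsD (k := k) (-f)) (hkr X c)

/-- The HKR map `ε`, as a map of complexes `HH → (Ω^•, -df)`. -/
def hkrMap (h : IsDifferential (hochGr X) (hochB X)) (hc : IsHKRChainMap X c) :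
    HH X h ⟶ formsCplx k (-f) :=
  cplxMap h (formsD_isDifferential (-f)) (hkr X c) hc

/-- The HKR map with supports `HH → ℝΓ_Z(Ω^•, -df)` in `D(Q)`, for `Z = V(g₁, …, g_m)`. It is
represented by `HH ← 𝒞 ⊗ HH → 𝒞 ⊗ (Ω^•, -df)`, where the first map is the augmentation, a
quasi-isomorphism, and the second one is induced by `ε`. -/
def hkrZ (gs : List Q) (h : IsDifferential (hochGr X) (hochB X)) (hc : IsHKRChainMap X c)
    (hs : QuasiIso (cechAug gs (HH X h))) :
    (toD Q).obj (HH X h) ⟶ (toD Q).obj ((cech gs).obj (formsCplx k (-f))) :=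
  haveI : IsIso ((toD Q).map (cechAug gs (HH X h))) :=
    (HomologicalComplexUpToQuasiIso.isIso_Q_map_iff_mem_quasiIso _).2
      ((HomologicalComplex.mem_quasiIso_iff _).2 hs)
  inv ((toD Q).map (cechAug gs (HH X h))) ≫ (toD Q).map ((cech gs).map (hkrMap X c h hc))

end Supports

end HKR
end

noncomputable section

namespace HKR

set_option linter.unusedSectionVars false

/-! The square commutes already before passing to supports, for a suitable choice of connections,
and the HKR map does not depend on the connections up to homotopy. The argument has four independent
ingredients.

Generating operators. Put `G = (1 + δ')⁻¹`, a finite geometric series because forms of high degree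
vanish. Expanding every `G` in `F = α₀ G α₁' G ⋯ α_n' G` produces exactly the products in the HKR
formula, and the coefficient `1 / (n + ∑ e)!` depends only on the form degree of the term. Hence `ε`
is the supertrace of `F` followed by division by `N!` on `Ω^N` (`hkr_eq`). Let `ω = df = [δ', δ]`,
let `ν` be the number operator and let `b'` be the Hochschild differential without its cyclic term.
Induction on the last letter gives `F(b' w) = δ F(w) ± F(w) δ - ω (ν F(w) - F(w) ν + F(w)) ± T(w)`
(`IsHKRSystem.opW_linW`), where in `T` the last letter is undifferentiated and not followed by `G`.
Under the supertrace the first two terms cancel, `T` cancels against the cyclic term, and `[ν, -] +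
1` is the factor `N + 1` that turns `1 / (N + 1)!` into `1 / N!`. So `ε` is a chain map. Only a
short list of identities enters, collected in `IsHKRSystem`.

Independence of the connections. Two connections differ by a linear operator `A`. The two systems of
operators fit into one system of upper triangular 2×2 matrices with `-A` off the diagonal of `δ'`
and `-1` off the diagonal of `δ` (`IsHKRSystem.triangular`). The formula above holds for these
matrices as well; its off-diagonal entry says that the off-diagonal entry of `F` is a homotopy
between the two HKR maps (`hkrHtpy_hochB`).

Duality. The map `Ψ` reverses the letters after the first one. For every connection on a dual object
there is a dual connection on the object itself, determined by `d⟨γ, x⟩ = ⟨∇γ, x⟩ + ⟨γ, ∇x⟩`. With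
these connections the signed transposition `ω ⊗ α ↦ (-1)^{|ω|} ω ⊗ α^*` is an anti-homomorphism up
to signs. It carries `α'` to `-(α^*)'` and `δ'` to the `δ'` of the dual object, since the
differential of the dual is `-δ^*`. Supertraces are changed by `γ`. Therefore `ε ∘ Ψ = γ ∘ ε` holds
on the nose (`hkr_psi`). That `Ψ` is a chain map is a separate comparison of recursions from the
right and from the left (`IsStar.revW_wordB`).

Supports. A point where `X` is contractible yields, after clearing denominators, an element `q`
outside the prime such that `q` is homotopic to zero on `X`. Hence some power of each `g_i` is
homotopic to zero on each object supported in `Z`. Left multiplication by such a homotopy contracts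
the Hochschild complex up to shorter words, so its homology is `g_i`-power torsion
(`exists_hochB_eq`). For such complexes the augmentation of the Čech complex is a quasi-isomorphism
(`quasiIso_cechAug`).

The conclusion follows by naturality of the augmentation and because homotopic maps agree in `D(Q)`,
also after applying the Čech functor. -/

lemma sgn_add (a b : ZMod 2) : sgn (a + b) = sgn a * sgn b := by revert a b; decide

lemma sgn_zero : sgn 0 = 1 := rfl

lemma sgn_one : sgn 1 = -1 := rfl

lemma sgn_mul_self (a : ZMod 2) : sgn a * sgn a = 1 := by revert a; decide

/-! ### Operators on words, and the Hochschild differential under appending a letter -/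

section WordOperators

variable {k : Type u} [Field k]
variable {H : Type u} [AddCommGroup H] [Module k H]
variable {N : Type u} [AddCommGroup N] [Module k N]

/-- The linear map on words given by multilinear functions of the letters. -/
def wordsLift (m : ∀ n, MultilinearMap k (fun _ : Fin (n + 1) => H) N) : AllWords k H →ₗ[k] N :=
  DirectSum.toModule k ℕ N fun n => ofMulti (m n)

lemma toModule_allWord (F : ∀ n, Words k H n →ₗ[k] N) (n : ℕ) (a : Fin (n + 1) → H) :
    DirectSum.toModule k ℕ N F (allWord n a) = F n (word k H n a) :=
  DirectSum.toModule_lof k n _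

@[simp]
lemma wordsLift_allWord (m : ∀ n, MultilinearMap k (fun _ : Fin (n + 1) => H) N) (n : ℕ)
    (a : Fin (n + 1) → H) : wordsLift m (allWord n a) = m n a := by
  rw [wordsLift, toModule_allWord, ofMulti_word]

lemma allWords_hom_ext {f g : AllWords k H →ₗ[k] N}
    (h : ∀ n (a : Fin (n + 1) → H), f (allWord n a) = g (allWord n a)) : f = g := by
  refine DirectSum.linearMap_ext k fun n => TensorProduct.ext (LinearMap.ext fun a =>
    PiTensorProduct.ext (MultilinearMap.ext fun v => ?_))
  have := h n (Fin.cons a v)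
  simpa [allWord, word, LinearMap.uncurryLeft_apply] using this

/-- The operator `a₀[a₁|⋯|a_n] ↦ a₀[a₁|⋯|a_n|x]`. -/
def appendW : H →ₗ[k] Module.End k (AllWords k H) where
  toFun x := wordsLift fun n =>
    (LinearMap.applyₗ x).compMultilinearMap (allWord (k := k) (n + 1)).curryRight
  map_add' x y := allWords_hom_ext fun n a => by simp
  map_smul' c x := allWords_hom_ext fun n a => by simp

@[simp]
lemma appendW_allWord (x : H) (n : ℕ) (a : Fin (n + 1) → H) :
    appendW (k := k) x (allWord n a) = allWord (n + 1) (Fin.snoc a x) := by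
  simp [appendW]

/-- The operator that applies `φ` to the first letter. -/
def mapFirstW (φ : H →ₗ[k] H) : Module.End k (AllWords k H) :=
  wordsLift fun n => (allWord n).compLinearMap fun l => if l = 0 then φ else LinearMap.id

/-- The operator that applies `φ` to the last letter. -/
def mapLastW (φ : H →ₗ[k] H) : Module.End k (AllWords k H) :=
  wordsLift fun n => (allWord n).compLinearMap fun l => if l = Fin.last n then φ else LinearMap.id

lemma mapFirstW_zero (φ : H →ₗ[k] H) (a : Fin 1 → H) :
    mapFirstW φ (allWord 0 a) = allWord 0 fun _ => φ (a 0) := by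
  rw [mapFirstW, wordsLift_allWord]
  refine congrArg (allWord 0) (funext fun l => ?_)
  obtain rfl : l = 0 := Fin.fin_one_eq_zero l
  simp

lemma mapLastW_zero (φ : H →ₗ[k] H) (a : Fin 1 → H) :
    mapLastW φ (allWord 0 a) = allWord 0 fun _ => φ (a 0) := by
  rw [mapLastW, wordsLift_allWord]
  refine congrArg (allWord 0) (funext fun l => ?_)
  obtain rfl : l = 0 := Fin.fin_one_eq_zero l
  simp

lemma mapFirstW_appendW (φ : H →ₗ[k] H) (x : H) (w : AllWords k H) :
    mapFirstW φ (appendW x w) = appendW x (mapFirstW φ w) := by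
  refine LinearMap.congr_fun (f := mapFirstW φ ∘ₗ appendW x) (g := appendW x ∘ₗ mapFirstW φ)
    (allWords_hom_ext fun n a => ?_) w
  simp only [LinearMap.comp_apply, appendW_allWord, mapFirstW, wordsLift_allWord,
    MultilinearMap.compLinearMap_apply]
  refine congrArg (allWord (n + 1)) (funext fun l => ?_)
  refine Fin.lastCases ?_ (fun l => ?_) l
  · simp [Fin.last_eq_zero_iff]
  · simp [Fin.castSucc_eq_zero_iff]

lemma mapLastW_appendW (φ : H →ₗ[k] H) (x : H) (w : AllWords k H) :
    mapLastW φ (appendW x w) = appendW (φ x) w := by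
  refine LinearMap.congr_fun (f := mapLastW φ ∘ₗ appendW x) (g := appendW (φ x))
    (allWords_hom_ext fun n a => ?_) w
  simp only [LinearMap.comp_apply, appendW_allWord, mapLastW, wordsLift_allWord,
    MultilinearMap.compLinearMap_apply]
  refine congrArg (allWord (n + 1)) (funext fun l => ?_)
  refine Fin.lastCases ?_ (fun l => ?_) l
  · simp
  · simp [Fin.castSucc_ne_last]

/-- The operator `a₀[a₁|⋯|a_n] ↦ d(a₀)[a₁|⋯|a_n] + ⋯`, the part `b₁` of the Hochschild
differential. -/
def b1W (part : ZMod 2 → H →ₗ[k] H) (d : H →ₗ[k] H) : Module.End k (AllWords k H) :=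
  DirectSum.toModule k ℕ _ fun n => DirectSum.lof k ℕ (Words k H) n ∘ₗ wordB1 part d n

/-- The part of the Hochschild differential `b₂` that does not involve the cyclic rotation. -/
def barW (part : ZMod 2 → H →ₗ[k] H) (mul : H →ₗ[k] H →ₗ[k] H) : Module.End k (AllWords k H) :=
  DirectSum.toModule k ℕ _ fun
    | 0 => 0
    | m + 1 => DirectSum.lof k ℕ (Words k H) m ∘ₗ ofMulti (∑ p : Fin (m + 2) → ZMod 2,
      (∑ i : Fin (m + 1), sgn (∑ l ∈ Finset.Iic i.castSucc, p l - ((i : ℕ) : ZMod 2)) •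
        wordContract mul m i).compLinearMap fun l => part (p l))

/-- The cyclic rotation term of the Hochschild differential `b₂`. -/
def cycW (part : ZMod 2 → H →ₗ[k] H) (mul : H →ₗ[k] H →ₗ[k] H) : Module.End k (AllWords k H) :=
  DirectSum.toModule k ℕ _ fun
    | 0 => 0
    | m + 1 => DirectSum.lof k ℕ (Words k H) m ∘ₗ ofMulti (∑ p : Fin (m + 2) → ZMod 2,
      (-(sgn ((p (Fin.last (m + 1)) - 1) *
          (∑ l ∈ Finset.Iio (Fin.last (m + 1)), p l - (m : ZMod 2))) •
        (wordContract mul m 0).domDomCongr (finRotate (m + 2)).symm)).compLinearMap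
          fun l => part (p l))

lemma ofMulti_add {n : ℕ} (m m' : MultilinearMap k (fun _ : Fin (n + 1) => H) N) :
    ofMulti (m + m') = ofMulti m + ofMulti m' := by
  refine TensorProduct.ext (LinearMap.ext fun a =>
    PiTensorProduct.ext (MultilinearMap.ext fun v => ?_))
  simp [ofMulti]

/-- Only the cyclic term sees both ends of a word. The other two parts have recursions in the last
letter alone, which is why they are separated from it. -/
lemma wordB_eq (part : ZMod 2 → H →ₗ[k] H) (mul : H →ₗ[k] H →ₗ[k] H) (d : H →ₗ[k] H) :
    wordB part mul d = b1W part d + (barW part mul + cycW part mul) := by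
  refine DirectSum.linearMap_ext k fun n => ?_
  cases n with
  | zero =>
    refine LinearMap.ext fun x => ?_
    simp [wordB, b1W, barW, cycW]
  | succ m =>
    refine LinearMap.ext fun x => ?_
    simp only [wordB, b1W, barW, cycW, LinearMap.comp_apply, LinearMap.add_apply,
      DirectSum.toModule_lof]
    rw [← map_add, ← LinearMap.add_apply, ← ofMulti_add, ← Finset.sum_add_distrib, add_comm]
    congr 4

/-- The letters `a_l` are homogeneous of parities `p_l`. -/
def HomLetters (part : ZMod 2 → H →ₗ[k] H) {n : ℕ} (p : Fin n → ZMod 2) (a : Fin n → H) : Prop :=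
  ∀ l q, part q (a l) = if q = p l then a l else 0

/-- Operations with Koszul signs are defined by summing over all vectors of parities and projecting
each letter. On homogeneous letters any wrong parity makes one letter zero, so a single summand
survives. -/
lemma HomLetters.sum_part {part : ZMod 2 → H →ₗ[k] H} {n : ℕ} {p : Fin (n + 1) → ZMod 2}
    {a : Fin (n + 1) → H} (h : HomLetters part p a)
    (F : (Fin (n + 1) → ZMod 2) → MultilinearMap k (fun _ : Fin (n + 1) => H) N) :
    (∑ q, (F q).compLinearMap fun l => part (q l)) a = F p a := by
  rw [sum_apply, Finset.sum_eq_single p]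
  · rw [MultilinearMap.compLinearMap_apply]
    congr 1
    funext l
    rw [h, if_pos rfl]
  · intro q _ hq
    obtain ⟨l, hl⟩ := Function.ne_iff.1 hq
    rw [MultilinearMap.compLinearMap_apply]
    refine (F q).map_coord_zero l ?_
    rw [h, if_neg hl]
  · simp

lemma HomLetters.snoc {part : ZMod 2 → H →ₗ[k] H} {n : ℕ} {p : Fin n → ZMod 2}
    {a : Fin n → H} (h : HomLetters part p a) {q : ZMod 2} {x : H}
    (hx : ∀ r, part r x = if r = q then x else 0) :
    HomLetters part (Fin.snoc p q : Fin (n + 1) → ZMod 2) (Fin.snoc a x : Fin (n + 1) → H) := by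
  intro l
  refine Fin.lastCases ?_ (fun l => ?_) l
  · simpa using hx
  · simpa using h l

lemma b1W_allWord {part : ZMod 2 → H →ₗ[k] H} (d : H →ₗ[k] H) {n : ℕ} {p : Fin (n + 1) → ZMod 2}
    {a : Fin (n + 1) → H} (h : HomLetters part p a) :
    b1W part d (allWord n a) = ∑ i : Fin (n + 1),
      sgn (∑ l ∈ Finset.Iio i, p l - ((i : ℕ) : ZMod 2)) •
        allWord n (fun l => if l = i then d (a l) else a l) := by
  rw [b1W, toModule_allWord, LinearMap.comp_apply, wordB1, ofMulti_word]
  have key : (∑ p : Fin (n + 1) → ZMod 2, ∑ i : Fin (n + 1),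
      sgn (∑ l ∈ Finset.Iio i, p l - ((i : ℕ) : ZMod 2)) •
        (word k H n).compLinearMap (fun l => if l = i then d ∘ₗ part (p l) else part (p l))) a =
      (∑ q : Fin (n + 1) → ZMod 2, (∑ i : Fin (n + 1),
      sgn (∑ l ∈ Finset.Iio i, q l - ((i : ℕ) : ZMod 2)) •
        (word k H n).compLinearMap (fun l => if l = i then d else LinearMap.id)).compLinearMap
          fun l => part (q l)) a := by
    congr 1
    refine Finset.sum_congr rfl fun q _ => MultilinearMap.ext fun v => ?_
    simp only [sum_apply, MultilinearMap.compLinearMap_apply]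
    refine Finset.sum_congr rfl fun i _ => ?_
    rw [smul_apply, smul_apply, MultilinearMap.compLinearMap_apply,
      MultilinearMap.compLinearMap_apply]
    congr 2
    funext l
    split_ifs <;> rfl
  rw [key, h.sum_part, sum_apply, map_sum]
  refine Finset.sum_congr rfl fun i _ => ?_
  rw [smul_apply, map_zsmul, MultilinearMap.compLinearMap_apply, allWord,
    LinearMap.compMultilinearMap_apply]
  congr 3
  funext l
  split_ifs <;> rfl

/-- The sign of each old term depends only on the letters to its left, so appending `x` does not
change it. The only new term differentiates `x` itself, past all the shifted letters of the word. -/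
lemma b1W_appendW {part : ZMod 2 → H →ₗ[k] H} (d : H →ₗ[k] H) {n : ℕ} {p : Fin (n + 1) → ZMod 2}
    {a : Fin (n + 1) → H} (h : HomLetters part p a) {q : ZMod 2} {x : H}
    (hx : ∀ r, part r x = if r = q then x else 0) :
    b1W part d (appendW x (allWord n a)) = appendW x (b1W part d (allWord n a)) +
      sgn (∑ l, (p l + 1)) • appendW (d x) (allWord n a) := by
  rw [appendW_allWord, b1W_allWord d (h.snoc hx), b1W_allWord d h, map_sum,
    Fin.sum_univ_castSucc]
  congr 1
  · refine Finset.sum_congr rfl fun i _ => ?_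
    rw [map_zsmul, appendW_allWord]
    congr 1
    · rw [Fin.Iio_castSucc, Finset.sum_map]
      simp
    · refine congrArg (allWord (n + 1)) (funext fun l => ?_)
      refine Fin.lastCases ?_ (fun l => ?_) l
      · simp [(Fin.castSucc_ne_last _).symm]
      · simp
  · rw [appendW_allWord]
    congr 1
    · rw [Fin.Iio_last_eq_map, Finset.sum_map, Finset.sum_add_distrib, sub_eq_add_neg]
      simp [ZMod.neg_eq_self_mod_two, add_comm]
    · refine congrArg (allWord (n + 1)) (funext fun l => ?_)
      refine Fin.lastCases ?_ (fun l => ?_) l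
      · simp
      · simp [Fin.castSucc_ne_last]

lemma b1W_zero {part : ZMod 2 → H →ₗ[k] H} (d : H →ₗ[k] H) {p : ZMod 2} {a : H}
    (h : ∀ r, part r a = if r = p then a else 0) :
    b1W part d (allWord 0 fun _ => a) = allWord 0 fun _ => d a := by
  rw [b1W_allWord d (p := fun _ => p) (fun _ => h)]
  simp only [Nat.reduceAdd, Finset.univ_unique, Finset.sum_singleton]
  rw [show (default : Fin 1) = 0 from rfl, show Finset.Iio (0 : Fin 1) = ∅ from rfl]
  simp only [Finset.sum_empty, Fin.val_zero, Nat.cast_zero, sub_zero, sgn_zero, one_smul]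
  refine congrArg (allWord 0) (funext fun l => ?_)
  rw [if_pos (Fin.fin_one_eq_zero l)]

lemma barW_zero (part : ZMod 2 → H →ₗ[k] H) (mul : H →ₗ[k] H →ₗ[k] H) (a : Fin 1 → H) :
    barW part mul (allWord 0 a) = 0 := by
  rw [barW, toModule_allWord]; rfl

lemma cycW_zero (part : ZMod 2 → H →ₗ[k] H) (mul : H →ₗ[k] H →ₗ[k] H) (a : Fin 1 → H) :
    cycW part mul (allWord 0 a) = 0 := by
  rw [cycW, toModule_allWord]; rfl

lemma barW_succ {part : ZMod 2 → H →ₗ[k] H} (mul : H →ₗ[k] H →ₗ[k] H) {m : ℕ}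
    {p : Fin (m + 2) → ZMod 2} {a : Fin (m + 2) → H} (h : HomLetters part p a) :
    barW part mul (allWord (m + 1) a) = ∑ i : Fin (m + 1),
      sgn (∑ l ∈ Finset.Iic i.castSucc, p l - ((i : ℕ) : ZMod 2)) •
        allWord m (i.castSucc.contractNth (fun x y => mul x y) a) := by
  rw [barW, toModule_allWord, LinearMap.comp_apply, ofMulti_word, h.sum_part, sum_apply, map_sum]
  refine Finset.sum_congr rfl fun i _ => ?_
  rw [smul_apply, map_zsmul]
  rfl

lemma contractNth_snoc_castSucc {A : Type u} (f : A → A → A) {m : ℕ} (i : Fin (m + 1))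
    (a : Fin (m + 2) → A) (x : A) : i.castSucc.castSucc.contractNth f (Fin.snoc a x : Fin (m + 3) → A) =
      (Fin.snoc (i.castSucc.contractNth f a) x : Fin (m + 2) → A) := by
  funext t
  refine Fin.lastCases ?_ (fun t => ?_) t
  · have : ¬ (m + 1 < (i : ℕ)) := by omega
    have h2 : m + 1 ≠ (i : ℕ) := by omega
    simp [Fin.contractNth, this, h2]
  · simp only [Fin.contractNth, Fin.val_castSucc, Fin.snoc_castSucc, Fin.succ_castSucc]

lemma contractNth_snoc_last {A : Type u} (f : A → A → A) {m : ℕ} (a : Fin (m + 1) → A) (x : A) :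
    (Fin.last m).castSucc.contractNth f (Fin.snoc a x : Fin (m + 2) → A) =
      fun l => if l = Fin.last m then f (a l) x else a l := by
  funext t
  refine Fin.lastCases ?_ (fun t => ?_) t
  · simp [Fin.contractNth, Fin.succ_last]
  · have : (t : ℕ) < m := t.2
    simp [Fin.contractNth, this, Fin.castSucc_ne_last]

/-- As for `b1W_appendW`, the old terms keep their signs. The only new product is that of the former
last letter with `x`; the sign counts one shift fewer than `∑ (p l + 1)`, whence the minus. -/
lemma barW_appendW {part : ZMod 2 → H →ₗ[k] H} (mul : H →ₗ[k] H →ₗ[k] H) {n : ℕ}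
    {p : Fin (n + 1) → ZMod 2}
    {a : Fin (n + 1) → H} (h : HomLetters part p a) {q : ZMod 2} {x : H}
    (hx : ∀ r, part r x = if r = q then x else 0) :
    barW part mul (appendW x (allWord n a)) = appendW x (barW part mul (allWord n a)) -
      sgn (∑ l, (p l + 1)) • mapLastW (mul.flip x) (allWord n a) := by
  rw [appendW_allWord, barW_succ mul (h.snoc hx), Fin.sum_univ_castSucc,
    sub_eq_add_neg (appendW x _)]
  congr 1
  · cases n with
    | zero => simp [barW_zero]
    | succ m =>
      rw [barW_succ mul h, map_sum]
      refine Finset.sum_congr rfl fun i _ => ?_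
      rw [map_zsmul, appendW_allWord, contractNth_snoc_castSucc]
      congr 2
      rw [← Fin.map_castSuccEmb_Iic, Finset.sum_map]
      simp
  · rw [contractNth_snoc_last, ← neg_smul, mapLastW, wordsLift_allWord,
      MultilinearMap.compLinearMap_apply]
    congr 1
    · rw [← Fin.map_castSuccEmb_Iic, Finset.sum_map, ← neg_one_mul, ← sgn_one, ← sgn_add,
        Finset.sum_add_distrib, sub_eq_add_neg]
      congr 1
      rw [show Finset.Iic (Fin.last n) = Finset.univ from Finset.Iic_top]
      simp only [Fin.snoc_castSucc, Fin.val_last, ZMod.neg_eq_self_mod_two, Finset.sum_const,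
        Finset.card_univ, Fintype.card_fin, nsmul_eq_mul, mul_one, Nat.cast_add, Nat.cast_one,
        Fin.castSuccEmb_apply]
      have h2 : (2 : ZMod 2) = 0 := rfl
      linear_combination -h2
    · refine congrArg (allWord n) (funext fun l => ?_)
      split_ifs <;> rfl

/-- The rotation brings `x` to the front, where it is multiplied with the first letter. On a word
that ends in `x` the cyclic term is thus left multiplication by `x`. The sign is that of moving the
shifted `x` past the word, whose first letter is not shifted. -/
lemma cycW_appendW {part : ZMod 2 → H →ₗ[k] H} (mul : H →ₗ[k] H →ₗ[k] H) {n : ℕ}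
    {p : Fin (n + 1) → ZMod 2}
    {a : Fin (n + 1) → H} (h : HomLetters part p a) {q : ZMod 2} {x : H}
    (hx : ∀ r, part r x = if r = q then x else 0) :
    cycW part mul (appendW x (allWord n a)) =
      -(sgn ((q + 1) * (∑ l, (p l + 1) + 1)) • mapFirstW (mul x) (allWord n a)) := by
  rw [appendW_allWord, cycW, toModule_allWord, LinearMap.comp_apply, ofMulti_word,
    (h.snoc hx).sum_part, neg_apply, smul_apply, map_neg, map_zsmul,
    mapFirstW, wordsLift_allWord, MultilinearMap.compLinearMap_apply]
  congr 2
  · rw [Fin.Iio_last_eq_map, Finset.sum_map, Finset.sum_add_distrib, sub_eq_add_neg]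
    simp [ZMod.neg_eq_self_mod_two, sub_eq_add_neg, add_assoc, CharTwo.add_self_eq_zero]
  · change allWord n _ = _
    refine congrArg (allWord n) (funext fun l => ?_)
    refine Fin.cases ?_ (fun l => ?_) l
    · have h0 : (finRotate (n + 2)).symm 0 = Fin.last (n + 1) := by
        rw [Equiv.symm_apply_eq, finRotate_last]
      have h1 : (finRotate (n + 2)).symm 1 = 0 := by
        rw [Equiv.symm_apply_eq]; simp
      have h2 : (Fin.snoc a x : Fin (n + 2) → H) 0 = a 0 :=
        Fin.snoc_castSucc (α := fun _ => H) x a 0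
      simp [Fin.contractNth, h0, h1, h2]
    · have h1 : (finRotate (n + 2)).symm l.succ.succ = l.succ.castSucc := by
        rw [Equiv.symm_apply_eq, finRotate_apply, Fin.coeSucc_eq_succ]
      simp [Fin.contractNth, h1, -Fin.castSucc_succ]

end WordOperators

/-! ### Composable words in a differential graded category -/

section Paths

variable {k Q : Type u} [Field k] [CommRing Q]
variable {H : Type u} [AddCommGroup H] [Module k H] [Module Q H] [SMulCommClass k Q H]
variable {N : Type u} [AddCommGroup N] [Module k N] [Module Q N]
variable {I : Type u}

/-- The submodules `𝓗 i j p` of `H` consist of the homogeneous arrows of parity `p` from `j` to `i`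
of a differential graded category over `Q`. -/
structure IsDG (part : ZMod 2 → H →ₗ[k] H) (mul : H →ₗ[k] H →ₗ[k] H) (d : H →ₗ[k] H)
    (𝓗 : I → I → ZMod 2 → Submodule Q H) : Prop where
  part_mem : ∀ {i j p a}, a ∈ 𝓗 i j p → ∀ r, part r a = if r = p then a else 0
  d_mem : ∀ {i j p a}, a ∈ 𝓗 i j p → d a ∈ 𝓗 i j (p + 1)
  mul_mem : ∀ {i j l p q a b}, a ∈ 𝓗 i j p → b ∈ 𝓗 j l q → mul a b ∈ 𝓗 i l (p + q)
  d_d : ∀ {i j p a}, a ∈ 𝓗 i j p → d (d a) = 0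
  leibniz : ∀ {i j l p q a b}, a ∈ 𝓗 i j p → b ∈ 𝓗 j l q →
    d (mul a b) = mul (d a) b + sgn p • mul a (d b)
  assoc : ∀ {i j l m p q r a b c}, a ∈ 𝓗 i j p → b ∈ 𝓗 j l q → c ∈ 𝓗 l m r →
    mul (mul a b) c = mul a (mul b c)
  d_smul : ∀ (q : Q) a, d (q • a) = q • d a
  mul_smul_left : ∀ (q : Q) a b, mul (q • a) b = q • mul a b
  mul_smul_right : ∀ (q : Q) a b, mul a (q • b) = q • mul a b

/-- The words of length `n + 1` of composable arrows from `j` to `i`; the index `σ` is the sum of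
the shifted parities of the letters. -/
inductive IsPath (𝓗 : I → I → ZMod 2 → Submodule Q H) :
    ℕ → I → I → ZMod 2 → AllWords k H → Prop
  | base {i j : I} {p σ : ZMod 2} {a : H} (ha : a ∈ 𝓗 i j p) (hσ : σ = p + 1) :
      IsPath 𝓗 0 i j σ (allWord 0 fun _ => a)
  | snoc {n : ℕ} {i j l : I} {σ q τ : ZMod 2} {w : AllWords k H} {x : H}
      (hw : IsPath 𝓗 n i j σ w) (hx : x ∈ 𝓗 j l q) (hτ : τ = σ + (q + 1)) :
      IsPath 𝓗 (n + 1) i l τ (appendW x w)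

/-- The additive group generated by the paths. -/
def pathSpan (𝓗 : I → I → ZMod 2 → Submodule Q H) (n : ℕ) (i j : I) (σ : ZMod 2) :
    AddSubgroup (AllWords k H) :=
  AddSubgroup.closure {w | IsPath 𝓗 n i j σ w}

variable {part : ZMod 2 → H →ₗ[k] H} {mul : H →ₗ[k] H →ₗ[k] H} {d : H →ₗ[k] H}
  {𝓗 : I → I → ZMod 2 → Submodule Q H}

lemma IsPath.mem {n : ℕ} {i j : I} {σ : ZMod 2} {w : AllWords k H} (h : IsPath 𝓗 n i j σ w) :
    w ∈ pathSpan 𝓗 n i j σ := AddSubgroup.subset_closure h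

lemma smul_allWord (q : Q) (n : ℕ) (a : Fin (n + 1) → H) :
    q • allWord (k := k) n a = allWord n fun l => if l = 0 then q • a l else a l := by
  have : (q • word k H n a : Words k H n) = word k H n fun l => if l = 0 then q • a l else a l := by
    simp only [word, LinearMap.uncurryLeft_apply, LinearMap.coe_mk, AddHom.coe_mk,
      LinearMap.compMultilinearMap_apply, TensorProduct.mk_apply, TensorProduct.smul_tmul', if_true]
    congr 2
  rw [allWord, LinearMap.compMultilinearMap_apply, LinearMap.compMultilinearMap_apply, ← this]
  exact ((DirectSum.lof Q ℕ (Words k H) n).map_smul q _).symm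

instance : SMulCommClass Q k (AllWords k H) where
  smul_comm q c w := by
    refine DFinsupp.ext fun n => ?_
    change q • c • w n = c • q • w n
    generalize w n = x
    induction x using TensorProduct.induction_on with
    | zero => simp
    | tmul a v => simp only [TensorProduct.smul_tmul', (smul_comm c q a).symm]
    | add x y hx hy => simp only [smul_add, hx, hy]

lemma appendW_smul (q : Q) (x : H) (w : AllWords k H) :
    appendW x (q • w) = q • appendW x w := by
  refine LinearMap.congr_fun (f := appendW x ∘ₗ DistribSMul.toLinearMap k _ q)
    (g := DistribSMul.toLinearMap k _ q ∘ₗ appendW x) (allWords_hom_ext fun n a => ?_) w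
  simp only [LinearMap.comp_apply, DistribSMul.toLinearMap_apply, smul_allWord, appendW_allWord]
  refine congrArg (allWord (n + 1)) (funext fun l => ?_)
  refine Fin.lastCases ?_ (fun l => ?_) l
  · simp [Fin.last_eq_zero_iff]
  · simp [Fin.castSucc_eq_zero_iff]

lemma mapFirstW_smul {φ : H →ₗ[k] H} (hφ : ∀ (q : Q) a, φ (q • a) = q • φ a) (q : Q)
    (w : AllWords k H) : mapFirstW φ (q • w) = q • mapFirstW φ w := by
  refine LinearMap.congr_fun (f := mapFirstW φ ∘ₗ DistribSMul.toLinearMap k _ q)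
    (g := DistribSMul.toLinearMap k _ q ∘ₗ mapFirstW φ) (allWords_hom_ext fun n a => ?_) w
  simp only [LinearMap.comp_apply, DistribSMul.toLinearMap_apply, smul_allWord, mapFirstW,
    wordsLift_allWord, MultilinearMap.compLinearMap_apply]
  refine congrArg (allWord n) (funext fun l => ?_)
  split_ifs <;> simp [hφ]

lemma mapLastW_smul {φ : H →ₗ[k] H} (hφ : ∀ (q : Q) a, φ (q • a) = q • φ a) (q : Q)
    (w : AllWords k H) : mapLastW φ (q • w) = q • mapLastW φ w := by
  refine LinearMap.congr_fun (f := mapLastW φ ∘ₗ DistribSMul.toLinearMap k _ q)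
    (g := DistribSMul.toLinearMap k _ q ∘ₗ mapLastW φ) (allWords_hom_ext fun n a => ?_) w
  simp only [LinearMap.comp_apply, DistribSMul.toLinearMap_apply, smul_allWord, mapLastW,
    wordsLift_allWord, MultilinearMap.compLinearMap_apply]
  refine congrArg (allWord n) (funext fun l => ?_)
  split_ifs <;> simp [hφ]

lemma IsPath.smul (q : Q) {n : ℕ} {i j : I} {σ : ZMod 2} {w : AllWords k H}
    (h : IsPath 𝓗 n i j σ w) : IsPath 𝓗 n i j σ (q • w) := by
  induction h with
  | base ha hσ =>
    rw [smul_allWord]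
    convert IsPath.base ((𝓗 _ _ _).smul_mem q ha) hσ using 3 with l
    exact if_pos (Fin.fin_one_eq_zero l)
  | snoc hw hx hτ ih =>
    rw [← appendW_smul]
    exact .snoc ih hx hτ

lemma IsDG.exists_letters (h : IsDG part mul d 𝓗) {n : ℕ} {i j : I} {σ : ZMod 2}
    {w : AllWords k H} (hw : IsPath 𝓗 n i j σ w) :
    ∃ (p : Fin (n + 1) → ZMod 2) (a : Fin (n + 1) → H), HomLetters part p a ∧ w = allWord n a ∧
      σ = ∑ l, (p l + 1) := by
  induction hw with
  | base ha hσ => exact ⟨fun _ => _, fun _ => _, fun _ => h.part_mem ha, rfl, by simp [hσ]⟩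
  | snoc hw hx hτ ih =>
    obtain ⟨p, a, h1, rfl, rfl⟩ := ih
    refine ⟨_, _, h1.snoc (h.part_mem hx), appendW_allWord _ _ _, ?_⟩
    rw [hτ, Fin.sum_univ_castSucc (n := _ + 1)]
    simp only [Fin.snoc_castSucc, Fin.snoc_last]

/-- An additive statement about words holds on the span of the paths if it holds for paths. -/
lemma pathSpan_hom_eq {n : ℕ} {i j : I} {σ : ZMod 2} {f g : AllWords k H →+ N}
    (hfg : ∀ w, IsPath 𝓗 n i j σ w → f w = g w) {w : AllWords k H}
    (hw : w ∈ pathSpan 𝓗 n i j σ) : f w = g w :=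
  AddMonoidHom.eqOn_closure (f := f) (g := g) (fun w hw => hfg w hw) hw

lemma pathSpan_hom_mem {n : ℕ} {i j : I} {σ : ZMod 2} {f : AllWords k H →ₗ[k] N}
    {S : AddSubgroup N} (hf : ∀ w, IsPath 𝓗 n i j σ w → f w ∈ S) {w : AllWords k H}
    (hw : w ∈ pathSpan 𝓗 n i j σ) : f w ∈ S :=
  (AddSubgroup.closure_le (S.comap f.toAddMonoidHom)).2 hf hw

namespace IsDG

variable {n : ℕ} {i j l : I} {σ q : ZMod 2} {w : AllWords k H} {x : H}

lemma appendW_mem (hw : w ∈ pathSpan 𝓗 n i j σ) (hx : x ∈ 𝓗 j l q) {τ : ZMod 2}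
    (hτ : τ = σ + (q + 1)) : appendW x w ∈ pathSpan 𝓗 (n + 1) i l τ :=
  pathSpan_hom_mem (fun _ hw => (IsPath.snoc hw hx hτ).mem) hw

lemma b1W_base (h : IsDG part mul d 𝓗) (hx : x ∈ 𝓗 i j q) :
    b1W part d (allWord 0 fun _ => x) = allWord 0 fun _ => d x :=
  b1W_zero d (h.part_mem hx)

lemma b1W_append (h : IsDG part mul d 𝓗) (hx : x ∈ 𝓗 j l q)
    (hw : w ∈ pathSpan 𝓗 n i j σ) :
    b1W part d (appendW x w) = appendW x (b1W part d w) + sgn σ • appendW (d x) w := by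
  refine pathSpan_hom_eq (f := (b1W part d ∘ₗ appendW x).toAddMonoidHom)
    (g := (appendW x ∘ₗ b1W part d + sgn σ • appendW (d x)).toAddMonoidHom) (fun v hv => ?_) hw
  obtain ⟨p, a, ha, rfl, rfl⟩ := h.exists_letters hv
  exact b1W_appendW d ha (h.part_mem hx)

lemma barW_append (h : IsDG part mul d 𝓗) (hx : x ∈ 𝓗 j l q)
    (hw : w ∈ pathSpan 𝓗 n i j σ) :
    barW part mul (appendW x w) =
      appendW x (barW part mul w) - sgn σ • mapLastW (mul.flip x) w := by
  refine pathSpan_hom_eq (f := (barW part mul ∘ₗ appendW x).toAddMonoidHom)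
    (g := (appendW x ∘ₗ barW part mul - sgn σ • mapLastW (mul.flip x)).toAddMonoidHom)
    (fun v hv => ?_) hw
  obtain ⟨p, a, ha, rfl, rfl⟩ := h.exists_letters hv
  exact barW_appendW mul ha (h.part_mem hx)

lemma cycW_append (h : IsDG part mul d 𝓗) (hx : x ∈ 𝓗 j l q)
    (hw : w ∈ pathSpan 𝓗 n i j σ) :
    cycW part mul (appendW x w) = -(sgn ((q + 1) * (σ + 1)) • mapFirstW (mul x) w) := by
  refine pathSpan_hom_eq (f := (cycW part mul ∘ₗ appendW x).toAddMonoidHom)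
    (g := (-(sgn ((q + 1) * (σ + 1)) • mapFirstW (mul x))).toAddMonoidHom) (fun v hv => ?_) hw
  obtain ⟨p, a, ha, rfl, rfl⟩ := h.exists_letters hv
  exact cycW_appendW mul ha (h.part_mem hx)

lemma mapFirstW_mem {φ : H →ₗ[k] H} {i' : I} {r : ZMod 2}
    (hφ : ∀ {j p a}, a ∈ 𝓗 i j p → φ a ∈ 𝓗 i' j (p + r))
    (hw : w ∈ pathSpan 𝓗 n i j σ) {τ : ZMod 2} (hτ : τ = σ + r) :
    mapFirstW φ w ∈ pathSpan 𝓗 n i' j τ := by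
  refine pathSpan_hom_mem (fun v hv => ?_) hw
  subst hτ
  clear hw
  induction hv with
  | base ha hσ =>
    rw [mapFirstW_zero]
    exact (IsPath.base (hφ ha) (by rw [hσ]; ring)).mem
  | snoc hw hx hτ ih =>
    rw [mapFirstW_appendW]
    exact appendW_mem (ih hφ) hx (by rw [hτ]; ring)

lemma mapLastW_mem {φ : H →ₗ[k] H} {r : ZMod 2}
    (hφ : ∀ {i p a}, a ∈ 𝓗 i j p → φ a ∈ 𝓗 i l (p + r))
    (hw : w ∈ pathSpan 𝓗 n i j σ) {τ : ZMod 2} (hτ : τ = σ + r) :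
    mapLastW φ w ∈ pathSpan 𝓗 n i l τ := by
  refine pathSpan_hom_mem (fun v hv => ?_) hw
  subst hτ
  cases hv with
  | base ha hσ =>
    rw [mapLastW_zero]
    exact (IsPath.base (hφ ha) (by rw [hσ]; ring)).mem
  | snoc hw hx hτ =>
    rw [mapLastW_appendW]
    exact (IsPath.snoc hw (hφ hx) (by rw [hτ]; ring)).mem

lemma left_mem (h : IsDG part mul d 𝓗) {i' : I} (hx : x ∈ 𝓗 i' i q)
    (hw : w ∈ pathSpan 𝓗 n i j σ) {τ : ZMod 2} (hτ : τ = σ + q) :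
    mapFirstW (mul x) w ∈ pathSpan 𝓗 n i' j τ :=
  mapFirstW_mem (φ := mul x) (r := q) (fun ha => by rw [add_comm]; exact h.mul_mem hx ha) hw hτ

lemma right_mem (h : IsDG part mul d 𝓗) (hx : x ∈ 𝓗 j l q)
    (hw : w ∈ pathSpan 𝓗 n i j σ) {τ : ZMod 2} (hτ : τ = σ + q) :
    mapLastW (mul.flip x) w ∈ pathSpan 𝓗 n i l τ :=
  mapLastW_mem (φ := mul.flip x) (r := q) (fun ha => by
    rw [LinearMap.flip_apply]; exact h.mul_mem ha hx) hw hτ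

lemma b1W_mem (h : IsDG part mul d 𝓗) (hw : w ∈ pathSpan 𝓗 n i j σ) {τ : ZMod 2}
    (hτ : τ = σ + 1) : b1W part d w ∈ pathSpan 𝓗 n i j τ := by
  refine pathSpan_hom_mem (fun v hv => ?_) hw
  subst hτ
  clear hw
  induction hv with
  | base ha hσ =>
    rw [h.b1W_base ha]
    exact (IsPath.base (h.d_mem ha) (by rw [hσ])).mem
  | snoc hw hx hτ ih =>
    rw [h.b1W_append hx hw.mem]
    exact add_mem (appendW_mem ih hx (by rw [hτ]; ring))
      (zsmul_mem (appendW_mem hw.mem (h.d_mem hx) (by rw [hτ]; ring)) _)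

lemma barW_mem (h : IsDG part mul d 𝓗) (hw : w ∈ pathSpan 𝓗 (n + 1) i j σ) {τ : ZMod 2}
    (hτ : τ = σ + 1) : barW part mul w ∈ pathSpan 𝓗 n i j τ := by
  refine pathSpan_hom_mem (fun v hv => ?_) hw
  subst hτ
  clear hw
  have h2 : (1 : ZMod 2) + 1 = 0 := rfl
  induction n generalizing j σ v with
  | zero =>
    cases hv with
    | snoc hw hx hτ =>
      rw [h.barW_append hx hw.mem]
      refine sub_mem ?_ (zsmul_mem (h.right_mem hx hw.mem ?_) _)
      · cases hw with
        | base => rw [barW_zero, map_zero]; exact zero_mem _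
      · rw [hτ, add_assoc, add_assoc, h2, add_zero]
  | succ n ih =>
    cases hv with
    | snoc hw hx hτ =>
      rw [h.barW_append hx hw.mem]
      refine sub_mem (appendW_mem (ih _ hw) hx (by rw [hτ]; ring))
        (zsmul_mem (h.right_mem hx hw.mem ?_) _)
      rw [hτ, add_assoc, add_assoc, h2, add_zero]

lemma barW_of_zero (hw : w ∈ pathSpan 𝓗 0 i j σ) : barW part mul w = 0 := by
  refine pathSpan_hom_eq (f := (barW part mul).toAddMonoidHom) (g := 0) (fun v hv => ?_) hw
  cases hv with
  | base => exact barW_zero _ _ _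

end IsDG

namespace IsDG

variable {n : ℕ} {i j l : I} {σ q : ZMod 2} {w : AllWords k H} {x : H}

end IsDG

end Paths

/-- Every parity is zero or one. -/
lemma parity_cases (s : ZMod 2) : s = 0 ∨ s = 1 := by revert s; decide

/-! ### The Hochschild differential squares to zero -/

section SquareZero

variable {k Q : Type u} [Field k] [CommRing Q]
variable {H : Type u} [AddCommGroup H] [Module k H] [Module Q H] [SMulCommClass k Q H]
variable {I : Type u}
variable {part : ZMod 2 → H →ₗ[k] H} {mul : H →ₗ[k] H →ₗ[k] H} {d : H →ₗ[k] H}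
  {𝓗 : I → I → ZMod 2 → Submodule Q H}
variable {n : ℕ} {i j l m : I} {σ q r : ZMod 2} {w : AllWords k H} {x y : H}

/-- The word with a single letter. -/
def letterW : H →ₗ[k] AllWords k H :=
  (MultilinearMap.ofSubsingleton k H (AllWords k H) (0 : Fin 1)).symm (allWord 0)

lemma letterW_apply (a : H) : letterW (k := k) a = allWord 0 fun _ => a := rfl

/-- The additive group generated by the paths of arbitrary length. -/
def pathsSpan (𝓗 : I → I → ZMod 2 → Submodule Q H) (i j : I) (σ : ZMod 2) :
    AddSubgroup (AllWords k H) :=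
  AddSubgroup.closure {w | ∃ n, IsPath 𝓗 n i j σ w}

lemma pathSpan_le (n : ℕ) : pathSpan (k := k) 𝓗 n i j σ ≤ pathsSpan 𝓗 i j σ :=
  AddSubgroup.closure_mono fun _ h => ⟨n, h⟩

lemma IsPath.mem' (h : IsPath 𝓗 n i j σ w) : w ∈ pathsSpan 𝓗 i j σ :=
  AddSubgroup.subset_closure ⟨n, h⟩

lemma pathsSpan_hom_eq {N : Type u} [AddCommGroup N] {f g : AllWords k H →+ N}
    (hfg : ∀ n w, IsPath 𝓗 n i j σ w → f w = g w) (hw : w ∈ pathsSpan 𝓗 i j σ) : f w = g w :=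
  AddMonoidHom.eqOn_closure (f := f) (g := g) (by rintro w ⟨n, hw⟩; exact hfg n w hw) hw

lemma pathsSpan_hom_mem {N : Type u} [AddCommGroup N] [Module k N] {f : AllWords k H →ₗ[k] N}
    {S : AddSubgroup N} (hf : ∀ n w, IsPath 𝓗 n i j σ w → f w ∈ S)
    (hw : w ∈ pathsSpan 𝓗 i j σ) : f w ∈ S :=
  (AddSubgroup.closure_le (S.comap f.toAddMonoidHom)).2 (by rintro w ⟨n, hw⟩; exact hf n w hw) hw

/-- The part of the Hochschild differential without the cyclic rotation term. -/
def linW (part : ZMod 2 → H →ₗ[k] H) (mul : H →ₗ[k] H →ₗ[k] H) (d : H →ₗ[k] H) :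
    Module.End k (AllWords k H) := b1W part d + barW part mul

lemma wordB_eq_linW_add (part : ZMod 2 → H →ₗ[k] H) (mul : H →ₗ[k] H →ₗ[k] H) (d : H →ₗ[k] H) :
    wordB part mul d = linW part mul d + cycW part mul := by
  rw [wordB_eq, linW, add_assoc]

namespace IsDG

lemma linW_base (h : IsDG part mul d 𝓗) (hx : x ∈ 𝓗 i j q) :
    linW part mul d (allWord 0 fun _ => x) = allWord 0 fun _ => d x := by
  rw [linW, LinearMap.add_apply, h.b1W_base hx, barW_zero, add_zero]

/-- This recursion together with `linW_base` determines `b'` on composable words; every later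
statement on `b'` is an induction over it. -/
lemma linW_append (h : IsDG part mul d 𝓗) (hx : x ∈ 𝓗 j l q)
    (hw : w ∈ pathsSpan 𝓗 i j σ) :
    linW part mul d (appendW x w) = appendW x (linW part mul d w) +
      sgn σ • (appendW (d x) w - mapLastW (mul.flip x) w) := by
  refine pathsSpan_hom_eq (f := (linW part mul d ∘ₗ appendW x).toAddMonoidHom)
    (g := (appendW x ∘ₗ linW part mul d +
      sgn σ • (appendW (d x) - mapLastW (mul.flip x))).toAddMonoidHom) (fun n v hv => ?_) hw
  change linW part mul d (appendW x v) = appendW x (linW part mul d v) +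
      sgn σ • (appendW (d x) v - mapLastW (mul.flip x) v)
  simp only [linW, LinearMap.add_apply, h.b1W_append hx hv.mem, h.barW_append hx hv.mem, map_add,
    smul_sub]
  abel

lemma linW_mem (h : IsDG part mul d 𝓗) (hw : w ∈ pathsSpan 𝓗 i j σ) {τ : ZMod 2}
    (hτ : τ = σ + 1) : linW part mul d w ∈ pathsSpan 𝓗 i j τ := by
  refine pathsSpan_hom_mem (fun n v hv => ?_) hw
  rw [linW, LinearMap.add_apply]
  refine add_mem (pathSpan_le _ (h.b1W_mem hv.mem hτ)) ?_
  cases n with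
  | zero => rw [barW_of_zero hv.mem]; exact zero_mem _
  | succ n => exact pathSpan_le _ (h.barW_mem hv.mem hτ)

lemma right_right (h : IsDG part mul d 𝓗) (hx : x ∈ 𝓗 j l q) (hy : y ∈ 𝓗 l m r)
    (hw : w ∈ pathsSpan 𝓗 i j σ) :
    mapLastW (mul.flip y) (mapLastW (mul.flip x) w) = mapLastW (mul.flip (mul x y)) w := by
  refine pathsSpan_hom_eq (f := (mapLastW (mul.flip y) ∘ₗ mapLastW (mul.flip x)).toAddMonoidHom)
    (g := (mapLastW (mul.flip (mul x y))).toAddMonoidHom) (fun n v hv => ?_) hw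
  cases hv with
  | base ha hσ =>
    simp [mapLastW_zero, h.assoc ha hx hy]
  | snoc hw ha hτ =>
    simp [mapLastW_appendW, h.assoc ha hx hy]

lemma left_right (h : IsDG part mul d 𝓗) (hx : x ∈ 𝓗 m i q) (hy : y ∈ 𝓗 j l r)
    (hw : w ∈ pathsSpan 𝓗 i j σ) :
    mapFirstW (mul x) (mapLastW (mul.flip y) w) = mapLastW (mul.flip y) (mapFirstW (mul x) w) := by
  refine pathsSpan_hom_eq (f := (mapFirstW (mul x) ∘ₗ mapLastW (mul.flip y)).toAddMonoidHom)
    (g := (mapLastW (mul.flip y) ∘ₗ mapFirstW (mul x)).toAddMonoidHom) (fun n v hv => ?_) hw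
  cases hv with
  | base ha hσ => simp [mapLastW_zero, mapFirstW_zero, h.assoc hx ha hy]
  | snoc hw ha hτ => simp [mapLastW_appendW, mapFirstW_appendW]

lemma left_left (h : IsDG part mul d 𝓗) (hx : x ∈ 𝓗 m l q) (hy : y ∈ 𝓗 l i r)
    (hw : w ∈ pathsSpan 𝓗 i j σ) :
    mapFirstW (mul x) (mapFirstW (mul y) w) = mapFirstW (mul (mul x y)) w := by
  refine pathsSpan_hom_eq (f := (mapFirstW (mul x) ∘ₗ mapFirstW (mul y)).toAddMonoidHom)
    (g := (mapFirstW (mul (mul x y))).toAddMonoidHom) (fun n v hv => ?_) hw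
  change mapFirstW (mul x) (mapFirstW (mul y) v) = mapFirstW (mul (mul x y)) v
  clear hw
  induction hv with
  | base ha hσ => simp [mapFirstW_zero, h.assoc hx hy ha]
  | snoc hw ha hτ ih => simp [mapFirstW_appendW, ih hy]

/-- Right multiplication by `x` touches only the last letter, so the Leibniz rule and associativity
for the last two letters suffice, and a case distinction replaces an induction. The term with `d x`
is what remains of the Leibniz rule. -/
lemma linW_right (h : IsDG part mul d 𝓗) (hx : x ∈ 𝓗 j l q)
    (hw : w ∈ pathsSpan 𝓗 i j σ) :
    linW part mul d (mapLastW (mul.flip x) w) = mapLastW (mul.flip x) (linW part mul d w) -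
      sgn σ • mapLastW (mul.flip (d x)) w := by
  refine pathsSpan_hom_eq (f := (linW part mul d ∘ₗ mapLastW (mul.flip x)).toAddMonoidHom)
    (g := (mapLastW (mul.flip x) ∘ₗ linW part mul d -
      sgn σ • mapLastW (mul.flip (d x))).toAddMonoidHom) (fun n v hv => ?_) hw
  change linW part mul d (mapLastW (mul.flip x) v) = mapLastW (mul.flip x) (linW part mul d v) -
      sgn σ • mapLastW (mul.flip (d x)) v
  cases hv with
  | @base _ _ p _ _ ha hσ =>
    rw [mapLastW_zero, LinearMap.flip_apply, h.linW_base (h.mul_mem ha hx), h.linW_base ha,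
      mapLastW_zero, mapLastW_zero, hσ, h.leibniz ha hx, sgn_add, sgn_one, mul_neg_one, neg_smul,
      sub_neg_eq_add]
    simp only [← letterW_apply, map_add, map_zsmul, LinearMap.flip_apply]
  | @snoc _ _ _ _ _ p _ _ c hw ha hτ =>
    rw [mapLastW_appendW, LinearMap.flip_apply, h.linW_append (h.mul_mem ha hx) hw.mem',
      h.linW_append ha hw.mem', h.leibniz ha hx, ← h.right_right ha hx hw.mem', hτ]
    simp only [map_add, map_sub, map_zsmul, mapLastW_appendW, LinearMap.flip_apply,
      LinearMap.add_apply, LinearMap.smul_apply, sgn_add, sgn_one]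
    module

/-- The cyclic term is left multiplication by the last letter. This graded Leibniz rule is therefore
what makes it anticommute with `b'`, up to the rotation of products. -/
lemma linW_left (h : IsDG part mul d 𝓗) (hx : x ∈ 𝓗 l i q)
    (hw : w ∈ pathsSpan 𝓗 i j σ) :
    linW part mul d (mapFirstW (mul x) w) = mapFirstW (mul (d x)) w +
      sgn q • mapFirstW (mul x) (linW part mul d w) := by
  refine pathsSpan_hom_eq (f := (linW part mul d ∘ₗ mapFirstW (mul x)).toAddMonoidHom)
    (g := (mapFirstW (mul (d x)) +
      sgn q • mapFirstW (mul x) ∘ₗ linW part mul d).toAddMonoidHom) (fun n v hv => ?_) hw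
  change linW part mul d (mapFirstW (mul x) v) = mapFirstW (mul (d x)) v +
      sgn q • mapFirstW (mul x) (linW part mul d v)
  clear hw
  induction hv with
  | base ha hσ =>
    rw [mapFirstW_zero, h.linW_base (h.mul_mem hx ha), h.linW_base ha,
      mapFirstW_zero, mapFirstW_zero, h.leibniz hx ha]
    simp only [← letterW_apply, map_add, map_zsmul]
  | @snoc n i j m σ p τ v c hv hc hτ ih =>
    rw [mapFirstW_appendW, h.linW_append hc (pathSpan_le _ (h.left_mem hx hv.mem rfl)), ih hx,
      h.linW_append hc hv.mem']
    simp only [map_add, map_sub, map_zsmul, mapFirstW_appendW, smul_sub, sgn_add,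
      h.left_right hx hc hv.mem']
    module

/-- Applying the recursion twice to a word ending in `c` gives `b' b'` of the shorter word, `d (d
c)`, and mixed terms. The mixed terms occur with the signs `sgn σ` and `sgn (σ + 1)` and cancel by
`linW_right`. -/
lemma linW_linW (h : IsDG part mul d 𝓗) (hw : w ∈ pathsSpan 𝓗 i j σ) :
    linW part mul d (linW part mul d w) = 0 := by
  refine pathsSpan_hom_eq (f := (linW part mul d ∘ₗ linW part mul d).toAddMonoidHom) (g := 0)
    (fun n v hv => ?_) hw
  change linW part mul d (linW part mul d v) = 0
  clear hw
  induction hv with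
  | base ha hσ =>
    rw [h.linW_base ha, h.linW_base (h.d_mem ha), h.d_d ha]
    exact map_zero (letterW (k := k))
  | @snoc n i j m σ p τ v c hv hc hτ ih =>
    rw [h.linW_append hc hv.mem', map_add, map_zsmul, map_sub,
      h.linW_append hc (h.linW_mem hv.mem' rfl), ih, h.linW_append (h.d_mem hc) hv.mem',
      h.linW_right hc hv.mem', h.d_d hc]
    simp only [map_zero, LinearMap.zero_apply, sgn_add, sgn_one]
    module

lemma cycW_append' (h : IsDG part mul d 𝓗) (hx : x ∈ 𝓗 j l q)
    (hw : w ∈ pathsSpan 𝓗 i j σ) :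
    cycW part mul (appendW x w) = -(sgn ((q + 1) * (σ + 1)) • mapFirstW (mul x) w) :=
  pathsSpan_hom_eq (f := (cycW part mul ∘ₗ appendW x).toAddMonoidHom)
    (g := (-(sgn ((q + 1) * (σ + 1)) • mapFirstW (mul x))).toAddMonoidHom)
    (fun _ _ hv => h.cycW_append hx hv.mem) hw

/-- The Hochschild differential squares to zero. -/
lemma wordB_wordB (h : IsDG part mul d 𝓗) (hw : w ∈ pathsSpan 𝓗 i i σ) :
    wordB part mul d (wordB part mul d w) = 0 := by
  rw [wordB_eq_linW_add]
  refine pathsSpan_hom_eq (f := ((linW part mul d + cycW part mul) ∘ₗ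
    (linW part mul d + cycW part mul)).toAddMonoidHom) (g := 0) (fun n v hv => ?_) hw
  change linW part mul d (linW part mul d v + cycW part mul v) +
    cycW part mul (linW part mul d v + cycW part mul v) = 0
  rw [map_add, h.linW_linW hv.mem', zero_add]
  clear hw
  cases hv with
  | base ha hσ =>
    rw [cycW_zero, h.linW_base ha, add_zero, cycW_zero, map_zero, add_zero]
  | @snoc n _ j _ σ p τ v c hv hc hτ =>
    rw [h.cycW_append' hc hv.mem', h.linW_append hc hv.mem', map_neg, map_zsmul,
      h.linW_left hc hv.mem', map_add, map_add, map_neg, map_zsmul, map_zsmul, map_sub,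
      h.cycW_append' hc (h.linW_mem hv.mem' rfl), h.cycW_append' (h.d_mem hc) hv.mem']
    -- In the mixed terms everything containing `d c` or `b' v` cancels in pairs by `linW_left`.
    -- What is left compares two ways to bring two letters to the front: multiply the last two
    -- letters and rotate once, or rotate twice. These agree by associativity.
    have key : sgn σ • cycW part mul (mapLastW (mul.flip c) v) +
        sgn ((p + 1) * (σ + 1)) • cycW part mul (mapFirstW (mul c) v) = 0 := by
      cases hv with
      | base ha hσ => simp [mapLastW_zero, mapFirstW_zero, cycW_zero]
      | @snoc n _ i' _ σ' p' τ v a hv ha hτ =>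
        rw [mapLastW_appendW, mapFirstW_appendW, LinearMap.flip_apply,
          h.cycW_append' (h.mul_mem ha hc) hv.mem',
          h.cycW_append' ha (pathSpan_le _ (h.left_mem hc hv.mem rfl)), h.left_left ha hc hv.mem',
          hτ]
        rcases parity_cases σ' with rfl | rfl <;> rcases parity_cases p with rfl | rfl <;>
          rcases parity_cases p' with rfl | rfl <;>
          simp [sgn, show (1 : ZMod 2) + 1 = 0 from rfl]
    rcases parity_cases σ with rfl | rfl <;> rcases parity_cases p with rfl | rfl <;>
      simp only [sgn, show (1 : ZMod 2) + 1 = 0 from rfl, zero_add, mul_zero, mul_one,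
        one_ne_zero, if_true, if_false, neg_smul, one_smul] at key ⊢ <;>
      linear_combination (norm := module) (-1 : ℤ) • key

lemma linW_smul (h : IsDG part mul d 𝓗) (hw : w ∈ pathsSpan 𝓗 i j σ) (q : Q) :
    linW part mul d (q • w) = q • linW part mul d w := by
  refine pathsSpan_hom_eq (f := (linW part mul d ∘ₗ DistribSMul.toLinearMap k _ q).toAddMonoidHom)
    (g := (DistribSMul.toLinearMap k _ q ∘ₗ linW part mul d).toAddMonoidHom) (fun n v hv => ?_) hw
  change linW part mul d (q • v) = q • linW part mul d v
  clear hw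
  have hl : ∀ a : H, q • letterW (k := k) a = letterW (q • a) := fun a => by
    rw [letterW_apply, smul_allWord, letterW_apply]
    exact congrArg (allWord 0) (funext fun l => if_pos (Fin.fin_one_eq_zero l))
  induction hv with
  | base ha hσ =>
    rw [h.linW_base ha, ← letterW_apply, ← letterW_apply, hl, hl, letterW_apply,
      h.linW_base (Submodule.smul_mem _ q ha), h.d_smul, letterW_apply]
  | snoc hv hc hτ ih =>
    rw [← appendW_smul, h.linW_append hc (hv.smul q).mem', h.linW_append hc hv.mem', ih,
      appendW_smul, appendW_smul, mapLastW_smul (fun q a => h.mul_smul_left q a _), smul_add,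
      smul_comm q (sgn _), smul_sub q]

lemma cycW_smul (h : IsDG part mul d 𝓗) (hw : w ∈ pathsSpan 𝓗 i j σ) (q : Q) :
    cycW part mul (q • w) = q • cycW part mul w := by
  refine pathsSpan_hom_eq (f := (cycW part mul ∘ₗ DistribSMul.toLinearMap k _ q).toAddMonoidHom)
    (g := (DistribSMul.toLinearMap k _ q ∘ₗ cycW part mul).toAddMonoidHom) (fun n v hv => ?_) hw
  change cycW part mul (q • v) = q • cycW part mul v
  cases hv with
  | base ha hσ => rw [smul_allWord, cycW_zero, cycW_zero, smul_zero]
  | snoc hv hc hτ =>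
    rw [← appendW_smul, h.cycW_append' hc (hv.smul q).mem', h.cycW_append' hc hv.mem',
      mapFirstW_smul (h.mul_smul_right · _), smul_neg, smul_comm q]

lemma wordB_smul (h : IsDG part mul d 𝓗) (hw : w ∈ pathsSpan 𝓗 i j σ) (q : Q) :
    wordB part mul d (q • w) = q • wordB part mul d w := by
  rw [wordB_eq_linW_add, LinearMap.add_apply, LinearMap.add_apply, h.linW_smul hw,
    h.cycW_smul hw, smul_add]

end IsDG

/-- The additive group generated by the closed paths of arbitrary length. -/
def loopsSpan (𝓗 : I → I → ZMod 2 → Submodule Q H) (σ : ZMod 2) :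
    AddSubgroup (AllWords k H) :=
  AddSubgroup.closure {w | ∃ n i, IsPath 𝓗 n i i σ w}

lemma IsPath.mem_loopsSpan (h : IsPath 𝓗 n i i σ w) : w ∈ loopsSpan 𝓗 σ :=
  AddSubgroup.subset_closure ⟨n, i, h⟩

lemma pathsSpan_le_loopsSpan : pathsSpan (k := k) 𝓗 i i σ ≤ loopsSpan 𝓗 σ :=
  AddSubgroup.closure_mono fun _ ⟨n, h⟩ => ⟨n, i, h⟩

lemma loopsSpan_hom_eq {N : Type u} [AddCommGroup N] {f g : AllWords k H →+ N}
    (hfg : ∀ n i w, IsPath 𝓗 n i i σ w → f w = g w) (hw : w ∈ loopsSpan 𝓗 σ) : f w = g w :=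
  AddMonoidHom.eqOn_closure (f := f) (g := g) (by rintro w ⟨n, i, hw⟩; exact hfg n i w hw) hw

lemma loopsSpan_hom_mem {N : Type u} [AddCommGroup N] [Module k N] {f : AllWords k H →ₗ[k] N}
    {S : AddSubgroup N} (hf : ∀ n i w, IsPath 𝓗 n i i σ w → f w ∈ S)
    (hw : w ∈ loopsSpan 𝓗 σ) : f w ∈ S :=
  (AddSubgroup.closure_le (S.comap f.toAddMonoidHom)).2
    (by rintro w ⟨n, i, hw⟩; exact hf n i w hw) hw

lemma smul_mem_loopsSpan (q : Q) (hw : w ∈ loopsSpan 𝓗 σ) : q • w ∈ loopsSpan 𝓗 σ :=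
  loopsSpan_hom_mem (f := DistribSMul.toLinearMap k _ q)
    (fun _ _ _ h => (h.smul q).mem_loopsSpan) hw

namespace IsDG

lemma cycW_mem_loopsSpan (h : IsDG part mul d 𝓗) (hw : IsPath 𝓗 n i i σ w) {τ : ZMod 2}
    (hτ : τ = σ + 1) : cycW part mul w ∈ loopsSpan 𝓗 τ := by
  cases hw with
  | base => rw [cycW_zero]; exact zero_mem _
  | snoc hw hx h' =>
    rw [h.cycW_append hx hw.mem]
    refine neg_mem (zsmul_mem (pathsSpan_le_loopsSpan (pathSpan_le _ (h.left_mem hx hw.mem ?_))) _)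
    rw [hτ, h', add_assoc, add_assoc, show (1 : ZMod 2) + 1 = 0 from rfl, add_zero]

lemma wordB_mem (h : IsDG part mul d 𝓗) (hw : w ∈ loopsSpan 𝓗 σ) {τ : ZMod 2}
    (hτ : τ = σ + 1) : wordB part mul d w ∈ loopsSpan 𝓗 τ := by
  refine loopsSpan_hom_mem (fun n i v hv => ?_) hw
  rw [wordB_eq_linW_add, LinearMap.add_apply]
  exact add_mem (pathsSpan_le_loopsSpan (h.linW_mem hv.mem' hτ)) (h.cycW_mem_loopsSpan hv hτ)

end IsDG


end SquareZero

/-! ### Paths in terms of their letters -/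

section Letters

variable {k Q : Type u} [Field k] [CommRing Q]
variable {H : Type u} [AddCommGroup H] [Module k H] [Module Q H] [SMulCommClass k Q H]
variable {I : Type u} {𝓗 : I → I → ZMod 2 → Submodule Q H}

lemma isPath_allWord {n : ℕ} {y : Fin (n + 2) → I} {p : Fin (n + 1) → ZMod 2}
    {a : Fin (n + 1) → H} (h : ∀ l, a l ∈ 𝓗 (y l.castSucc) (y l.succ) (p l)) :
    IsPath (k := k) 𝓗 n (y 0) (y (Fin.last (n + 1))) (∑ l, (p l + 1)) (allWord n a) := by
  induction n with
  | zero =>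
    have : a = fun _ => a 0 := funext fun l => by rw [Fin.fin_one_eq_zero l]
    rw [this]
    exact .base (h 0) (by simp)
  | succ n ih =>
    rw [← Fin.snoc_init_self a, ← appendW_allWord]
    refine .snoc (ih (y := Fin.init y) (p := Fin.init p) fun l => ?_) (h (Fin.last _)) ?_
    · exact h l.castSucc
    · rw [Fin.sum_univ_castSucc]
      rfl

lemma IsPath.exists_letters {n : ℕ} {i j : I} {σ : ZMod 2} {w : AllWords k H}
    (hw : IsPath 𝓗 n i j σ w) :
    ∃ (y : Fin (n + 2) → I) (p : Fin (n + 1) → ZMod 2) (a : Fin (n + 1) → H),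
      y 0 = i ∧ y (Fin.last (n + 1)) = j ∧ (∀ l, a l ∈ 𝓗 (y l.castSucc) (y l.succ) (p l)) ∧
      w = allWord n a ∧ σ = ∑ l, (p l + 1) := by
  induction hw with
  | @base i j p σ a ha hσ =>
    refine ⟨![i, j], fun _ => p, fun _ => a, rfl, rfl, fun l => ?_, rfl, by simp [hσ]⟩
    obtain rfl : l = 0 := Fin.fin_one_eq_zero l
    exact ha
  | @snoc n i j l σ q τ w x hw hx hτ ih =>
    obtain ⟨y, p, a, rfl, rfl, h, rfl, rfl⟩ := ih
    refine ⟨Fin.snoc y l, Fin.snoc p q, Fin.snoc a x, ?_, Fin.snoc_last _ _, fun t => ?_,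
      appendW_allWord _ _ _, ?_⟩
    · exact Fin.snoc_castSucc (α := fun _ => I) l y 0
    · refine Fin.lastCases ?_ (fun t => ?_) t
      · rw [Fin.succ_last, Fin.snoc_last, Fin.snoc_last, Fin.snoc_last, Fin.snoc_castSucc]
        exact hx
      · rw [Fin.succ_castSucc, Fin.snoc_castSucc, Fin.snoc_castSucc, Fin.snoc_castSucc,
          Fin.snoc_castSucc]
        exact h t
    · rw [hτ, Fin.sum_univ_castSucc (n := n + 1)]
      simp only [Fin.snoc_castSucc, Fin.snoc_last]

end Letters

/-! ### Matrix factorizations as a differential graded category, and their Hochschild complex -/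

section Arrows

variable {k Q : Type u} [Field k] [CommRing Q] [Algebra k Q]

namespace MatFac

variable {f : Q} (X Y Z : MatFac k f)

/-- The submodule of homogeneous maps. -/
def homog (p : ZMod 2) : Submodule Q (X.P →ₗ[Q] Y.P) where
  carrier := {α | IsHomog X Y p α}
  zero_mem' := fun _ _ _ => zero_mem _
  add_mem' := fun ha hb s x hx => add_mem (ha s x hx) (hb s x hx)
  smul_mem' := fun q _ ha s x hx => Submodule.smul_mem _ q (ha s x hx)

variable {X Y Z}

lemma IsHomog.comp {p q : ZMod 2} {α : Y.P →ₗ[Q] Z.P} {β : X.P →ₗ[Q] Y.P} (hα : IsHomog Y Z p α)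
    (hβ : IsHomog X Y q β) : IsHomog X Z (p + q) (α ∘ₗ β) := fun s x hx => by
  have := hα _ _ (hβ s x hx)
  rwa [add_assoc, add_comm q p] at this

lemma homD_of_isHomog {p : ZMod 2} {α : X.P →ₗ[Q] Y.P} (h : IsHomog X Y p α) :
    homD X Y α = Y.δ ∘ₗ α - sgn p • (α ∘ₗ X.δ) := by
  change Y.δ ∘ₗ α - ∑ q : ZMod 2, sgn q • (homPart X Y q α ∘ₗ X.δ) = _
  rw [Finset.sum_eq_single p]
  · rw [homPart_of_isHomog X Y h, if_pos rfl]
  · intro q _ hq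
    rw [homPart_of_isHomog X Y h, if_neg hq, LinearMap.zero_comp, smul_zero]
  · simp

lemma IsHomog.homD {p : ZMod 2} {α : X.P →ₗ[Q] Y.P} (h : IsHomog X Y p α) :
    IsHomog X Y (p + 1) (homD X Y α) := by
  rw [homD_of_isHomog h]
  refine (homog X Y (p + 1)).sub_mem ?_ (zsmul_mem ?_ _)
  · rw [add_comm]
    exact IsHomog.comp Y.δ_odd h
  · exact IsHomog.comp h X.δ_odd

lemma homD_comp {p q : ZMod 2} {α : Y.P →ₗ[Q] Z.P} {β : X.P →ₗ[Q] Y.P} (hα : IsHomog Y Z p α)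
    (hβ : IsHomog X Y q β) :
    homD X Z (α ∘ₗ β) = homD Y Z α ∘ₗ β + sgn p • (α ∘ₗ homD X Y β) := by
  rw [homD_of_isHomog hα, homD_of_isHomog hβ, homD_of_isHomog (hα.comp hβ), sgn_add]
  ext x
  simp only [LinearMap.sub_apply, LinearMap.add_apply, LinearMap.smul_apply, LinearMap.comp_apply,
    map_sub, map_zsmul]
  module

lemma homD_homD {p : ZMod 2} {α : X.P →ₗ[Q] Y.P} (h : IsHomog X Y p α) :
    homD X Y (homD X Y α) = 0 := by
  rw [homD_of_isHomog h.homD, homD_of_isHomog h, sgn_add, sgn_one]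
  ext x
  simp only [LinearMap.sub_apply, LinearMap.smul_apply, LinearMap.comp_apply,
    map_sub, map_zsmul, LinearMap.zero_apply, X.δ_sq, Y.δ_sq, map_smul]
  rcases parity_cases p with rfl | rfl <;> simp [sgn, add_comm]

lemma homPart_smul (p : ZMod 2) (q : Q) (α : X.P →ₗ[Q] Y.P) :
    homPart X Y p (q • α) = q • homPart X Y p α := by
  change ∑ s : ZMod 2, Y.proj (s + p) ∘ₗ (q • α) ∘ₗ X.proj s =
    q • ∑ s : ZMod 2, Y.proj (s + p) ∘ₗ α ∘ₗ X.proj s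
  simp only [Finset.smul_sum, LinearMap.smul_comp, LinearMap.comp_smul]

lemma homD_smul (q : Q) (α : X.P →ₗ[Q] Y.P) : homD X Y (q • α) = q • homD X Y α := by
  change Y.δ ∘ₗ (q • α) - ∑ p : ZMod 2, sgn p • (homPart X Y p (q • α) ∘ₗ X.δ) =
    q • (Y.δ ∘ₗ α - ∑ p : ZMod 2, sgn p • (homPart X Y p α ∘ₗ X.δ))
  simp only [homPart_smul, LinearMap.smul_comp, LinearMap.comp_smul, smul_sub, Finset.smul_sum,
    smul_comm q (sgn _)]

end MatFac

variable {f : Q} {I : Type u}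

section Arr

variable (M : I → Type u) [∀ i, AddCommGroup (M i)] [∀ i, Module Q (M i)]
  [∀ i, Module k (M i)] [∀ i, IsScalarTower k Q (M i)]

lemma transport_self (i : I) : transport (Q := Q) M i i = LinearMap.id := by
  classical
  ext x
  simp [transport]

lemma arrMul_arr (i j l m : I) (α : M j →ₗ[Q] M i) (β : M m →ₗ[Q] M l) :
    arrMul k M (arr M i j α) (arr M l m β) = arr M i m (α ∘ₗ transport M l j ∘ₗ β) := by
  classical
  simp only [arrMul, arr]
  rw [DFinsupp.lsum_single, LinearMap.flip_apply, DFinsupp.lsum_single, LinearMap.flip_apply,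
    LinearMap.mk₂_apply]

lemma arrMul_arr_self (i j l : I) (α : M j →ₗ[Q] M i) (β : M l →ₗ[Q] M j) :
    arrMul k M (arr M i j α) (arr M j l β) = arr M i l (α ∘ₗ β) := by
  rw [arrMul_arr, transport_self, LinearMap.id_comp]

lemma arr_smul' (i j : I) (q : Q) (α : M j →ₗ[Q] M i) : arr M i j (q • α) = q • arr M i j α := by
  classical
  exact DFinsupp.single_smul _ _

lemma arr_zsmul (i j : I) (q : ℤ) (α : M j →ₗ[Q] M i) : arr M i j (q • α) = q • arr M i j α := by
  classical
  exact DFinsupp.single_smul _ _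

lemma arr_zero (i j : I) : arr M i j (0 : M j →ₗ[Q] M i) = 0 := by
  classical
  exact DFinsupp.single_zero _

/-- Linear maps on the category algebra are determined by their values on arrows. -/
lemma arr_hom_ext {N : Type u} [AddCommGroup N] {F G : Arr Q M →+ N}
    (h : ∀ i j α, F (arr M i j α) = G (arr M i j α)) : F = G := by
  classical
  exact DFinsupp.addHom_ext fun e α => h e.1 e.2 α

end Arr

variable (X : I → MatFac k f)

/-- The homogeneous arrows in the category algebra. -/
def arrows (i j : I) (p : ZMod 2) : Submodule Q (HArr X) where
  carrier := {a | ∃ α, MatFac.IsHomog (X j) (X i) p α ∧ arr (fun i => (X i).P) i j α = a}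
  zero_mem' := ⟨0, (MatFac.homog _ _ p).zero_mem, arr_zero _ _ _⟩
  add_mem' := by
    rintro _ _ ⟨α, hα, rfl⟩ ⟨β, hβ, rfl⟩
    exact ⟨α + β, (MatFac.homog _ _ p).add_mem hα hβ, arr_add _ _ _ _ _⟩
  smul_mem' := by
    rintro q _ ⟨α, hα, rfl⟩
    exact ⟨q • α, (MatFac.homog _ _ p).smul_mem q hα, arr_smul' _ _ _ _ _⟩

variable {X}

lemma arr_mem_arrows {i j : I} {p : ZMod 2} {α : (X j).P →ₗ[Q] (X i).P}
    (h : MatFac.IsHomog (X j) (X i) p α) : arr (fun i => (X i).P) i j α ∈ arrows X i j p :=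
  ⟨α, h, rfl⟩

lemma arrPart_arr (p : ZMod 2) (i j : I) (α : (X j).P →ₗ[Q] (X i).P) :
    arrPart X p (arr (fun i => (X i).P) i j α) =
      arr (fun i => (X i).P) i j (MatFac.homPart (X j) (X i) p α) := by
  classical
  exact DFinsupp.mapRange_single (hf := fun _ => map_zero _)

lemma arrD_arr (i j : I) (α : (X j).P →ₗ[Q] (X i).P) :
    arrD X (arr (fun i => (X i).P) i j α) =
      arr (fun i => (X i).P) i j (MatFac.homD (X j) (X i) α) := by
  classical
  exact DFinsupp.mapRange_single (hf := fun _ => map_zero _)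

variable (X)

lemma isDG_arrows :
    IsDG (arrPart X) (arrMul k fun i => (X i).P) (arrD X) (arrows X) where
  part_mem := by
    rintro i j p _ ⟨α, hα, rfl⟩ r
    rw [arrPart_arr, MatFac.homPart_of_isHomog _ _ hα]
    split_ifs
    · rfl
    · exact arr_zero _ _ _
  d_mem := by
    rintro i j p _ ⟨α, hα, rfl⟩
    rw [arrD_arr]
    exact arr_mem_arrows hα.homD
  mul_mem := by
    rintro i j l p q _ _ ⟨α, hα, rfl⟩ ⟨β, hβ, rfl⟩
    rw [arrMul_arr_self]
    exact arr_mem_arrows (hα.comp hβ)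
  d_d := by
    rintro i j p _ ⟨α, hα, rfl⟩
    rw [arrD_arr, arrD_arr, MatFac.homD_homD hα, arr_zero]
  leibniz := by
    rintro i j l p q _ _ ⟨α, hα, rfl⟩ ⟨β, hβ, rfl⟩
    rw [arrMul_arr_self, arrD_arr, arrD_arr, arrD_arr, arrMul_arr_self, arrMul_arr_self,
      MatFac.homD_comp hα hβ, arr_add, arr_zsmul]
  assoc := by
    rintro i j l m p q r _ _ _ ⟨α, hα, rfl⟩ ⟨β, hβ, rfl⟩ ⟨γ, hγ, rfl⟩
    simp only [arrMul_arr_self, LinearMap.comp_assoc]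
  d_smul := fun q a => by
    refine DFunLike.congr_fun (arr_hom_ext (fun i => (X i).P)
      (F := (arrD X).toAddMonoidHom.comp (DistribSMul.toAddMonoidHom _ q))
      (G := (DistribSMul.toAddMonoidHom _ q).comp (arrD X).toAddMonoidHom) fun i j α => ?_) a
    change arrD X (q • arr (fun i => (X i).P) i j α) = q • arrD X (arr (fun i => (X i).P) i j α)
    rw [← arr_smul', arrD_arr, arrD_arr, MatFac.homD_smul, arr_smul']
  mul_smul_left := fun q a b => by
    refine DFunLike.congr_fun (arr_hom_ext (fun i => (X i).P)
      (F := ((arrMul k fun i => (X i).P).flip b).toAddMonoidHom.comp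
        (DistribSMul.toAddMonoidHom _ q))
      (G := (DistribSMul.toAddMonoidHom _ q).comp
        ((arrMul k fun i => (X i).P).flip b).toAddMonoidHom) fun i j α => ?_) a
    refine DFunLike.congr_fun (arr_hom_ext (fun i => (X i).P)
      (F := (arrMul k (fun i => (X i).P) (q • arr (fun i => (X i).P) i j α)).toAddMonoidHom)
      (G := (DistribSMul.toAddMonoidHom _ q).comp
        (arrMul k (fun i => (X i).P) (arr (fun i => (X i).P) i j α)).toAddMonoidHom)
          fun l m β => ?_) b
    change arrMul k (fun i => (X i).P) (q • arr (fun i => (X i).P) i j α)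
      (arr (fun i => (X i).P) l m β) = q • arrMul k (fun i => (X i).P)
        (arr (fun i => (X i).P) i j α) (arr (fun i => (X i).P) l m β)
    rw [← arr_smul', arrMul_arr, arrMul_arr, LinearMap.smul_comp, arr_smul']
  mul_smul_right := fun q a b => by
    refine DFunLike.congr_fun (arr_hom_ext (fun i => (X i).P)
      (F := ((arrMul k fun i => (X i).P).flip (q • b)).toAddMonoidHom)
      (G := (DistribSMul.toAddMonoidHom _ q).comp
        ((arrMul k fun i => (X i).P).flip b).toAddMonoidHom) fun i j α => ?_) a
    refine DFunLike.congr_fun (arr_hom_ext (fun i => (X i).P)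
      (F := (arrMul k (fun i => (X i).P) (arr (fun i => (X i).P) i j α)).toAddMonoidHom.comp
        (DistribSMul.toAddMonoidHom _ q))
      (G := (DistribSMul.toAddMonoidHom _ q).comp
        (arrMul k (fun i => (X i).P) (arr (fun i => (X i).P) i j α)).toAddMonoidHom)
          fun l m β => ?_) b
    change arrMul k (fun i => (X i).P) (arr (fun i => (X i).P) i j α)
      (q • arr (fun i => (X i).P) l m β) = q • arrMul k (fun i => (X i).P)
        (arr (fun i => (X i).P) i j α) (arr (fun i => (X i).P) l m β)
    rw [← arr_smul', arrMul_arr, arrMul_arr, LinearMap.comp_smul, LinearMap.comp_smul, arr_smul']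

/-- The shift by one arises because the index of a path counts every letter with a shift, whereas
the first letter of a Hochschild word is unshifted. The `Q`-span and the additive span agree since
the multiples of a closed path by elements of `Q`, which act on the first letter, are closed paths.
-/
lemma mem_hochGr_iff {j : ZMod 2} {w : AllWords k (HArr X)} :
    w ∈ hochGr X j ↔ w ∈ loopsSpan (arrows X) (j + 1) := by
  have hsum : ∀ {n : ℕ} (p : Fin (n + 1) → ZMod 2),
      ∑ l, (p l + 1) = ∑ l, p l - (n : ZMod 2) + 1 := fun {n} p => by
    rw [Finset.sum_add_distrib, sub_eq_add_neg, ZMod.neg_eq_self_mod_two]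
    simp [add_assoc]
  constructor
  · intro hw
    let S : Submodule Q (AllWords k (HArr X)) :=
      { loopsSpan (arrows X) (j + 1) with
        smul_mem' := fun q _ hw => smul_mem_loopsSpan q hw }
    refine (Submodule.span_le (p := S)).2 ?_ hw
    rintro _ ⟨n, x, p, α, hα, rfl, rfl⟩
    change _ ∈ loopsSpan (arrows X) _
    have := isPath_allWord (k := k) (𝓗 := arrows X) (y := (Fin.snoc x (x 0) : Fin (n + 2) → I))
      (p := p) (a := fun i => arr (fun i => (X i).P) (x i) (x (i + 1)) (α i)) fun l => by
        rw [Fin.snoc_castSucc]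
        have : (Fin.snoc x (x 0) : Fin (n + 2) → I) l.succ = x (l + 1) := by
          refine Fin.lastCases ?_ (fun l => ?_) l
          · rw [Fin.succ_last, Fin.snoc_last, Fin.last_add_one]
          · rw [Fin.succ_castSucc, Fin.snoc_castSucc, Fin.coeSucc_eq_succ]
        rw [this]
        exact arr_mem_arrows (hα l)
    rw [Fin.snoc_last, hsum] at this
    have h0 : (Fin.snoc x (x 0) : Fin (n + 2) → I) 0 = x 0 :=
      Fin.snoc_castSucc (α := fun _ => I) (x 0) x 0
    rw [h0] at this
    exact this.mem_loopsSpan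
  · intro hw
    refine (AddSubgroup.closure_le (hochGr X j).toAddSubgroup).2 ?_ hw
    rintro _ ⟨n, i, hw⟩
    obtain ⟨y, p, a, h0, h1, ha, rfl, hσ⟩ := hw.exists_letters
    -- The path is closed, so its `n + 2` vertices are `n + 1` vertices indexed modulo `n + 1`, as
    -- in the definition of `hochGr`.
    have hy : ∀ l : Fin (n + 1), y l.succ = y (l + 1).castSucc := fun l => by
      refine Fin.lastCases ?_ (fun l => ?_) l
      · rw [Fin.succ_last, Fin.last_add_one, h1, Fin.castSucc_zero, h0]
      · rw [Fin.succ_castSucc, Fin.coeSucc_eq_succ]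
    simp only [hy] at ha
    choose α hα h using ha
    refine Submodule.subset_span ⟨n, fun l => y l.castSucc, p, α, hα, ?_, ?_⟩
    · rw [hsum] at hσ
      exact (add_right_cancel hσ).symm
    · exact congrArg (allWord n) (funext fun l => (h l).symm)

/-- The Hochschild complex is a complex. -/
lemma hochB_isDifferential : IsDifferential (hochGr X) (hochB X) := by
  intro j w hw
  rw [mem_hochGr_iff] at hw
  refine ⟨(mem_hochGr_iff X).2 ((isDG_arrows X).wordB_mem hw rfl), ?_, fun q => ?_⟩
  · exact loopsSpan_hom_eq (f := (hochB X ∘ₗ hochB X).toAddMonoidHom) (g := 0)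
      (fun n i v hv => (isDG_arrows X).wordB_wordB hv.mem') hw
  · exact loopsSpan_hom_eq (f := (hochB X ∘ₗ DistribSMul.toLinearMap k _ q).toAddMonoidHom)
      (g := (DistribSMul.toLinearMap k _ q ∘ₗ hochB X).toAddMonoidHom)
      (fun n i v hv => (isDG_arrows X).wordB_smul hv.mem' q) hw

end Arrows

/-! ### Differential forms: degrees, signs and graded commutativity -/

section FormsLemmas

variable {k Q : Type u} [Field k] [CommRing Q] [Algebra k Q]

/-- With `n` generators, the exterior power of degree `N` is spanned by the products indexed by the
`N`-element subsets of the generators, and there are none for `N > n`. -/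
lemma exteriorPower_eq_bot {M : Type u} [AddCommGroup M] [Module Q M] [Module.Finite Q M] :
    ∃ B : ℕ, ∀ N, B ≤ N → ⋀[Q]^N M = ⊥ := by
  obtain ⟨n, v, hv⟩ := Module.Finite.exists_fin (R := Q) (M := M)
  refine ⟨n + 1, fun N hN => ?_⟩
  have := exteriorPower.ιMulti_family_span_fixedDegree_of_span Q (n := N) hv
  rw [← this, Submodule.span_eq_bot]
  rintro _ ⟨⟨s, hs⟩, rfl⟩
  exfalso
  have h1 := Finset.card_le_univ s
  rw [Set.powersetCard.mem_iff] at hs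
  rw [Fintype.card_fin] at h1
  omega

lemma forms_hom_ext {N : Type u} [AddCommGroup N] [Module Q N] {F G : Forms k Q →ₗ[Q] N}
    (h : ∀ n, ∀ x ∈ ⋀[Q]^n Ω[Q⁄k], F x = G x) : F = G := by
  refine LinearMap.ext fun x => ?_
  induction x using DirectSum.Decomposition.inductionOn
    (fun n : ℕ => ⋀[Q]^n Ω[Q⁄k]) with
  | zero => simp
  | @homogeneous i m => exact h i m.1 m.2
  | add x y hx hy => rw [map_add, map_add, hx, hy]

variable (k) in
/-- The operator that is multiplication by `c n` on `Ω^n`. -/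
def scaleForms (c : ℕ → Q) : Forms k Q →ₗ[Q] Forms k Q :=
  DirectSum.toModule Q ℕ _ (fun n => c n • (⋀[Q]^n Ω[Q⁄k]).subtype) ∘ₗ
    (DirectSum.decomposeLinearEquiv (fun n : ℕ => ⋀[Q]^n Ω[Q⁄k])).toLinearMap

lemma scaleForms_of_mem (c : ℕ → Q) {n : ℕ} {x : Forms k Q} (hx : x ∈ ⋀[Q]^n Ω[Q⁄k]) :
    scaleForms k c x = c n • x := by
  rw [scaleForms, LinearMap.comp_apply, LinearEquiv.coe_coe,
    DirectSum.decomposeLinearEquiv_apply, DirectSum.decompose_of_mem (fun n : ℕ => ⋀[Q]^n Ω[Q⁄k]) hx]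
  exact DirectSum.toModule_lof Q n _

lemma mul_mem_exteriorPower {m n : ℕ} {x y : Forms k Q} (hx : x ∈ ⋀[Q]^m Ω[Q⁄k])
    (hy : y ∈ ⋀[Q]^n Ω[Q⁄k]) : x * y ∈ ⋀[Q]^(m + n) Ω[Q⁄k] :=
  SetLike.mul_mem_graded (A := fun i : ℕ => ⋀[Q]^i Ω[Q⁄k]) hx hy

lemma ι_mem_exteriorPower (v : Ω[Q⁄k]) : ExteriorAlgebra.ι Q v ∈ ⋀[Q]^1 Ω[Q⁄k] := by
  change _ ∈ LinearMap.range (ExteriorAlgebra.ι Q) ^ 1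
  rw [pow_one]
  exact LinearMap.mem_range_self _ _

lemma one_mem_exteriorPower : (1 : Forms k Q) ∈ ⋀[Q]^0 Ω[Q⁄k] :=
  SetLike.one_mem_graded (A := fun i : ℕ => ⋀[Q]^i Ω[Q⁄k])

lemma exteriorPower_le_formsGr (n : ℕ) {x : Forms k Q} (hx : x ∈ ⋀[Q]^n Ω[Q⁄k]) :
    x ∈ formsGr k Q (n : ZMod 2) :=
  Submodule.mem_iSup_of_mem (p := fun j : {m : ℕ // (m : ZMod 2) = (n : ZMod 2)} =>
    LinearMap.range (CliffordAlgebra.ι (0 : QuadraticForm Q Ω[Q⁄k])) ^ (j : ℕ)) ⟨n, rfl⟩ hx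

lemma scaleForms_mem_formsGr (c : ℕ → Q) {p : ZMod 2} {x : Forms k Q} (hx : x ∈ formsGr k Q p) :
    scaleForms k c x ∈ formsGr k Q p := by
  have : formsGr k Q p ≤ (formsGr k Q p).comap (scaleForms k c) := by
    refine iSup_le ?_
    rintro ⟨n, rfl⟩ y hy
    rw [Submodule.mem_comap, scaleForms_of_mem c hy]
    exact Submodule.smul_mem _ _ (exteriorPower_le_formsGr n hy)
  exact this hx

variable (k Q) in
/-- The automorphism `γ^p` of the algebra of differential forms. -/
def gam (p : ZMod 2) : Forms k Q →ₐ[Q] Forms k Q :=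
  if p = 0 then AlgHom.id Q _ else gammaHom k Q

lemma gam_zero : gam k Q 0 = AlgHom.id Q _ := rfl

lemma gam_one : gam k Q 1 = gammaHom k Q := rfl

lemma gam_gam (p q : ZMod 2) (x : Forms k Q) : gam k Q p (gam k Q q x) = gam k Q (p + q) x := by
  rcases parity_cases p with rfl | rfl <;> rcases parity_cases q with rfl | rfl
  · simp [gam_zero]
  · simp [gam_zero]
  · simp [gam_zero]
  · rw [show (1 : ZMod 2) + 1 = 0 from rfl, gam_zero, gam_one]
    exact CliffordAlgebra.involute_involute x

lemma gam_of_mem (p : ZMod 2) {n : ℕ} {x : Forms k Q} (hx : x ∈ ⋀[Q]^n Ω[Q⁄k]) :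
    gam k Q p x = sgn (p * n) • x := by
  rcases parity_cases p with rfl | rfl
  · simp [gam_zero, sgn]
  · rw [gam_one, gammaHom_apply n x hx, one_mul]
    have (n : ℕ) : ((-1 : Q) ^ n) = ((sgn n : ℤ) : Q) := by
      induction n with
      | zero => simp [sgn]
      | succ n ih => rw [pow_succ, Nat.cast_succ, sgn_add, sgn_one, ih]; simp
    rw [this, Int.cast_smul_eq_zsmul]

lemma gam_mem (p : ZMod 2) {n : ℕ} {x : Forms k Q} (hx : x ∈ ⋀[Q]^n Ω[Q⁄k]) :
    gam k Q p x ∈ ⋀[Q]^n Ω[Q⁄k] := by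
  rw [gam_of_mem p hx]
  exact zsmul_mem hx _

lemma ι_mul_eq (v : Ω[Q⁄k]) (x : Forms k Q) :
    ExteriorAlgebra.ι Q v * x = gammaHom k Q x * ExteriorAlgebra.ι Q v := by
  induction x using ExteriorAlgebra.induction with
  | algebraMap r => rw [AlgHom.commutes, Algebra.commutes]
  | ι m =>
    have h : gammaHom k Q (ExteriorAlgebra.ι Q m) = - ExteriorAlgebra.ι Q m :=
      CliffordAlgebra.involute_ι m
    rw [h, neg_mul, ← add_eq_zero_iff_eq_neg]
    exact ExteriorAlgebra.ι_add_mul_swap v m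
  | mul a b ha hb => rw [← mul_assoc, ha, mul_assoc, hb, map_mul, mul_assoc]
  | add a b ha hb => rw [mul_add, ha, hb, map_add, add_mul]

/-- Differential forms commute up to sign. -/
lemma forms_mul_comm {n : ℕ} {x : Forms k Q} (hx : x ∈ ⋀[Q]^n Ω[Q⁄k]) (y : Forms k Q) :
    x * y = gam k Q n y * x := by
  induction n generalizing x y with
  | zero =>
    change x ∈ LinearMap.range (ExteriorAlgebra.ι Q) ^ 0 at hx
    rw [pow_zero] at hx
    obtain ⟨r, rfl⟩ := Submodule.mem_one.1 hx
    rw [Nat.cast_zero, gam_zero, Algebra.commutes]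
    rfl
  | succ n ih =>
    change x ∈ LinearMap.range (ExteriorAlgebra.ι Q) ^ (n + 1) at hx
    rw [pow_succ] at hx
    induction hx using Submodule.mul_induction_on' with
    | mem_mul_mem a ha b hb =>
      obtain ⟨v, rfl⟩ := hb
      rw [mul_assoc, ι_mul_eq, ← mul_assoc, ih ha, ← gam_one, gam_gam, Nat.cast_succ, mul_assoc]
    | add a _ b _ ha hb => rw [add_mul, ha, hb, mul_add]

/-- The same group structure as the one on tensor products, in a form that agrees with the
additive monoid structure at the transparency of instances. -/
instance (M : Type u) [AddCommGroup M] [Module Q M] : AddCommGroup (Forms k Q ⊗[Q] M) :=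
  { (TensorProduct.addCommMonoid : AddCommMonoid (Forms k Q ⊗[Q] M)),
    (TensorProduct.addCommGroup : AddCommGroup (Forms k Q ⊗[Q] M)) with }

end FormsLemmas

/-! ### Operators `ω ⊗ α` on differential forms with coefficients -/

section Operators

variable {k Q : Type u} [Field k] [CommRing Q] [Algebra k Q]
variable {P P' P'' : Type u} [AddCommGroup P] [Module Q P] [AddCommGroup P'] [Module Q P']
  [AddCommGroup P''] [Module Q P'']

/-- The operator `η ⊗ x ↦ (-1)^{p|η|} ω η ⊗ α(x)` on differential forms. -/
def el (p : ZMod 2) (ω : Forms k Q) (α : P →ₗ[Q] P') :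
    Forms k Q ⊗[Q] P →ₗ[Q] Forms k Q ⊗[Q] P' :=
  TensorProduct.map (LinearMap.mulLeft Q ω ∘ₗ (gam k Q p).toLinearMap) α

@[simp] lemma el_tmul (p : ZMod 2) (ω : Forms k Q) (α : P →ₗ[Q] P') (η : Forms k Q) (x : P) :
    el p ω α (η ⊗ₜ x) = (ω * gam k Q p η) ⊗ₜ α x := rfl

lemma el_comp {p q : ZMod 2} {n : ℕ} {ω η : Forms k Q} (hη : η ∈ ⋀[Q]^n Ω[Q⁄k])
    (α : P' →ₗ[Q] P'') (β : P →ₗ[Q] P') :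
    el p ω α ∘ₗ el q η β = sgn (p * n) • el (p + q) (ω * η) (α ∘ₗ β) := by
  refine TensorProduct.ext' fun ζ x => ?_
  rw [LinearMap.comp_apply, LinearMap.smul_apply, el_tmul, el_tmul, el_tmul, map_mul, gam_gam,
    gam_of_mem p hη, smul_mul_assoc, mul_smul_comm, TensorProduct.smul_tmul', mul_assoc]
  rfl

lemma el_smul_right (p : ZMod 2) (q : Q) (ω : Forms k Q) (α : P →ₗ[Q] P') :
    el p ω (q • α) = q • el p ω α :=
  TensorProduct.ext' fun ζ x => by simp

lemma el_zsmul_left (p : ZMod 2) (n : ℤ) (ω : Forms k Q) (α : P →ₗ[Q] P') :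
    el p (n • ω) α = n • el p ω α :=
  TensorProduct.ext' fun ζ x => by
    rw [LinearMap.smul_apply, el_tmul, el_tmul, smul_mul_assoc, TensorProduct.smul_tmul']

lemma el_zero_left (p : ZMod 2) (α : P →ₗ[Q] P') : el p (0 : Forms k Q) α = 0 :=
  TensorProduct.ext' fun ζ x => by simp

variable [Module k P'] [IsScalarTower k Q P']

lemma extend_tmul (s : ZMod 2) (φ : P →ₗ[Q] Forms k Q ⊗[Q] P') (ω : Forms k Q) (x : P) :
    extend s φ (ω ⊗ₜ x) = gam k Q s ω • φ x := by
  have key : ∀ (ω : Forms k Q) (z : Forms k Q ⊗[Q] P'),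
      (LinearMap.mul' Q (Forms k Q)).rTensor P'
        ((TensorProduct.assoc Q (Forms k Q) (Forms k Q) P').symm (ω ⊗ₜ z)) = ω • z := by
    intro ω z
    induction z with
    | zero => simp
    | tmul a y => simp [TensorProduct.smul_tmul']
    | add a b ha hb => rw [TensorProduct.tmul_add, map_add, map_add, ha, hb, smul_add]
  have h : (if s = 0 then LinearMap.id else (gammaHom k Q).toLinearMap) =
      (gam k Q s).toLinearMap := by
    rw [gam]
    split_ifs <;> rfl
  refine (key _ _).trans ?_
  rw [h]
  rfl

/-- The extension of total parity `s` multiplies by `ω` on the right, while `el` multiplies by it on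
the left. Graded commutativity costs `(-1)^{n|η|}`, which turns the total parity `s` into the parity
`s + n` of the homomorphism alone. -/
lemma extend_mk (s : ZMod 2) {n : ℕ} {ω : Forms k Q} (hω : ω ∈ ⋀[Q]^n Ω[Q⁄k]) (α : P →ₗ[Q] P') :
    extend s (TensorProduct.mk Q (Forms k Q) P' ω ∘ₗ α) = el (s + n) ω α := by
  refine TensorProduct.ext' fun η x => ?_
  rw [extend_tmul, el_tmul, forms_mul_comm hω, gam_gam, add_comm s, ← add_assoc,
    CharTwo.add_self_eq_zero, zero_add]
  rfl

lemma smul_rTensor_ι (ψ : Ω[Q⁄k] ⊗[Q] P) (α : P →ₗ[Q] P') (p : ZMod 2) (ω : Forms k Q) :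
    el p 1 α (ω • (ExteriorAlgebra.ι Q).rTensor P ψ) =
      sgn p • gam k Q p ω • (ExteriorAlgebra.ι Q).rTensor P' (α.lTensor _ ψ) := by
  induction ψ with
  | zero => simp
  | tmul v y =>
    rw [LinearMap.rTensor_tmul, LinearMap.lTensor_tmul, LinearMap.rTensor_tmul,
      TensorProduct.smul_tmul', TensorProduct.smul_tmul', el_tmul, smul_eq_mul, smul_eq_mul,
      one_mul, map_mul, gam_of_mem p (ι_mem_exteriorPower v), Nat.cast_one, mul_one,
      mul_smul_comm, TensorProduct.smul_tmul']
  | add a b ha hb => simp only [map_add, smul_add, ha, hb]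

end Operators

/-! ### Operators of a given form degree and parity -/

section Spans

variable {k Q : Type u} [Field k] [CommRing Q] [Algebra k Q] {f : Q} (X Y Z : MatFac k f)

/-- The operators spanned by `ω ⊗ α`, for forms `ω` of degree `N` and maps `α` of parity `p`. -/
def opSpan (N : ℕ) (p : ZMod 2) : Submodule Q (Forms k Q ⊗[Q] X.P →ₗ[Q] Forms k Q ⊗[Q] Y.P) :=
  Submodule.span Q {Φ | ∃ ω ∈ ⋀[Q]^N Ω[Q⁄k], ∃ α, MatFac.IsHomog X Y p α ∧ Φ = el p ω α}

variable {X Y Z}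

lemma el_mem_opSpan {N : ℕ} {p : ZMod 2} {ω : Forms k Q} (hω : ω ∈ ⋀[Q]^N Ω[Q⁄k])
    {α : X.P →ₗ[Q] Y.P} (hα : MatFac.IsHomog X Y p α) : el p ω α ∈ opSpan X Y N p :=
  Submodule.subset_span ⟨ω, hω, α, hα, rfl⟩

lemma opSpan_comp {N M : ℕ} {p q : ZMod 2} {Φ Ψ} (hΦ : Φ ∈ opSpan Y Z N p)
    (hΨ : Ψ ∈ opSpan X Y M q) : Φ ∘ₗ Ψ ∈ opSpan X Z (N + M) (p + q) := by
  induction hΦ using Submodule.span_induction with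
  | zero => rw [LinearMap.zero_comp]; exact zero_mem _
  | add a b _ _ ha hb => rw [LinearMap.add_comp]; exact add_mem ha hb
  | smul r a _ ha => rw [LinearMap.smul_comp]; exact Submodule.smul_mem _ r ha
  | mem a ha =>
    obtain ⟨ω, hω, α, hα, rfl⟩ := ha
    induction hΨ using Submodule.span_induction with
    | zero => rw [LinearMap.comp_zero]; exact zero_mem _
    | add a b _ _ ha hb => rw [LinearMap.comp_add]; exact add_mem ha hb
    | smul r a _ ha => rw [LinearMap.comp_smul]; exact Submodule.smul_mem _ r ha
    | mem b hb =>
      obtain ⟨η, hη, β, hβ, rfl⟩ := hb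
      rw [el_comp hη]
      rw [← Int.cast_smul_eq_zsmul Q]
      exact Submodule.smul_mem _ _ (el_mem_opSpan (mul_mem_exteriorPower hω hη) (hα.comp hβ))

lemma opSpan_eq_bot {N : ℕ} (h : ⋀[Q]^N Ω[Q⁄k] = ⊥) (p : ZMod 2) : opSpan X Y N p = ⊥ := by
  rw [opSpan, Submodule.span_eq_bot]
  rintro _ ⟨ω, hω, α, -, rfl⟩
  rw [h, Submodule.mem_bot] at hω
  rw [hω, el_zero_left]

lemma isHomog_homPart (p : ZMod 2) (α : X.P →ₗ[Q] Y.P) :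
    MatFac.IsHomog X Y p (MatFac.homPart X Y p α) := by
  intro s x hx
  change (∑ t : ZMod 2, Y.proj (t + p) ∘ₗ α ∘ₗ X.proj t) x ∈ _
  rw [LinearMap.sum_apply]
  refine sum_mem fun t _ => ?_
  rw [LinearMap.comp_apply, LinearMap.comp_apply, X.proj_of_mem hx]
  split_ifs with h
  · subst h
    exact Y.proj_mem _ _
  · rw [map_zero, map_zero]
    exact zero_mem _

/-- `ψ : P_X → Ω¹ ⊗ P_Y` is homogeneous of parity `p`, when `Ω¹` is placed in parity `0`. -/
def IsHomogForm (X Y : MatFac k f) (p : ZMod 2) (ψ : X.P →ₗ[Q] Ω[Q⁄k] ⊗[Q] Y.P) : Prop :=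
  ∀ s, ∀ x ∈ X.gr s, ψ x ∈ LinearMap.range ((Y.gr (s + p)).subtype.lTensor Ω[Q⁄k])

lemma lTensor_proj_of_mem {s : ZMod 2} {z : Ω[Q⁄k] ⊗[Q] Y.P}
    (hz : z ∈ LinearMap.range ((Y.gr s).subtype.lTensor Ω[Q⁄k])) :
    (Y.proj s).lTensor Ω[Q⁄k] z = z := by
  obtain ⟨z, rfl⟩ := hz
  rw [← LinearMap.lTensor_comp_apply]
  congr 2
  ext y
  exact (Y.proj_of_mem y.2 s).trans (if_pos rfl)

lemma sum_zmod_two {A : Type*} [AddCommMonoid A] (g : ZMod 2 → A) : ∑ s, g s = g 0 + g 1 := by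
  rw [show (Finset.univ : Finset (ZMod 2)) = {0, 1} from rfl, Finset.sum_pair zero_ne_one]

lemma IsHomogForm.eq_sum {p : ZMod 2} {ψ : X.P →ₗ[Q] Ω[Q⁄k] ⊗[Q] Y.P} (h : IsHomogForm X Y p ψ) :
    ψ = ∑ s : ZMod 2, (Y.proj (s + p)).lTensor Ω[Q⁄k] ∘ₗ ψ ∘ₗ X.proj s := by
  ext x
  simp only [LinearMap.sum_apply, LinearMap.comp_apply,
    lTensor_proj_of_mem (h _ _ (X.proj_mem _ x))]
  rw [← map_sum, sum_zmod_two, X.sum_proj]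

/-- By finite projectivity every map to `Ω¹ ⊗ P_Y` is a sum of maps of rank one, and for these the
operator is visibly of the form `ω ⊗ α` with a one-form `ω`. -/
lemma extend_mem_opSpan {p : ZMod 2} {ψ : X.P →ₗ[Q] Ω[Q⁄k] ⊗[Q] Y.P} (h : IsHomogForm X Y p ψ) :
    extend (p + 1) ((ExteriorAlgebra.ι Q).rTensor Y.P ∘ₗ ψ) ∈ opSpan X Y 1 p := by
  -- The rank one summands of a homogeneous map need not be homogeneous. The parity projections are
  -- therefore built into the statement, which then makes sense for all `ψ` and is additive in `ψ`.
  have key : ∀ ψ : X.P →ₗ[Q] Ω[Q⁄k] ⊗[Q] Y.P, extend (p + 1) ((ExteriorAlgebra.ι Q).rTensor Y.P ∘ₗ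
      ∑ s : ZMod 2, (Y.proj (s + p)).lTensor Ω[Q⁄k] ∘ₗ ψ ∘ₗ X.proj s) ∈ opSpan X Y 1 p := by
    intro ψ
    obtain ⟨t, rfl⟩ := (dualTensorHom_bijective (R := Q) (M := X.P) (N := Ω[Q⁄k] ⊗[Q] Y.P)).2 ψ
    induction t with
    | zero => simp
    | add a b ha hb =>
      simp only [map_add, LinearMap.add_comp, LinearMap.comp_add, Finset.sum_add_distrib]
      exact add_mem ha hb
    | tmul g z =>
      induction z with
      | zero => simp
      | add a b ha hb =>
        simp only [map_add, TensorProduct.tmul_add, LinearMap.add_comp, LinearMap.comp_add,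
          Finset.sum_add_distrib]
        exact add_mem ha hb
      | tmul v y =>
        have : (ExteriorAlgebra.ι Q).rTensor Y.P ∘ₗ ∑ s : ZMod 2, (Y.proj (s + p)).lTensor Ω[Q⁄k] ∘ₗ
            dualTensorHom Q X.P (Ω[Q⁄k] ⊗[Q] Y.P) (g ⊗ₜ (v ⊗ₜ y)) ∘ₗ X.proj s =
            TensorProduct.mk Q (Forms k Q) Y.P (ExteriorAlgebra.ι Q v) ∘ₗ
              MatFac.homPart X Y p (dualTensorHom Q X.P Y.P (g ⊗ₜ y)) := by
          ext x
          rw [LinearMap.comp_apply, LinearMap.comp_apply, LinearMap.sum_apply, map_sum,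
            show MatFac.homPart X Y p (dualTensorHom Q X.P Y.P (g ⊗ₜ y)) = ∑ s : ZMod 2,
              Y.proj (s + p) ∘ₗ dualTensorHom Q X.P Y.P (g ⊗ₜ y) ∘ₗ X.proj s from rfl,
            LinearMap.sum_apply, map_sum]
          simp
        rw [this, extend_mk _ (ι_mem_exteriorPower v), Nat.cast_one, add_assoc,
          CharTwo.add_self_eq_zero, add_zero]
        exact el_mem_opSpan (ι_mem_exteriorPower v) (isHomog_homPart _ _)
  have := key ψ
  rwa [← h.eq_sum] at this

end Spans

/-! ### Connections and the operators `α'` -/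

section Connections

variable {k Q : Type u} [Field k] [CommRing Q] [Algebra k Q]

section

variable {P P' P'' : Type u} [AddCommGroup P] [Module Q P] [AddCommGroup P'] [Module Q P']
  [AddCommGroup P''] [Module Q P''] [Module k P'] [IsScalarTower k Q P'] [Module k P'']
  [IsScalarTower k Q P'']

/-- The operator on differential forms of total parity `s` that is given by `ψ : P → Ω¹ ⊗ P'`. -/
def opOne (s : ZMod 2) :
    (P →ₗ[Q] Ω[Q⁄k] ⊗[Q] P') →ₗ[Q] (Forms k Q ⊗[Q] P →ₗ[Q] Forms k Q ⊗[Q] P') where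
  toFun ψ := extend s ((ExteriorAlgebra.ι Q).rTensor P' ∘ₗ ψ)
  map_add' ψ φ := by rw [LinearMap.comp_add, map_add]
  map_smul' q ψ := by
    refine TensorProduct.ext' fun ω x => ?_
    rw [extend_tmul, RingHom.id_apply, LinearMap.smul_apply, extend_tmul, LinearMap.comp_apply,
      LinearMap.smul_apply, map_smul, smul_comm]
    rfl

lemma opOne_tmul (s : ZMod 2) (ψ : P →ₗ[Q] Ω[Q⁄k] ⊗[Q] P') (ω : Forms k Q) (x : P) :
    opOne s ψ (ω ⊗ₜ x) = gam k Q s ω • (ExteriorAlgebra.ι Q).rTensor P' (ψ x) :=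
  extend_tmul _ _ _ _

lemma opOne_comp_el (s q : ZMod 2) (ψ : P' →ₗ[Q] Ω[Q⁄k] ⊗[Q] P'') (β : P →ₗ[Q] P') :
    opOne s ψ ∘ₗ el q 1 β = opOne (s + q) (ψ ∘ₗ β) := by
  refine TensorProduct.ext' fun ω x => ?_
  rw [LinearMap.comp_apply, el_tmul, opOne_tmul, opOne_tmul, one_mul, gam_gam]
  rfl

lemma el_comp_opOne (s p : ZMod 2) (ψ : P →ₗ[Q] Ω[Q⁄k] ⊗[Q] P') (α : P' →ₗ[Q] P'') :
    el p 1 α ∘ₗ opOne s ψ = sgn p • opOne (p + s) (α.lTensor _ ∘ₗ ψ) := by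
  refine TensorProduct.ext' fun ω x => ?_
  rw [LinearMap.comp_apply, opOne_tmul, LinearMap.smul_apply, opOne_tmul, smul_rTensor_ι, gam_gam]
  rfl

end

variable {f : Q} {X Y Z : MatFac k f}

namespace MatFac

variable (cX c0 c1 : X.Connection) (cY d0 d1 : Y.Connection) (cZ : Z.Connection)

/-- The commutator `∇_Y α - (id ⊗ α) ∇_X`, as a map to `Ω¹ ⊗ P_Y`. -/
def commConn (α : X.P →ₗ[Q] Y.P) : X.P →ₗ[Q] Ω[Q⁄k] ⊗[Q] Y.P where
  toFun x := cY.D (α x) - α.lTensor Ω[Q⁄k] (cX.D x)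
  map_add' x y := by simp only [map_add]; abel
  map_smul' q x := by simp [cX.leibniz, cY.leibniz, smul_sub]

lemma isHomogForm_commConn {p : ZMod 2} {α : X.P →ₗ[Q] Y.P} (h : IsHomog X Y p α) :
    IsHomogForm X Y p (commConn cX cY α) := by
  intro s x hx
  refine Submodule.sub_mem _ (cY.odd _ _ (h s x hx)) ?_
  obtain ⟨z, hz⟩ := cX.odd s x hx
  rw [← hz, ← LinearMap.lTensor_comp_apply]
  refine ⟨(α.restrict (h s)).lTensor _ z, ?_⟩
  rw [← LinearMap.lTensor_comp_apply]
  rfl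

lemma commConn_comp (α : Y.P →ₗ[Q] Z.P) (β : X.P →ₗ[Q] Y.P) :
    commConn cX cZ (α ∘ₗ β) = commConn cY cZ α ∘ₗ β + α.lTensor _ ∘ₗ commConn cX cY β := by
  ext x
  simp only [commConn, LinearMap.coe_mk, AddHom.coe_mk, LinearMap.comp_apply, LinearMap.add_apply,
    map_sub, LinearMap.lTensor_comp]
  abel

lemma opForms_of_isHomog {p : ZMod 2} {α : X.P →ₗ[Q] Y.P} (h : IsHomog X Y p α) :
    opForms X Y α = el p 1 α := by
  change ∑ q : ZMod 2, extend q (TensorProduct.mk Q (Forms k Q) Y.P 1 ∘ₗ homPart X Y q α) = _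
  rw [Finset.sum_eq_single p]
  · rw [homPart_of_isHomog X Y h, if_pos rfl, extend_mk _ one_mem_exteriorPower, Nat.cast_zero,
      add_zero]
  · intro q _ hq
    rw [homPart_of_isHomog X Y h, if_neg hq, LinearMap.comp_zero, map_zero]
  · simp

lemma opDeriv_of_isHomog {p : ZMod 2} {α : X.P →ₗ[Q] Y.P} (h : IsHomog X Y p α) :
    opDeriv X Y cX cY α = opOne (p + 1) (commConn cX cY α) := by
  change (∑ q : ZMod 2, extend (q + 1) ∘ₗ deriv X Y cX cY ∘ₗ homPart X Y q) α = _
  rw [LinearMap.sum_apply, Finset.sum_eq_single p]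
  · simp only [LinearMap.comp_apply]
    rw [homPart_of_isHomog X Y h, if_pos rfl]
    rfl
  · intro q _ hq
    simp only [LinearMap.comp_apply]
    rw [homPart_of_isHomog X Y h, if_neg hq, map_zero, map_zero]
  · simp

lemma opForms_mem {p : ZMod 2} {α : X.P →ₗ[Q] Y.P} (h : IsHomog X Y p α) :
    opForms X Y α ∈ opSpan X Y 0 p := by
  rw [opForms_of_isHomog h]
  exact el_mem_opSpan one_mem_exteriorPower h

lemma opDeriv_mem {p : ZMod 2} {α : X.P →ₗ[Q] Y.P} (h : IsHomog X Y p α) :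
    opDeriv X Y cX cY α ∈ opSpan X Y 1 p := by
  rw [opDeriv_of_isHomog cX cY h]
  exact extend_mem_opSpan (isHomogForm_commConn cX cY h)

lemma opForms_comp {p q : ZMod 2} {α : Y.P →ₗ[Q] Z.P} {β : X.P →ₗ[Q] Y.P} (hα : IsHomog Y Z p α)
    (hβ : IsHomog X Y q β) : opForms X Z (α ∘ₗ β) = opForms Y Z α ∘ₗ opForms X Y β := by
  rw [opForms_of_isHomog hα, opForms_of_isHomog hβ, opForms_of_isHomog (hα.comp hβ),
    el_comp one_mem_exteriorPower]
  simp [sgn]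

lemma opDeriv_comp {p q : ZMod 2} {α : Y.P →ₗ[Q] Z.P} {β : X.P →ₗ[Q] Y.P} (hα : IsHomog Y Z p α)
    (hβ : IsHomog X Y q β) : opDeriv X Z cX cZ (α ∘ₗ β) =
      opDeriv Y Z cY cZ α ∘ₗ opForms X Y β + sgn p • (opForms Y Z α ∘ₗ opDeriv X Y cX cY β) := by
  rw [opForms_of_isHomog hα, opForms_of_isHomog hβ, opDeriv_of_isHomog _ _ hα,
    opDeriv_of_isHomog _ _ hβ, opDeriv_of_isHomog _ _ (hα.comp hβ), opOne_comp_el, el_comp_opOne,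
    smul_smul, sgn_mul_self, one_smul, commConn_comp cX cY cZ, map_add, add_right_comm p 1 q,
    ← add_assoc p q 1]

/-- Left multiplication by the one-form `dq`. -/
def dMul (X : MatFac k f) (q : Q) : Module.End Q (Forms k Q ⊗[Q] X.P) :=
  el 0 (ExteriorAlgebra.ι Q (KaehlerDifferential.D k Q q)) LinearMap.id

lemma isHomog_id : IsHomog X X 0 LinearMap.id := fun s x hx => by rwa [add_zero]

/-- The Leibniz rule says that the commutator of the connection with `q` is multiplication by `dq`.
Applied to `δ² = f` it yields the relation between `δ'` and `df`. -/
lemma opDeriv_smul_id (q : Q) : opDeriv X X cX cX (q • LinearMap.id) = dMul X q := by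
  have h : IsHomog X X 0 (q • LinearMap.id : X.P →ₗ[Q] X.P) :=
    (homog X X 0).smul_mem q isHomog_id
  rw [opDeriv_of_isHomog _ _ h]
  refine TensorProduct.ext' fun ω x => ?_
  have : commConn cX cX (q • LinearMap.id : X.P →ₗ[Q] X.P) x = KaehlerDifferential.D k Q q ⊗ₜ x := by
    change cX.D (q • x) - (q • LinearMap.id : X.P →ₗ[Q] X.P).lTensor Ω[Q⁄k] (cX.D x) = _
    rw [cX.leibniz, LinearMap.lTensor_smul, LinearMap.lTensor_id]
    simp
  rw [opOne_tmul, this, LinearMap.rTensor_tmul, TensorProduct.smul_tmul', smul_eq_mul, zero_add,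
    gam_one, ← ι_mul_eq]
  rfl

lemma comp_δ_δ : X.δ ∘ₗ X.δ = f • LinearMap.id := LinearMap.ext fun x => X.δ_sq x

/-- `[δ', δ] = df`. -/
lemma opDeriv_δ_comp : opDeriv X X cX cX X.δ ∘ₗ opForms X X X.δ -
    opForms X X X.δ ∘ₗ opDeriv X X cX cX X.δ = dMul X f := by
  rw [← opDeriv_smul_id cX, ← comp_δ_δ, opDeriv_comp cX cX cX X.δ_odd X.δ_odd, sgn_one, neg_smul,
    one_smul, ← sub_eq_add_neg]

lemma opForms_homD {p : ZMod 2} {α : X.P →ₗ[Q] Y.P} (hα : IsHomog X Y p α) :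
    opForms X Y (homD X Y α) = opForms Y Y Y.δ ∘ₗ opForms X Y α -
      sgn p • (opForms X Y α ∘ₗ opForms X X X.δ) := by
  rw [homD_of_isHomog hα, map_sub, map_zsmul, opForms_comp Y.δ_odd hα, opForms_comp hα X.δ_odd]

lemma opDeriv_homD {p : ZMod 2} {α : X.P →ₗ[Q] Y.P} (hα : IsHomog X Y p α) :
    opDeriv X Y cX cY (homD X Y α) = opDeriv Y Y cY cY Y.δ ∘ₗ opForms X Y α -
      opForms X Y α ∘ₗ opDeriv X X cX cX X.δ - (opForms Y Y Y.δ ∘ₗ opDeriv X Y cX cY α +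
        sgn p • (opDeriv X Y cX cY α ∘ₗ opForms X X X.δ)) := by
  rw [homD_of_isHomog hα, map_sub, map_zsmul, opDeriv_comp cX cY cY Y.δ_odd hα,
    opDeriv_comp cX cX cY hα X.δ_odd, sgn_one, smul_add, smul_smul, sgn_mul_self]
  module

/-- The difference of two connections. -/
def connDiff : X.P →ₗ[Q] Ω[Q⁄k] ⊗[Q] X.P where
  toFun x := c1.D x - c0.D x
  map_add' x y := by simp only [map_add]; abel
  map_smul' q x := by simp [c0.leibniz, c1.leibniz, smul_sub]

lemma isHomogForm_connDiff : IsHomogForm X X 0 (connDiff c0 c1) := by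
  intro s x hx
  rw [add_zero]
  exact Submodule.sub_mem _ (c1.odd _ _ hx) (c0.odd _ _ hx)

/-- The operator on differential forms given by the difference of two connections. -/
def opDiff : Module.End Q (Forms k Q ⊗[Q] X.P) := opOne 1 (connDiff c0 c1)

lemma opDiff_mem : opDiff c0 c1 ∈ opSpan X X 1 0 := by
  have := extend_mem_opSpan (isHomogForm_connDiff c0 c1)
  rwa [zero_add] at this

/-- The derivations `d ⊗ -` in the two connections cancel, so a change of connection changes `α ↦
α'` by the graded commutator with a linear operator. This is the input to the homotopy between HKR
maps. -/
lemma opDeriv_sub_opDeriv {p : ZMod 2} {α : X.P →ₗ[Q] Y.P} (h : IsHomog X Y p α) :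
    opDeriv X Y c1 d1 α - opDeriv X Y c0 d0 α =
      opDiff d0 d1 ∘ₗ opForms X Y α - sgn p • (opForms X Y α ∘ₗ opDiff c0 c1) := by
  rw [opDeriv_of_isHomog _ _ h, opDeriv_of_isHomog _ _ h, opForms_of_isHomog h, opDiff, opDiff,
    opOne_comp_el, el_comp_opOne, smul_smul, sgn_mul_self, one_smul, add_comm 1 p, ← map_sub,
    ← map_sub]
  congr 1
  ext x
  simp only [commConn, connDiff, LinearMap.sub_apply, LinearMap.coe_mk, AddHom.coe_mk,
    LinearMap.comp_apply, map_sub]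
  abel

/-- The operator that is multiplication by `n` on `Ω^n ⊗ P`. -/
def numOp (X : MatFac k f) : Module.End Q (Forms k Q ⊗[Q] X.P) :=
  (scaleForms k fun n => (n : Q)).rTensor X.P

/-- An operator of form degree `N` raises degrees by `N`, so the commutator with the number operator
detects `N`. In this way the factorials of the HKR formula are reached by ring identities. -/
lemma numOp_comp {N : ℕ} {p : ZMod 2} {Φ} (hΦ : Φ ∈ opSpan X Y N p) :
    numOp Y ∘ₗ Φ - Φ ∘ₗ numOp X = (N : Q) • Φ := by
  induction hΦ using Submodule.span_induction with
  | zero => simp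
  | add a b _ _ ha hb =>
    rw [smul_add, ← ha, ← hb, LinearMap.add_comp, LinearMap.comp_add]
    abel
  | smul r a _ ha =>
    rw [smul_comm, ← ha, smul_sub, LinearMap.smul_comp, LinearMap.comp_smul]
  | mem a ha =>
    obtain ⟨ω, hω, α, hα, rfl⟩ := ha
    refine TensorProduct.ext' fun η x => ?_
    have key : (scaleForms k fun n => (n : Q)) ∘ₗ LinearMap.mulLeft Q ω ∘ₗ (gam k Q p).toLinearMap =
        LinearMap.mulLeft Q ω ∘ₗ (gam k Q p).toLinearMap ∘ₗ (scaleForms k fun n => (n : Q)) +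
          (N : Q) • (LinearMap.mulLeft Q ω ∘ₗ (gam k Q p).toLinearMap) := by
      refine forms_hom_ext fun n y hy => ?_
      simp only [LinearMap.comp_apply, LinearMap.add_apply, LinearMap.smul_apply,
        scaleForms_of_mem _ hy, LinearMap.mulLeft_apply, AlgHom.toLinearMap_apply,
        scaleForms_of_mem _ (mul_mem_exteriorPower hω (gam_mem p hy)), map_smul,
        Nat.cast_add, add_smul]
      rw [add_comm]
    have := congrArg (fun F => F η ⊗ₜ[Q] α x) key
    simp only [LinearMap.comp_apply, LinearMap.add_apply, LinearMap.smul_apply,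
      LinearMap.mulLeft_apply, AlgHom.toLinearMap_apply, TensorProduct.add_tmul] at this
    rw [LinearMap.sub_apply, LinearMap.comp_apply, LinearMap.comp_apply, LinearMap.smul_apply,
      el_tmul, numOp, numOp, LinearMap.rTensor_tmul, LinearMap.rTensor_tmul, el_tmul, this,
      add_sub_cancel_left, TensorProduct.smul_tmul']

lemma dMul_comp {N : ℕ} {p : ZMod 2} (q : Q) {Φ} (hΦ : Φ ∈ opSpan X Y N p) :
    dMul Y q ∘ₗ Φ = sgn (N + p) • (Φ ∘ₗ dMul X q) := by
  induction hΦ using Submodule.span_induction with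
  | zero => simp
  | add a b _ _ ha hb => rw [LinearMap.comp_add, ha, hb, ← smul_add, LinearMap.add_comp]
  | smul r a _ ha => rw [LinearMap.comp_smul, ha, smul_comm, LinearMap.smul_comp]
  | mem a ha =>
    obtain ⟨ω, hω, α, hα, rfl⟩ := ha
    rw [dMul, dMul, el_comp hω, el_comp (ι_mem_exteriorPower _), ι_mul_eq, ← gam_one,
      gam_of_mem 1 hω, smul_mul_assoc, smul_smul, Nat.cast_one, mul_one, zero_mul, one_mul, sgn_add,
      mul_assoc, sgn_mul_self, el_zsmul_left, mul_one, add_comm p, sgn_zero, one_smul]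
    rfl

end MatFac

end Connections

/-! ### Traces and supertraces -/

section Trace

variable {k Q : Type u} [Field k] [CommRing Q] [Algebra k Q]
variable {P P' : Type u} [AddCommGroup P] [Module Q P] [Module.Finite Q P] [Module.Projective Q P]
  [AddCommGroup P'] [Module Q P'] [Module.Finite Q P'] [Module.Projective Q P']

/-- The trace of an endomorphism of a finitely generated projective module. -/
def projTrace : (P →ₗ[Q] P) →ₗ[Q] Q :=
  contractLeft Q P ∘ₗ
    (LinearEquiv.ofBijective (dualTensorHom Q P P) dualTensorHom_bijective).symm.toLinearMap

lemma projTrace_dualTensorHom (t : Module.Dual Q P ⊗[Q] P) :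
    projTrace (dualTensorHom Q P P t) = contractLeft Q P t := by
  have := (LinearEquiv.ofBijective (dualTensorHom Q P P) dualTensorHom_bijective).symm_apply_apply t
  exact congrArg (contractLeft Q P) this

/-- Every map between finitely generated projective modules is a sum of maps of rank one. -/
lemma hom_induction {N : Type u} [AddCommGroup N] [Module Q N] {p : (P →ₗ[Q] N) → Prop}
    (h0 : p 0) (hadd : ∀ a b, p a → p b → p (a + b))
    (h : ∀ (g : Module.Dual Q P) (y : N), p (dualTensorHom Q P N (g ⊗ₜ y))) (α : P →ₗ[Q] N) :
    p α := by
  obtain ⟨t, rfl⟩ := (dualTensorHom_bijective (R := Q) (M := P) (N := N)).2 α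
  induction t with
  | zero => rwa [map_zero]
  | add a b ha hb => rw [map_add]; exact hadd _ _ ha hb
  | tmul g y => exact h g y

lemma projTrace_comp_comm (α : P →ₗ[Q] P') (β : P' →ₗ[Q] P) :
    projTrace (α ∘ₗ β) = projTrace (β ∘ₗ α) := by
  induction α using hom_induction with
  | h0 => simp
  | hadd a b ha hb => rw [LinearMap.add_comp, LinearMap.comp_add, map_add, map_add, ha, hb]
  | h g y =>
    induction β using hom_induction with
    | h0 => simp
    | hadd a b ha hb => rw [LinearMap.add_comp, LinearMap.comp_add, map_add, map_add, ha, hb]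
    | h g' x =>
      have h1 : dualTensorHom Q P P' (g ⊗ₜ y) ∘ₗ dualTensorHom Q P' P (g' ⊗ₜ x) =
          dualTensorHom Q P' P' ((g x • g') ⊗ₜ y) := by
        ext z
        simp [smul_smul]
      have h2 : dualTensorHom Q P' P (g' ⊗ₜ x) ∘ₗ dualTensorHom Q P P' (g ⊗ₜ y) =
          dualTensorHom Q P P ((g' y • g) ⊗ₜ x) := by
        ext z
        simp [smul_smul, mul_comm]
      rw [h1, h2, projTrace_dualTensorHom, projTrace_dualTensorHom]
      simp [contractLeft_apply, mul_comm]

lemma traceForms_mk (ω : Forms k Q) (β : P →ₗ[Q] P) :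
    traceForms (TensorProduct.mk Q (Forms k Q) P ω ∘ₗ β) = projTrace β • ω := by
  induction β using hom_induction with
  | h0 => simp
  | hadd a b ha hb => rw [LinearMap.comp_add, map_add, map_add, add_smul, ha, hb]
  | h g y =>
    have h1 : TensorProduct.mk Q (Forms k Q) P ω ∘ₗ dualTensorHom Q P P (g ⊗ₜ y) =
        dualTensorHom Q P (Forms k Q ⊗[Q] P) (g ⊗ₜ (ω ⊗ₜ y)) := by
      ext z
      simp
    have h2 := (LinearEquiv.ofBijective (dualTensorHom Q P (Forms k Q ⊗[Q] P))
      dualTensorHom_bijective).symm_apply_apply (g ⊗ₜ (ω ⊗ₜ y))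
    rw [h1, projTrace_dualTensorHom, contractLeft_apply]
    have h3 : traceForms (dualTensorHom Q P (Forms k Q ⊗[Q] P) (g ⊗ₜ (ω ⊗ₜ y))) = _ :=
      congrArg (TensorProduct.lift (LinearMap.compRight Q
        (TensorProduct.rid Q (Forms k Q)).toLinearMap ∘ₗ
          LinearMap.lTensorHom (R := Q) (N := P) (P := Q) (Forms k Q))) h2
    rw [h3]
    simp

variable {f : Q} {X Y : MatFac k f}

namespace MatFac

lemma IsHomog.comp_proj {p : ZMod 2} {α : X.P →ₗ[Q] Y.P} (h : IsHomog X Y p α) (s : ZMod 2) :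
    α ∘ₗ X.proj s = Y.proj (s + p) ∘ₗ α := by
  ext x
  rw [← X.sum_proj x, map_add, map_add]
  congr 1
  · rw [LinearMap.comp_apply, LinearMap.comp_apply, X.proj_of_mem (X.proj_mem 0 x),
      Y.proj_of_mem (h _ _ (X.proj_mem 0 x))]
    simp only [add_left_inj]
    split_ifs <;> simp
  · rw [LinearMap.comp_apply, LinearMap.comp_apply, X.proj_of_mem (X.proj_mem 1 x),
      Y.proj_of_mem (h _ _ (X.proj_mem 1 x))]
    simp only [add_left_inj]
    split_ifs <;> simp

variable (X) in
/-- The supertrace of an endomorphism. -/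
def superTrace : (X.P →ₗ[Q] X.P) →ₗ[Q] Q :=
  projTrace ∘ₗ (LinearMap.lcomp Q X.P (X.proj 0) - LinearMap.lcomp Q X.P (X.proj 1))

lemma superTrace_apply (α : X.P →ₗ[Q] X.P) :
    superTrace X α = projTrace (α ∘ₗ X.proj 0) - projTrace (α ∘ₗ X.proj 1) :=
  map_sub projTrace (α ∘ₗ X.proj 0) (α ∘ₗ X.proj 1)

/-- Moving `β` around the trace carries the projection onto the part of parity `s` to that of parity
`s + q`. For odd `q` the two parts are exchanged, which changes the sign of the supertrace. -/
lemma superTrace_comp_comm {q : ZMod 2} (α : Y.P →ₗ[Q] X.P)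
    {β : X.P →ₗ[Q] Y.P} (hβ : IsHomog X Y q β) :
    superTrace X (α ∘ₗ β) = sgn q • superTrace Y (β ∘ₗ α) := by
  have (s : ZMod 2) : projTrace ((α ∘ₗ β) ∘ₗ X.proj s) = projTrace ((β ∘ₗ α) ∘ₗ Y.proj (s + q)) := by
    rw [LinearMap.comp_assoc, hβ.comp_proj, projTrace_comp_comm, LinearMap.comp_assoc,
      projTrace_comp_comm]
  rw [superTrace_apply, superTrace_apply, this, this]
  rcases parity_cases q with rfl | rfl <;> simp [sgn, show (1 : ZMod 2) + 1 = 0 from rfl]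

/-- Since `π_s = π_s²`, the trace of `α π_s` equals that of `π_s α π_s = π_s π_{s+1} α = 0`. -/
lemma superTrace_odd {α : X.P →ₗ[Q] X.P} (hα : IsHomog X X 1 α) : superTrace X α = 0 := by
  have h0 (s : ZMod 2) : X.proj s ∘ₗ X.proj (s + 1) = 0 := by
    ext x
    rw [LinearMap.comp_apply, X.proj_of_mem (X.proj_mem _ x)]
    simp
  have hs (s : ZMod 2) : X.proj s ∘ₗ X.proj s = X.proj s := by
    ext x
    rw [LinearMap.comp_apply, X.proj_of_mem (X.proj_mem s x)]
    simp
  have (s : ZMod 2) : projTrace (α ∘ₗ X.proj s) = 0 := by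
    rw [← hs, ← LinearMap.comp_assoc, projTrace_comp_comm, hα.comp_proj, ← LinearMap.comp_assoc, h0,
      LinearMap.zero_comp, map_zero]
  rw [superTrace_apply, this, this, sub_zero]

variable (X) in
/-- The supertrace, as a linear map. -/
def strLin : (Forms k Q ⊗[Q] X.P →ₗ[Q] Forms k Q ⊗[Q] X.P) →ₗ[Q] Forms k Q :=
  traceForms ∘ₗ
    (LinearMap.lcomp Q _ (TensorProduct.mk Q (Forms k Q) X.P 1 ∘ₗ X.proj 0) -
      LinearMap.lcomp Q _ (TensorProduct.mk Q (Forms k Q) X.P 1 ∘ₗ X.proj 1))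

lemma strLin_apply (Φ : Forms k Q ⊗[Q] X.P →ₗ[Q] Forms k Q ⊗[Q] X.P) : strLin X Φ = str X Φ :=
  map_sub traceForms _ _

lemma strLin_el (p : ZMod 2) (ω : Forms k Q) (α : X.P →ₗ[Q] X.P) :
    strLin X (el p ω α) = superTrace X α • ω := by
  have (s : ZMod 2) : el p ω α ∘ₗ TensorProduct.mk Q (Forms k Q) X.P 1 ∘ₗ X.proj s =
      TensorProduct.mk Q (Forms k Q) X.P ω ∘ₗ α ∘ₗ X.proj s := by
    ext x
    simp
  rw [strLin_apply, str, this, this, traceForms_mk, traceForms_mk, superTrace_apply, sub_smul]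

lemma strLin_mem {N : ℕ} {p : ZMod 2} {Φ} (hΦ : Φ ∈ opSpan X X N p) :
    strLin X Φ ∈ ⋀[Q]^N Ω[Q⁄k] := by
  induction hΦ using Submodule.span_induction with
  | zero => rw [map_zero]; exact Submodule.zero_mem _
  | add a b _ _ ha hb => rw [map_add]; exact Submodule.add_mem _ ha hb
  | smul r a _ ha => rw [map_smul]; exact Submodule.smul_mem _ r ha
  | mem a ha =>
    obtain ⟨ω, hω, α, hα, rfl⟩ := ha
    rw [strLin_el]
    exact Submodule.smul_mem _ _ hω

lemma strLin_odd {N : ℕ} {Φ} (hΦ : Φ ∈ opSpan X X N 1) : strLin X Φ = 0 := by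
  induction hΦ using Submodule.span_induction with
  | zero => rw [map_zero]
  | add a b _ _ ha hb => rw [map_add, ha, hb, add_zero]
  | smul r a _ ha => rw [map_smul, ha, smul_zero]
  | mem a ha =>
    obtain ⟨ω, hω, α, hα, rfl⟩ := ha
    rw [strLin_el, superTrace_odd hα, zero_smul]

/-- On generators `ω ⊗ α` and `η ⊗ β` four signs are collected: one from each of the two
compositions, one from commuting the forms, and one from the supertrace of `α β`. -/
lemma strLin_comp_comm {N M : ℕ} {p q : ZMod 2} {Φ Ψ} (hΦ : Φ ∈ opSpan Y X N p)
    (hΨ : Ψ ∈ opSpan X Y M q) :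
    strLin X (Φ ∘ₗ Ψ) = sgn ((N + p) * (M + q)) • strLin Y (Ψ ∘ₗ Φ) := by
  induction hΦ using Submodule.span_induction with
  | zero => simp
  | add a b _ _ ha hb => rw [LinearMap.comp_add, LinearMap.add_comp, map_add, ha, hb, ← smul_add,
      map_add]
  | smul r a _ ha => rw [LinearMap.comp_smul, LinearMap.smul_comp, map_smul, ha, smul_comm, map_smul]
  | mem a ha =>
    obtain ⟨ω, hω, α, hα, rfl⟩ := ha
    induction hΨ using Submodule.span_induction with
    | zero => simp
    | add a b _ _ ha hb => rw [LinearMap.comp_add, LinearMap.add_comp, map_add, ha, hb, ← smul_add,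
        map_add]
    | smul r a _ ha =>
      rw [LinearMap.comp_smul, LinearMap.smul_comp, map_smul, ha, smul_comm, map_smul]
    | mem b hb =>
      obtain ⟨η, hη, β, hβ, rfl⟩ := hb
      rw [el_comp hη, el_comp hω, map_zsmul, map_zsmul, strLin_el, strLin_el, forms_mul_comm hω,
        gam_of_mem _ hη, superTrace_comp_comm α hβ]
      -- The collected sign is the one claimed only for `p = q`. Otherwise `β α` is odd, and both
      -- sides vanish.
      by_cases hpq : p + q = 0
      · obtain rfl : p = q := by
          rcases parity_cases p with rfl | rfl <;> rcases parity_cases q with rfl | rfl <;>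
            first | rfl | simp at hpq
        rw [smul_mul_assoc, smul_assoc, smul_comm (superTrace Y _) (sgn _), smul_smul, smul_smul,
          smul_smul, ← sgn_add, ← sgn_add, ← sgn_add]
        congr 2
        clear * -
        generalize (N : ZMod 2) = n
        generalize (M : ZMod 2) = m
        revert p n m
        decide
      · have : superTrace Y (β ∘ₗ α) = 0 := by
          refine superTrace_odd ?_
          have := hβ.comp hα
          rwa [show q + p = 1 by
            clear * - hpq
            revert p q
            decide] at this
        simp [this]

end MatFac

end Trace

/-! ### Linear maps on words defined by recursion on the last letter -/

section Recursion

variable {k : Type u} [Field k] {H V : Type u} [AddCommGroup H] [Module k H]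
  [AddCommGroup V] [Module k V]

/-- The multilinear maps underlying `recW`. -/
def recMulti (base : H →ₗ[k] V) (step : H →ₗ[k] V →ₗ[k] V) :
    (n : ℕ) → MultilinearMap k (fun _ : Fin (n + 1) => H) V
  | 0 => base.compMultilinearMap (MultilinearMap.ofSubsingleton k H H (0 : Fin 1) LinearMap.id)
  | n + 1 => MultilinearMap.uncurryRight (step.flip.compMultilinearMap (recMulti base step n))

/-- The linear map on words that is given recursively by appending letters. -/
def recW (base : H →ₗ[k] V) (step : H →ₗ[k] V →ₗ[k] V) : AllWords k H →ₗ[k] V :=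
  DirectSum.toModule k ℕ _ fun n => ofMulti (recMulti base step n)

variable (base : H →ₗ[k] V) (step : H →ₗ[k] V →ₗ[k] V)

lemma recW_allWord (n : ℕ) (a : Fin (n + 1) → H) :
    recW base step (allWord n a) = recMulti base step n a := by
  rw [recW, toModule_allWord, ofMulti_word]

lemma recW_letterW (a : H) : recW base step (letterW a) = base a := by
  rw [letterW_apply, recW_allWord]
  rfl

lemma recW_appendW (x : H) (w : AllWords k H) :
    recW base step (appendW x w) = step x (recW base step w) := by
  have : recW base step ∘ₗ appendW x = step x ∘ₗ recW base step := by
    refine allWords_hom_ext fun n a => ?_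
    rw [LinearMap.comp_apply, LinearMap.comp_apply, appendW_allWord, recW_allWord, recW_allWord]
    change step ((Fin.snoc a x : Fin (n + 2) → H) (Fin.last _))
      (recMulti base step n (Fin.init (Fin.snoc a x : Fin (n + 2) → H))) = _
    rw [Fin.init_snoc, Fin.snoc_last]
  exact LinearMap.congr_fun this w

end Recursion

/-! ### The ring of all operators, its supertrace and the factorials -/

section OpRing

/-- Injective linear maps over a field have a left inverse. -/
lemma exists_leftInverse {k V W : Type u} [Field k] [AddCommMonoid V] [Module k V]
    [AddCommMonoid W] [Module k W] (f : V →ₗ[k] W) (hf : Function.Injective f) :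
    ∃ g : W →ₗ[k] V, ∀ x, g (f x) = x := by
  let _ := Module.addCommMonoidToAddCommGroup k (M := V)
  let _ := Module.addCommMonoidToAddCommGroup k (M := W)
  obtain ⟨g, hg⟩ := f.exists_leftInverse_of_injective (LinearMap.ker_eq_bot.2 hf)
  exact ⟨g, LinearMap.congr_fun hg⟩

variable {k Q : Type u} [Field k] [CommRing Q] [Algebra k Q] {f : Q} {I : Type u}
  (X : I → MatFac k f)

open Classical in
/-- The ring of operators on the direct sum of all `Ω^• ⊗ P_i`. -/
def OpRing : Type u := Module.End Q (Π₀ i, Forms k Q ⊗[Q] (X i).P)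

instance : Ring (OpRing X) := inferInstanceAs (Ring (Module.End Q (Π₀ i, Forms k Q ⊗[Q] (X i).P)))

instance : Algebra Q (OpRing X) :=
  inferInstanceAs (Algebra Q (Module.End Q (Π₀ i, Forms k Q ⊗[Q] (X i).P)))

instance : Algebra k (OpRing X) :=
  inferInstanceAs (Algebra k (Module.End Q (Π₀ i, Forms k Q ⊗[Q] (X i).P)))

instance : IsScalarTower k Q (OpRing X) :=
  inferInstanceAs (IsScalarTower k Q (Module.End Q (Π₀ i, Forms k Q ⊗[Q] (X i).P)))

variable {X} in
open Classical in
/-- The operator with the single matrix entry `φ`. -/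
def block (i j : I) :
    (Forms k Q ⊗[Q] (X j).P →ₗ[Q] Forms k Q ⊗[Q] (X i).P) →ₗ[Q] OpRing X where
  toFun φ := (DFinsupp.lsingle (R := Q) i ∘ₗ φ ∘ₗ DFinsupp.lapply (R := Q) j :
    Module.End Q (Π₀ i, Forms k Q ⊗[Q] (X i).P))
  map_add' φ ψ := by rw [LinearMap.add_comp, LinearMap.comp_add]; rfl
  map_smul' q φ := by rw [LinearMap.smul_comp, LinearMap.comp_smul]; rfl

variable {X} in
/-- A diagonal operator. -/
def diagOp (T : ∀ i, Module.End Q (Forms k Q ⊗[Q] (X i).P)) : OpRing X :=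
  (DFinsupp.mapRange.linearMap T : Module.End Q (Π₀ i, Forms k Q ⊗[Q] (X i).P))

variable {X}

lemma block_mul_block' (i j l m : I) (φ : Forms k Q ⊗[Q] (X j).P →ₗ[Q] Forms k Q ⊗[Q] (X i).P)
    (ψ : Forms k Q ⊗[Q] (X m).P →ₗ[Q] Forms k Q ⊗[Q] (X l).P) :
    block i j φ * block l m ψ =
      block i m (φ ∘ₗ transport (Q := Q) (fun i => Forms k Q ⊗[Q] (X i).P) l j ∘ₗ ψ) := rfl

lemma block_mul_block (i j l : I) (φ : Forms k Q ⊗[Q] (X j).P →ₗ[Q] Forms k Q ⊗[Q] (X i).P)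
    (ψ : Forms k Q ⊗[Q] (X l).P →ₗ[Q] Forms k Q ⊗[Q] (X j).P) :
    block i j φ * block j l ψ = block i l (φ ∘ₗ ψ) := by
  rw [block_mul_block', transport_self, LinearMap.id_comp]

lemma block_mul_diagOp (i j : I) (φ : Forms k Q ⊗[Q] (X j).P →ₗ[Q] Forms k Q ⊗[Q] (X i).P)
    (T : ∀ i, Module.End Q (Forms k Q ⊗[Q] (X i).P)) :
    block i j φ * diagOp T = block i j (φ ∘ₗ T j) := rfl

lemma diagOp_mul_block (i j : I) (φ : Forms k Q ⊗[Q] (X j).P →ₗ[Q] Forms k Q ⊗[Q] (X i).P)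
    (T : ∀ i, Module.End Q (Forms k Q ⊗[Q] (X i).P)) :
    diagOp T * block i j φ = block i j (T i ∘ₗ φ) := by
  classical
  refine LinearMap.ext fun v => ?_
  exact DFinsupp.mapRange_single (hf := fun _ => map_zero _)

lemma diagOp_mul (T T' : ∀ i, Module.End Q (Forms k Q ⊗[Q] (X i).P)) :
    diagOp T * diagOp T' = diagOp fun i => T i * T' i := by
  refine LinearMap.ext fun _ => DFinsupp.ext fun _ => rfl

lemma diagOp_pow (T : ∀ i, Module.End Q (Forms k Q ⊗[Q] (X i).P)) (e : ℕ) :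
    diagOp T ^ e = diagOp fun i => T i ^ e := by
  induction e with
  | zero => exact LinearMap.ext fun _ => DFinsupp.ext fun _ => rfl
  | succ e ih => rw [pow_succ, ih, diagOp_mul]; simp only [pow_succ]

lemma diagOp_sub (T T' : ∀ i, Module.End Q (Forms k Q ⊗[Q] (X i).P)) :
    diagOp T - diagOp T' = diagOp fun i => T i - T' i :=
  LinearMap.ext fun _ => DFinsupp.ext fun _ => rfl

lemma diagOp_add (T T' : ∀ i, Module.End Q (Forms k Q ⊗[Q] (X i).P)) :
    diagOp T + diagOp T' = diagOp fun i => T i + T' i :=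
  LinearMap.ext fun _ => DFinsupp.ext fun _ => rfl

lemma diagOp_zero : diagOp (X := X) (fun _ => 0) = 0 :=
  LinearMap.ext fun _ => DFinsupp.ext fun _ => rfl

variable (X) in
open Classical in
/-- The embedding of the category algebra of the modules `Ω^• ⊗ P_i` into the ring of operators. -/
def blockMap : FArr X →ₗ[k] OpRing X :=
  DFinsupp.lsum (R := k) k fun e : I × I => (block e.1 e.2).restrictScalars k

lemma blockMap_arr (i j : I) (φ : Forms k Q ⊗[Q] (X j).P →ₗ[Q] Forms k Q ⊗[Q] (X i).P) :
    blockMap X (arr (fun i => Forms k Q ⊗[Q] (X i).P) i j φ) = block i j φ := by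
  classical
  exact DFinsupp.lsum_single _ _ _ _

lemma blockMap_arrMul (a b : FArr X) :
    blockMap X (arrMul k _ a b) = blockMap X a * blockMap X b := by
  refine DFunLike.congr_fun (arr_hom_ext _
    (F := (blockMap X ∘ₗ (arrMul k fun i => Forms k Q ⊗[Q] (X i).P).flip b).toAddMonoidHom)
    (G := ((LinearMap.mulRight k (blockMap X b)) ∘ₗ blockMap X).toAddMonoidHom)
    fun i j α => ?_) a
  refine DFunLike.congr_fun (arr_hom_ext _
    (F := (blockMap X ∘ₗ arrMul k (fun i => Forms k Q ⊗[Q] (X i).P) (arr _ i j α)).toAddMonoidHom)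
    (G := ((LinearMap.mulLeft k (blockMap X (arr _ i j α))) ∘ₗ blockMap X).toAddMonoidHom)
    fun l m β => ?_) b
  change blockMap X (arrMul k _ (arr _ i j α) (arr _ l m β)) =
    blockMap X (arr _ i j α) * blockMap X (arr _ l m β)
  rw [arrMul_arr, blockMap_arr, blockMap_arr, blockMap_arr, block_mul_block']

open Classical in
/-- The matrix entries of an operator. -/
def entry (i j : I) : OpRing X →+ (Forms k Q ⊗[Q] (X j).P →ₗ[Q] Forms k Q ⊗[Q] (X i).P) where
  toFun (T : Module.End Q (Π₀ i, Forms k Q ⊗[Q] (X i).P)) :=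
    DFinsupp.lapply (R := Q) i ∘ₗ T ∘ₗ
      DFinsupp.lsingle (R := Q) (M := fun i => Forms k Q ⊗[Q] (X i).P) j
  map_zero' := rfl
  map_add' _ _ := rfl

lemma entry_blockMap (a : FArr X) (i j : I) : entry i j (blockMap X a) = a (i, j) := by
  refine DFunLike.congr_fun (arr_hom_ext _ (F := (entry i j).comp (blockMap X).toAddMonoidHom)
    (G := DFinsupp.evalAddMonoidHom (i, j)) fun l m φ => ?_) a
  change entry i j (blockMap X (arr _ l m φ)) =
    arr (fun i => Forms k Q ⊗[Q] (X i).P) l m φ (i, j)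
  rw [blockMap_arr]
  refine LinearMap.ext fun x => ?_
  classical
  change DFinsupp.single (β := fun i => Forms k Q ⊗[Q] (X i).P) l
      (φ (DFinsupp.single (β := fun i => Forms k Q ⊗[Q] (X i).P) j x m)) i =
    DFinsupp.single (β := fun e : I × I => Forms k Q ⊗[Q] (X e.2).P →ₗ[Q] Forms k Q ⊗[Q] (X e.1).P)
      (l, m) φ (i, j) x
  by_cases hl : l = i
  · subst hl
    by_cases hm : m = j
    · subst hm
      rw [DFinsupp.single_eq_same, DFinsupp.single_eq_same, DFinsupp.single_eq_same]
    · rw [DFinsupp.single_eq_same, DFinsupp.single_eq_of_ne hm,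
        DFinsupp.single_eq_of_ne (by simp [Ne.symm hm]), map_zero]
      rfl
  · rw [DFinsupp.single_eq_of_ne (Ne.symm hl), DFinsupp.single_eq_of_ne (by simp [Ne.symm hl])]
    rfl

lemma blockMap_injective : Function.Injective (blockMap X) := fun a b h =>
  DFinsupp.ext fun e => by
    rw [← entry_blockMap a e.1 e.2, ← entry_blockMap b e.1 e.2, h]

variable (X) in
/-- An extension of the supertrace to the ring of operators. -/
def opStr : OpRing X →ₗ[k] Forms k Q :=
  arrStr X ∘ₗ (exists_leftInverse (blockMap X) blockMap_injective).choose

/-- The left inverse in the definition of `opStr` is arbitrary outside the image of `blockMap`. Only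
the values on matrices with finitely many entries are ever evaluated, and this is the statement that
they are the right ones. -/
lemma opStr_blockMap (a : FArr X) : opStr X (blockMap X a) = arrStr X a :=
  congrArg (arrStr X) ((exists_leftInverse (blockMap X) blockMap_injective).choose_spec a)

lemma arrStr_arr (i j : I) (φ : Forms k Q ⊗[Q] (X j).P →ₗ[Q] Forms k Q ⊗[Q] (X i).P) :
    arrStr X (arr _ i j φ) =
      MatFac.str (X i) (φ ∘ₗ transport (fun i => Forms k Q ⊗[Q] (X i).P) i j) := by
  classical
  unfold arrStr arr
  rw [DFinsupp.lsum_single]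
  rfl

lemma opStr_block (i : I) (φ : Forms k Q ⊗[Q] (X i).P →ₗ[Q] Forms k Q ⊗[Q] (X i).P) :
    opStr X (block i i φ) = MatFac.strLin (X i) φ := by
  rw [← blockMap_arr, opStr_blockMap, MatFac.strLin_apply, arrStr_arr, transport_self,
    LinearMap.comp_id]

/-- The operators on differential forms of total parity `t`. -/
def opTot (A B : MatFac k f) (t : ZMod 2) :
    Submodule Q (Forms k Q ⊗[Q] A.P →ₗ[Q] Forms k Q ⊗[Q] B.P) :=
  ⨆ N : ℕ, opSpan A B N (t + N)

lemma opSpan_le_opTot {A B : MatFac k f} {N : ℕ} {p t : ZMod 2} (h : t = N + p) :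
    opSpan A B N p ≤ opTot A B t := by
  have : p = t + N := by
    rw [h, add_right_comm, CharTwo.add_self_eq_zero, zero_add]
  subst this
  exact le_iSup (fun N : ℕ => opSpan A B N (t + N)) N

lemma opTot_induction {A B : MatFac k f} {t : ZMod 2}
    {P : ∀ Φ : Forms k Q ⊗[Q] A.P →ₗ[Q] Forms k Q ⊗[Q] B.P, Φ ∈ opTot A B t → Prop}
    (h : ∀ (N : ℕ) (p : ZMod 2) (ht : t = N + p) (Φ) (hΦ : Φ ∈ opSpan A B N p),
      P Φ (opSpan_le_opTot ht hΦ)) (h0 : P 0 (zero_mem _))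
    (hadd : ∀ a b ha hb, P a ha → P b hb → P (a + b) (add_mem ha hb))
    {Φ : Forms k Q ⊗[Q] A.P →ₗ[Q] Forms k Q ⊗[Q] B.P} (hΦ : Φ ∈ opTot A B t) : P Φ hΦ := by
  refine Submodule.iSup_induction' _ (motive := P) (fun N x hx => h N _ ?_ x hx) h0
    (fun a b ha hb => hadd a b ha hb) hΦ
  rw [add_left_comm, CharTwo.add_self_eq_zero, add_zero]

lemma opTot_comp {A B C : MatFac k f} {s t : ZMod 2} {Φ Ψ} (hΦ : Φ ∈ opTot B C s)
    (hΨ : Ψ ∈ opTot A B t) : Φ ∘ₗ Ψ ∈ opTot A C (s + t) := by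
  induction hΦ using opTot_induction with
  | h0 => rw [LinearMap.zero_comp]; exact zero_mem _
  | hadd a b _ _ ha hb => rw [LinearMap.add_comp]; exact add_mem ha hb
  | h N p hN a ha =>
    induction hΨ using opTot_induction with
    | h0 => rw [LinearMap.comp_zero]; exact zero_mem _
    | hadd a b _ _ ha hb => rw [LinearMap.comp_add]; exact add_mem ha hb
    | h M q hM b hb =>
      refine opSpan_le_opTot ?_ (opSpan_comp ha hb)
      rw [hN, hM, Nat.cast_add]
      ring

/-- The operators with a single matrix entry, homogeneous of total parity `t`. -/
def blkT (i j : I) (t : ZMod 2) : Submodule Q (OpRing X) := (opTot (X j) (X i) t).map (block i j)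

lemma block_mem_blkT {i j : I} {N : ℕ} {p t : ZMod 2} {φ} (h : φ ∈ opSpan (X j) (X i) N p)
    (ht : t = N + p) : block i j φ ∈ blkT (X := X) i j t :=
  Submodule.mem_map_of_mem (opSpan_le_opTot ht h)

lemma blkT_mul {i j l : I} {s t : ZMod 2} {A B : OpRing X} (hA : A ∈ blkT i j s)
    (hB : B ∈ blkT j l t) : A * B ∈ blkT i l (s + t) := by
  obtain ⟨φ, hφ, rfl⟩ := hA
  obtain ⟨ψ, hψ, rfl⟩ := hB
  rw [block_mul_block]
  exact Submodule.mem_map_of_mem (opTot_comp hφ hψ)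

lemma blkT_mul_diagOp {i j : I} {s t : ZMod 2} {A : OpRing X} (hA : A ∈ blkT i j s)
    {T : ∀ i, Module.End Q (Forms k Q ⊗[Q] (X i).P)} (hT : ∀ i, T i ∈ opTot (X i) (X i) t) :
    A * diagOp T ∈ blkT i j (s + t) := by
  obtain ⟨φ, hφ, rfl⟩ := hA
  rw [block_mul_diagOp]
  exact Submodule.mem_map_of_mem (opTot_comp hφ (hT _))

lemma strLin_opTot_comm {A B : MatFac k f} {s t : ZMod 2} {Φ Ψ} (hΦ : Φ ∈ opTot B A s)
    (hΨ : Ψ ∈ opTot A B t) :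
    MatFac.strLin A (Φ ∘ₗ Ψ) = sgn (s * t) • MatFac.strLin B (Ψ ∘ₗ Φ) := by
  induction hΦ using opTot_induction with
  | h0 => simp
  | hadd a b _ _ ha hb => rw [LinearMap.add_comp, LinearMap.comp_add, map_add, map_add, ha, hb, smul_add]
  | h N p hN a ha =>
    induction hΨ using opTot_induction with
    | h0 => simp
    | hadd a b _ _ ha hb =>
      rw [LinearMap.add_comp, LinearMap.comp_add, map_add, map_add, ha, hb, smul_add]
    | h M q hM b hb => rw [MatFac.strLin_comp_comm ha hb, hN, hM]

lemma opStr_mul_comm {i j : I} {s t : ZMod 2} {A B : OpRing X} (hA : A ∈ blkT i j s)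
    (hB : B ∈ blkT j i t) : opStr X (A * B) = sgn (s * t) • opStr X (B * A) := by
  obtain ⟨φ, hφ, rfl⟩ := hA
  obtain ⟨ψ, hψ, rfl⟩ := hB
  rw [block_mul_block, block_mul_block, opStr_block, opStr_block, strLin_opTot_comm hφ hψ]

lemma opStr_diagOp_mul {i : I} {s t : ZMod 2} {A : OpRing X} (hA : A ∈ blkT i i t)
    {T : ∀ i, Module.End Q (Forms k Q ⊗[Q] (X i).P)} (hT : ∀ i, T i ∈ opTot (X i) (X i) s) :
    opStr X (diagOp T * A) = sgn (s * t) • opStr X (A * diagOp T) := by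
  obtain ⟨φ, hφ, rfl⟩ := hA
  rw [diagOp_mul_block, block_mul_diagOp, opStr_block, opStr_block, strLin_opTot_comm (hT i) hφ]

lemma opStr_smul {i : I} {t : ZMod 2} {A : OpRing X} (hA : A ∈ blkT i i t) (q : Q) :
    opStr X (q • A) = q • opStr X A := by
  obtain ⟨φ, hφ, rfl⟩ := hA
  rw [← map_smul, opStr_block, opStr_block, map_smul]

lemma opStr_mem {i : I} {t : ZMod 2} {A : OpRing X} (hA : A ∈ blkT i i t) :
    opStr X A ∈ formsGr k Q t := by
  obtain ⟨φ, hφ, rfl⟩ := hA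
  rw [opStr_block]
  induction hφ using opTot_induction with
  | h0 => rw [map_zero]; exact zero_mem _
  | hadd a b _ _ ha hb => rw [map_add]; exact add_mem ha hb
  | h N p hN a ha =>
    rcases parity_cases p with rfl | rfl
    · rw [hN, add_zero]
      exact exteriorPower_le_formsGr N (MatFac.strLin_mem ha)
    · rw [MatFac.strLin_odd ha]
      exact zero_mem _

variable (k Q) in
/-- The operator that is multiplication by `1 / n!` on `Ω^n`. -/
def factScale : Forms k Q →ₗ[Q] Forms k Q :=
  scaleForms k fun n => algebraMap k Q ((n.factorial : k)⁻¹)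

lemma factScale_of_mem {n : ℕ} {x : Forms k Q} (hx : x ∈ ⋀[Q]^n Ω[Q⁄k]) :
    factScale k Q x = (n.factorial : k)⁻¹ • x := by
  rw [factScale, scaleForms_of_mem _ hx, algebraMap_smul]

variable (X) in
/-- The number operator. -/
def opNum : OpRing X := diagOp fun i => MatFac.numOp (X i)

variable (X) in
/-- Left multiplication by the one-form `dq`. -/
def opD (q : Q) : OpRing X := diagOp fun i => MatFac.dMul (X i) q

lemma opD_mul {i j : I} {t : ZMod 2} {A : OpRing X} (hA : A ∈ blkT i j t) (q : Q) :
    opD X q * A = sgn t • (A * opD X q) := by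
  obtain ⟨φ, hφ, rfl⟩ := hA
  rw [opD, diagOp_mul_block, block_mul_diagOp, ← map_zsmul]
  congr 1
  induction hφ using opTot_induction with
  | h0 => simp
  | hadd a b _ _ ha hb => rw [LinearMap.add_comp, LinearMap.comp_add, ha, hb, smul_add]
  | h N p hN a ha => rw [MatFac.dMul_comp q ha, hN]

/-- On form degree `N` the operator `[ν, -] + 1` is multiplication by `N + 1`, and multiplication by
`dq` moves to degree `N + 1`. The factor becomes `(N + 1) / (N + 1)! = 1 / N!`; characteristic zero
is needed to cancel `N + 1`. -/
lemma factScale_opStr [CharZero k] {i : I} {t : ZMod 2} {A : OpRing X} (hA : A ∈ blkT i i t) (q : Q) :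
    factScale k Q (opStr X (opD X q * (opNum X * A - A * opNum X + A))) =
      formsD q (factScale k Q (opStr X A)) := by
  obtain ⟨φ, hφ, rfl⟩ := hA
  rw [opD, opNum, diagOp_mul_block, block_mul_diagOp, ← map_sub, ← map_add, diagOp_mul_block,
    opStr_block, opStr_block]
  induction hφ using opTot_induction with
  | h0 => simp
  | hadd a b _ _ ha hb =>
    have : MatFac.numOp (X i) ∘ₗ (a + b) - (a + b) ∘ₗ MatFac.numOp (X i) + (a + b) =
        (MatFac.numOp (X i) ∘ₗ a - a ∘ₗ MatFac.numOp (X i) + a) +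
          (MatFac.numOp (X i) ∘ₗ b - b ∘ₗ MatFac.numOp (X i) + b) := by
      rw [LinearMap.comp_add, LinearMap.add_comp]
      abel
    rw [this, LinearMap.comp_add, map_add, map_add, ha, hb, ← map_add, ← map_add, ← map_add]
  | h N p hN a ha =>
    have h1 : MatFac.numOp (X i) ∘ₗ a - a ∘ₗ MatFac.numOp (X i) + a = ((N + 1 : ℕ) : Q) • a := by
      rw [MatFac.numOp_comp ha, Nat.cast_succ, add_smul, one_smul]
    have h2 : MatFac.strLin (X i) (MatFac.dMul (X i) q ∘ₗ a) =
        ExteriorAlgebra.ι Q (KaehlerDifferential.D k Q q) * MatFac.strLin (X i) a := by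
      clear h1
      induction ha using Submodule.span_induction with
      | zero => simp
      | add a b _ _ ha hb => rw [LinearMap.comp_add, map_add, map_add, ha, hb, mul_add]
      | smul r a _ ha => rw [LinearMap.comp_smul, map_smul, map_smul, ha, mul_smul_comm]
      | mem a ha =>
        obtain ⟨ω, hω, α, hα, rfl⟩ := ha
        rw [MatFac.dMul, el_comp hω, LinearMap.id_comp, zero_mul, sgn_zero, one_smul,
          MatFac.strLin_el, MatFac.strLin_el, mul_smul_comm]
    have h3 := mul_mem_exteriorPower (ι_mem_exteriorPower (KaehlerDifferential.D k Q q))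
      (MatFac.strLin_mem ha)
    rw [h1, LinearMap.comp_smul, map_smul, map_smul, h2, factScale_of_mem h3,
      factScale_of_mem (MatFac.strLin_mem ha), map_smul, add_comm 1 N, Nat.factorial_succ,
      ← map_natCast (algebraMap k Q), algebraMap_smul, smul_smul, Nat.cast_mul, mul_inv,
      mul_inv_cancel_left₀ (Nat.cast_ne_zero.2 (Nat.succ_ne_zero N))]
    rfl

end OpRing

/-! ### The operator of a word, and its value on `b'` -/

section System

variable {k Q : Type u} [Field k] [CommRing Q]
variable {H : Type u} [AddCommGroup H] [Module k H] [Module Q H] [SMulCommClass k Q H]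
variable {I : Type u} {E : Type u} [Ring E] [Algebra k E]

/-- The algebraic relations between the operators `a`, `a'`, `δ`, `δ'`, `G = (1 + δ')⁻¹`, `ω = df` and
the number operator `ν`. -/
structure IsHKRSystem (mul : H →ₗ[k] H →ₗ[k] H) (d : H →ₗ[k] H) (𝓗 : I → I → ZMod 2 → Submodule Q H)
    (ρ D : H →ₗ[k] E) (δ δ' G ω ν : E) : Prop where
  ρ_mul : ∀ {i j l p q a b}, a ∈ 𝓗 i j p → b ∈ 𝓗 j l q → ρ (mul a b) = ρ a * ρ b
  ρ_d : ∀ {i j p a}, a ∈ 𝓗 i j p → ρ (d a) = δ * ρ a - sgn p • (ρ a * δ)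
  D_mul : ∀ {i j l p q a b}, a ∈ 𝓗 i j p → b ∈ 𝓗 j l q →
    D (mul a b) = D a * ρ b + sgn p • (ρ a * D b)
  D_d : ∀ {i j p a}, a ∈ 𝓗 i j p →
    D (d a) = δ' * ρ a - ρ a * δ' - (δ * D a + sgn p • (D a * δ))
  G_left : G * (1 + δ') = 1
  G_right : (1 + δ') * G = 1
  comm : δ' * δ - δ * δ' = ω
  ν_ρ : ∀ {i j p a}, a ∈ 𝓗 i j p → ν * ρ a = ρ a * ν
  ν_D : ∀ {i j p a}, a ∈ 𝓗 i j p → ν * D a = D a * ν + D a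
  ν_δ' : ν * δ' = δ' * ν + δ'
  ω_ρ : ∀ {i j p a}, a ∈ 𝓗 i j p → ω * ρ a = sgn p • (ρ a * ω)
  ω_D : ∀ {i j p a}, a ∈ 𝓗 i j p → ω * D a = sgn (p + 1) • (D a * ω)
  ω_δ' : ω * δ' = δ' * ω

lemma sgn_cases (p : ZMod 2) : sgn p = 1 ∨ sgn p = -1 := by
  rcases parity_cases p with rfl | rfl <;> simp [sgn]

namespace IsHKRSystem

variable {part : ZMod 2 → H →ₗ[k] H} {mul : H →ₗ[k] H →ₗ[k] H} {d : H →ₗ[k] H}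
  {𝓗 : I → I → ZMod 2 → Submodule Q H} {ρ D : H →ₗ[k] E} {δ δ' G ω ν : E}

/-- Commutation rules for `G` follow from those for `1 + δ'` by multiplying with `G` on both sides.
For `δ` this turns `[δ', δ] = ω` into `[δ, G] = G ω G`; in `ν_G`, the identity `[ν, δ'] = δ'`
becomes `[ν, G] = -G δ' G = G² - G`. -/
lemma δ_G (h : IsHKRSystem mul d 𝓗 ρ D δ δ' G ω ν) : δ * G = G * δ + G * ω * G := by
  have h1 := h.G_left
  have h2 := h.G_right
  have h3 := h.comm
  linear_combination (norm := noncomm_ring) G * h3 * G - h1 * δ * G + G * δ * h2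

lemma ω_G (h : IsHKRSystem mul d 𝓗 ρ D δ δ' G ω ν) : ω * G = G * ω := by
  have h1 := h.G_left
  have h2 := h.G_right
  have h3 := h.ω_δ'
  linear_combination (norm := noncomm_ring) - (G * h3 * G) - h1 * ω * G + G * ω * h2

lemma ν_G (h : IsHKRSystem mul d 𝓗 ρ D δ δ' G ω ν) : ν * G = G * ν + G * G - G := by
  have h1 := h.G_left
  have h2 := h.G_right
  have h3 := h.ν_δ'
  linear_combination (norm := noncomm_ring) - (G * h3 * G) - h1 * ν * G + G * ν * h2 - G * h2

end IsHKRSystem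

variable (ρ D : H →ₗ[k] E) (G : E)

/-- The operator `α₀ G α₁' G ⋯ α_n' G` of a word. -/
def opW : AllWords k H →ₗ[k] E :=
  recW (LinearMap.mulRight k G ∘ₗ ρ)
    ((LinearMap.mul k E).flip ∘ₗ LinearMap.mulRight k G ∘ₗ D)

lemma opW_letterW (a : H) : opW ρ D G (letterW a) = ρ a * G := recW_letterW _ _ _

lemma opW_appendW (x : H) (w : AllWords k H) :
    opW ρ D G (appendW x w) = opW ρ D G w * (D x * G) := recW_appendW _ _ _ _

/-- The linear map `a ↦ (-1)^{|a| + c} a`. -/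
def signL (part : ZMod 2 → H →ₗ[k] H) (c : ZMod 2) : H →ₗ[k] H := ∑ p, sgn (p + c) • part p

lemma signL_of_mem {part : ZMod 2 → H →ₗ[k] H} {mul : H →ₗ[k] H →ₗ[k] H} {d : H →ₗ[k] H}
    {𝓗 : I → I → ZMod 2 → Submodule Q H} (h : IsDG part mul d 𝓗) {i j : I} {p : ZMod 2} {a : H}
    (ha : a ∈ 𝓗 i j p) (c : ZMod 2) : signL part c a = sgn (p + c) • a := by
  rw [signL, LinearMap.sum_apply, Finset.sum_eq_single p]
  · rw [LinearMap.smul_apply, h.part_mem ha, if_pos rfl]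
  · intro q _ hq
    rw [LinearMap.smul_apply, h.part_mem ha, if_neg hq, smul_zero]
  · simp

/-- The auxiliary operator `α₀ G α₁' G ⋯ α_{n-1}' G α_n` of a word, up to a sign. -/
def lastW (part : ZMod 2 → H →ₗ[k] H) : AllWords k H →ₗ[k] E :=
  LinearMap.snd k E E ∘ₗ recW (LinearMap.inl k E E ∘ₗ LinearMap.mulRight k G ∘ₗ ρ)
    { toFun := fun x => LinearMap.prod (LinearMap.mulRight k (D x * G) ∘ₗ LinearMap.fst k E E)
        (LinearMap.mulRight k (ρ (signL part 0 x)) ∘ₗ LinearMap.fst k E E)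
      map_add' := fun x y => by ext <;> simp [add_mul, mul_add, mul_assoc]
      map_smul' := fun c x => by ext <;> simp [mul_assoc] }

/-- The value of `lastW` on a longer word depends on `opW` of the shorter one. Both are therefore
computed by one recursion with values in pairs, whose first component is `opW`. -/
lemma lastW_aux {S : H →ₗ[k] E × E →ₗ[k] E × E}
    (hS : ∀ x v, (S x v).1 = v.1 * (D x * G)) (w : AllWords k H) :
    (recW (LinearMap.inl k E E ∘ₗ LinearMap.mulRight k G ∘ₗ ρ) S w).1 = opW ρ D G w := by
  have : LinearMap.fst k E E ∘ₗ recW (LinearMap.inl k E E ∘ₗ LinearMap.mulRight k G ∘ₗ ρ) S =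
      opW ρ D G := by
    refine allWords_hom_ext fun n a => ?_
    induction n with
    | zero =>
      have : a = fun _ => a 0 := funext fun l => by rw [Fin.fin_one_eq_zero l]
      rw [this, ← letterW_apply, LinearMap.comp_apply, recW_letterW, opW_letterW]
      rfl
    | succ n ih =>
      rw [← Fin.snoc_init_self a, ← appendW_allWord, LinearMap.comp_apply, recW_appendW,
        LinearMap.fst_apply, hS, opW_appendW, ← ih]
      rfl
  exact LinearMap.congr_fun this w

lemma lastW_letterW (part : ZMod 2 → H →ₗ[k] H) (a : H) : lastW ρ D G part (letterW a) = 0 := by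
  rw [lastW, LinearMap.comp_apply, recW_letterW]
  rfl

lemma lastW_appendW (part : ZMod 2 → H →ₗ[k] H) (x : H) (w : AllWords k H) :
    lastW ρ D G part (appendW x w) = opW ρ D G w * ρ (signL part 0 x) := by
  rw [lastW, LinearMap.comp_apply, recW_appendW]
  refine congrArg (· * ρ (signL part 0 x)) (lastW_aux ρ D G (fun x v => ?_) w)
  rfl

variable {ρ D G}

namespace IsHKRSystem

variable {part : ZMod 2 → H →ₗ[k] H} {mul : H →ₗ[k] H →ₗ[k] H} {d : H →ₗ[k] H}
  {𝓗 : I → I → ZMod 2 → Submodule Q H} {δ δ' ω ν : E}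

variable {i j l : I} {σ p : ZMod 2} {n : ℕ} {w : AllWords k H} {x : H}

lemma ω_opW (hs : IsHKRSystem mul d 𝓗 ρ D δ δ' G ω ν) (hw : IsPath 𝓗 n i j σ w) :
    ω * opW ρ D G w = sgn (σ + 1) • (opW ρ D G w * ω) := by
  have h1 := hs.ω_G
  induction hw with
  | @base i j p σ a ha hσ =>
    have h2 := hs.ω_ρ ha
    rw [← letterW_apply, opW_letterW, hσ, add_assoc, show (1 : ZMod 2) + 1 = 0 from rfl, add_zero,
      ← mul_assoc, h2, smul_mul_assoc, mul_assoc, h1, mul_assoc]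
  | @snoc n i j l σ q τ w x hw hx hτ ih =>
    rw [opW_appendW, ← mul_assoc, ih, smul_mul_assoc, mul_assoc _ ω, ← mul_assoc ω, hs.ω_D hx,
      smul_mul_assoc, mul_smul_comm, smul_smul, mul_assoc _ ω G, h1, mul_assoc, mul_assoc, hτ,
      ← sgn_add]
    congr 2
    ring

/-- By the Leibniz rule, `D (a x)` is `D a · ρ x` plus a term with `a` undifferentiated. In the
first term `G (1 + δ') = 1` is inserted behind `D a` so that the operator of the original word
reappears; the second term is by definition `lastW` times `D x`. -/
lemma opW_right (h : IsDG part mul d 𝓗) (hs : IsHKRSystem mul d 𝓗 ρ D δ δ' G ω ν)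
    (hw : IsPath 𝓗 n i j σ w) (hx : x ∈ 𝓗 j l p) :
    opW ρ D G (mapLastW (mul.flip x) w) =
      opW ρ D G w * (1 + δ') * ρ x * G + lastW ρ D G part w * D x * G := by
  have h1 := hs.G_left
  cases hw with
  | base ha hσ =>
    rw [mapLastW_zero, ← letterW_apply, ← letterW_apply, opW_letterW, opW_letterW, lastW_letterW,
      LinearMap.flip_apply, hs.ρ_mul ha hx, mul_assoc _ G, h1]
    noncomm_ring
  | snoc hw ha hτ =>
    rw [mapLastW_appendW, opW_appendW, opW_appendW, lastW_appendW, LinearMap.flip_apply,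
      hs.D_mul ha hx, signL_of_mem h ha, add_zero, map_zsmul, ← mul_assoc _ _ G,
      ← mul_assoc _ (D _) G, mul_assoc _ G (1 + δ'), h1]
    simp only [mul_add, add_mul, mul_smul_comm, smul_mul_assoc, mul_assoc, mul_one]

/-- The operator of `b'(w)`, where `b'` is the Hochschild differential without the cyclic term. -/
lemma opW_linW (h : IsDG part mul d 𝓗) (hs : IsHKRSystem mul d 𝓗 ρ D δ δ' G ω ν)
    (hw : IsPath 𝓗 n i j σ w) : opW ρ D G (linW part mul d w) =
      δ * opW ρ D G w + sgn σ • (opW ρ D G w * δ) -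
        ω * (ν * opW ρ D G w - opW ρ D G w * ν + opW ρ D G w) + sgn σ • lastW ρ D G part w := by
  have hA := hs.δ_G
  have hB := hs.ω_G
  have hC := hs.ν_G
  have hD := hs.G_right
  induction hw with
  -- For one letter `F = a G`. The defect `δ G - G δ = G ω G` has to match `[ν, F] + F = a G²`, up
  -- to moving `ω` past `a`.
  | @base i j p σ a ha hσ =>
    have h1 := hs.ω_ρ ha
    have h2 := hs.ν_ρ ha
    rw [h.linW_base ha, ← letterW_apply, ← letterW_apply, opW_letterW, opW_letterW, lastW_letterW,
      hs.ρ_d ha, hσ, sgn_add, sgn_one]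
    generalize ρ a = a at *
    rcases sgn_cases p with hp | hp <;> rw [hp] at h1 ⊢ <;>
      simp only [one_smul, neg_smul, mul_neg, mul_one, neg_neg, smul_zero, add_zero] at h1 ⊢
    · linear_combination (norm := noncomm_ring) - a * hA + ω * h2 * G + ω * a * hC + h1 * G * G
        + a * hB * G
    · linear_combination (norm := noncomm_ring) a * hA + ω * h2 * G + ω * a * hC + h1 * G * G
        - a * hB * G
  -- The term `lastW w · D x · G` in `opW_right` cancels the one in the induction hypothesis. From
  -- `D (d x)` and `F (1 + δ') ρ x G` there remains `-F ρ x (1 + δ') G = -F ρ x`, the new value of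
  -- `lastW` up to sign. The other terms are commutation rules, checked for each choice of signs.
  | @snoc n i j l σ p τ w x hw hx hτ ih =>
    have h1 := hs.ω_opW hw
    have h2 := hs.ω_D hx
    have h3 := hs.ν_D hx
    rw [h.linW_append hx hw.mem', map_add, map_zsmul, map_sub, opW_appendW, opW_appendW, opW_appendW,
      ih, hs.opW_right h hw hx, lastW_appendW, signL_of_mem h hx, hs.D_d hx, hτ, sgn_add, sgn_add,
      sgn_add, sgn_one, sgn_zero, map_zsmul]
    rw [sgn_add, sgn_one] at h1 h2
    generalize opW ρ D G w = F at *
    generalize lastW ρ D G part w = T at *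
    generalize ρ x = r at *
    generalize D x = y at *
    rcases sgn_cases p with hp | hp <;> rcases sgn_cases σ with hσ | hσ <;>
      rw [hp] at h2 ⊢ <;> rw [hσ] at h1 ⊢ <;>
      simp only [one_smul, neg_smul, mul_neg, mul_one, neg_neg] at h1 h2 ⊢
    · linear_combination (norm := noncomm_ring) - F * r * hD - F * y * hA + ω * F * h3 * G +
        ω * F * y * hC + h1 * y * G * G - F * h2 * G * G + F * y * hB * G
    · linear_combination (norm := noncomm_ring) F * r * hD + F * y * hA + ω * F * h3 * G +
        ω * F * y * hC + h1 * y * G * G + F * h2 * G * G - F * y * hB * G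
    · linear_combination (norm := noncomm_ring) - F * r * hD + F * y * hA + ω * F * h3 * G +
        ω * F * y * hC + h1 * y * G * G - F * h2 * G * G - F * y * hB * G
    · linear_combination (norm := noncomm_ring) F * r * hD - F * y * hA + ω * F * h3 * G +
        ω * F * y * hC + h1 * y * G * G + F * h2 * G * G + F * y * hB * G

lemma opW_left (hs : IsHKRSystem mul d 𝓗 ρ D δ δ' G ω ν) (hx : x ∈ 𝓗 l i p)
    (hw : IsPath 𝓗 n i j σ w) : opW ρ D G (mapFirstW (mul x) w) = ρ x * opW ρ D G w := by
  induction hw with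
  | base ha hσ =>
    rw [mapFirstW_zero, ← letterW_apply, ← letterW_apply, opW_letterW, opW_letterW,
      hs.ρ_mul hx ha, mul_assoc]
  | snoc hw ha hτ ih =>
    rw [mapFirstW_appendW, opW_appendW, opW_appendW, ih hx, mul_assoc]

end IsHKRSystem

end System

/-! ### The HKR operators of matrix factorizations with connections -/

section HKRSystem

variable {k Q : Type u} [Field k] [CommRing Q] [Algebra k Q] {f : Q} {I : Type u}
  (X : I → MatFac k f) (c : ∀ i, (X i).Connection)

/-- The action of the category algebra on differential forms. -/
def opL : HArr X →ₗ[k] OpRing X :=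
  blockMap X ∘ₗ DFinsupp.mapRange.linearMap fun e => MatFac.opForms (X e.2) (X e.1)

/-- The action `α ↦ α'` of the category algebra on differential forms. -/
def derL : HArr X →ₗ[k] OpRing X :=
  blockMap X ∘ₗ DFinsupp.mapRange.linearMap fun e => MatFac.opDeriv (X e.2) (X e.1) (c e.2) (c e.1)

variable {X} in
lemma opL_arr (i j : I) (α : (X j).P →ₗ[Q] (X i).P) :
    opL X (arr (fun i => (X i).P) i j α) = block i j (MatFac.opForms (X j) (X i) α) := by
  classical
  rw [← blockMap_arr]
  exact congrArg (blockMap X) (DFinsupp.mapRange_single (hf := fun _ => map_zero _))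

variable {X} in
lemma derL_arr (i j : I) (α : (X j).P →ₗ[Q] (X i).P) :
    derL X c (arr (fun i => (X i).P) i j α) =
      block i j (MatFac.opDeriv (X j) (X i) (c j) (c i) α) := by
  classical
  rw [← blockMap_arr]
  exact congrArg (blockMap X) (DFinsupp.mapRange_single (hf := fun _ => map_zero _))

/-- The operator `δ`. -/
def opδ : OpRing X := diagOp fun i => MatFac.opForms (X i) (X i) (X i).δ

/-- The operator `δ'`. -/
def opδ' : OpRing X := diagOp (deltaPrime X c)

variable (k Q) in
/-- A bound for the degrees of differential forms. -/
def formsBound [Module.Finite Q Ω[Q⁄k]] : ℕ := (exteriorPower_eq_bot (Q := Q) (M := Ω[Q⁄k])).choose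

variable (k Q) in
lemma formsBound_spec [Module.Finite Q Ω[Q⁄k]] {N : ℕ} (h : formsBound k Q ≤ N) :
    ⋀[Q]^N Ω[Q⁄k] = ⊥ :=
  (exteriorPower_eq_bot (Q := Q) (M := Ω[Q⁄k])).choose_spec N h

/-- The operator `(1 + δ')⁻¹`. -/
def opG [Module.Finite Q Ω[Q⁄k]] : OpRing X :=
  diagOp fun i => ∑ e ∈ Finset.range (formsBound k Q), (-deltaPrime X c i) ^ e

variable {X}

lemma deltaPrime_mem (i : I) : deltaPrime X c i ∈ opSpan (X i) (X i) 1 1 :=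
  MatFac.opDeriv_mem (c i) (c i) (X i).δ_odd

lemma one_mem_opSpan (A : MatFac k f) : (1 : Module.End Q (Forms k Q ⊗[Q] A.P)) ∈ opSpan A A 0 0 := by
  have : (1 : Module.End Q (Forms k Q ⊗[Q] A.P)) = el 0 1 LinearMap.id :=
    TensorProduct.ext' fun ω x => by simp [gam_zero]
  rw [this]
  exact el_mem_opSpan one_mem_exteriorPower MatFac.isHomog_id

lemma opSpan_pow {A : MatFac k f} {T : Module.End Q (Forms k Q ⊗[Q] A.P)} (h : T ∈ opSpan A A 1 1)
    (e : ℕ) : T ^ e ∈ opSpan A A e e := by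
  induction e with
  | zero => rw [pow_zero, Nat.cast_zero]; exact one_mem_opSpan A
  | succ e ih =>
    rw [pow_succ, Nat.cast_succ]
    exact opSpan_comp ih h

lemma natCast_add_self (e : ℕ) : (0 : ZMod 2) = (e : ZMod 2) + e := (CharTwo.add_self_eq_zero _).symm

variable [Module.Finite Q Ω[Q⁄k]]

/-- The power `T ^ e` has form degree `e`, and there are no forms of degree `formsBound` or more.
Hence the geometric series for `(1 + δ')⁻¹` terminates. -/
lemma opSpan_pow_eq_zero {A : MatFac k f} {T : Module.End Q (Forms k Q ⊗[Q] A.P)}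
    (h : T ∈ opSpan A A 1 1) {e : ℕ} (he : formsBound k Q ≤ e) : T ^ e = 0 := by
  have := opSpan_pow h e
  rwa [opSpan_eq_bot (formsBound_spec k Q he), Submodule.mem_bot] at this

lemma opG_summand_mem (i : I) :
    ∑ e ∈ Finset.range (formsBound k Q), (-deltaPrime X c i) ^ e ∈ opTot (X i) (X i) 0 :=
  sum_mem fun e _ =>
    opSpan_le_opTot (natCast_add_self e) (opSpan_pow (neg_mem (deltaPrime_mem c i)) e)

lemma mul_opG_mem {i j : I} {t : ZMod 2} {A : OpRing X} (hA : A ∈ blkT i j t) :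
    A * opG X c ∈ blkT i j t := by
  have := blkT_mul_diagOp hA (opG_summand_mem c)
  rwa [add_zero] at this

lemma opL_mem {i j : I} {p : ZMod 2} {a : HArr X} (ha : a ∈ arrows X i j p) :
    opL X a ∈ blkT i j p := by
  obtain ⟨α, hα, rfl⟩ := ha
  rw [opL_arr]
  exact block_mem_blkT (MatFac.opForms_mem hα) (by simp)

lemma derL_mem {i j : I} {p : ZMod 2} {a : HArr X} (ha : a ∈ arrows X i j p) :
    derL X c a ∈ blkT i j (p + 1) := by
  obtain ⟨α, hα, rfl⟩ := ha
  rw [derL_arr]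
  exact block_mem_blkT (MatFac.opDeriv_mem _ _ hα) (by rw [add_comm]; simp)

lemma diagOp_one : diagOp (X := X) (fun _ => 1) = 1 :=
  LinearMap.ext fun _ => DFinsupp.ext fun _ => rfl

variable (X)

lemma isHKRSystem_op : IsHKRSystem (arrMul k fun i => (X i).P) (arrD X) (arrows X) (opL X) (derL X c)
    (opδ X) (opδ' X c) (opG X c) (opD X f) (opNum X) where
  ρ_mul := by
    rintro i j l p q _ _ ⟨α, hα, rfl⟩ ⟨β, hβ, rfl⟩
    rw [arrMul_arr_self, opL_arr, opL_arr, opL_arr, block_mul_block, MatFac.opForms_comp hα hβ]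
  ρ_d := by
    rintro i j p _ ⟨α, hα, rfl⟩
    rw [arrD_arr, opL_arr, opL_arr, opδ, diagOp_mul_block, block_mul_diagOp,
      MatFac.opForms_homD hα, map_sub, map_zsmul]
  D_mul := by
    rintro i j l p q _ _ ⟨α, hα, rfl⟩ ⟨β, hβ, rfl⟩
    rw [arrMul_arr_self, opL_arr, opL_arr, derL_arr, derL_arr, derL_arr, block_mul_block,
      block_mul_block, MatFac.opDeriv_comp (c l) (c j) (c i) hα hβ, map_add, map_zsmul]
  D_d := by
    rintro i j p _ ⟨α, hα, rfl⟩
    rw [arrD_arr, opL_arr, derL_arr, derL_arr, opδ, opδ', diagOp_mul_block, block_mul_diagOp,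
      diagOp_mul_block, block_mul_diagOp, MatFac.opDeriv_homD (c j) (c i) hα, map_sub, map_sub,
      map_add, map_zsmul]
    rfl
  G_left := by
    have h (i : I) : (∑ e ∈ Finset.range (formsBound k Q), (-deltaPrime X c i) ^ e) *
        (1 + deltaPrime X c i) = 1 := by
      have := geom_sum_mul_neg (-deltaPrime X c i) (formsBound k Q)
      rwa [sub_neg_eq_add, opSpan_pow_eq_zero (neg_mem (deltaPrime_mem c i)) le_rfl, sub_zero] at this
    rw [opG, opδ', ← diagOp_one, diagOp_add, diagOp_mul]
    simp only [h]
  G_right := by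
    have h (i : I) : (1 + deltaPrime X c i) *
        (∑ e ∈ Finset.range (formsBound k Q), (-deltaPrime X c i) ^ e) = 1 := by
      have := mul_neg_geom_sum (-deltaPrime X c i) (formsBound k Q)
      rwa [sub_neg_eq_add, opSpan_pow_eq_zero (neg_mem (deltaPrime_mem c i)) le_rfl, sub_zero] at this
    rw [opG, opδ', ← diagOp_one, diagOp_add, diagOp_mul]
    simp only [h]
  comm := by
    rw [opδ, opδ', diagOp_mul, diagOp_mul, diagOp_sub]
    exact congrArg diagOp (funext fun i => MatFac.opDeriv_δ_comp (c i))
  ν_ρ := by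
    rintro i j p _ ⟨α, hα, rfl⟩
    rw [opL_arr, opNum, diagOp_mul_block, block_mul_diagOp, ← sub_eq_zero, ← map_sub,
      MatFac.numOp_comp (MatFac.opForms_mem hα), Nat.cast_zero, zero_smul, map_zero]
  ν_D := by
    rintro i j p _ ⟨α, hα, rfl⟩
    rw [derL_arr, opNum, diagOp_mul_block, block_mul_diagOp, ← sub_eq_iff_eq_add', ← map_sub,
      MatFac.numOp_comp (MatFac.opDeriv_mem _ _ hα), Nat.cast_one, one_smul]
  ν_δ' := by
    rw [opδ', opNum, diagOp_mul, diagOp_mul, diagOp_add]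
    refine congrArg diagOp (funext fun i => ?_)
    rw [← sub_eq_iff_eq_add']
    refine (MatFac.numOp_comp (deltaPrime_mem c i)).trans ?_
    rw [Nat.cast_one, one_smul]
  ω_ρ := fun ha => opD_mul (opL_mem ha) f
  ω_D := fun ha => opD_mul (derL_mem c ha) f
  ω_δ' := by
    rw [opδ', opD, diagOp_mul, diagOp_mul]
    refine congrArg diagOp (funext fun i => ?_)
    refine (MatFac.dMul_comp f (deltaPrime_mem c i)).trans ?_
    rw [Nat.cast_one, show (1 : ZMod 2) + 1 = 0 from rfl, sgn_zero, one_smul]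
    rfl

/-- The HKR operator of a word. -/
abbrev hkrOp : AllWords k (HArr X) →ₗ[k] OpRing X := opW (opL X) (derL X c) (opG X c)

variable {X} {i j : I} {σ : ZMod 2} {n : ℕ} {w : AllWords k (HArr X)}

lemma hkrOp_mem (hw : IsPath (arrows X) n i j σ w) : hkrOp X c w ∈ blkT i j (σ + 1) := by
  induction hw with
  | base ha hσ =>
    rw [← letterW_apply, opW_letterW, hσ, add_assoc, show (1 : ZMod 2) + 1 = 0 from rfl, add_zero]
    exact mul_opG_mem c (opL_mem ha)
  | snoc hw hx hτ ih =>
    rw [opW_appendW, ← mul_assoc, hτ, add_right_comm]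
    exact mul_opG_mem c (blkT_mul ih (derL_mem c hx))

/-- Only the first letter is multiplied by `q`, and it enters the operator undifferentiated; a
differentiated letter would contribute `dq`. -/
lemma hkrOp_smul (hw : IsPath (arrows X) n i j σ w) (q : Q) :
    hkrOp X c (q • w) = q • hkrOp X c w := by
  induction hw with
  | base ha hσ =>
    obtain ⟨α, hα, rfl⟩ := ha
    have h0 : q • letterW (k := k) (arr (fun i => (X i).P) _ _ α) =
        letterW (arr (fun i => (X i).P) _ _ (q • α)) := by
      rw [letterW_apply, smul_allWord, letterW_apply, arr_smul']
      simp only [Fin.fin_one_eq_zero, if_true]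
    have hqα := (MatFac.homog _ _ _).smul_mem q hα
    rw [← letterW_apply, h0, opW_letterW, opW_letterW, opL_arr, opL_arr,
      MatFac.opForms_of_isHomog hα, MatFac.opForms_of_isHomog hqα, el_smul_right, map_smul,
      smul_mul_assoc]
  | snoc hw hx hτ ih => rw [← appendW_smul, opW_appendW, opW_appendW, ih, smul_mul_assoc]

lemma opStr_δ_mul {A : OpRing X} {t : ZMod 2} (hA : A ∈ blkT i i t) :
    opStr X (opδ X * A) = sgn t • opStr X (A * opδ X) := by
  have := opStr_diagOp_mul hA (T := fun i => MatFac.opForms (X i) (X i) (X i).δ) (s := 1) fun i =>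
    opSpan_le_opTot (N := 0) (by simp) (MatFac.opForms_mem (X i).δ_odd)
  rwa [one_mul] at this

lemma formsD_neg (q : Q) (x : Forms k Q) : formsD (k := k) (-q) x = -formsD (k := k) q x := by
  change ExteriorAlgebra.ι Q (KaehlerDifferential.D k Q (-q)) * x =
    -(ExteriorAlgebra.ι Q (KaehlerDifferential.D k Q q) * x)
  rw [map_neg, map_neg, neg_mul]

/-- The HKR map is compatible with the differentials. -/
lemma factScale_hkrOp_hochB [CharZero k] (hw : IsPath (arrows X) n i i σ w) :
    factScale k Q (opStr X (hkrOp X c (hochB X w))) =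
      formsD (-f) (factScale k Q (opStr X (hkrOp X c w))) := by
  have hs := isHKRSystem_op X c
  have h := isDG_arrows X
  -- For a word ending in `x`, the boundary term is `F ρ(x)` and the cyclic term has operator `ρ(x)
  -- F`. Cyclicity of the supertrace identifies them, and the signs are opposite.
  have hcyc : sgn σ • opStr X (lastW (opL X) (derL X c) (opG X c) (arrPart X) w) +
      opStr X (hkrOp X c (cycW (arrPart X) (arrMul k fun i => (X i).P) w)) = 0 := by
    cases hw with
    | base ha hσ =>
      rw [cycW_zero, ← letterW_apply, lastW_letterW, map_zero, map_zero, smul_zero, zero_add,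
        map_zero]
    | snoc hv hx hτ =>
      rename_i m j τ p v x
      rw [h.cycW_append hx hv.mem, lastW_appendW, signL_of_mem h hx, add_zero, map_zsmul,
        mul_smul_comm, map_zsmul, smul_smul, map_neg, map_zsmul, map_neg, map_zsmul,
        hs.opW_left hx hv, opStr_mul_comm (opL_mem hx) (hkrOp_mem c hv), smul_smul, ← sub_eq_add_neg,
        sub_eq_zero, ← sgn_add, ← sgn_add, hτ]
      congr 2
      clear * -
      revert p τ
      decide
  have hF := hkrOp_mem c hw
  rw [formsD_neg, ← factScale_opStr hF, ← map_neg]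
  congr 1
  -- The operator `F` has parity `σ + 1`, so the supertraces of `δ F` and `sgn σ • F δ` cancel. Only
  -- the term with `df` survives.
  rw [hochB, wordB_eq_linW_add, LinearMap.add_apply, map_add, hs.opW_linW h hw, map_add, map_add,
    map_sub, map_add, map_zsmul, map_zsmul, opStr_δ_mul hF, sgn_add, sgn_one, mul_neg_one, neg_smul,
    neg_add_cancel, zero_sub, add_assoc, hcyc, add_zero]

end HKRSystem

/-! ### Comparison with the explicit HKR formula -/

section HKRFormula

variable {k Q : Type u} [Field k] [CommRing Q] [Algebra k Q] {f : Q} {I : Type u}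
  {X : I → MatFac k f} (c : ∀ i, (X i).Connection)

/-- Blocks of form degree `N` and parity `p`. -/
def blkD (i j : I) (N : ℕ) (p : ZMod 2) : Submodule Q (OpRing X) :=
  (opSpan (X j) (X i) N p).map (block i j)

lemma blkD_mul {i j l : I} {N M : ℕ} {p q : ZMod 2} {A B : OpRing X} (hA : A ∈ blkD i j N p)
    (hB : B ∈ blkD j l M q) : A * B ∈ blkD i l (N + M) (p + q) := by
  obtain ⟨φ, hφ, rfl⟩ := hA
  obtain ⟨ψ, hψ, rfl⟩ := hB
  rw [block_mul_block]
  exact Submodule.mem_map_of_mem (opSpan_comp hφ hψ)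

lemma blkD_mul_diagOp {i j : I} {N M : ℕ} {p q : ZMod 2} {A : OpRing X} (hA : A ∈ blkD i j N p)
    {T : ∀ i, Module.End Q (Forms k Q ⊗[Q] (X i).P)} (hT : T j ∈ opSpan (X j) (X j) M q) :
    A * diagOp T ∈ blkD i j (N + M) (p + q) := by
  obtain ⟨φ, hφ, rfl⟩ := hA
  rw [block_mul_diagOp]
  exact Submodule.mem_map_of_mem (opSpan_comp hφ hT)

lemma prod_mem_blkD {n : ℕ} {y : Fin (n + 2) → I} {N : Fin (n + 1) → ℕ} {p : Fin (n + 1) → ZMod 2}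
    {A : Fin (n + 1) → OpRing X} (h : ∀ l, A l ∈ blkD (y l.castSucc) (y l.succ) (N l) (p l)) :
    (List.ofFn A).prod ∈ blkD (y 0) (y (Fin.last (n + 1))) (∑ l, N l) (∑ l, p l) := by
  induction n with
  | zero =>
    rw [List.ofFn_succ, List.ofFn_zero, List.prod_singleton, Fin.sum_univ_one, Fin.sum_univ_one]
    exact h 0
  | succ n ih =>
    rw [List.ofFn_succ', List.prod_concat, Fin.sum_univ_castSucc N, Fin.sum_univ_castSucc p]
    have h1 := ih (y := fun l => y l.castSucc) (N := fun l => N l.castSucc)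
      (p := fun l => p l.castSucc) (A := fun l => A l.castSucc) fun l => h l.castSucc
    exact blkD_mul h1 (h (Fin.last (n + 1)))

lemma factScale_opStr_blkD {i : I} {N : ℕ} {p : ZMod 2} {A : OpRing X} (hA : A ∈ blkD i i N p) :
    factScale k Q (opStr X A) = (N.factorial : k)⁻¹ • opStr X A := by
  obtain ⟨φ, hφ, rfl⟩ := hA
  rw [opStr_block, factScale_of_mem (MatFac.strLin_mem hφ)]

lemma blockMap_arrProd (n : ℕ) (v : Fin (n + 1) → FArr X) :
    blockMap X (arrProd k (fun i => Forms k Q ⊗[Q] (X i).P) n v) =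
      (List.ofFn fun l => blockMap X (v l)).prod := by
  induction n with
  | zero =>
    rw [List.ofFn_succ, List.ofFn_zero, List.prod_singleton]
    rfl
  | succ n ih =>
    rw [List.ofFn_succ, List.prod_cons, ← ih, ← blockMap_arrMul]
    rfl

lemma opL_mem_blkD {i j : I} {p : ZMod 2} {a : HArr X} (ha : a ∈ arrows X i j p) :
    opL X a ∈ blkD i j 0 p := by
  obtain ⟨α, hα, rfl⟩ := ha
  rw [opL_arr]
  exact Submodule.mem_map_of_mem (MatFac.opForms_mem hα)

lemma derL_mem_blkD {i j : I} {p : ZMod 2} {a : HArr X} (ha : a ∈ arrows X i j p) :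
    derL X c a ∈ blkD i j 1 p := by
  obtain ⟨α, hα, rfl⟩ := ha
  rw [derL_arr]
  exact Submodule.mem_map_of_mem (MatFac.opDeriv_mem _ _ hα)

lemma blockMap_factor {n : ℕ} (l : Fin (n + 1)) (e : ℕ) (a : HArr X) :
    blockMap X (factor X c l e a) = (if l = 0 then opL X a else derL X c a) * opδ' X c ^ e := by
  classical
  have : (blockMap X ∘ₗ factor X c l e).toAddMonoidHom =
      (LinearMap.mulRight k (opδ' X c ^ e) ∘ₗ if l = 0 then opL X else derL X c).toAddMonoidHom := by
    refine arr_hom_ext (M := fun i => (X i).P) fun i j α => ?_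
    have h1 : factor X c l e (arr (fun i => (X i).P) i j α) =
        arr (fun i => Forms k Q ⊗[Q] (X i).P) i j ((if l = 0 then MatFac.opForms (X j) (X i) α
          else MatFac.opDeriv (X j) (X i) (c j) (c i) α) ∘ₗ deltaPrime X c j ^ e) := by
      refine (DFinsupp.mapRange_single (hf := fun _ => map_zero _)).trans ?_
      split_ifs <;> rfl
    change blockMap X (factor X c l e (arr (fun i => (X i).P) i j α)) = _
    rw [h1, blockMap_arr, ← block_mul_diagOp i j _ (fun i => deltaPrime X c i ^ e), ← diagOp_pow]
    split_ifs
    · rw [← opL_arr]; rfl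
    · rw [← derL_arr]; rfl
  have h2 := DFunLike.congr_fun this a
  refine h2.trans ?_
  split_ifs <;> rfl

variable [Module.Finite Q Ω[Q⁄k]]

lemma opG_eq : opG X c = ∑ e ∈ Finset.range (formsBound k Q), (-1 : k) ^ e • opδ' X c ^ e := by
  have h : ∀ (s : Finset ℕ) (T : ℕ → ∀ i, Module.End Q (Forms k Q ⊗[Q] (X i).P)),
      diagOp (fun i => ∑ e ∈ s, T e i) = ∑ e ∈ s, diagOp (T e) := by
    intro s T
    classical
    induction s using Finset.induction_on with
    | empty => simp only [Finset.sum_empty]; exact diagOp_zero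
    | insert a s ha ih =>
      simp only [Finset.sum_insert ha]
      rw [← ih, ← diagOp_add]
  rw [opG, h]
  refine Finset.sum_congr rfl fun e _ => ?_
  rw [opδ', ← diagOp_pow]
  have h2 : diagOp (fun i => -deltaPrime X c i) = -diagOp (deltaPrime X c) := by
    have := diagOp_sub (X := X) (fun _ => 0) (deltaPrime X c)
    rw [diagOp_zero, zero_sub] at this
    rw [this]
    exact congrArg diagOp (funext fun i => (zero_sub _).symm)
  rw [h2, neg_pow, ← smul_one_mul ((-1 : k) ^ e)]
  congr 1
  rcases Nat.even_or_odd e with he | he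
  · rw [he.neg_one_pow, he.neg_one_pow, one_smul]
  · rw [he.neg_one_pow, he.neg_one_pow, neg_smul, one_smul]

lemma hkrOp_allWord (n : ℕ) (a : Fin (n + 1) → HArr X) :
    hkrOp X c (allWord n a) =
      (List.ofFn fun l => (if l = 0 then opL X (a l) else derL X c (a l)) * opG X c).prod := by
  induction n with
  | zero =>
    rw [List.ofFn_succ, List.ofFn_zero, List.prod_singleton, if_pos rfl]
    have : a = fun _ => a 0 := funext fun l => by rw [Fin.fin_one_eq_zero l]
    rw [this, ← letterW_apply, opW_letterW]
  | succ n ih =>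
    conv_lhs => rw [← Fin.snoc_init_self a, ← appendW_allWord]
    rw [opW_appendW, ih, List.ofFn_succ' (n := n + 1), List.prod_concat,
      if_neg (Fin.last_pos (n := n)).ne']
    simp only [Fin.castSucc_eq_zero_iff]
    rfl

/-- Substituting the finite geometric series for each of the `n + 1` factors `G` and expanding
multilinearly produces the exponents `e₀, …, e_n` with their sign. -/
lemma hkrOp_allWord_eq_sum (n : ℕ) (a : Fin (n + 1) → HArr X) :
    hkrOp X c (allWord n a) =
      ∑ e ∈ Fintype.piFinset fun _ : Fin (n + 1) => Finset.range (formsBound k Q),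
        (-1 : k) ^ (∑ l, e l) • (List.ofFn fun l => blockMap X (factor X c l (e l) (a l))).prod := by
  have h := MultilinearMap.map_sum_finset (MultilinearMap.mkPiAlgebraFin k (n + 1) (OpRing X))
    (fun l e => (-1 : k) ^ e • blockMap X (factor X c l e (a l)))
    fun _ => Finset.range (formsBound k Q)
  rw [MultilinearMap.mkPiAlgebraFin_apply] at h
  rw [hkrOp_allWord]
  convert h using 3 with e he
  · funext l
    rw [opG_eq, Finset.mul_sum]
    refine Finset.sum_congr rfl fun e _ => ?_
    rw [blockMap_factor, mul_smul_comm]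
  · rw [MultilinearMap.map_smul_univ, MultilinearMap.mkPiAlgebraFin_apply, Finset.prod_pow_eq_pow_sum]

lemma factor_eq_zero {n : ℕ} (l : Fin (n + 1)) {e : ℕ} (he : formsBound k Q ≤ e) :
    factor X c l e = 0 := by
  refine LinearMap.ext fun a => blockMap_injective ?_
  rw [blockMap_factor, opδ', diagOp_pow]
  have : (fun i => deltaPrime X c i ^ e) = fun _ => 0 :=
    funext fun i => opSpan_pow_eq_zero (deltaPrime_mem c i) he
  rw [this, diagOp_zero, mul_zero, LinearMap.zero_apply, map_zero]

/-- The HKR map is the supertrace of the HKR operator, up to factorials. -/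
lemma hkr_eq {n : ℕ} {i : I} {σ : ZMod 2} {w : AllWords k (HArr X)}
    (hw : IsPath (arrows X) n i i σ w) :
    hkr X c w = factScale k Q (opStr X (hkrOp X c w)) := by
  obtain ⟨y, p, a, rfl, hy, ha, rfl, -⟩ := hw.exists_letters
  rw [hkr, toModule_allWord, ofMulti_word,
    finsum_eq_sum_of_support_subset (s := Fintype.piFinset fun _ => Finset.range (formsBound k Q)),
    _root_.sum_apply, hkrOp_allWord_eq_sum, map_sum, map_sum]
  · refine Finset.sum_congr rfl fun e _ => ?_
    -- The first letter has form degree `0`, the other `n` letters and every `δ'` have degree `1`.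
    -- The total degree `n + ∑ e` is the argument of the factorial in the HKR formula, so
    -- `factScale` supplies precisely that factor.
    have h1 : (List.ofFn fun l => blockMap X (factor X c l (e l) (a l))).prod ∈
        blkD (y 0) (y 0) (n + ∑ l, e l) (∑ l, (p l + e l)) := by
      have h2 := prod_mem_blkD (X := X) (y := y) (N := fun l => (if l = 0 then 0 else 1) + e l)
        (p := fun l => p l + e l) (A := fun l => blockMap X (factor X c l (e l) (a l)))
        fun l => by
          rw [blockMap_factor, opδ', diagOp_pow]
          split_ifs with h0
          · exact blkD_mul_diagOp (opL_mem_blkD (ha l)) (opSpan_pow (deltaPrime_mem c _) _)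
          · exact blkD_mul_diagOp (derL_mem_blkD c (ha l)) (opSpan_pow (deltaPrime_mem c _) _)
      rw [hy, Finset.sum_add_distrib (f := fun l : Fin (n + 1) => if l = 0 then 0 else 1)] at h2
      convert h2 using 2
      simp [Fin.sum_univ_succ]
    rw [map_smul, LinearMap.map_smul_of_tower, factScale_opStr_blkD h1, smul_smul, ← blockMap_arrProd,
      opStr_blockMap]
    rfl
  -- An exponent that reaches `formsBound` makes its factor zero, so the sum over all exponents is
  -- supported in a finite box.
  · intro e he
    rw [Function.mem_support] at he
    rw [Finset.mem_coe, Fintype.mem_piFinset]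
    intro l
    rw [Finset.mem_range]
    by_contra! h
    refine he ?_
    ext v
    rw [_root_.smul_apply, LinearMap.compMultilinearMap_apply,
      MultilinearMap.compLinearMap_apply, MultilinearMap.map_coord_zero _ l, map_zero, smul_zero]
    · rfl
    · rw [factor_eq_zero c l h]; rfl

variable (X)

/-- The HKR map is a map of complexes. -/
lemma isHKRChainMap [CharZero k] : IsHKRChainMap X c := by
  intro j w hw
  rw [mem_hochGr_iff] at hw
  -- The boundary of a path is only a sum of closed paths, of different lengths, so the formula
  -- `hkr_eq` is first extended additively.
  have hb : ∀ n i v, IsPath (arrows X) n i i (j + 1) v →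
      hkr X c (hochB X v) = factScale k Q (opStr X (hkrOp X c (hochB X v))) := fun n i v hv =>
    loopsSpan_hom_eq (f := (hkr X c).toAddMonoidHom)
      (g := ((factScale k Q).toAddMonoidHom.comp
        (opStr X ∘ₗ hkrOp X c).toAddMonoidHom)) (fun _ _ _ h => hkr_eq c h)
      ((isDG_arrows X).wordB_mem hv.mem_loopsSpan rfl)
  refine ⟨?_, ?_, fun q => ?_⟩
  · refine loopsSpan_hom_mem (f := hkr X c) (S := (formsGr k Q j).toAddSubgroup)
      (fun n i v hv => ?_) hw
    rw [hkr_eq c hv]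
    have := opStr_mem (hkrOp_mem c hv)
    rw [add_assoc, show (1 : ZMod 2) + 1 = 0 from rfl, add_zero] at this
    exact scaleForms_mem_formsGr _ this
  · refine loopsSpan_hom_eq (f := (hkr X c ∘ₗ hochB X).toAddMonoidHom)
      (g := (formsD (-f) ∘ₗ hkr X c).toAddMonoidHom) (fun n i v hv => ?_) hw
    change hkr X c (hochB X v) = formsD (-f) (hkr X c v)
    rw [hb n i v hv, hkr_eq c hv, factScale_hkrOp_hochB c hv]
  · refine loopsSpan_hom_eq (f := (hkr X c ∘ₗ DistribSMul.toLinearMap k _ q).toAddMonoidHom)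
      (g := (DistribSMul.toLinearMap k _ q ∘ₗ hkr X c).toAddMonoidHom) (fun n i v hv => ?_) hw
    change hkr X c (q • v) = q • hkr X c v
    rw [hkr_eq c hv, hkr_eq c (hv.smul q), hkrOp_smul c hv, opStr_smul (hkrOp_mem c hv), map_smul]

end HKRFormula

/-! ### Triangular matrices: two connections in one system -/

section Triangular

variable {k Q : Type u} [Field k] [CommRing Q]
variable {H : Type u} [AddCommGroup H] [Module k H] [Module Q H] [SMulCommClass k Q H]
variable {I : Type u} {E : Type u} [Ring E] [Algebra k E]

/-- Diagonal matrices of linear maps. -/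
def diagL (φ ψ : H →ₗ[k] E) : H →ₗ[k] Matrix (Fin 2) (Fin 2) E where
  toFun a := !![φ a, 0; 0, ψ a]
  map_add' a b := by ext i j; fin_cases i <;> fin_cases j <;> simp
  map_smul' c a := by ext i j; fin_cases i <;> fin_cases j <;> simp

lemma diagL_apply (φ ψ : H →ₗ[k] E) (a : H) : diagL φ ψ a = !![φ a, 0; 0, ψ a] := rfl

variable {part : ZMod 2 → H →ₗ[k] H} {mul : H →ₗ[k] H →ₗ[k] H} {d : H →ₗ[k] H}
  {𝓗 : I → I → ZMod 2 → Submodule Q H} {ρ D₀ D₁ : H →ₗ[k] E} {δ δ₀ δ₁ G₀ G₁ ω ν A : E}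

/-- Two systems that differ by a change of connection `A` combine to a system of triangular
matrices. -/
lemma IsHKRSystem.triangular (h : IsDG part mul d 𝓗) (h0 : IsHKRSystem mul d 𝓗 ρ D₀ δ δ₀ G₀ ω ν)
    (h1 : IsHKRSystem mul d 𝓗 ρ D₁ δ δ₁ G₁ ω ν)
    (hA : ∀ {i j p a}, a ∈ 𝓗 i j p → D₁ a - D₀ a = A * ρ a - sgn p • (ρ a * A))
    (hδ : δ₁ - δ₀ = A * δ + δ * A) (hν : ν * A = A * ν + A) (hω : ω * A = -(A * ω)) :
    IsHKRSystem mul d 𝓗 (diagL ρ (ρ ∘ₗ signL part 0)) (diagL D₁ (D₀ ∘ₗ signL part 1))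
      !![δ, -1; 0, -δ] !![δ₁, -A; 0, δ₀] !![G₁, G₁ * A * G₀; 0, G₀] !![ω, 0; 0, -ω]
      !![ν, 0; 0, ν] where
  ρ_mul {i j l p q a b} ha hb := by
    simp only [diagL_apply, LinearMap.comp_apply, signL_of_mem h ha, signL_of_mem h hb,
      signL_of_mem h (h.mul_mem ha hb), map_zsmul, h0.ρ_mul ha hb, Matrix.mul_fin_two]
    rcases sgn_cases p with hp | hp <;> rcases sgn_cases q with hq | hq <;>
      simp [sgn_add, hp, hq]
  -- Off the diagonal, the entry `-1` of the matrix of `δ` contributes `-(-1)^p ρ(a) + (-1)^p ρ(a) =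
  -- 0`. The sign in the second diagonal entry of `ρ` is chosen for this.
  ρ_d {i j p a} ha := by
    simp only [diagL_apply, LinearMap.comp_apply, signL_of_mem h ha, signL_of_mem h (h.d_mem ha),
      map_zsmul, h0.ρ_d ha, Matrix.mul_fin_two]
    rcases sgn_cases p with hp | hp <;>
    · simp only [sgn_add, hp, sgn_one, sgn_zero]
      ext i j
      fin_cases i <;> fin_cases j <;> simp <;> abel
  D_mul {i j l p q a b} ha hb := by
    simp only [diagL_apply, LinearMap.comp_apply, signL_of_mem h ha, signL_of_mem h hb,
      signL_of_mem h (h.mul_mem ha hb), map_zsmul, h0.D_mul ha hb, h1.D_mul ha hb,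
      Matrix.mul_fin_two]
    rcases sgn_cases p with hp | hp <;> rcases sgn_cases q with hq | hq <;>
    · simp only [sgn_add, hp, hq, sgn_one, sgn_zero]
      ext i j
      fin_cases i <;> fin_cases j <;> simp
  -- The off-diagonal entry is the hypothesis `hA`: the entries `-1` of `δ` produce `D₁ a - D₀ a`,
  -- and the entry `-A` of `δ'` produces the commutator with `A`.
  D_d {i j p a} ha := by
    have e := hA ha
    rw [sub_eq_iff_eq_add] at e
    simp only [diagL_apply, LinearMap.comp_apply, signL_of_mem h ha, signL_of_mem h (h.d_mem ha),
      map_zsmul, h0.D_d ha, h1.D_d ha, Matrix.mul_fin_two]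
    rcases sgn_cases p with hp | hp <;>
    · simp only [sgn_add, hp, sgn_one, sgn_zero] at e ⊢
      ext i j
      fin_cases i <;> fin_cases j <;> simp [e] <;> abel
  G_left := by
    have e0 := h0.G_left
    have e1 := h1.G_left
    ext i j
    fin_cases i <;> fin_cases j <;>
      simp [Matrix.one_fin_two, Matrix.vecHead, Matrix.vecTail]
    · exact e1
    · rw [mul_assoc, e0, mul_one]; abel
    · exact e0
  G_right := by
    have e0 := h0.G_right
    have e1 := h1.G_right
    ext i j
    fin_cases i <;> fin_cases j <;>
      simp [Matrix.one_fin_two, Matrix.vecHead, Matrix.vecTail]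
    · exact e1
    · rw [mul_assoc G₁, ← mul_assoc, e1, one_mul]; abel
    · exact e0
  -- The diagonal entries are the relations of the two systems, the second one with the opposite
  -- sign, which is why `ω` becomes `diag(ω, -ω)`. The off-diagonal entry is `hδ`.
  comm := by
    have e := h1.comm
    have e0 := h0.comm
    rw [sub_eq_iff_eq_add] at hδ
    ext i j
    fin_cases i <;> fin_cases j <;> simp
    · exact e
    · rw [hδ]; abel
    · rw [← e0]; abel
  ν_ρ {i j p a} ha := by
    rcases sgn_cases p with hp | hp <;>
      simp [diagL_apply, signL_of_mem h ha, hp, h0.ν_ρ ha]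
  ν_D {i j p a} ha := by
    rcases sgn_cases p with hp | hp <;>
      simp [diagL_apply, signL_of_mem h ha, sgn_add, hp, sgn_one, h0.ν_D ha, h1.ν_D ha, add_comm]
  ν_δ' := by
    simp [h0.ν_δ', h1.ν_δ', hν, add_comm]
  ω_ρ {i j p a} ha := by
    rcases sgn_cases p with hp | hp <;>
      simp [diagL_apply, signL_of_mem h ha, hp, h0.ω_ρ ha]
  ω_D {i j p a} ha := by
    rcases sgn_cases p with hp | hp <;>
      simp [diagL_apply, signL_of_mem h ha, sgn_add, hp, sgn_one, h0.ω_D ha, h1.ω_D ha, add_comm]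
  ω_δ' := by
    simp [h0.ω_δ', h1.ω_δ', hω]

variable {i j l : I} {σ p : ZMod 2} {n : ℕ} {w : AllWords k H} {x : H} {U : E}

/-- The operators of words for a system of triangular matrices. -/
lemma opW_triangular (h : IsDG part mul d 𝓗) (hw : IsPath 𝓗 n i j σ w) :
    opW (diagL ρ (ρ ∘ₗ signL part 0)) (diagL D₁ (D₀ ∘ₗ signL part 1)) !![G₁, U; 0, G₀] w =
      !![opW ρ D₁ G₁ w, opW (diagL ρ (ρ ∘ₗ signL part 0)) (diagL D₁ (D₀ ∘ₗ signL part 1))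
        !![G₁, U; 0, G₀] w 0 1; 0, sgn (σ + 1) • opW ρ D₀ G₀ w] := by
  induction hw with
  | base ha hσ =>
    rw [← letterW_apply, opW_letterW, opW_letterW, opW_letterW, diagL_apply, LinearMap.comp_apply,
      signL_of_mem h ha, hσ, add_assoc, show (1 : ZMod 2) + 1 = 0 from rfl]
    simp [mul_assoc]
  | snoc hw hx hτ ih =>
    rw [opW_appendW, opW_appendW, opW_appendW, ih, diagL_apply, LinearMap.comp_apply,
      signL_of_mem h hx, hτ, add_right_comm, sgn_add (_ + 1)]
    rename_i q _ _ _
    rcases sgn_cases (q + 1) with hq | hq <;> simp [mul_assoc, hq]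

lemma opW_triangular_letterW (a : H) :
    opW (diagL ρ (ρ ∘ₗ signL part 0)) (diagL D₁ (D₀ ∘ₗ signL part 1)) !![G₁, U; 0, G₀]
      (letterW a) 0 1 = ρ a * U := by
  rw [opW_letterW, diagL_apply]
  simp

lemma opW_triangular_appendW (h : IsDG part mul d 𝓗) (hw : IsPath 𝓗 n i j σ w) (x : H) :
    opW (diagL ρ (ρ ∘ₗ signL part 0)) (diagL D₁ (D₀ ∘ₗ signL part 1)) !![G₁, U; 0, G₀]
        (appendW x w) 0 1 =
      opW ρ D₁ G₁ w * (D₁ x * U) +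
        opW (diagL ρ (ρ ∘ₗ signL part 0)) (diagL D₁ (D₀ ∘ₗ signL part 1)) !![G₁, U; 0, G₀] w 0 1 *
          (D₀ (signL part 1 x) * G₀) := by
  rw [opW_appendW, opW_triangular h hw, diagL_apply]
  simp

end Triangular

/-! ### The homotopy between the HKR maps for two connections -/

section Homotopy

variable {k Q : Type u} [Field k] [CommRing Q] [Algebra k Q] {f : Q} {I : Type u}
  (X : I → MatFac k f) (c₀ c₁ : ∀ i, (X i).Connection) [Module.Finite Q Ω[Q⁄k]]

/-- The difference of two connections, as an operator. -/
def opA : OpRing X := diagOp fun i => MatFac.opDiff (c₀ i) (c₁ i)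

/-- The difference of two operators `(1 + δ')⁻¹`. -/
def opU : OpRing X := opG X c₁ * opA X c₀ c₁ * opG X c₀

/-- The operators of words in the system of triangular matrices given by two connections. -/
abbrev triW : AllWords k (HArr X) →ₗ[k] Matrix (Fin 2) (Fin 2) (OpRing X) :=
  opW (diagL (opL X) (opL X ∘ₗ signL (arrPart X) 0)) (diagL (derL X c₁) (derL X c₀ ∘ₗ signL (arrPart X) 1))
    !![opG X c₁, opU X c₀ c₁; 0, opG X c₀]

lemma isHKRSystem_triangular : IsHKRSystem (arrMul k fun i => (X i).P) (arrD X) (arrows X)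
    (diagL (opL X) (opL X ∘ₗ signL (arrPart X) 0))
    (diagL (derL X c₁) (derL X c₀ ∘ₗ signL (arrPart X) 1))
    !![opδ X, -1; 0, -opδ X] !![opδ' X c₁, -opA X c₀ c₁; 0, opδ' X c₀]
    !![opG X c₁, opU X c₀ c₁; 0, opG X c₀] !![opD X f, 0; 0, -opD X f]
    !![opNum X, 0; 0, opNum X] := by
  refine IsHKRSystem.triangular (isDG_arrows X) (isHKRSystem_op X c₀) (isHKRSystem_op X c₁) ?_ ?_ ?_ ?_
  · rintro i j p _ ⟨α, hα, rfl⟩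
    rw [derL_arr, derL_arr, opL_arr, opA, diagOp_mul_block, block_mul_diagOp, ← map_sub, ← map_zsmul,
      ← map_sub, MatFac.opDeriv_sub_opDeriv _ _ _ _ hα]
  · rw [opδ', opδ', opA, opδ, diagOp_mul, diagOp_mul, diagOp_sub, diagOp_add]
    refine congrArg diagOp (funext fun i => ?_)
    refine (MatFac.opDeriv_sub_opDeriv _ _ _ _ (X i).δ_odd).trans ?_
    rw [sgn_one, neg_smul, one_smul, sub_neg_eq_add]
    rfl
  · rw [opNum, opA, diagOp_mul, diagOp_mul, diagOp_add]
    refine congrArg diagOp (funext fun i => ?_)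
    rw [← sub_eq_iff_eq_add']
    refine (MatFac.numOp_comp (MatFac.opDiff_mem (c₀ i) (c₁ i))).trans ?_
    rw [Nat.cast_one, one_smul]
  · rw [opD, opA, diagOp_mul, diagOp_mul, ← zero_sub, ← diagOp_zero, diagOp_sub]
    refine congrArg diagOp (funext fun i => ?_)
    refine (MatFac.dMul_comp f (MatFac.opDiff_mem (c₀ i) (c₁ i))).trans ?_
    rw [Nat.cast_one, add_zero, sgn_one, neg_smul, one_smul, zero_sub]
    rfl

variable {X} {i j : I} {σ : ZMod 2} {n : ℕ} {w : AllWords k (HArr X)}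

lemma mul_opU_mem {t : ZMod 2} {B : OpRing X} (hB : B ∈ blkT i j t) :
    B * opU X c₀ c₁ ∈ blkT i j (t + 1) := by
  rw [opU, ← mul_assoc, ← mul_assoc]
  exact mul_opG_mem c₀ (blkT_mul_diagOp (mul_opG_mem c₁ hB) fun i =>
    opSpan_le_opTot (by simp) (MatFac.opDiff_mem (c₀ i) (c₁ i)))

/-- Each summand of the off-diagonal entry contains exactly one factor `A`, which has odd total
parity. The entry is therefore of parity one off from the HKR operator, as befits a homotopy. -/
lemma triW_mem (hw : IsPath (arrows X) n i j σ w) : triW X c₀ c₁ w 0 1 ∈ blkT i j σ := by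
  induction hw with
  | base ha hσ =>
    rw [← letterW_apply, opW_triangular_letterW, hσ]
    exact mul_opU_mem c₀ c₁ (opL_mem ha)
  | snoc hw hx hτ ih =>
    rw [opW_triangular_appendW (isDG_arrows X) hw, signL_of_mem (isDG_arrows X) hx, map_zsmul,
      smul_mul_assoc, mul_smul_comm, ← mul_assoc, ← mul_assoc, hτ]
    refine add_mem ?_ (zsmul_mem (mul_opG_mem c₀ (blkT_mul ih (derL_mem c₀ hx))) _)
    have := mul_opU_mem c₀ c₁ (blkT_mul (hkrOp_mem c₁ hw) (derL_mem c₁ hx))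
    convert this using 1
    rw [add_right_comm (_ + 1), add_assoc _ (1 : ZMod 2) 1, show (1 : ZMod 2) + 1 = 0 from rfl,
      add_zero]

lemma smul_letterW (q : Q) (a : HArr X) : q • letterW (k := k) a = letterW (q • a) := by
  rw [letterW_apply, smul_allWord, letterW_apply]
  simp only [Fin.fin_one_eq_zero, if_true]

lemma opL_smul {p : ZMod 2} {a : HArr X} (ha : a ∈ arrows X i j p) (q : Q) :
    opL X (q • a) = q • opL X a := by
  obtain ⟨α, hα, rfl⟩ := ha
  rw [← arr_smul', opL_arr, opL_arr, MatFac.opForms_of_isHomog hα,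
    MatFac.opForms_of_isHomog ((MatFac.homog _ _ _).smul_mem q hα), el_smul_right, map_smul]

lemma triW_smul (hw : IsPath (arrows X) n i j σ w) (q : Q) :
    triW X c₀ c₁ (q • w) 0 1 = q • triW X c₀ c₁ w 0 1 := by
  induction hw with
  | base ha hσ =>
    rw [← letterW_apply, smul_letterW, opW_triangular_letterW, opW_triangular_letterW, opL_smul ha,
      smul_mul_assoc]
  | snoc hw hx hτ ih =>
    rw [← appendW_smul, opW_triangular_appendW (isDG_arrows X) hw,
      opW_triangular_appendW (isDG_arrows X) (hw.smul q), ih, hkrOp_smul c₁ hw, smul_add, smul_mul_assoc,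
      smul_mul_assoc]

/-- The homotopy between the HKR maps for two connections, up to signs. -/
def hkrHtpy : AllWords k (HArr X) →ₗ[k] Forms k Q :=
  (factScale k Q).restrictScalars k ∘ₗ opStr X ∘ₗ Matrix.entryLinearMap k (OpRing X) 0 1 ∘ₗ
    triW X c₀ c₁

lemma hkrHtpy_apply (w : AllWords k (HArr X)) :
    hkrHtpy c₀ c₁ w = factScale k Q (opStr X (triW X c₀ c₁ w 0 1)) := rfl

/-- This is the off-diagonal entry of `opW_linW` for triangular matrices. The two entries `-1` in
the products with `δ` pick out the diagonal entries of `F`, that is, the HKR operators for the two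
connections. -/
lemma hkrHtpy_hochB_path [CharZero k] (hw : IsPath (arrows X) n i i σ w) :
    hkrHtpy c₀ c₁ (hochB X w) =
      sgn σ • (hkr X c₀ w - hkr X c₁ w) + formsD (-f) (hkrHtpy c₀ c₁ w) := by
  have hs := isHKRSystem_triangular X c₀ c₁
  have h := isDG_arrows X
  -- The second diagonal entry of `ρ` carries the sign of `x`, which cancels the one built into
  -- `lastW`. This makes up for the different parity of the off-diagonal entry, and the boundary
  -- term again cancels the cyclic term.
  have hcyc : sgn σ • opStr X (lastW (diagL (opL X) (opL X ∘ₗ signL (arrPart X) 0))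
      (diagL (derL X c₁) (derL X c₀ ∘ₗ signL (arrPart X) 1))
      !![opG X c₁, opU X c₀ c₁; 0, opG X c₀] (arrPart X) w 0 1) +
      opStr X (triW X c₀ c₁ (cycW (arrPart X) (arrMul k fun i => (X i).P) w) 0 1) = 0 := by
    cases hw with
    | base ha hσ =>
      rw [cycW_zero, ← letterW_apply, lastW_letterW, map_zero, Matrix.zero_apply, map_zero,
        smul_zero, zero_add]
    | snoc hv hx hτ =>
      rename_i m j τ p v x
      have h1 : (triW X c₀ c₁ v * diagL (opL X) (opL X ∘ₗ signL (arrPart X) 0)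
          (signL (arrPart X) 0 x)) 0 1 = triW X c₀ c₁ v 0 1 * opL X x := by
        rw [diagL_apply, signL_of_mem h hx, add_zero, LinearMap.comp_apply,
          map_zsmul (signL (arrPart X) 0), signL_of_mem h hx, add_zero, smul_smul, sgn_mul_self,
          one_smul]
        simp [Matrix.mul_apply]
      have h2 : (diagL (opL X) (opL X ∘ₗ signL (arrPart X) 0) x * triW X c₀ c₁ v) 0 1 =
          opL X x * triW X c₀ c₁ v 0 1 := by
        rw [diagL_apply]
        simp [Matrix.mul_apply]
      rw [h.cycW_append hx hv.mem, lastW_appendW, h1, map_neg, map_zsmul, Matrix.neg_apply,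
        Matrix.smul_apply, hs.opW_left hx hv, h2, map_neg, map_zsmul,
        opStr_mul_comm (opL_mem hx) (triW_mem c₀ c₁ hv), smul_smul, ← sub_eq_add_neg,
        sub_eq_zero, ← sgn_add, hτ]
      congr 2
      clear * -
      revert p τ
      decide
  have hF := triW_mem c₀ c₁ hw
  -- The entries on the diagonal are `F₁` and `(-1)^{σ+1} F₀`. Multiplied by the entries `-1` they
  -- combine to `sgn σ • (F₀ - F₁)`.
  have hb : triW X c₀ c₁ (hochB X w) 0 1 = opδ X * triW X c₀ c₁ w 0 1 -
      sgn σ • (triW X c₀ c₁ w 0 1 * opδ X) + sgn σ • (hkrOp X c₀ w - hkrOp X c₁ w) -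
      opD X f * (opNum X * triW X c₀ c₁ w 0 1 - triW X c₀ c₁ w 0 1 * opNum X + triW X c₀ c₁ w 0 1) +
      sgn σ • lastW (diagL (opL X) (opL X ∘ₗ signL (arrPart X) 0))
      (diagL (derL X c₁) (derL X c₀ ∘ₗ signL (arrPart X) 1))
      !![opG X c₁, opU X c₀ c₁; 0, opG X c₀] (arrPart X) w 0 1 +
      triW X c₀ c₁ (cycW (arrPart X) (arrMul k fun i => (X i).P) w) 0 1 := by
    rw [hochB, wordB_eq_linW_add, LinearMap.add_apply, map_add, hs.opW_linW h hw]
    have e00 := congrFun (congrFun (opW_triangular (ρ := opL X) (D₀ := derL X c₀)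
      (D₁ := derL X c₁) (G₀ := opG X c₀) (G₁ := opG X c₁) (U := opU X c₀ c₁) h hw) 0) 0
    have e11 := congrFun (congrFun (opW_triangular (ρ := opL X) (D₀ := derL X c₀)
      (D₁ := derL X c₁) (G₀ := opG X c₀) (G₁ := opG X c₁) (U := opU X c₀ c₁) h hw) 1) 1
    simp only [Matrix.of_apply, Matrix.cons_val', Matrix.cons_val_zero, Matrix.cons_val_one,
      Matrix.cons_val_fin_one] at e00 e11
    simp only [Matrix.add_apply, Matrix.sub_apply, Matrix.smul_apply, Matrix.mul_apply,
      Fin.sum_univ_two, Matrix.of_apply, Matrix.cons_val', Matrix.cons_val_zero,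
      Matrix.cons_val_one, Matrix.cons_val_fin_one, e00, e11, zero_mul, mul_zero, add_zero]
    rw [sgn_add, sgn_one]
    rcases sgn_cases σ with hσ | hσ <;> simp only [hσ, one_smul, neg_smul, mul_neg, neg_mul,
      mul_one, one_mul, neg_neg, zero_add] <;> abel
  rw [hkrHtpy_apply, hkrHtpy_apply, formsD_neg, ← factScale_opStr hF, hb, hkr_eq c₀ hw, hkr_eq c₁ hw,
    ← map_sub, ← map_zsmul, ← map_neg, ← map_add]
  congr 1
  have hδ : opStr X (opδ X * triW X c₀ c₁ w 0 1) = sgn σ • opStr X (triW X c₀ c₁ w 0 1 * opδ X) :=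
    opStr_δ_mul hF
  rw [map_add, map_add, map_sub, map_add, map_sub, hδ, map_zsmul, sub_self, zero_add, map_zsmul,
    map_zsmul, add_assoc, hcyc, add_zero, map_sub, sub_eq_add_neg]

variable (X)

lemma hkrHtpy_mem {w : AllWords k (HArr X)} {j : ZMod 2} (hw : w ∈ hochGr X j) :
    hkrHtpy c₀ c₁ w ∈ formsGr k Q (j + 1) := by
  rw [mem_hochGr_iff] at hw
  refine loopsSpan_hom_mem (f := hkrHtpy c₀ c₁) (S := (formsGr k Q (j + 1)).toAddSubgroup)
    (fun n i v hv => ?_) hw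
  exact scaleForms_mem_formsGr _ (opStr_mem (triW_mem c₀ c₁ hv))

lemma hkrHtpy_smul {w : AllWords k (HArr X)} {j : ZMod 2} (hw : w ∈ hochGr X j) (q : Q) :
    hkrHtpy c₀ c₁ (q • w) = q • hkrHtpy c₀ c₁ w := by
  rw [mem_hochGr_iff] at hw
  refine loopsSpan_hom_eq (f := (hkrHtpy c₀ c₁ ∘ₗ DistribSMul.toLinearMap k _ q).toAddMonoidHom)
    (g := (DistribSMul.toLinearMap k _ q ∘ₗ hkrHtpy c₀ c₁).toAddMonoidHom) (fun n i v hv => ?_) hw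
  change hkrHtpy c₀ c₁ (q • v) = q • hkrHtpy c₀ c₁ v
  rw [hkrHtpy_apply, hkrHtpy_apply, triW_smul c₀ c₁ hv, opStr_smul (triW_mem c₀ c₁ hv), map_smul]

lemma hkrHtpy_hochB [CharZero k] {w : AllWords k (HArr X)} {j : ZMod 2} (hw : w ∈ hochGr X j) :
    hkrHtpy c₀ c₁ (hochB X w) =
      sgn (j + 1) • (hkr X c₀ w - hkr X c₁ w) + formsD (-f) (hkrHtpy c₀ c₁ w) := by
  rw [mem_hochGr_iff] at hw
  refine loopsSpan_hom_eq (f := (hkrHtpy c₀ c₁ ∘ₗ hochB X).toAddMonoidHom)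
    (g := (sgn (j + 1) • (hkr X c₀ - hkr X c₁) +
      formsD (-f) ∘ₗ hkrHtpy c₀ c₁).toAddMonoidHom) (fun n i v hv => ?_) hw
  exact hkrHtpy_hochB_path c₀ c₁ hv

end Homotopy

/-! ### Words with a distinguished first letter, read from the right and from the left -/

section Tails

variable {k Q : Type u} [Field k] [CommRing Q]
variable {H : Type u} [AddCommGroup H] [Module k H] [Module Q H] [SMulCommClass k Q H]
variable {I : Type u}

/-- Insertion of a letter after the first letter: `a₀[a₁|⋯|a_n] ↦ a₀[y|a₁|⋯|a_n]`. -/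
def insW (y : H) : Module.End k (AllWords k H) := recW (appendW y ∘ₗ letterW) appendW

lemma insW_letterW (y a : H) : insW (k := k) y (letterW a) = appendW y (letterW a) :=
  recW_letterW _ _ _

lemma insW_appendW (y x : H) (w : AllWords k H) :
    insW y (appendW x w) = appendW x (insW y w) := recW_appendW _ _ _ _

lemma insW_zsmul (r : ℤ) (y : H) (w : AllWords k H) : insW (r • y) w = r • insW y w := by
  have : insW (k := k) (r • y) = r • insW y := by
    refine allWords_hom_ext fun n a => ?_
    induction n with
    | zero =>
      have : a = fun _ => a 0 := funext fun l => by rw [Fin.fin_one_eq_zero l]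
      rw [this, ← letterW_apply, LinearMap.smul_apply, insW_letterW, insW_letterW, map_zsmul]
      rfl
    | succ n ih =>
      rw [← Fin.snoc_init_self a, ← appendW_allWord, LinearMap.smul_apply, insW_appendW,
        insW_appendW, ih, LinearMap.smul_apply, map_zsmul]
  rw [this, LinearMap.smul_apply]

/-- The operator that multiplies the last letter by `x`, if it is not the first letter, and is zero
on words with one letter. -/
def rightW (mul : H →ₗ[k] H →ₗ[k] H) (x : H) : Module.End k (AllWords k H) :=
  mapLastW (mul.flip x) ∘ₗ wordsLift fun n => if n = 0 then 0 else allWord n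

lemma rightW_letterW (mul : H →ₗ[k] H →ₗ[k] H) (x a : H) : rightW (k := k) mul x (letterW a) = 0 := by
  rw [rightW, LinearMap.comp_apply, letterW_apply, wordsLift_allWord, if_pos rfl]
  exact map_zero _

lemma rightW_appendW (mul : H →ₗ[k] H →ₗ[k] H) (x y : H) (w : AllWords k H) :
    rightW mul x (appendW y w) = appendW (mul y x) w := by
  refine LinearMap.congr_fun (f := rightW mul x ∘ₗ appendW y) (g := appendW (mul y x))
    (allWords_hom_ext fun n a => ?_) w
  rw [LinearMap.comp_apply, appendW_allWord, rightW, LinearMap.comp_apply, wordsLift_allWord,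
    if_neg n.succ_ne_zero, ← appendW_allWord, mapLastW_appendW, LinearMap.flip_apply]

/-- The part of `b'` that does not involve the first letter, together with a sign operator. -/
def tailLinAux (part : ZMod 2 → H →ₗ[k] H) (mul : H →ₗ[k] H →ₗ[k] H) (d : H →ₗ[k] H) :
    AllWords k H →ₗ[k] AllWords k H × AllWords k H :=
  recW (LinearMap.prod (letterW ∘ₗ signL part 1) 0)
    { toFun := fun x => LinearMap.prod (appendW (signL part 1 x) ∘ₗ LinearMap.fst k _ _)
        (appendW x ∘ₗ LinearMap.snd k _ _ + (appendW (d x) - rightW mul x) ∘ₗ LinearMap.fst k _ _)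
      map_add' := fun x y => by
        have : rightW mul (x + y) = rightW mul x + rightW mul y := by
          refine allWords_hom_ext fun n a => ?_
          cases n with
          | zero =>
            have : a = fun _ => a 0 := funext fun l => by rw [Fin.fin_one_eq_zero l]
            rw [this, ← letterW_apply, LinearMap.add_apply, rightW_letterW, rightW_letterW,
              rightW_letterW, add_zero]
          | succ n =>
            rw [← Fin.snoc_init_self a, ← appendW_allWord, LinearMap.add_apply, rightW_appendW,
              rightW_appendW, rightW_appendW, map_add, map_add, LinearMap.add_apply]
        refine LinearMap.ext fun v => Prod.ext ?_ ?_
        · simp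
        · simp [this]
          abel
      map_smul' := fun c x => by
        have : rightW mul (c • x) = c • rightW mul x := by
          refine allWords_hom_ext fun n a => ?_
          cases n with
          | zero =>
            have : a = fun _ => a 0 := funext fun l => by rw [Fin.fin_one_eq_zero l]
            rw [this, ← letterW_apply, LinearMap.smul_apply, rightW_letterW, rightW_letterW,
              smul_zero]
          | succ n =>
            rw [← Fin.snoc_init_self a, ← appendW_allWord, LinearMap.smul_apply, rightW_appendW,
              rightW_appendW, map_smul, map_smul, LinearMap.smul_apply]
        refine LinearMap.ext fun v => Prod.ext ?_ ?_
        · simp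
        · simp [this, smul_sub] }

/-- The part of `b'` that does not involve the first letter. -/
def tailLin (part : ZMod 2 → H →ₗ[k] H) (mul : H →ₗ[k] H →ₗ[k] H) (d : H →ₗ[k] H) :
    Module.End k (AllWords k H) := LinearMap.snd k _ _ ∘ₗ tailLinAux part mul d

/-- The maps `a₀ ↦ a₀[a₁|⋯|a_n]` given by composable letters `a₁, …, a_n`. -/
inductive IsTail (𝓗 : I → I → ZMod 2 → Submodule Q H) :
    ℕ → I → I → ZMod 2 → (H →ₗ[k] AllWords k H) → Prop
  | base {i : I} {σ : ZMod 2} (hσ : σ = 0) : IsTail 𝓗 0 i i σ letterW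
  | snoc {n : ℕ} {i j l : I} {σ q τ : ZMod 2} {t : H →ₗ[k] AllWords k H} {x : H}
      (ht : IsTail 𝓗 n i j σ t) (hx : x ∈ 𝓗 j l q) (hτ : τ = σ + (q + 1)) :
      IsTail 𝓗 (n + 1) i l τ (appendW x ∘ₗ t)

variable {part : ZMod 2 → H →ₗ[k] H} {mul : H →ₗ[k] H →ₗ[k] H} {d : H →ₗ[k] H}
  {𝓗 : I → I → ZMod 2 → Submodule Q H}
variable {i j l m m' : I} {σ τ p q r : ZMod 2} {n : ℕ} {t : H →ₗ[k] AllWords k H} {b x y z : H}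

lemma IsTail.isPath (ht : IsTail 𝓗 n i j σ t) (hb : b ∈ 𝓗 m i p) (hτ : τ = p + 1 + σ) :
    IsPath 𝓗 n m j τ (t b) := by
  induction ht generalizing τ with
  | base hσ =>
    rw [hσ, add_zero] at hτ
    exact .base hb hτ
  | snoc ht hx h ih =>
    refine .snoc (ih hb rfl) hx ?_
    rw [hτ, h, ← add_assoc (p + 1)]

lemma IsPath.exists_tail {w : AllWords k H} (hw : IsPath 𝓗 n m j τ w) :
    ∃ (i : I) (p σ : ZMod 2) (t : H →ₗ[k] AllWords k H) (b : H), IsTail 𝓗 n i j σ t ∧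
      b ∈ 𝓗 m i p ∧ τ = p + 1 + σ ∧ w = t b := by
  induction hw with
  | base ha hσ => exact ⟨_, _, 0, _, _, .base rfl, ha, by rw [hσ, add_zero], rfl⟩
  | snoc hw hx hτ ih =>
    obtain ⟨i, p, σ, t, b, ht, hb, rfl, rfl⟩ := ih
    exact ⟨i, p, _, _, b, .snoc ht hx rfl, hb, by rw [hτ, add_assoc], rfl⟩

lemma IsTail.ins (ht : IsTail 𝓗 n i j σ t) (hy : y ∈ 𝓗 m i q) (hτ : τ = σ + (q + 1)) :
    IsTail 𝓗 (n + 1) m j τ (insW y ∘ₗ t) := by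
  induction ht generalizing τ with
  | base hσ =>
    rw [show insW y ∘ₗ letterW = appendW y ∘ₗ letterW (k := k) from
      LinearMap.ext fun a => insW_letterW y a]
    exact .snoc (.base rfl) hy (by rw [hτ, hσ])
  | @snoc n i j l σ r τ' t x ht hx h ih =>
    rw [show insW y ∘ₗ appendW x ∘ₗ t = appendW x ∘ₗ insW y ∘ₗ t from
      LinearMap.ext fun a => insW_appendW y x _]
    exact .snoc (ih hy rfl) hx (by rw [hτ, h, add_right_comm])

/-- Tails are built from the right, but reversal exchanges the two ends, so a letter must also be
split off on the left. -/
lemma IsTail.exists_ins (ht : IsTail 𝓗 (n + 1) i j σ t) :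
    ∃ (m : I) (q τ : ZMod 2) (s : H →ₗ[k] AllWords k H) (y : H), IsTail 𝓗 n m j τ s ∧
      y ∈ 𝓗 i m q ∧ σ = τ + (q + 1) ∧ t = insW y ∘ₗ s := by
  induction n generalizing j σ t with
  | zero =>
    cases ht with
    | snoc ht hx hτ =>
      cases ht with
      | base hσ => exact ⟨_, _, _, _, _, .base hσ, hx, hτ, LinearMap.ext fun a =>
          (insW_letterW _ a).symm⟩
  | succ n ih =>
    cases ht with
    | snoc ht hx hτ =>
      obtain ⟨m, q, τ, s, y, hs, hy, rfl, rfl⟩ := ih ht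
      refine ⟨m, q, _, _, y, .snoc hs hx rfl, hy, by rw [hτ, add_right_comm],
        LinearMap.ext fun a => (insW_appendW y _ _).symm⟩

lemma IsTail.mapFirstW (ht : IsTail 𝓗 n i j σ t) (φ : H →ₗ[k] H) (b : H) :
    mapFirstW φ (t b) = t (φ b) := by
  induction ht with
  | base hσ => rw [letterW_apply, mapFirstW_zero, letterW_apply]
  | snoc ht hx hτ ih => rw [LinearMap.comp_apply, mapFirstW_appendW, ih, LinearMap.comp_apply]

variable (k) in
/-- The span of the words with first letter `b` and given tails. -/
def tailSpan (𝓗 : I → I → ZMod 2 → Submodule Q H) (b : H) (i j : I) (σ : ZMod 2) :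
    AddSubgroup (AllWords k H) :=
  AddSubgroup.closure {w | ∃ (n : ℕ) (t : H →ₗ[k] AllWords k H), IsTail 𝓗 n i j σ t ∧ w = t b}

lemma IsTail.mem (ht : IsTail 𝓗 n i j σ t) (b : H) : t b ∈ tailSpan k 𝓗 b i j σ :=
  AddSubgroup.subset_closure ⟨n, t, ht, rfl⟩

lemma tailSpan_hom_eq {N : Type u} [AddCommGroup N] {f g : AllWords k H →+ N}
    (hfg : ∀ n t, IsTail 𝓗 n i j σ t → f (t b) = g (t b)) {w : AllWords k H}
    (hw : w ∈ tailSpan k 𝓗 b i j σ) : f w = g w :=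
  AddMonoidHom.eqOn_closure (f := f) (g := g) (by rintro w ⟨n, t, ht, rfl⟩; exact hfg n t ht) hw

lemma appendW_mem_tailSpan {w : AllWords k H} (hw : w ∈ tailSpan k 𝓗 b i j σ) (hx : x ∈ 𝓗 j l q)
    (hτ : τ = σ + (q + 1)) : appendW x w ∈ tailSpan k 𝓗 b i l τ := by
  refine (AddSubgroup.closure_le ((tailSpan k 𝓗 b i l τ).comap (appendW x).toAddMonoidHom)).2 ?_ hw
  rintro w ⟨n, t, ht, rfl⟩
  exact (IsTail.snoc ht hx hτ).mem b

namespace IsDG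

/-- The recursion for `b'` contains the sign of the word, which is not linear data of an arbitrary
word. The first component carries this sign along as an operator. -/
lemma tailLinAux_fst (h : IsDG part mul d 𝓗) (hb : b ∈ 𝓗 m m' p) (ht : IsTail 𝓗 n i j σ t) :
    (tailLinAux part mul d (t b)).1 = sgn (p + 1 + σ) • t b := by
  induction ht with
  | base hσ =>
    rw [tailLinAux, recW_letterW, LinearMap.prod_apply, hσ, add_zero]
    change letterW (signL part 1 b) = _
    rw [signL_of_mem h hb, map_zsmul]
  | snoc ht hx hτ ih =>
    rw [LinearMap.comp_apply, tailLinAux, recW_appendW]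
    change appendW (signL part 1 _) (tailLinAux part mul d _).1 = _
    rw [ih, signL_of_mem h hx, map_zsmul, map_zsmul, LinearMap.smul_apply, smul_smul, hτ,
      ← add_assoc (p + 1), sgn_add (p + 1 + _)]

lemma tailLin_letterW (a : H) : tailLin part mul d (letterW a) = 0 := by
  rw [tailLin, LinearMap.comp_apply, tailLinAux, recW_letterW]
  rfl

lemma tailLin_append (h : IsDG part mul d 𝓗) (hb : b ∈ 𝓗 m m' p) (ht : IsTail 𝓗 n i j σ t) (x : H) :
    tailLin part mul d (appendW x (t b)) = appendW x (tailLin part mul d (t b)) +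
      sgn (p + 1 + σ) • (appendW (d x) (t b) - rightW mul x (t b)) := by
  rw [tailLin, LinearMap.comp_apply, tailLinAux, recW_appendW]
  change appendW x (tailLin part mul d (t b)) + (appendW (d x) - rightW mul x : Module.End k (AllWords k H))
    (tailLinAux part mul d (t b)).1 = _
  rw [h.tailLinAux_fst hb ht, map_zsmul, LinearMap.sub_apply]
  rfl

lemma tailLin_mem (h : IsDG part mul d 𝓗) (hb : b ∈ 𝓗 m m' p) (ht : IsTail 𝓗 n i j σ t)
    (hτ : τ = σ + 1) : tailLin part mul d (t b) ∈ tailSpan k 𝓗 b i j τ := by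
  induction ht generalizing τ with
  | base hσ => rw [tailLin_letterW]; exact zero_mem _
  | @snoc n i j l σ q ρ t x ht hx hρ ih =>
    rw [LinearMap.comp_apply, h.tailLin_append hb ht]
    refine add_mem (appendW_mem_tailSpan (ih rfl) hx ?_) (zsmul_mem (sub_mem ?_ ?_) _)
    · rw [hτ, hρ, add_right_comm]
    · refine (IsTail.snoc ht (h.d_mem hx) ?_).mem b
      rw [hτ, hρ, add_assoc]
    · cases ht with
      | base => rw [rightW_letterW]; exact zero_mem _
      | snoc ht hy h' =>
        rw [LinearMap.comp_apply, rightW_appendW]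
        refine (IsTail.snoc ht (h.mul_mem hy hx) ?_).mem b
        rw [hτ, hρ, h']
        ring_nf
        rw [show (3 : ZMod 2) = 1 from rfl]

lemma rightW_insW (ht : IsTail 𝓗 (n + 1) i j σ t) (x y b : H) :
    rightW mul x (insW y (t b)) = insW y (rightW mul x (t b)) := by
  cases ht with
  | snoc ht hz hτ =>
    rw [LinearMap.comp_apply, insW_appendW, rightW_appendW, rightW_appendW, insW_appendW]

lemma rightW_eq_mapLastW (ht : IsTail 𝓗 (n + 1) i j σ t) (x b : H) :
    rightW mul x (t b) = mapLastW (mul.flip x) (t b) := by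
  cases ht with
  | snoc ht hz hτ =>
    rw [LinearMap.comp_apply, rightW_appendW, mapLastW_appendW, LinearMap.flip_apply]

lemma tailLin_ins_letterW (h : IsDG part mul d 𝓗) (hb : b ∈ 𝓗 m m' p) (y : H) :
    tailLin part mul d (insW y (letterW b)) = sgn (p + 1) • insW (d y) (letterW b) := by
  have := h.tailLin_append hb (IsTail.base (i := m) (k := k) rfl) y
  rw [insW_letterW, this, tailLin_letterW, map_zero, rightW_letterW, sub_zero, zero_add, add_zero,
    insW_letterW]

/-- This is the mirror image of `tailLin_append`: the recursion obtained by adding a letter at the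
left end of the tail. Reversal takes one recursion to the other. -/
lemma tailLin_ins_ins (h : IsDG part mul d 𝓗) (hb : b ∈ 𝓗 m m' p) (ht : IsTail 𝓗 n i j σ t)
    {m₁ : I} (hz : z ∈ 𝓗 l i r) (hy : y ∈ 𝓗 m₁ l q) :
    tailLin part mul d (insW y (insW z (t b))) =
      sgn (q + 1) • insW y (tailLin part mul d (insW z (t b))) +
        sgn (p + 1) • insW (d y) (insW z (t b)) -
        sgn (p + 1 + (q + 1)) • insW (mul y z) (t b) := by
  induction ht with
  | @base i σ hσ =>
    have h1 := h.tailLin_append hb (IsTail.snoc (IsTail.base (i := m₁) (k := k) rfl) hy rfl) z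
    rw [LinearMap.comp_apply, ← insW_letterW, h.tailLin_ins_letterW hb, insW_letterW,
      rightW_appendW, zero_add] at h1
    rw [h.tailLin_ins_letterW hb, insW_letterW z, insW_appendW, insW_letterW y, h1]
    simp only [insW_letterW, insW_appendW, map_zsmul, smul_smul, sgn_add (p + 1), smul_sub,
      mul_comm (sgn (q + 1))]
    abel
  | @snoc n i j j' σ s τ t x ht hx hτ ih =>
    have h1 := h.tailLin_append hb ((ht.ins hz rfl).ins hy rfl) x
    have h2 := h.tailLin_append hb (ht.ins hz rfl) x
    simp only [LinearMap.comp_apply] at h1 h2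
    have h3 := rightW_insW (mul := mul) (ht.ins hz rfl) x y b
    rw [LinearMap.comp_apply] at h3
    simp only [LinearMap.comp_apply, insW_appendW]
    rw [h1, h2, ih hz, h3]
    simp only [insW_appendW, map_add, map_sub, map_zsmul, smul_add, smul_sub, smul_smul, sgn_add]
    module

end IsDG

/-- The part of `b'` that multiplies the first two letters. -/
def headW (part : ZMod 2 → H →ₗ[k] H) (mul : H →ₗ[k] H →ₗ[k] H) (d : H →ₗ[k] H) :
    Module.End k (AllWords k H) := linW part mul d - mapFirstW d - tailLin part mul d

namespace IsDG

lemma headW_letterW (h : IsDG part mul d 𝓗) (hb : b ∈ 𝓗 m i p) :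
    headW part mul d (letterW b) = 0 := by
  rw [headW, LinearMap.sub_apply, LinearMap.sub_apply, tailLin_letterW, letterW_apply,
    h.linW_base hb, mapFirstW_zero, sub_self, sub_zero]

/-- The two recursions differ only in the multiplication of the last letter by `x`, which `rightW`
omits when the last letter is also the first one. -/
lemma headW_append (h : IsDG part mul d 𝓗) (hb : b ∈ 𝓗 m i p) (ht : IsTail 𝓗 n i j σ t)
    (hx : x ∈ 𝓗 j l q) :
    headW part mul d (appendW x (t b)) = appendW x (headW part mul d (t b)) +
      sgn (p + 1 + σ) • (rightW mul x (t b) - mapLastW (mul.flip x) (t b)) := by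
  simp only [headW, LinearMap.sub_apply]
  rw [h.linW_append hx (ht.isPath hb rfl).mem', h.tailLin_append hb ht, mapFirstW_appendW]
  simp only [map_sub]
  module

/-- The product of the first two letters arises when the second letter is appended to the first. For
all later letters `rightW` and `mapLastW` agree, so nothing is added. -/
lemma headW_ins (h : IsDG part mul d 𝓗) (hb : b ∈ 𝓗 m l p) (hy : y ∈ 𝓗 l i q)
    (ht : IsTail 𝓗 n i j σ t) :
    headW part mul d (insW y (t b)) = sgn p • t (mul b y) := by
  induction ht with
  | base hσ =>
    have := h.headW_append hb (IsTail.base rfl) hy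
    rw [h.headW_letterW hb, map_zero, zero_add, rightW_letterW, zero_sub, add_zero, letterW_apply,
      mapLastW_zero, LinearMap.flip_apply, sgn_add, sgn_one, mul_neg_one, neg_smul, smul_neg,
      neg_neg] at this
    rw [insW_letterW, letterW_apply, this, letterW_apply]
  | snoc ht hx hτ ih =>
    have := h.headW_append hb (ht.ins hy rfl) hx
    rw [LinearMap.comp_apply] at this
    rw [LinearMap.comp_apply, insW_appendW, this, ih hy, map_zsmul, LinearMap.comp_apply,
      ← LinearMap.comp_apply (insW _)]
    rw [rightW_eq_mapLastW (ht.ins hy rfl) _ b, LinearMap.comp_apply, sub_self, smul_zero,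
      add_zero]

end IsDG

section Letters

lemma sum_Ioo_eq_sum_ite {n : ℕ} (g : Fin (n + 1) → ZMod 2) (j : Fin (n + 1)) :
    ∑ i ∈ Finset.Ioo 0 j, g i = ∑ i, if 0 < i ∧ i < j then g i else 0 := by
  rw [← Finset.sum_filter]
  congr 1
  ext
  simp

/-- The new pairs are those of an old letter other than the first with the new one, and `-1 = 1` for
parities. -/
lemma sum_sign_snoc {n : ℕ} (p : Fin (n + 1) → ZMod 2) (q : ZMod 2) :
    ∑ j : Fin (n + 2), ∑ i ∈ Finset.Ioo 0 j,
      ((Fin.snoc p q : Fin (n + 2) → ZMod 2) i - 1) *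
        ((Fin.snoc p q : Fin (n + 2) → ZMod 2) j - 1) =
    ∑ j : Fin (n + 1), ∑ i ∈ Finset.Ioo 0 j, (p i - 1) * (p j - 1) +
      (∑ l : Fin n, (p l.succ + 1)) * (q + 1) := by
  have e : ∀ a : ZMod 2, a - 1 = a + 1 := by decide
  simp only [sum_Ioo_eq_sum_ite, e]
  rw [Fin.sum_univ_castSucc]
  congr 1
  · refine Finset.sum_congr rfl fun j _ => ?_
    rw [Fin.sum_univ_castSucc]
    simp only [Fin.snoc_castSucc]
    rw [if_neg (fun h => absurd h.2 (not_lt.2 (Fin.castSucc_lt_last j).le)), add_zero]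
    refine Finset.sum_congr rfl fun i _ => ?_
    simp only [Fin.castSucc_lt_castSucc_iff, Fin.castSucc_pos_iff]
  · rw [Fin.sum_univ_castSucc, Fin.sum_univ_succ]
    simp only [Fin.snoc_castSucc, Fin.snoc_last, Fin.castSucc_pos_iff, Fin.castSucc_lt_last,
      lt_self_iff_false, false_and, and_false, if_false, zero_add, add_zero, Fin.succ_pos, and_self,
      if_true, Finset.sum_mul]

/-- Negation modulo `n + 1` fixes `0` and reverses `1, …, n`. In this way the reindexing in the
definition of `Ψ` keeps the first letter and reverses the rest. -/
lemma cons_comp_neg {A B : Type u} {n : ℕ} (g : A → B) (b : A) (a : Fin n → A) :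
    (fun l : Fin (n + 1) => g ((Fin.cons b a : Fin (n + 1) → A) (-l))) =
      (Fin.cons (g b) fun l => g (a l.rev) : Fin (n + 1) → B) := by
  funext l
  refine Fin.cases ?_ (fun l => ?_) l
  · simp
  · have : -l.succ = l.rev.succ := by
      refine Fin.ext ?_
      rw [Fin.val_neg, if_neg (Fin.succ_ne_zero l), Fin.val_succ, Fin.val_succ, Fin.val_rev]
      omega
    rw [this, Fin.cons_succ, Fin.cons_succ]

lemma insW_allWord (y b : H) {n : ℕ} (a : Fin n → H) :
    insW y (allWord (k := k) n (Fin.cons b a)) = allWord (n + 1) (Fin.cons b (Fin.cons y a)) := by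
  induction n with
  | zero =>
    have h1 : (Fin.cons b a : Fin 1 → H) = fun _ => b := funext fun l => by
      rw [Fin.fin_one_eq_zero l]; rfl
    rw [h1, ← letterW_apply, insW_letterW, letterW_apply, appendW_allWord]
    congr 1
    funext l
    refine Fin.cases rfl (fun l => ?_) l
    rw [Fin.fin_one_eq_zero l]
    rfl
  | succ n ih =>
    rw [← Fin.snoc_init_self a, Fin.cons_snoc_eq_snoc_cons, ← appendW_allWord, insW_appendW, ih,
      appendW_allWord, ← Fin.cons_snoc_eq_snoc_cons, ← Fin.cons_snoc_eq_snoc_cons]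

lemma IsTail.exists_letters (h : IsDG part mul d 𝓗) (ht : IsTail 𝓗 n i j σ t) :
    ∃ (p : Fin n → ZMod 2) (a : Fin n → H), (∀ b, t b = allWord n (Fin.cons b a)) ∧
      HomLetters part p a ∧ σ = ∑ l, (p l + 1) := by
  induction ht with
  | base hσ =>
    refine ⟨Fin.elim0, Fin.elim0, fun b => ?_, fun l => l.elim0, by simpa using hσ⟩
    rw [letterW_apply]
    congr 1
    funext l
    rw [Fin.fin_one_eq_zero l]
    rfl
  | snoc ht hx hτ ih =>
    obtain ⟨p, a, h1, h2, rfl⟩ := ih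
    refine ⟨_, _, fun b => ?_, h2.snoc (h.part_mem hx), ?_⟩
    · rw [LinearMap.comp_apply, h1, appendW_allWord, Fin.cons_snoc_eq_snoc_cons]
    · rw [hτ, Fin.sum_univ_castSucc]
      simp only [Fin.snoc_castSucc, Fin.snoc_last]

lemma HomLetters.cons {p : Fin n → ZMod 2} {a : Fin n → H} (h : HomLetters part p a)
    (hx : ∀ r, part r x = if r = q then x else 0) :
    HomLetters part (Fin.cons q p : Fin (n + 1) → ZMod 2) (Fin.cons x a : Fin (n + 1) → H) := by
  intro l
  refine Fin.cases ?_ (fun l => ?_) l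
  · simpa using hx
  · simpa using h l

end Letters

section Reverse

variable {H' : Type u} [AddCommGroup H'] [Module k H']

/-- The map on words induced by an operation `a ↦ a^*`. -/
def revW (part : ZMod 2 → H →ₗ[k] H) (star : H →ₗ[k] H') : AllWords k H →ₗ[k] AllWords k H' :=
  DirectSum.toModule k ℕ _ fun n => DirectSum.lof k ℕ (Words k H') n ∘ₗ wordReverse part star n

variable {star : H →ₗ[k] H'}

lemma revW_cons {p₀ : ZMod 2} {p : Fin n → ZMod 2} {a : Fin n → H}
    (hb : ∀ r, part r b = if r = p₀ then b else 0) (ha : HomLetters part p a) :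
    revW part star (allWord n (Fin.cons b a)) =
      sgn ((n : ZMod 2) + ∑ j : Fin (n + 1), ∑ i ∈ Finset.Ioo 0 j,
        ((Fin.cons p₀ p : Fin (n + 1) → ZMod 2) i - 1) *
          ((Fin.cons p₀ p : Fin (n + 1) → ZMod 2) j - 1)) •
        allWord n (Fin.cons (star b) fun l => star (a l.rev)) := by
  rw [revW, toModule_allWord, LinearMap.comp_apply, wordReverse, ofMulti_word]
  have key : (∑ p : Fin (n + 1) → ZMod 2,
      sgn ((n : ZMod 2) + ∑ j : Fin (n + 1), ∑ i ∈ Finset.Ioo 0 j, (p i - 1) * (p j - 1)) •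
      ((word k H' n).domDomCongr (Equiv.neg (Fin (n + 1)))).compLinearMap
        fun l => star ∘ₗ part (p l)) = ∑ p : Fin (n + 1) → ZMod 2,
      (sgn ((n : ZMod 2) + ∑ j : Fin (n + 1), ∑ i ∈ Finset.Ioo 0 j, (p i - 1) * (p j - 1)) •
      ((word k H' n).domDomCongr (Equiv.neg (Fin (n + 1)))).compLinearMap
        fun _ => star).compLinearMap fun l => part (p l) := rfl
  rw [key, (ha.cons hb).sum_part, smul_apply, map_zsmul, ← cons_comp_neg]
  rfl

lemma revW_letterW (hb : ∀ r, part r b = if r = p then b else 0) :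
    revW part star (letterW b) = letterW (star b) := by
  have h0 : ∀ {A : Type u} (c : A) (a : Fin 0 → A), (Fin.cons c a : Fin 1 → A) = fun _ => c :=
    fun c a => funext fun l => by rw [Fin.fin_one_eq_zero l]; rfl
  have := revW_cons (star := star) (p := Fin.elim0) (a := Fin.elim0) hb fun l => l.elim0
  rw [h0, h0] at this
  rw [letterW_apply, this, letterW_apply]
  simp [sgn_zero]

/-- A letter at the right end moves to the left end of the reversed tail. The sign comes from the
new pairs of letters, and the minus from the increase of `n` by one. -/
lemma revW_append (h : IsDG part mul d 𝓗) (hb : b ∈ 𝓗 m m' p) (ht : IsTail 𝓗 n i j σ t)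
    (hx : x ∈ 𝓗 j l q) : revW part star (appendW x (t b)) =
      -(sgn ((q + 1) * σ) • insW (star x) (revW part star (t b))) := by
  obtain ⟨r, a, h1, h2, rfl⟩ := ht.exists_letters h
  rw [h1, appendW_allWord, ← Fin.cons_snoc_eq_snoc_cons, revW_cons (h.part_mem hb) h2,
    revW_cons (h.part_mem hb) (h2.snoc (h.part_mem hx)), Fin.cons_snoc_eq_snoc_cons,
    sum_sign_snoc, map_zsmul, insW_allWord, smul_smul, ← neg_smul]
  congr 1
  · simp only [Fin.cons_succ, Nat.cast_succ, sgn_add, sgn_one, mul_comm (q + 1)]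
    ring
  · congr 2
    funext l
    refine Fin.cases ?_ (fun l => ?_) l
    · rw [Fin.rev_zero, Fin.snoc_last, Fin.cons_zero]
    · rw [Fin.rev_succ, Fin.snoc_castSucc, Fin.cons_succ]

end Reverse

end Tails

/-! ### Reversal of words is compatible with the Hochschild differential -/

section Reverse

variable {k Q : Type u} [Field k] [CommRing Q]
variable {H : Type u} [AddCommGroup H] [Module k H] [Module Q H] [SMulCommClass k Q H]
variable {H' : Type u} [AddCommGroup H'] [Module k H'] [Module Q H'] [SMulCommClass k Q H']
variable {I J : Type u}

/-- A contravariant operation `a ↦ a^*` on homogeneous arrows. -/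
structure IsStar (mul : H →ₗ[k] H →ₗ[k] H) (d : H →ₗ[k] H) (𝓗 : I → I → ZMod 2 → Submodule Q H)
    (mul' : H' →ₗ[k] H' →ₗ[k] H') (d' : H' →ₗ[k] H') (𝓗' : J → J → ZMod 2 → Submodule Q H')
    (θ : I → J) (star : H →ₗ[k] H') : Prop where
  star_mem : ∀ {i j p a}, a ∈ 𝓗 i j p → star a ∈ 𝓗' (θ j) (θ i) p
  star_mul : ∀ {i j l p q a b}, a ∈ 𝓗 i j p → b ∈ 𝓗 j l q →
    star (mul a b) = sgn (p * q) • mul' (star b) (star a)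
  star_d : ∀ {i j p a}, a ∈ 𝓗 i j p → star (d a) = d' (star a)
  star_smul : ∀ {i j p a} (r : Q), a ∈ 𝓗 i j p → star (r • a) = r • star a

variable {part : ZMod 2 → H →ₗ[k] H} {mul : H →ₗ[k] H →ₗ[k] H} {d : H →ₗ[k] H}
  {𝓗 : I → I → ZMod 2 → Submodule Q H} {part' : ZMod 2 → H' →ₗ[k] H'}
  {mul' : H' →ₗ[k] H' →ₗ[k] H'} {d' : H' →ₗ[k] H'} {𝓗' : J → J → ZMod 2 → Submodule Q H'}
  {θ : I → J} {star : H →ₗ[k] H'}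
variable {i j l m m' : I} {σ τ p q r : ZMod 2} {n : ℕ} {t : H →ₗ[k] AllWords k H} {b x y z : H}
  {w : AllWords k H}

namespace IsStar

/-- The sign of `Ψ` involves only the letters after the first one. Hence the image of a tail is a
fixed multiple of a tail, uniformly in the first letter. -/
lemma exists_revW (h : IsDG part mul d 𝓗) (hs : IsStar mul d 𝓗 mul' d' 𝓗' θ star)
    (ht : IsTail 𝓗 n i j σ t) : ∃ (ε : ℤ) (t' : H' →ₗ[k] AllWords k H'),
      IsTail 𝓗' n (θ j) (θ i) σ t' ∧ ∀ {m m' p b}, b ∈ 𝓗 m m' p →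
        revW part star (t b) = ε • t' (star b) := by
  induction ht with
  | base hσ => exact ⟨1, _, .base hσ, fun hb => by rw [revW_letterW (h.part_mem hb), one_smul]⟩
  | @snoc n i j l σ q τ t x ht hx hτ ih =>
    obtain ⟨ε, t', ht', h'⟩ := ih
    refine ⟨-(sgn ((q + 1) * σ)) * ε, _, ht'.ins (hs.star_mem hx) hτ, fun hb => ?_⟩
    rw [LinearMap.comp_apply, revW_append h hb ht hx, h' hb, map_zsmul, LinearMap.comp_apply,
      mul_smul, neg_smul]

/-- The sign is the same as in `revW_append`, because the sum over pairs of letters is symmetric. -/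
lemma revW_ins (h : IsDG part mul d 𝓗) (hb : b ∈ 𝓗 m m' p) (ht : IsTail 𝓗 n i j σ t) (hy : y ∈ 𝓗 l i q) :
    revW part star (insW y (t b)) =
      -(sgn ((q + 1) * σ) • appendW (star y) (revW part star (t b))) := by
  induction ht with
  | base hσ =>
    have := revW_append (star := star) h hb (IsTail.base rfl) hy
    rw [insW_letterW, this, hσ, revW_letterW (h.part_mem hb), insW_letterW]
  | snoc ht hx hτ ih =>
    have := revW_append (star := star) h hb (ht.ins hy rfl) hx
    rw [LinearMap.comp_apply] at this
    rw [LinearMap.comp_apply, insW_appendW, this, ih hy, revW_append h hb ht hx, hτ]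
    simp only [map_neg, map_zsmul, insW_appendW, smul_neg, neg_neg, smul_smul]
    rw [← sgn_add, ← sgn_add]
    congr 2
    ring

lemma revW_mapFirstW (h : IsDG part mul d 𝓗) (hs : IsStar mul d 𝓗 mul' d' 𝓗' θ star)
    {φ : H →ₗ[k] H} {φ' : H' →ₗ[k] H'} (hb : b ∈ 𝓗 m m' p) {l l' : I} (hb' : φ b ∈ 𝓗 l l' r) {c : ℤ}
    (hφ : star (φ b) = c • φ' (star b)) (ht : IsTail 𝓗 n i j σ t) :
    revW part star (t (φ b)) = c • mapFirstW φ' (revW part star (t b)) := by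
  obtain ⟨ε, t', ht', h'⟩ := hs.exists_revW h ht
  rw [h' hb', h' hb, hφ, map_zsmul, map_zsmul, ht'.mapFirstW, smul_comm]

lemma revW_append_mem (h : IsDG part mul d 𝓗) (hb : b ∈ 𝓗 m m' p) (hw : w ∈ tailSpan k 𝓗 b i j σ)
    (hx : x ∈ 𝓗 j l q) : revW part star (appendW x w) =
      -(sgn ((q + 1) * σ) • insW (star x) (revW part star w)) :=
  tailSpan_hom_eq (f := (revW part star ∘ₗ appendW x).toAddMonoidHom)
    (g := (-(sgn ((q + 1) * σ) • insW (star x) ∘ₗ revW part star)).toAddMonoidHom)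
    (fun _ _ ht => revW_append h hb ht hx) hw

/-- Induction on the last letter of the source: `tailLin_append` there is matched with
`tailLin_ins_ins` on the reversed word. The product of the last two letters becomes the product of
the first two in the opposite order, with the sign of `star_mul`. -/
lemma revW_tailLin (h : IsDG part mul d 𝓗) (h' : IsDG part' mul' d' 𝓗')
    (hs : IsStar mul d 𝓗 mul' d' 𝓗' θ star) (hb : b ∈ 𝓗 m m' p) (ht : IsTail 𝓗 n i j σ t) :
    revW part star (tailLin part mul d (t b)) = tailLin part' mul' d' (revW part star (t b)) := by
  induction ht with
  | base hσ =>
    rw [IsDG.tailLin_letterW, revW_letterW (h.part_mem hb), IsDG.tailLin_letterW, map_zero]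
  | @snoc n i j l σ q τ t x ht hx hτ ih =>
    have hb' := hs.star_mem hb
    rw [LinearMap.comp_apply, h.tailLin_append hb ht, map_add, map_zsmul, map_sub,
      revW_append_mem h hb (h.tailLin_mem hb ht rfl) hx, ih, revW_append h hb ht hx,
      revW_append h hb ht (h.d_mem hx), hs.star_d hx]
    cases ht with
    | base hσ =>
      rw [rightW_letterW, map_zero, revW_letterW (h.part_mem hb), IsDG.tailLin_letterW, map_neg,
        map_zsmul, h'.tailLin_ins_letterW hb', hσ]
      simp [sgn_zero]
    | @snoc n _ j' _ σ' q' _ t y ht hy hτ' =>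
      obtain ⟨ε, t', ht', e⟩ := hs.exists_revW h ht
      rw [LinearMap.comp_apply, rightW_appendW, revW_append h hb ht (h.mul_mem hy hx),
        revW_append h hb ht hy, hs.star_mul hy hx, insW_zsmul, e hb]
      have := h'.tailLin_ins_ins hb' ht' (hs.star_mem hy) (hs.star_mem hx)
      simp only [map_neg, map_zsmul, this, hτ']
      simp only [smul_sub, smul_add, smul_neg, smul_smul, neg_neg]
      generalize insW (star x) (tailLin part' mul' d' (insW (star y) (t' (star b)))) = A
      generalize insW (d' (star x)) (insW (star y) (t' (star b))) = B
      generalize insW (mul' (star x) (star y)) (t' (star b)) = C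
      clear * -
      rcases parity_cases p with rfl | rfl <;> rcases parity_cases q with rfl | rfl <;>
      rcases parity_cases q' with rfl | rfl <;> rcases parity_cases σ' with rfl | rfl <;>
      simp [sgn, show (1 : ZMod 2) + 1 = 0 from rfl] <;> abel

/-- The map `Ψ` is compatible with the Hochschild differentials. -/
lemma revW_wordB (h : IsDG part mul d 𝓗) (h' : IsDG part' mul' d' 𝓗')
    (hs : IsStar mul d 𝓗 mul' d' 𝓗' θ star) (hw : IsPath 𝓗 n i i τ w) :
    revW part star (wordB part mul d w) = wordB part' mul' d' (revW part star w) := by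
  obtain ⟨j, p, σ, t, b, ht, hb, rfl, rfl⟩ := hw.exists_tail
  have hb' := hs.star_mem hb
  -- The differential is split into `d` on the first letter, the part within the tail, and the two
  -- products that involve the first letter: with its right neighbour, and cyclically with the last
  -- letter.
  have hlin : ∀ {K : Type u} [AddCommGroup K] [Module k K] (part : ZMod 2 → K →ₗ[k] K)
      (mul : K →ₗ[k] K →ₗ[k] K) (d : K →ₗ[k] K) (w : AllWords k K), wordB part mul d w =
        mapFirstW d w + tailLin part mul d w + (headW part mul d w + cycW part mul w) := by
    intro K _ _ part mul d w
    rw [wordB_eq_linW_add, LinearMap.add_apply, headW, LinearMap.sub_apply, LinearMap.sub_apply]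
    abel
  have h1 : revW part star (mapFirstW d (t b)) = mapFirstW d' (revW part star (t b)) := by
    rw [ht.mapFirstW, hs.revW_mapFirstW h (c := 1) (φ := d) (φ' := d') hb (h.d_mem hb) (by
      rw [one_smul, hs.star_d hb]) ht, one_smul]
  -- Reversal exchanges the two neighbours of the first letter on the circle. So `Ψ` interchanges
  -- the head term and the cyclic term, and each is compared with the other one on the dual side.
  have h2 : revW part star (headW part mul d (t b) + cycW part mul (t b)) =
      headW part' mul' d' (revW part star (t b)) + cycW part' mul' (revW part star (t b)) := by
    cases n with
    | zero =>
      cases ht with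
      | base hσ =>
        rw [h.headW_letterW hb, revW_letterW (h.part_mem hb), h'.headW_letterW hb', letterW_apply,
          letterW_apply, cycW_zero, cycW_zero, add_zero, add_zero, map_zero]
    | succ n =>
      rw [map_add, add_comm (headW part' mul' d' _)]
      congr 1
      · obtain ⟨m, q, τ, s, y, hs', hy, rfl, rfl⟩ := ht.exists_ins
        obtain ⟨ε, t', ht', e⟩ := hs.exists_revW h hs'
        have hy' := hs.star_mem hy
        have e' := hs.revW_mapFirstW h (φ := mul.flip y) (φ' := mul' (star y)) hb (h.mul_mem hb hy)
          (hs.star_mul hb hy) hs'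
        rw [LinearMap.flip_apply] at e'
        rw [LinearMap.comp_apply, h.headW_ins hb hy hs', map_zsmul, e',
          revW_ins h hb hs' hy, e hb, map_neg, map_zsmul, map_zsmul, map_zsmul,
          map_zsmul, h'.cycW_append hy' (ht'.isPath hb' rfl).mem]
        generalize mapFirstW (mul' (star y)) (t' (star b)) = A
        clear * -
        rcases parity_cases p with rfl | rfl <;> rcases parity_cases q with rfl | rfl <;>
        rcases parity_cases τ with rfl | rfl <;>
        simp [sgn, show (1 : ZMod 2) + 1 = 0 from rfl]
      · cases ht with
        | @snoc _ _ j' _ σ q _ s x hs' hx hτ =>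
          obtain ⟨ε, t', ht', e⟩ := hs.exists_revW h hs'
          have hx' := hs.star_mem hx
          have e' := hs.revW_mapFirstW h (φ := mul x) (φ' := mul'.flip (star x)) hb
            (h.mul_mem hx hb) (hs.star_mul hx hb) hs'
          rw [LinearMap.comp_apply, h.cycW_append hx (hs'.isPath hb rfl).mem, revW_append h hb hs' hx,
            map_neg, map_neg, map_zsmul, map_zsmul, hs'.mapFirstW, e', e hb, map_zsmul, map_zsmul,
            map_zsmul, h'.headW_ins hb' hx' ht', ht'.mapFirstW, LinearMap.flip_apply]
          generalize t' (mul' (star b) (star x)) = A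
          clear * -
          rcases parity_cases p with rfl | rfl <;> rcases parity_cases q with rfl | rfl <;>
          rcases parity_cases σ with rfl | rfl <;>
          simp [sgn, show (1 : ZMod 2) + 1 = 0 from rfl]
  rw [hlin, hlin, map_add, map_add, h1, h2, hs.revW_tailLin h h' hb ht]

lemma revW_isPath (h : IsDG part mul d 𝓗) (hs : IsStar mul d 𝓗 mul' d' 𝓗' θ star)
    (hw : IsPath 𝓗 n i i τ w) :
    ∃ (ε : ℤ) (j : J) (v : AllWords k H'), IsPath 𝓗' n j j τ v ∧ revW part star w = ε • v := by
  obtain ⟨j, p, σ, t, b, ht, hb, rfl, rfl⟩ := hw.exists_tail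
  obtain ⟨ε, t', ht', h'⟩ := hs.exists_revW h ht
  exact ⟨ε, _, _, ht'.isPath (hs.star_mem hb) rfl, h' hb⟩

lemma revW_mem (h : IsDG part mul d 𝓗) (hs : IsStar mul d 𝓗 mul' d' 𝓗' θ star)
    (hw : w ∈ loopsSpan 𝓗 τ) : revW part star w ∈ loopsSpan 𝓗' τ := by
  refine loopsSpan_hom_mem (f := revW part star) (fun n i v hv => ?_) hw
  obtain ⟨ε, j, v', hv', e⟩ := hs.revW_isPath h hv
  rw [e]
  exact zsmul_mem hv'.mem_loopsSpan _

lemma revW_smul (h : IsDG part mul d 𝓗) (hs : IsStar mul d 𝓗 mul' d' 𝓗' θ star)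
    (hw : w ∈ loopsSpan 𝓗 τ) (r : Q) : revW part star (r • w) = r • revW part star w := by
  have ht_smul : ∀ {K : Type u} [AddCommGroup K] [Module k K] [Module Q K] [SMulCommClass k Q K]
      {L : Type u} {𝓚 : L → L → ZMod 2 → Submodule Q K} {n : ℕ} {i j : L} {σ : ZMod 2}
      {t : K →ₗ[k] AllWords k K}, IsTail 𝓚 n i j σ t → ∀ b, t (r • b) = r • t b := by
    intro K _ _ _ _ L 𝓚 n i j σ t ht b
    induction ht with
    | base hσ =>
      rw [letterW_apply, letterW_apply, smul_allWord]
      simp only [Fin.fin_one_eq_zero, if_true]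
    | snoc ht hx hτ ih => rw [LinearMap.comp_apply, ih, appendW_smul, LinearMap.comp_apply]
  refine loopsSpan_hom_eq (f := (revW part star ∘ₗ DistribSMul.toLinearMap k _ r).toAddMonoidHom)
    (g := (DistribSMul.toLinearMap k _ r ∘ₗ revW part star).toAddMonoidHom) (fun n i v hv => ?_) hw
  change revW part star (r • v) = r • revW part star v
  obtain ⟨j, p, σ, t, b, ht, hb, rfl, rfl⟩ := hv.exists_tail
  obtain ⟨ε, t', ht', h'⟩ := hs.exists_revW h ht
  rw [← ht_smul ht, h' hb, h' ((𝓗 _ _ _).smul_mem r hb), hs.star_smul r hb, ht_smul ht', smul_comm]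

end IsStar

end Reverse

/-! ### Dual matrix factorizations and the chain map `Ψ` -/

section Duality

variable {k Q : Type u} [Field k] [CommRing Q] [Algebra k Q] {f : Q}

namespace MatFac

variable {X Y Z : MatFac k f} {p q s : ZMod 2} {α : X.P →ₗ[Q] Y.P} {β : Y.P →ₗ[Q] Z.P}

lemma dual_hom_ext {γ γ' : Module.Dual Q X.P} (h : ∀ s, ∀ x ∈ X.gr s, γ x = γ' x) : γ = γ' := by
  ext x
  rw [← X.sum_proj x, map_add, map_add, h 0 _ (X.proj_mem 0 x), h 1 _ (X.proj_mem 1 x)]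

/-- Since `α x` has parity `s + p`, only the component of `γ` of that parity contributes, and its
sign is `(-1)^{p(s+p)}`. -/
lemma homDual_apply_of_mem (hα : IsHomog X Y p α) (γ : Module.Dual Q Y.P) {x : X.P}
    (hx : x ∈ X.gr s) : homDual X Y α γ x = sgn (p * (s + p)) • γ (α x) := by
  change (∑ r : ZMod 2, ∑ s : ZMod 2, sgn (r * s) • (Y.proj s ∘ₗ homPart X Y r α).dualMap) γ x = _
  have h2 : (Finset.univ : Finset (ZMod 2)) = {0, 1} := rfl
  simp only [homPart_of_isHomog X Y hα, h2, Finset.sum_pair (zero_ne_one (α := ZMod 2))]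
  have e : ∀ t : ZMod 2, Y.proj t (α x) = if t = s + p then α x else 0 :=
    proj_of_mem Y (hα _ _ hx)
  rcases parity_cases p with rfl | rfl <;> rcases parity_cases s with rfl | rfl <;>
    simp [sgn, e, show (1 : ZMod 2) + 1 = 0 from rfl]

lemma homDual_comp (hα : IsHomog X Y p α) (hβ : IsHomog Y Z q β) :
    homDual X Z (β ∘ₗ α) = sgn (q * p) • (homDual X Y α ∘ₗ homDual Y Z β) := by
  refine LinearMap.ext fun γ => dual_hom_ext fun s x hx => ?_
  change _ = sgn (q * p) • homDual X Y α (homDual Y Z β γ) x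
  rw [homDual_apply_of_mem (hβ.comp hα) γ hx, LinearMap.comp_apply, homDual_apply_of_mem hα _ hx,
    homDual_apply_of_mem hβ γ (hα _ _ hx), smul_smul, smul_smul, ← sgn_add, ← sgn_add]
  congr 2
  ring

lemma isHomog_homDual (hα : IsHomog X Y p α) : IsHomog Y.dual X.dual p (dualHom X Y α) := by
  intro s γ hγ
  have hγ' : ∀ y ∈ Y.gr (s + 1), (show Module.Dual Q Y.P from γ) y = 0 :=
    (Submodule.mem_dualAnnihilator _).1 hγ
  refine (Submodule.mem_dualAnnihilator _).2 fun x hx => ?_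
  refine (homDual_apply_of_mem hα γ hx).trans ?_
  have := hα _ _ hx
  rw [show s + p + 1 + p = s + 1 by
    rw [add_right_comm, add_assoc s, CharTwo.add_self_eq_zero, add_zero]] at this
  rw [hγ' _ this, smul_zero]

/-- Dualizing reverses compositions with Koszul signs, so the two terms of `∂α` change places. The
minus sign in the differential `-δ^*` of the dual makes the result the commutator in the right
order. -/
lemma homDual_homD (hα : IsHomog X Y p α) :
    dualHom X Y (homD X Y α) = homD Y.dual X.dual (dualHom X Y α) := by
  rw [homD_of_isHomog hα, homD_of_isHomog (isHomog_homDual hα), map_sub, map_zsmul]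
  have h1 : dualHom X Y (Y.δ ∘ₗ α) = sgn (1 * p) • (dualHom X Y α ∘ₗ dualHom Y Y Y.δ) :=
    homDual_comp hα Y.δ_odd
  have h2 : dualHom X Y (α ∘ₗ X.δ) = sgn (p * 1) • (dualHom X X X.δ ∘ₗ dualHom X Y α) :=
    homDual_comp X.δ_odd hα
  have h3 : ∀ X : MatFac k f, X.dual.δ = -dualHom X X X.δ := fun _ => rfl
  rw [h1, h2, h3, h3, LinearMap.neg_comp, LinearMap.comp_neg, one_mul, mul_one, smul_smul,
    sgn_mul_self, one_smul]
  module

lemma homDual_smul (hα : IsHomog X Y p α) (r : Q) :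
    homDual X Y (r • α) = r • homDual X Y α := by
  refine LinearMap.ext fun γ => dual_hom_ext fun s x hx => ?_
  change _ = r • homDual X Y α γ x
  rw [homDual_apply_of_mem ((homog _ _ _).smul_mem r hα) γ hx, LinearMap.smul_apply, map_smul,
    homDual_apply_of_mem hα γ hx, smul_comm]

lemma dualHom_smul (hα : IsHomog X Y p α) (r : Q) :
    dualHom X Y (r • α) = r • dualHom X Y α := homDual_smul hα r

variable {f' : Q} {A B A' B' : MatFac k f'}

/-- An even isomorphism maps homogeneous components to homogeneous components, hence commutes with
the parity projections, and so does its inverse. -/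
lemma Iso.symm_mem (v : Iso A A') {x : A'.P} (hx : x ∈ A'.gr s) : v.e.symm x ∈ A.gr s := by
  have h0 : ∀ t, v.e (A.proj t (v.e.symm x)) = A'.proj t x := by
    intro t
    have e : x = v.e (A.proj 0 (v.e.symm x)) + v.e (A.proj 1 (v.e.symm x)) := by
      rw [← map_add, A.sum_proj, LinearEquiv.apply_symm_apply]
    conv_rhs => rw [e]
    rw [map_add, proj_of_mem A' (v.even _ _ (A.proj_mem 0 _)),
      proj_of_mem A' (v.even _ _ (A.proj_mem 1 _))]
    rcases parity_cases t with rfl | rfl <;> simp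
  have h1 := h0 s
  rw [proj_of_mem A' hx, if_pos rfl] at h1
  rw [← h1, LinearEquiv.symm_apply_apply]
  exact A.proj_mem _ _

lemma isHomog_conj (v : Iso A A') (w : Iso B B') {φ : A.P →ₗ[Q] B.P} (hφ : IsHomog A B p φ) :
    IsHomog A' B' p (w.e.toLinearMap ∘ₗ φ ∘ₗ v.e.symm.toLinearMap) :=
  fun s _ hx => w.even _ _ (hφ s _ (v.symm_mem hx))

lemma homD_conj (v : Iso A A') (w : Iso B B') {φ : A.P →ₗ[Q] B.P} (hφ : IsHomog A B p φ) :
    w.e.toLinearMap ∘ₗ homD A B φ ∘ₗ v.e.symm.toLinearMap =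
      homD A' B' (w.e.toLinearMap ∘ₗ φ ∘ₗ v.e.symm.toLinearMap) := by
  rw [homD_of_isHomog hφ, homD_of_isHomog (isHomog_conj v w hφ)]
  refine LinearMap.ext fun x => ?_
  obtain ⟨y, rfl⟩ := v.e.surjective x
  simp only [LinearMap.comp_apply, LinearMap.sub_apply, LinearMap.smul_apply,
    LinearEquiv.coe_coe, ← v.comm, LinearEquiv.symm_apply_apply, map_sub, map_zsmul, ← w.comm]

end MatFac

variable {I J : Type u} (X : I → MatFac k f) (Y : J → MatFac k (-f)) (θ : I → J)
  (u : ∀ i, MatFac.Iso (X i).dual (Y (θ i)))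

/-- The dual of an arrow, as a map between the chosen representatives. -/
def dualArrow (i j : I) (α : (X j).P →ₗ[Q] (X i).P) : (Y (θ i)).P →ₗ[Q] (Y (θ j)).P :=
  (u j).e.toLinearMap ∘ₗ MatFac.dualHom (X j) (X i) α ∘ₗ (u i).e.symm.toLinearMap

lemma arrDual_arr (i j : I) (α : (X j).P →ₗ[Q] (X i).P) :
    arrDual X Y θ u (arr (fun i => (X i).P) i j α) =
      arr (fun j => (Y j).P) (θ j) (θ i) (dualArrow X Y θ u i j α) := by
  classical
  rw [arrDual, arr]
  rw [DFinsupp.lsum_single]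
  rfl

lemma isStar_arrDual : IsStar (arrMul k fun i => (X i).P) (arrD X) (arrows X)
    (arrMul k fun j => (Y j).P) (arrD Y) (arrows Y) θ (arrDual X Y θ u) where
  star_mem := by
    rintro i j p _ ⟨α, hα, rfl⟩
    rw [arrDual_arr]
    exact arr_mem_arrows (MatFac.isHomog_conj _ _ (MatFac.isHomog_homDual hα))
  star_mul := by
    rintro i j l p q _ _ ⟨α, hα, rfl⟩ ⟨β, hβ, rfl⟩
    rw [arrMul_arr_self, arrDual_arr, arrDual_arr, arrDual_arr, arrMul_arr_self, ← arr_zsmul]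
    congr 1
    have : MatFac.dualHom (X l) (X i) (α ∘ₗ β) =
        sgn (p * q) • (MatFac.dualHom (X l) (X j) β ∘ₗ MatFac.dualHom (X j) (X i) α) :=
      MatFac.homDual_comp hβ hα
    rw [dualArrow, this]
    refine LinearMap.ext fun x => ?_
    simp [dualArrow]
  star_d := by
    rintro i j p _ ⟨α, hα, rfl⟩
    rw [arrD_arr, arrDual_arr, arrDual_arr, arrD_arr, dualArrow, MatFac.homDual_homD hα,
      MatFac.homD_conj _ _ (MatFac.isHomog_homDual hα)]
    rfl
  star_smul := by
    rintro i j p _ r ⟨α, hα, rfl⟩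
    rw [← arr_smul', arrDual_arr, arrDual_arr, ← arr_smul', dualArrow, MatFac.dualHom_smul hα]
    congr 1
    refine LinearMap.ext fun x => ?_
    simp [dualArrow]

/-- The map `Ψ` is a map of complexes. -/
lemma psi_isChainMap :
    IsChainMap (hochGr X) (hochB X) (hochGr Y) (hochB Y) (psi X Y θ u) := by
  intro j w hw
  rw [mem_hochGr_iff] at hw
  have hs := isStar_arrDual X Y θ u
  have h := isDG_arrows X
  refine ⟨(mem_hochGr_iff Y).2 (hs.revW_mem h hw), ?_, fun q => hs.revW_smul h hw q⟩
  exact loopsSpan_hom_eq (f := (psi X Y θ u ∘ₗ hochB X).toAddMonoidHom)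
    (g := (hochB Y ∘ₗ psi X Y θ u).toAddMonoidHom)
    (fun n i v hv => hs.revW_wordB h (isDG_arrows Y) hv) hw

end Duality

/-! ### Contraction of `W ⊗ P` with functionals on `P` -/

section Contraction

variable {Q : Type u} [CommRing Q] {W P P' : Type u} [AddCommGroup W] [Module Q W]
  [AddCommGroup P] [Module Q P] [AddCommGroup P'] [Module Q P']

/-- The contraction `w ⊗ x ↦ g(x) w`. -/
def contr (W : Type u) [AddCommGroup W] [Module Q W] (g : P →ₗ[Q] Q) : W ⊗[Q] P →ₗ[Q] W :=
  (TensorProduct.rid Q W).toLinearMap ∘ₗ g.lTensor W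

@[simp] lemma contr_tmul (g : P →ₗ[Q] Q) (w : W) (x : P) : contr W g (w ⊗ₜ x) = g x • w := by
  simp [contr]

lemma contr_comp (g : P' →ₗ[Q] Q) (α : P →ₗ[Q] P') (z : W ⊗[Q] P) :
    contr W (g ∘ₗ α) z = contr W g (α.lTensor W z) := by
  rw [contr, LinearMap.lTensor_comp]
  rfl

lemma contr_add (g g' : P →ₗ[Q] Q) (z : W ⊗[Q] P) :
    contr W (g + g') z = contr W g z + contr W g' z := by
  rw [contr, LinearMap.lTensor_add]
  exact map_add (TensorProduct.rid Q W) _ _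

lemma contr_smul (r : Q) (g : P →ₗ[Q] Q) (z : W ⊗[Q] P) :
    contr W (r • g) z = r • contr W g z := by
  rw [contr, LinearMap.lTensor_smul]
  exact map_smul (TensorProduct.rid Q W) _ _

lemma contr_eq_zero {g : P →ₗ[Q] Q} {S : Submodule Q P} (h : ∀ x ∈ S, g x = 0) {z : W ⊗[Q] P}
    (hz : z ∈ LinearMap.range (S.subtype.lTensor W)) : contr W g z = 0 := by
  obtain ⟨z, rfl⟩ := hz
  rw [← contr_comp, show g ∘ₗ S.subtype = 0 from LinearMap.ext fun x => h x x.2, contr,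
    LinearMap.lTensor_zero, LinearMap.comp_zero, LinearMap.zero_apply]

variable [Module.Finite Q P] [Module.Projective Q P]

/-- `w ⊗ γ ↦ (x ↦ γ(x) w)` is injective. -/
lemma contr_eval_injective {z z' : W ⊗[Q] Module.Dual Q P}
    (h : ∀ x, contr W (Module.Dual.eval Q P x) z = contr W (Module.Dual.eval Q P x) z') : z = z' := by
  refine (TensorProduct.comm Q W (Module.Dual Q P)).injective
    ((dualTensorHom_bijective (R := Q) (M := P) (N := W)).1 (LinearMap.ext fun x => ?_))
  have key : ∀ z : W ⊗[Q] Module.Dual Q P,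
      dualTensorHom Q P W (TensorProduct.comm Q W _ z) x = contr W (Module.Dual.eval Q P x) z := by
    intro z
    induction z with
    | zero => simp
    | tmul w γ => simp
    | add a b ha hb => simp only [map_add, LinearMap.add_apply, ha, hb]
  rw [key, key, h]

/-- For a finitely generated projective module `P` one has `P ≅ P^{**}` and `W ⊗ P^{**} ≅ Hom(P^*,
W)`. Elements of `W ⊗ P` can thus be defined and compared through their contractions. -/
lemma contr_bijective :
    (∀ z z' : W ⊗[Q] P, (∀ γ, contr W γ z = contr W γ z') → z = z') ∧
      ∀ L : Module.Dual Q P →ₗ[Q] W, ∃ z : W ⊗[Q] P, ∀ γ, contr W γ z = L γ := by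
  have key : ∀ (z : W ⊗[Q] P) (γ : Module.Dual Q P),
      dualTensorHom Q (Module.Dual Q P) W (TensorProduct.comm Q W _
        ((Module.evalEquiv Q P).toLinearMap.lTensor W z)) γ = contr W γ z := by
    intro z γ
    induction z with
    | zero => simp
    | tmul w γ => simp
    | add a b ha hb => simp only [map_add, LinearMap.add_apply, ha, hb]
  have hb := dualTensorHom_bijective (R := Q) (M := Module.Dual Q P) (N := W)
  refine ⟨fun z z' h => ?_, fun L => ?_⟩
  · refine (LinearEquiv.lTensor W (Module.evalEquiv Q P)).injective
      ((TensorProduct.comm Q W _).injective (hb.1 (LinearMap.ext fun γ => ?_)))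
    exact (key z γ).trans ((h γ).trans (key z' γ).symm)
  · obtain ⟨t, rfl⟩ := hb.2 L
    obtain ⟨t, rfl⟩ := (TensorProduct.comm Q W _).surjective t
    obtain ⟨z, rfl⟩ := (LinearEquiv.lTensor W (Module.evalEquiv Q P)).surjective t
    exact ⟨z, fun γ => (key z γ).symm⟩

end Contraction

/-! ### The dual connection -/

section DualConnection

variable {k Q : Type u} [Field k] [CommRing Q] [Algebra k Q] {f : Q}

namespace MatFac

variable {X : MatFac k f} {Y : MatFac k (-f)} (v : Iso X.dual Y) (c : Y.Connection)

/-- The identification of `Y` with `D(X)`. -/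
def Iso.toDual : Y.P ≃ₗ[Q] Module.Dual Q X.P := v.e.symm

lemma Iso.toDual_e (γ : Module.Dual Q X.P) : v.toDual (v.e γ) = γ := v.e.symm_apply_apply γ

/-- The pairing of `Y = D(X)` with an element of `X`. -/
def pairing (x : X.P) : Y.P →ₗ[Q] Q :=
  (Module.Dual.eval Q X.P x) ∘ₗ v.toDual.toLinearMap

lemma pairing_apply (x : X.P) (y : Y.P) :
    pairing v x y = v.toDual y x := rfl

lemma pairing_add (x x' : X.P) : pairing v (x + x') = pairing v x + pairing v x' := by
  rw [pairing, map_add, LinearMap.add_comp]; rfl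

lemma pairing_smul (r : Q) (x : X.P) : pairing v (r • x) = r • pairing v x := by
  rw [pairing, map_smul, LinearMap.smul_comp]; rfl

lemma pairing_injective {W : Type u} [AddCommGroup W] [Module Q W] {z z' : W ⊗[Q] Y.P}
    (h : ∀ x, contr W (pairing v x) z = contr W (pairing v x) z') : z = z' := by
  refine (LinearEquiv.lTensor W v.toDual).injective (contr_eval_injective fun x => ?_)
  exact (contr_comp _ _ _).symm.trans ((h x).trans (contr_comp _ _ _))

/-- The form `γ ↦ d(γ(x)) - ⟨∇γ, x⟩`. -/
def dualConnForm (x : X.P) : Module.Dual Q X.P →ₗ[Q] Ω[Q⁄k] where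
  toFun γ := KaehlerDifferential.D k Q (γ x) - contr Ω[Q⁄k] (pairing v x) (c.D (v.e γ))
  map_add' γ γ' := by
    have h : v.e (γ + γ' : Module.Dual Q X.P) = v.e γ + v.e γ' := map_add v.e γ γ'
    rw [h]
    simp only [LinearMap.add_apply, map_add]
    abel
  map_smul' r γ := by
    have h : v.e (r • γ : Module.Dual Q X.P) = r • v.e γ := map_smul v.e r γ
    have h2 : pairing v x (v.e γ) = γ x := by
      rw [pairing_apply, v.toDual_e]
    rw [h, c.leibniz, LinearMap.smul_apply, smul_eq_mul, Derivation.leibniz, map_add, contr_tmul,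
      h2, map_smul, RingHom.id_apply, smul_sub]
    abel

/-- The connection on `X` that is dual to a connection on `D(X)`. -/
def dualConnD (x : X.P) : Ω[Q⁄k] ⊗[Q] X.P := (contr_bijective.2 (dualConnForm v c x)).choose

lemma contr_dualConnD (x : X.P) (γ : Module.Dual Q X.P) : contr Ω[Q⁄k] γ (dualConnD v c x) =
    KaehlerDifferential.D k Q (γ x) - contr Ω[Q⁄k] (pairing v x) (c.D (v.e γ)) :=
  (contr_bijective.2 (dualConnForm v c x)).choose_spec γ

lemma dualConnD_add (x y : X.P) : dualConnD v c (x + y) = dualConnD v c x + dualConnD v c y := by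
  refine contr_bijective.1 _ _ fun γ => ?_
  rw [map_add, contr_dualConnD, contr_dualConnD, contr_dualConnD, pairing_add, contr_add, map_add,
    map_add]
  abel

lemma dualConnD_leibniz (r : Q) (x : X.P) :
    dualConnD v c (r • x) = KaehlerDifferential.D k Q r ⊗ₜ x + r • dualConnD v c x := by
  refine contr_bijective.1 _ _ fun γ => ?_
  rw [map_add, contr_tmul, map_smul (contr Ω[Q⁄k] γ), contr_dualConnD, contr_dualConnD, pairing_smul,
    contr_smul, map_smul γ, smul_eq_mul, Derivation.leibniz, smul_sub]
  abel

/-- The connection on `X` that is dual to a connection on `D(X)`. -/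
def dualConnection : X.Connection where
  D :=
    { toFun := dualConnD v c
      map_add' := dualConnD_add v c
      map_smul' := fun r x => by
        rw [← algebraMap_smul Q r x, dualConnD_leibniz, Derivation.map_algebraMap,
          TensorProduct.zero_tmul, zero_add, algebraMap_smul, RingHom.id_apply] }
  leibniz := dualConnD_leibniz v c
  odd := fun s x hx => by
    change dualConnD v c x ∈ _
    -- It is enough that the functionals of the other parity contract `∇x` to zero. Such a
    -- functional vanishes on `x`, and its derivative has coefficients of the same parity, which
    -- vanish on `x` as well.
    have h : (X.proj s).lTensor Ω[Q⁄k] (dualConnD v c x) = dualConnD v c x := by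
      refine contr_bijective.1 _ _ fun γ => ?_
      have e : γ = γ ∘ₗ X.proj s + γ ∘ₗ X.proj (s + 1) := by
        refine LinearMap.ext fun y => ?_
        have := X.sum_proj y
        rcases parity_cases s with rfl | rfl
        · rw [LinearMap.add_apply, LinearMap.comp_apply, LinearMap.comp_apply, ← map_add, zero_add,
            this]
        · rw [LinearMap.add_apply, LinearMap.comp_apply, LinearMap.comp_apply, ← map_add, add_comm,
            show (1 : ZMod 2) + 1 = 0 from rfl, this]
      rw [← contr_comp]
      conv_rhs => rw [e, contr_add]
      rw [left_eq_add, contr_dualConnD, LinearMap.comp_apply, X.proj_of_mem hx,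
        if_neg (by simp), map_zero, map_zero, zero_sub, neg_eq_zero]
      refine contr_eq_zero (S := Y.gr (s + 1)) (fun y hy => ?_) (c.odd _ _ (v.even _ _ ?_))
      · exact (Submodule.mem_dualAnnihilator _).1 (v.symm_mem hy) x (by
          rwa [add_assoc, show (1 : ZMod 2) + 1 = 0 from rfl, add_zero])
      · refine (Submodule.mem_dualAnnihilator _).2 fun y hy => ?_
        rw [add_assoc, show (1 : ZMod 2) + 1 = 0 from rfl, add_zero] at hy
        rw [LinearMap.comp_apply, X.proj_of_mem hy, if_neg (by simp), map_zero]
    rw [← h]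
    have h3 : X.proj s = (X.gr s).subtype ∘ₗ (X.proj s).codRestrict (X.gr s) (X.proj_mem s) := rfl
    rw [h3, LinearMap.lTensor_comp]
    exact ⟨_, rfl⟩

lemma contr_dualConnection (x : X.P) (γ : Module.Dual Q X.P) :
    contr Ω[Q⁄k] γ ((dualConnection v c).D x) =
      KaehlerDifferential.D k Q (γ x) - contr Ω[Q⁄k] (pairing v x) (c.D (v.e γ)) :=
  contr_dualConnD v c x γ

end MatFac

end DualConnection

/-! ### Transposition of operators on differential forms -/

section Transpose

variable {k Q : Type u} [Field k] [CommRing Q] [Algebra k Q] {f : Q} {I J : Type u}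
  (X : I → MatFac k f) (Y : J → MatFac k (-f)) (θ : I → J)
  (u : ∀ i, MatFac.Iso (X i).dual (Y (θ i)))

/-- The graph of the transposition `ω ⊗ α ↦ (-1)^{|ω|} ω ⊗ α^*` of operators of total parity `t`. -/
def transp (i j : I) (t : ZMod 2) : AddSubgroup (OpRing X × OpRing Y) :=
  AddSubgroup.closure {z | ∃ (N : ℕ) (p : ZMod 2), ∃ ω ∈ ⋀[Q]^N Ω[Q⁄k],
    ∃ α, MatFac.IsHomog (X j) (X i) p α ∧ t = N + p ∧ z = (block i j (el p ω α),
      sgn N • block (θ j) (θ i) (el p ω (dualArrow X Y θ u i j α)))}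

variable {X Y θ u} {i j l : I} {s t p q : ZMod 2}

lemma dualArrow_isHomog {α : (X j).P →ₗ[Q] (X i).P} (hα : MatFac.IsHomog (X j) (X i) p α) :
    MatFac.IsHomog (Y (θ i)) (Y (θ j)) p (dualArrow X Y θ u i j α) :=
  MatFac.isHomog_conj _ _ (MatFac.isHomog_homDual hα)

lemma dualArrow_comp {α : (X j).P →ₗ[Q] (X i).P} (hα : MatFac.IsHomog (X j) (X i) p α)
    {β : (X l).P →ₗ[Q] (X j).P} (hβ : MatFac.IsHomog (X l) (X j) q β) :
    dualArrow X Y θ u i l (α ∘ₗ β) =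
      sgn (p * q) • (dualArrow X Y θ u j l β ∘ₗ dualArrow X Y θ u i j α) := by
  have : MatFac.dualHom (X l) (X i) (α ∘ₗ β) =
      sgn (p * q) • (MatFac.dualHom (X l) (X j) β ∘ₗ MatFac.dualHom (X j) (X i) α) :=
    MatFac.homDual_comp hβ hα
  rw [dualArrow, this]
  refine LinearMap.ext fun x => ?_
  simp [dualArrow]

lemma el_mem_transp {N : ℕ} {ω : Forms k Q} (hω : ω ∈ ⋀[Q]^N Ω[Q⁄k]) {α : (X j).P →ₗ[Q] (X i).P}
    (hα : MatFac.IsHomog (X j) (X i) p α) (ht : t = N + p) : (block i j (el p ω α),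
      sgn N • block (θ j) (θ i) (el p ω (dualArrow X Y θ u i j α))) ∈ transp X Y θ u i j t :=
  AddSubgroup.subset_closure ⟨N, p, ω, hω, α, hα, ht, rfl⟩

lemma el_zsmul_right {P P' : Type u} [AddCommGroup P] [Module Q P] [AddCommGroup P'] [Module Q P']
    (p : ZMod 2) (n : ℤ) (ω : Forms k Q) (α : P →ₗ[Q] P') : el p ω (n • α) = n • el p ω α :=
  TensorProduct.ext' fun ζ x => by
    rw [LinearMap.smul_apply, el_tmul, el_tmul, LinearMap.smul_apply, TensorProduct.tmul_smul]

/-- On generators, the signs of the two compositions, of the dual of a composition and of commuting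
the forms add up to `(-1)^{st}`. Transposition is treated as an additive relation closed under
reversed products, so that it need not be shown to be a well-defined map. -/
lemma transp_mul {z z' : OpRing X × OpRing Y} (hz : z ∈ transp X Y θ u i j s)
    (hz' : z' ∈ transp X Y θ u j l t) :
    (z.1 * z'.1, sgn (s * t) • (z'.2 * z.2)) ∈ transp X Y θ u i l (s + t) := by
  induction hz using AddSubgroup.closure_induction with
  | zero => convert zero_mem (transp X Y θ u i l (s + t)) using 1; simp
  | neg a _ ha => convert neg_mem ha using 1; simp
  | add a b _ _ ha hb => convert add_mem ha hb using 1; simp [add_mul, mul_add]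
  | mem a ha =>
    obtain ⟨N, p, ω, hω, α, hα, hs, rfl⟩ := ha
    induction hz' using AddSubgroup.closure_induction with
    | zero => convert zero_mem (transp X Y θ u i l (s + t)) using 1; simp
    | neg a _ ha => convert neg_mem ha using 1; simp
    | add a b _ _ ha hb => convert add_mem ha hb using 1; simp [add_mul, mul_add]
    | mem b hb =>
      obtain ⟨M, q, η, hη, β, hβ, ht, rfl⟩ := hb
      have h := el_mem_transp (Y := Y) (θ := θ) (u := u) (t := s + t) (mul_mem_exteriorPower hω hη)
        (hα.comp hβ) (by rw [hs, ht, Nat.cast_add]; ring)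
      have h2 := zsmul_mem h (sgn (p * M))
      convert h2 using 1
      rw [Prod.smul_mk]
      refine Prod.ext ?_ ?_
      · dsimp only
        rw [block_mul_block, el_comp hη, map_zsmul]
      · dsimp only
        rw [smul_mul_smul_comm, block_mul_block, el_comp hω, dualArrow_comp hα hβ, el_zsmul_right,
          map_zsmul, map_zsmul, forms_mul_comm hω, gam_of_mem _ hη, smul_mul_assoc, el_zsmul_left,
          map_zsmul, smul_smul, smul_smul, smul_smul, smul_smul, smul_smul, ← sgn_add, ← sgn_add,
          ← sgn_add, ← sgn_add, ← sgn_add, ← sgn_add, add_comm q p, hs, ht, Nat.cast_add]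
        congr 2
        generalize (N : ZMod 2) = N'
        generalize (M : ZMod 2) = M'
        clear * -
        revert p q N' M'
        decide

lemma transp_mem_blkT {z : OpRing X × OpRing Y} (hz : z ∈ transp X Y θ u i j t) :
    z.1 ∈ blkT i j t ∧ z.2 ∈ blkT (θ j) (θ i) t := by
  induction hz using AddSubgroup.closure_induction with
  | zero => exact ⟨zero_mem _, zero_mem _⟩
  | neg a _ ha => exact ⟨neg_mem ha.1, neg_mem ha.2⟩
  | add a b _ _ ha hb => exact ⟨add_mem ha.1 hb.1, add_mem ha.2 hb.2⟩
  | mem a ha =>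
    obtain ⟨N, p, ω, hω, α, hα, hs, rfl⟩ := ha
    exact ⟨block_mem_blkT (el_mem_opSpan hω hα) hs,
      zsmul_mem (block_mem_blkT (el_mem_opSpan hω (dualArrow_isHomog hα)) hs) _⟩

lemma blkT_eq {A : OpRing X} (hA : A ∈ blkT i j t) : ∃ φ, A = block i j φ :=
  ⟨_, hA.choose_spec.2.symm⟩

/-- A diagonal operator is not a finite matrix, but multiplied with an operator with a single entry
it only acts through its entry at one object. -/
lemma transp_mul_diagOp {T : ∀ i, Module.End Q (Forms k Q ⊗[Q] (X i).P)}
    {T' : ∀ j, Module.End Q (Forms k Q ⊗[Q] (Y j).P)}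
    (hT : (block j j (T j), block (θ j) (θ j) (T' (θ j))) ∈ transp X Y θ u j j 0)
    {z : OpRing X × OpRing Y} (hz : z ∈ transp X Y θ u i j t) :
    (z.1 * diagOp T, diagOp T' * z.2) ∈ transp X Y θ u i j t := by
  have h := transp_mul hz hT
  rw [mul_zero, sgn_zero, one_smul, add_zero] at h
  obtain ⟨h1, h2⟩ := transp_mem_blkT hz
  obtain ⟨φ, hφ⟩ := blkT_eq h1
  obtain ⟨ψ, hψ⟩ := blkT_eq h2
  rw [hφ, hψ] at h ⊢
  rwa [block_mul_diagOp, diagOp_mul_block, ← block_mul_block, ← block_mul_block]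

lemma one_mem_transp : (block i i 1, block (θ i) (θ i) 1) ∈ transp X Y θ u i i 0 := by
  have e : ∀ {f : Q} (A : MatFac k f), (1 : Module.End Q (Forms k Q ⊗[Q] A.P)) =
      el 0 1 LinearMap.id := fun A => TensorProduct.ext' fun ω x => by simp [gam_zero]
  have h := el_mem_transp (Y := Y) (θ := θ) (u := u) (t := 0) one_mem_exteriorPower
    (MatFac.isHomog_id (X := X i)) (by simp)
  have h2 : dualArrow X Y θ u i i LinearMap.id = LinearMap.id := by
    have h3 : MatFac.dualHom (X i) (X i) LinearMap.id = LinearMap.id := by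
      refine LinearMap.ext fun γ => MatFac.dual_hom_ext fun s x hx => ?_
      refine (MatFac.homDual_apply_of_mem MatFac.isHomog_id γ hx).trans ?_
      rw [zero_mul, sgn_zero, one_smul]
      rfl
    refine LinearMap.ext fun x => ?_
    rw [dualArrow, h3]
    simp
  rw [h2, Nat.cast_zero, sgn_zero, one_smul] at h
  rwa [e, e]

end Transpose

/-! ### Supertraces of dual maps -/

section DualTrace

variable {Q P : Type u} [CommRing Q] [AddCommGroup P] [Module Q P] [Module.Finite Q P]
  [Module.Projective Q P]

lemma projTrace_dualMap (α : P →ₗ[Q] P) :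
    projTrace (α.dualMap : Module.Dual Q P →ₗ[Q] Module.Dual Q P) = projTrace α := by
  induction α using hom_induction with
  | h0 =>
    rw [show (0 : P →ₗ[Q] P).dualMap = 0 from LinearMap.ext fun γ => by ext; simp,
      map_zero, map_zero]
  | hadd a b ha hb =>
    rw [show (a + b).dualMap = a.dualMap + b.dualMap from LinearMap.ext fun γ => by ext; simp,
      map_add, map_add, ha, hb]
  | h g y =>
    have : (dualTensorHom Q P P (g ⊗ₜ y)).dualMap =
        dualTensorHom Q (Module.Dual Q P) (Module.Dual Q P) (Module.Dual.eval Q P y ⊗ₜ g) := by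
      refine LinearMap.ext fun γ => LinearMap.ext fun x => ?_
      simp [mul_comm]
    rw [this, projTrace_dualTensorHom, projTrace_dualTensorHom]
    simp

variable {k : Type u} [Field k] [Algebra k Q] {f : Q}

namespace MatFac

variable {X : MatFac k f}

lemma dual_proj (s : ZMod 2) (γ : Module.Dual Q X.P) : X.dual.proj s γ = γ ∘ₗ X.proj s := by
  have hmem : ∀ s, (γ ∘ₗ X.proj s : Module.Dual Q X.P) ∈ X.dual.gr s := fun s => by
    refine (Submodule.mem_dualAnnihilator _).2 fun x hx => ?_
    rw [LinearMap.comp_apply, X.proj_of_mem hx, if_neg (by simp), map_zero]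
  have e : γ = γ ∘ₗ X.proj 0 + γ ∘ₗ X.proj 1 := by
    refine LinearMap.ext fun y => ?_
    rw [LinearMap.add_apply, LinearMap.comp_apply, LinearMap.comp_apply, ← map_add, X.sum_proj]
  have h : X.dual.proj s γ = X.dual.proj s (γ ∘ₗ X.proj 0 : Module.Dual Q X.P) +
      X.dual.proj s (γ ∘ₗ X.proj 1 : Module.Dual Q X.P) :=
    (congrArg (X.dual.proj s) e).trans (map_add (X.dual.proj s) _ _)
  rw [h, proj_of_mem X.dual (hmem 0), proj_of_mem X.dual (hmem 1)]
  rcases parity_cases s with rfl | rfl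
  · exact add_zero _
  · exact zero_add _

lemma homDual_even {α : X.P →ₗ[Q] X.P} (hα : IsHomog X X 0 α) (γ : Module.Dual Q X.P) :
    homDual X X α γ = γ ∘ₗ α := by
  refine dual_hom_ext fun t x hx => ?_
  rw [homDual_apply_of_mem hα γ hx, zero_mul, sgn_zero, one_smul]
  rfl

/-- For even maps `α^*` is the ordinary transpose, and traces are invariant under transposition and
cyclic. For odd maps both sides vanish. -/
lemma superTrace_dualHom {p : ZMod 2} {α : X.P →ₗ[Q] X.P} (hα : IsHomog X X p α) :
    superTrace X.dual (dualHom X X α) = superTrace X α := by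
  rcases parity_cases p with rfl | rfl
  · have h : ∀ s, projTrace (dualHom X X α ∘ₗ X.dual.proj s) = projTrace (α ∘ₗ X.proj s) := by
      intro s
      have e : dualHom X X α ∘ₗ X.dual.proj s = (X.proj s ∘ₗ α).dualMap :=
        LinearMap.ext fun γ => (congrArg (homDual X X α) (dual_proj s γ)).trans
          (homDual_even hα (γ ∘ₗ X.proj s))
      exact (congrArg (projTrace (P := X.dual.P)) e).trans
        ((projTrace_dualMap _).trans (projTrace_comp_comm _ _))
    rw [superTrace_apply, superTrace_apply, h, h]
  · rw [superTrace_odd (isHomog_homDual hα), superTrace_odd hα]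

lemma superTrace_conj {f' : Q} {A B : MatFac k f'} (v : Iso A B) (φ : A.P →ₗ[Q] A.P) :
    superTrace B (v.e.toLinearMap ∘ₗ φ ∘ₗ v.e.symm.toLinearMap) = superTrace A φ := by
  have h0 : IsHomog B A 0 v.e.symm.toLinearMap := fun s x hx => by
    rw [add_zero]; exact v.symm_mem hx
  rw [← LinearMap.comp_assoc, superTrace_comp_comm _ h0, sgn_zero, one_smul, ← LinearMap.comp_assoc]
  congr 1
  refine LinearMap.ext fun x => ?_
  simp

end MatFac

end DualTrace

/-! ### Transposition and the supertrace -/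

section TransposeTrace

variable {k Q : Type u} [Field k] [CommRing Q] [Algebra k Q] {f : Q} {I J : Type u}
  {X : I → MatFac k f} {Y : J → MatFac k (-f)} {θ : I → J}
  {u : ∀ i, MatFac.Iso (X i).dual (Y (θ i))} {i j l : I} {s t p q : ZMod 2}

/-- The supertrace of `α^*` equals that of `α`, so only the sign `(-1)^N` of the transposition
remains, and this sign is `γ` on `Ω^N`. -/
lemma opStr_transp {z : OpRing X × OpRing Y} (hz : z ∈ transp X Y θ u i i t) :
    opStr Y z.2 = gammaHom k Q (opStr X z.1) := by
  induction hz using AddSubgroup.closure_induction with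
  | zero => simp
  | neg a _ ha => simp [ha]
  | add a b _ _ ha hb => simp [ha, hb]
  | mem a ha =>
    obtain ⟨N, p, ω, hω, α, hα, hs, rfl⟩ := ha
    dsimp only
    rw [map_zsmul, opStr_block, opStr_block, MatFac.strLin_el, MatFac.strLin_el, map_smul,
      ← gam_one, gam_of_mem _ hω, one_mul, smul_comm, dualArrow,
      MatFac.superTrace_conj, MatFac.superTrace_dualHom hα]

lemma factScale_gammaHom (x : Forms k Q) :
    factScale k Q (gammaHom k Q x) = gammaHom k Q (factScale k Q x) := by
  induction x using DirectSum.Decomposition.inductionOn (fun n : ℕ => ⋀[Q]^n Ω[Q⁄k]) with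
  | zero => simp
  | add a b ha hb => simp only [map_add, ha, hb]
  | homogeneous a =>
    have h := gam_of_mem 1 a.2
    rw [gam_one] at h
    rw [h, map_zsmul, factScale_of_mem a.2, ← algebraMap_smul Q ((_ : k)⁻¹) a.1, map_smul, h,
      smul_comm]

end TransposeTrace

/-! ### Transposition of derivatives with respect to dual connections -/

section TransposeDerivative

lemma contr_zsmul {Q W P : Type u} [CommRing Q] [AddCommGroup W] [Module Q W]
    [AddCommGroup P] [Module Q P] (r : ℤ) (g : P →ₗ[Q] Q) (z : W ⊗[Q] P) :
    contr W (r • g) z = r • contr W g z := by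
  rw [← Int.cast_smul_eq_zsmul Q, contr_smul, Int.cast_smul_eq_zsmul]

lemma contr_sub {Q W P : Type u} [CommRing Q] [AddCommGroup W] [Module Q W]
    [AddCommGroup P] [Module Q P] (g g' : P →ₗ[Q] Q) (z : W ⊗[Q] P) :
    contr W (g - g') z = contr W g z - contr W g' z := by
  rw [sub_eq_add_neg, ← neg_one_zsmul, contr_add, contr_zsmul, neg_one_zsmul, sub_eq_add_neg]

variable {k Q : Type u} [Field k] [CommRing Q] [Algebra k Q] {f : Q} {I J : Type u}
  {X : I → MatFac k f} {Y : J → MatFac k (-f)} {θ : I → J}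
  {u : ∀ i, MatFac.Iso (X i).dual (Y (θ i))} {i j l : I} {s t p q : ZMod 2}

lemma toDual_dualArrow {α : (X j).P →ₗ[Q] (X i).P} (hα : MatFac.IsHomog (X j) (X i) p α)
    {x : (X j).P} (hx : x ∈ (X j).gr s) (y : (Y (θ i)).P) :
    (u j).toDual (dualArrow X Y θ u i j α y) x = sgn (p * (s + p)) • (u i).toDual y (α x) := by
  have h : (u j).toDual (dualArrow X Y θ u i j α y) =
      MatFac.homDual (X j) (X i) α ((u i).toDual y) := (u j).toDual_e _
  rw [h, MatFac.homDual_apply_of_mem hα _ hx]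

lemma pairing_comp_dualArrow {α : (X j).P →ₗ[Q] (X i).P} (hα : MatFac.IsHomog (X j) (X i) p α)
    {x : (X j).P} (hx : x ∈ (X j).gr s) :
    MatFac.pairing (u j) x ∘ₗ dualArrow X Y θ u i j α =
      sgn (p * (s + p)) • MatFac.pairing (u i) (α x) :=
  LinearMap.ext fun y => toDual_dualArrow hα hx y

variable (u) in
/-- `ψ'` is the transpose of the form `ψ` with values in homomorphisms of parity `p`. -/
def IsTranspForm (p : ZMod 2) (i j : I) (ψ : (X j).P →ₗ[Q] Ω[Q⁄k] ⊗[Q] (X i).P)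
    (ψ' : (Y (θ i)).P →ₗ[Q] Ω[Q⁄k] ⊗[Q] (Y (θ j)).P) : Prop :=
  ∀ s, ∀ x ∈ (X j).gr s, ∀ y, contr Ω[Q⁄k] (MatFac.pairing (u j) x) (ψ' y) =
    sgn (p * (s + p)) • contr Ω[Q⁄k] ((u i).toDual y) (ψ x)

lemma IsTranspForm.unique {ψ : (X j).P →ₗ[Q] Ω[Q⁄k] ⊗[Q] (X i).P}
    {ψ' ψ'' : (Y (θ i)).P →ₗ[Q] Ω[Q⁄k] ⊗[Q] (Y (θ j)).P} (h' : IsTranspForm u p i j ψ ψ')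
    (h'' : IsTranspForm u p i j ψ ψ'') : ψ' = ψ'' := by
  refine LinearMap.ext fun y => MatFac.pairing_injective (u j) fun x => ?_
  rw [← (X j).sum_proj x, MatFac.pairing_add, contr_add, contr_add, h' 0 _ ((X j).proj_mem 0 x),
    h' 1 _ ((X j).proj_mem 1 x), h'' 0 _ ((X j).proj_mem 0 x), h'' 1 _ ((X j).proj_mem 1 x)]

/-- The definition of the dual connection gives `⟨∇γ, x⟩ + ⟨γ, ∇x⟩ = d⟨γ, x⟩`. It is applied to
`(α^* y, x)` and to `(y, α x)`, whose pairings agree up to the sign of `α^*`, so the exact terms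
cancel. -/
lemma isTranspForm_commConn (cY : ∀ j, (Y j).Connection) {α : (X j).P →ₗ[Q] (X i).P}
    (hα : MatFac.IsHomog (X j) (X i) p α) :
    IsTranspForm u p i j (MatFac.commConn (MatFac.dualConnection (u j) (cY (θ j)))
      (MatFac.dualConnection (u i) (cY (θ i))) α)
      (MatFac.commConn (cY (θ i)) (cY (θ j)) (dualArrow X Y θ u i j α)) := by
  intro s x hx y
  have h1 := MatFac.contr_dualConnection (u j) (cY (θ j)) x
    ((u j).toDual (dualArrow X Y θ u i j α y))
  have h2 := MatFac.contr_dualConnection (u i) (cY (θ i)) (α x) ((u i).toDual y)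
  have e : ∀ i (y : (Y (θ i)).P), (u i).e ((u i).toDual y) = y := fun i y =>
    (u i).e.apply_symm_apply y
  have h3 : contr Ω[Q⁄k] ((u j).toDual (dualArrow X Y θ u i j α y))
      ((MatFac.dualConnection (u j) (cY (θ j))).D x) = sgn (p * (s + p)) •
        contr Ω[Q⁄k] ((u i).toDual y)
          (α.lTensor _ ((MatFac.dualConnection (u j) (cY (θ j))).D x)) := by
    -- The functional `α^* y` is a multiple of `y ∘ α` only on each homogeneous part separately.
    -- This suffices because `∇x` has its coefficients in the part that contains `x`.
    rw [← contr_comp, ← contr_zsmul, ← sub_eq_zero, ← contr_sub]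
    refine contr_eq_zero (S := (X j).gr s) (fun z hz => ?_)
      ((MatFac.dualConnection (u j) (cY (θ j))).odd s x hx)
    rw [LinearMap.sub_apply, toDual_dualArrow hα hz]
    exact sub_self _
  rw [e, toDual_dualArrow hα hx, h3, map_zsmul] at h1
  rw [e] at h2
  change contr Ω[Q⁄k] (MatFac.pairing (u j) x) ((cY (θ j)).D (dualArrow X Y θ u i j α y) -
    (dualArrow X Y θ u i j α).lTensor _ ((cY (θ i)).D y)) = _ • contr Ω[Q⁄k] ((u i).toDual y)
      ((MatFac.dualConnection (u i) (cY (θ i))).D (α x) -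
        α.lTensor _ ((MatFac.dualConnection (u j) (cY (θ j))).D x))
  rw [map_sub, ← contr_comp, pairing_comp_dualArrow hα hx, contr_zsmul, map_sub, smul_sub, h2,
    smul_sub, ← sub_eq_zero]
  rw [eq_comm, ← sub_eq_zero] at h1
  rw [← neg_eq_zero, ← h1]
  abel

/-- For maps of rank one the operator is some `ω ⊗ α`, whose transpose is known; the general case
follows by additivity. The projections serve to make the summands homogeneous. Together with
`IsTranspForm.unique` this computes the transpose of any operator given by one-forms. -/
lemma exists_isTranspForm (p : ZMod 2) (ψ : (X j).P →ₗ[Q] Ω[Q⁄k] ⊗[Q] (X i).P) :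
    ∃ ψ', IsTranspForm u p i j
        (∑ s : ZMod 2, ((X i).proj (s + p)).lTensor Ω[Q⁄k] ∘ₗ ψ ∘ₗ (X j).proj s) ψ' ∧
      (block i j (opOne (p + 1) (∑ s : ZMod 2,
          ((X i).proj (s + p)).lTensor Ω[Q⁄k] ∘ₗ ψ ∘ₗ (X j).proj s)),
        -block (θ j) (θ i) (opOne (p + 1) ψ')) ∈ transp X Y θ u i j (p + 1) := by
  induction ψ using hom_induction with
  | h0 =>
    refine ⟨0, fun s x hx y => by simp, ?_⟩
    convert zero_mem (transp X Y θ u i j (p + 1)) using 1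
    simp
  | hadd a b ha hb =>
    obtain ⟨a', ha, ha'⟩ := ha
    obtain ⟨b', hb, hb'⟩ := hb
    simp only [LinearMap.add_comp, LinearMap.comp_add, Finset.sum_add_distrib]
    refine ⟨a' + b', fun s x hx y => ?_, ?_⟩
    · rw [LinearMap.add_apply, map_add, ha s x hx, hb s x hx, LinearMap.add_apply, map_add, smul_add]
    · convert add_mem ha' hb' using 1
      rw [Prod.mk_add_mk, map_add, map_add, map_add, map_add, neg_add]
  | h g z =>
    induction z with
    | zero =>
      refine ⟨0, fun s x hx y => by simp, ?_⟩
      convert zero_mem (transp X Y θ u i j (p + 1)) using 1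
      simp
    | add a b ha hb =>
      obtain ⟨a', ha, ha'⟩ := ha
      obtain ⟨b', hb, hb'⟩ := hb
      simp only [LinearMap.add_comp, LinearMap.comp_add, Finset.sum_add_distrib,
        TensorProduct.tmul_add, map_add]
      refine ⟨a' + b', fun s x hx y => ?_, ?_⟩
      · rw [LinearMap.add_apply, map_add, ha s x hx, hb s x hx, LinearMap.add_apply, map_add,
          smul_add]
      · convert add_mem ha' hb' using 1
        rw [Prod.mk_add_mk, map_add, map_add, neg_add]
    | tmul v w =>
      have h := isHomog_homPart (X := X j) (Y := X i) p (dualTensorHom Q (X j).P (X i).P (g ⊗ₜ w))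
      set α := MatFac.homPart (X j) (X i) p (dualTensorHom Q (X j).P (X i).P (g ⊗ₜ w)) with hα
      have e : ∑ s : ZMod 2, ((X i).proj (s + p)).lTensor Ω[Q⁄k] ∘ₗ
          dualTensorHom Q (X j).P (Ω[Q⁄k] ⊗[Q] (X i).P) (g ⊗ₜ (v ⊗ₜ w)) ∘ₗ (X j).proj s =
          TensorProduct.mk Q Ω[Q⁄k] (X i).P v ∘ₗ α := by
        ext x
        rw [LinearMap.comp_apply, LinearMap.sum_apply, hα,
          show MatFac.homPart (X j) (X i) p (dualTensorHom Q (X j).P (X i).P (g ⊗ₜ w)) =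
            ∑ s : ZMod 2, (X i).proj (s + p) ∘ₗ dualTensorHom Q (X j).P (X i).P (g ⊗ₜ w) ∘ₗ
              (X j).proj s from rfl,
          LinearMap.sum_apply, map_sum]
        simp
      have e2 : ∀ {f : Q} (A B : MatFac k f) (α : A.P →ₗ[Q] B.P),
          opOne (p + 1) (TensorProduct.mk Q Ω[Q⁄k] B.P v ∘ₗ α) =
            el p (ExteriorAlgebra.ι Q v) α := by
        intro f A B α
        have := extend_mk (p + 1) (ι_mem_exteriorPower v) α
        rw [Nat.cast_one, add_assoc, CharTwo.add_self_eq_zero, add_zero] at this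
        rw [← this]
        rfl
      rw [e]
      refine ⟨TensorProduct.mk Q Ω[Q⁄k] _ v ∘ₗ dualArrow X Y θ u i j α, fun s x hx y => ?_, ?_⟩
      · rw [LinearMap.comp_apply, LinearMap.comp_apply, TensorProduct.mk_apply,
          TensorProduct.mk_apply, contr_tmul, contr_tmul, MatFac.pairing_apply,
          toDual_dualArrow h hx, smul_assoc]
      · rw [e2, e2]
        have := el_mem_transp (Y := Y) (θ := θ) (u := u) (t := p + 1) (ι_mem_exteriorPower v) h
          (by rw [Nat.cast_one, add_comm])
        rwa [Nat.cast_one, sgn_one, neg_one_smul] at this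

/-- The form of `(α^*)'` is the transpose of the form of `α'`. The minus sign is the sign
`(-1)^{|ω|}` of the transposition on one-forms. -/
lemma opDeriv_mem_transp (cY : ∀ j, (Y j).Connection) {α : (X j).P →ₗ[Q] (X i).P}
    (hα : MatFac.IsHomog (X j) (X i) p α) :
    (block i j (MatFac.opDeriv (X j) (X i) (MatFac.dualConnection (u j) (cY (θ j)))
        (MatFac.dualConnection (u i) (cY (θ i))) α),
      -block (θ j) (θ i) (MatFac.opDeriv (Y (θ i)) (Y (θ j)) (cY (θ i)) (cY (θ j))
        (dualArrow X Y θ u i j α))) ∈ transp X Y θ u i j (p + 1) := by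
  obtain ⟨ψ', h1, h2⟩ := exists_isTranspForm (u := u) p
    (MatFac.commConn (MatFac.dualConnection (u j) (cY (θ j)))
      (MatFac.dualConnection (u i) (cY (θ i))) α)
  rw [← (MatFac.isHomogForm_commConn _ _ hα).eq_sum] at h1 h2
  rw [h1.unique (isTranspForm_commConn cY hα)] at h2
  rwa [MatFac.opDeriv_of_isHomog _ _ hα, MatFac.opDeriv_of_isHomog _ _ (dualArrow_isHomog hα)]

variable (X u) in
/-- The connections on the objects `X i` that are dual to the given ones. -/
abbrev dualConns (cY : ∀ j, (Y j).Connection) (i : I) : (X i).Connection :=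
  MatFac.dualConnection (u i) (cY (θ i))

lemma derL_mem_transp (cY : ∀ j, (Y j).Connection) {a : HArr X} (ha : a ∈ arrows X i j p) :
    (derL X (dualConns X u cY) a, -derL Y cY (arrDual X Y θ u a)) ∈ transp X Y θ u i j (p + 1) := by
  obtain ⟨α, hα, rfl⟩ := ha
  rw [arrDual_arr, derL_arr, derL_arr]
  exact opDeriv_mem_transp cY hα

lemma opL_mem_transp {a : HArr X} (ha : a ∈ arrows X i j p) :
    (opL X a, opL Y (arrDual X Y θ u a)) ∈ transp X Y θ u i j p := by
  obtain ⟨α, hα, rfl⟩ := ha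
  rw [arrDual_arr, opL_arr, opL_arr, MatFac.opForms_of_isHomog hα,
    MatFac.opForms_of_isHomog (dualArrow_isHomog hα)]
  have := el_mem_transp (Y := Y) (θ := θ) (u := u) (t := p) one_mem_exteriorPower hα (by simp)
  rwa [Nat.cast_zero, sgn_zero, one_smul] at this

/-- Two minus signs cancel: the one of `opDeriv_mem_transp`, and the one in the differential `-δ^*`
of the dual. -/
lemma deltaPrime_mem_transp (cY : ∀ j, (Y j).Connection) :
    (block i i (deltaPrime X (dualConns X u cY) i), block (θ i) (θ i) (deltaPrime Y cY (θ i))) ∈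
      transp X Y θ u i i 0 := by
  have h := opDeriv_mem_transp (u := u) cY (X i).δ_odd
  have e : dualArrow X Y θ u i i (X i).δ = -(Y (θ i)).δ := by
    refine LinearMap.ext fun y => ?_
    obtain ⟨γ, rfl⟩ := (u i).e.surjective y
    have h1 : MatFac.dualHom (X i) (X i) (X i).δ γ = -(X i).dual.δ γ := (neg_neg _).symm
    rw [LinearMap.neg_apply, ← (u i).comm, ← map_neg, ← h1]
    simp [dualArrow]
  rwa [e, map_neg, map_neg, neg_neg] at h

variable [Module.Finite Q Ω[Q⁄k]]

lemma mul_opG_mem_transp (cY : ∀ j, (Y j).Connection) {z : OpRing X × OpRing Y}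
    (hz : z ∈ transp X Y θ u i j t) :
    (z.1 * opG X (dualConns X u cY), opG Y cY * z.2) ∈ transp X Y θ u i j t := by
  refine transp_mul_diagOp ?_ hz
  have h : ∀ e : ℕ, (block j j ((-deltaPrime X (dualConns X u cY) j) ^ e),
      block (θ j) (θ j) ((-deltaPrime Y cY (θ j)) ^ e)) ∈ transp X Y θ u j j 0 := by
    intro e
    induction e with
    | zero => exact one_mem_transp
    | succ e ih =>
      have := transp_mul ih (neg_mem (deltaPrime_mem_transp (u := u) (i := j) cY))
      rw [mul_zero, sgn_zero, one_smul, add_zero] at this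
      convert this using 1
      refine Prod.ext ?_ ?_
      · dsimp only
        rw [Prod.fst_neg, ← map_neg, block_mul_block]
        rfl
      · dsimp only
        rw [Prod.snd_neg, ← map_neg, block_mul_block, pow_succ']
        rfl
  rw [map_sum, map_sum]
  have := sum_mem (t := Finset.range (formsBound k Q)) fun e _ => h e
  convert this using 1
  refine Prod.ext ?_ ?_
  · rw [Prod.fst_sum]
  · rw [Prod.snd_sum]

end TransposeDerivative

/-! ### The operator of a tail -/

section TailOperator

variable {k : Type u} [Field k] {H E : Type u} [AddCommGroup H] [Module k H] [Ring E] [Algebra k E]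

/-- `W` is the operator of the letters after the first one in the words `t b`. -/
inductive IsTailOp (D : H →ₗ[k] E) (G : E) : (H →ₗ[k] AllWords k H) → E → Prop
  | base : IsTailOp D G letterW 1
  | snoc {t : H →ₗ[k] AllWords k H} {W : E} (h : IsTailOp D G t W) (x : H) :
      IsTailOp D G (appendW x ∘ₗ t) (W * (D x * G))

variable {ρ D : H →ₗ[k] E} {G W : E} {t : H →ₗ[k] AllWords k H}

lemma IsTailOp.opW (h : IsTailOp D G t W) (b : H) : opW ρ D G (t b) = ρ b * (G * W) := by
  induction h with
  | base => rw [opW_letterW, mul_one]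
  | snoc h x ih => rw [LinearMap.comp_apply, opW_appendW, ih, mul_assoc, mul_assoc]

lemma IsTailOp.ins (h : IsTailOp D G t W) (y : H) : IsTailOp D G (insW y ∘ₗ t) (D y * (G * W)) := by
  induction h with
  | base =>
    have := IsTailOp.snoc (IsTailOp.base (D := D) (G := G)) y
    rw [one_mul] at this
    rwa [mul_one, show insW y ∘ₗ letterW = appendW y ∘ₗ letterW (k := k) from
      LinearMap.ext fun a => insW_letterW y a]
  | @snoc t W h x ih =>
    rw [show insW y ∘ₗ appendW x ∘ₗ t = appendW x ∘ₗ insW y ∘ₗ t from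
      LinearMap.ext fun a => insW_appendW y x _]
    have := ih.snoc x
    rwa [mul_assoc, mul_assoc] at this

end TailOperator

/-! ### Strict compatibility of the HKR maps with duality for dual connections -/

section Strict

lemma block_one_mul_opG {k Q : Type u} [Field k] [CommRing Q] [Algebra k Q] {f : Q} {I : Type u}
    {X : I → MatFac k f} [Module.Finite Q Ω[Q⁄k]] (c : ∀ i, (X i).Connection) (i : I) :
    block i i (1 : Module.End Q (Forms k Q ⊗[Q] (X i).P)) * opG X c = opG X c * block i i 1 := by
  rw [opG, diagOp_mul_block, block_mul_diagOp]
  rfl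

variable {k Q : Type u} [Field k] [CommRing Q] [Algebra k Q] {f : Q} {I J : Type u}
  {X : I → MatFac k f} {Y : J → MatFac k (-f)} {θ : I → J}
  {u : ∀ i, MatFac.Iso (X i).dual (Y (θ i))} {i j l : I} {σ s t p q : ZMod 2}
  [Module.Finite Q Ω[Q⁄k]] (cY : ∀ j, (Y j).Connection)

/-- The letters after the first contribute `V = G x₁' G ⋯ x_n' G`. This pattern begins and ends with
`G`, so its transpose is the operator of the same shape for the reversed dual letters. The minus
sign of each transposed derivative and the sign of each reversed product are exactly those in the
recursion for `Ψ`. -/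
lemma exists_tail_transp {n : ℕ} {t : HArr X →ₗ[k] AllWords k (HArr X)}
    (ht : IsTail (arrows X) n i j σ t) :
    ∃ (ε : ℤ) (t' : HArr Y →ₗ[k] AllWords k (HArr Y)) (W : OpRing Y) (V : OpRing X),
      IsTailOp (derL Y cY) (opG Y cY) t' W ∧
      (∀ l p, ∀ b ∈ arrows X l i p, psi X Y θ u (t b) = ε • t' (arrDual X Y θ u b)) ∧
      (∀ l p, ∀ b ∈ arrows X l i p, hkrOp X (dualConns X u cY) (t b) = opL X b * V) ∧
      (V, ε • (block (θ j) (θ j) 1 * (opG Y cY * W))) ∈ transp X Y θ u i j σ := by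
  induction ht with
  | base hσ =>
    rename_i i σ
    refine ⟨1, letterW, 1, block i i 1 * opG X (dualConns X u cY), .base, fun l p b hb => ?_,
      fun l p b hb => ?_, ?_⟩
    · rw [one_smul]
      exact revW_letterW ((isDG_arrows X).part_mem hb)
    · rw [opW_letterW, ← mul_assoc]
      obtain ⟨α, hα, rfl⟩ := hb
      rw [opL_arr, block_mul_block]
      rfl
    · have := mul_opG_mem_transp cY (one_mem_transp (u := u) (i := i))
      rw [hσ, one_smul, mul_one]
      dsimp only at this
      rwa [← block_one_mul_opG cY] at this
  | snoc ht hx hτ ih =>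
    rename_i n i j l σ q τ t x
    obtain ⟨ε, t', W, V, h1, h2, h3, h4⟩ := ih
    refine ⟨-(sgn ((q + 1) * σ) * ε), insW (arrDual X Y θ u x) ∘ₗ t', _,
      V * derL X (dualConns X u cY) x * opG X (dualConns X u cY), h1.ins _, fun m p b hb => ?_,
      fun m p b hb => ?_, ?_⟩
    · refine (revW_append (isDG_arrows X) hb ht hx).trans ?_
      have := h2 m p b hb
      rw [psi] at this
      rw [revW, this, map_zsmul, smul_smul, neg_smul]
      rfl
    · rw [LinearMap.comp_apply, opW_appendW, h3 m p b hb]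
      simp only [mul_assoc]
    · have h5 := mul_opG_mem_transp cY (transp_mul h4 (derL_mem_transp cY hx))
      rw [hτ]
      convert h5 using 1
      refine Prod.ext rfl ?_
      dsimp only
      obtain ⟨φ, hφ⟩ := blkT_eq (derL_mem cY ((isStar_arrDual X Y θ u).star_mem hx))
      have e1 : block (θ l) (θ l) 1 * derL Y cY (arrDual X Y θ u x) =
          derL Y cY (arrDual X Y θ u x) := by rw [hφ, block_mul_block]; rfl
      have e2 : derL Y cY (arrDual X Y θ u x) * block (θ j) (θ j) 1 =
          derL Y cY (arrDual X Y θ u x) := by rw [hφ, block_mul_block]; rfl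
      rw [← mul_assoc (block (θ l) (θ l) 1), block_one_mul_opG, mul_assoc,
        ← mul_assoc (block (θ l) (θ l) 1), e1, mul_smul_comm, neg_mul, mul_smul_comm,
        ← mul_assoc (derL Y cY _) (block (θ j) (θ j) 1), e2, mul_comm (q + 1), neg_smul, mul_neg,
        mul_smul_comm, smul_neg, smul_smul]

/-- The HKR maps are compatible with duality, if one takes dual connections. -/
lemma hkr_psi_isPath {n : ℕ} {w : AllWords k (HArr X)} (hw : IsPath (arrows X) n i i σ w) :
    hkr Y cY (psi X Y θ u w) = gammaHom k Q (hkr X (dualConns X u cY) w) := by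
  have hψ := (isStar_arrDual X Y θ u).revW_isPath (isDG_arrows X) hw
  rw [hkr_eq _ hw]
  obtain ⟨j, p, τ, t, b, ht, hb, rfl, rfl⟩ := hw.exists_tail
  obtain ⟨ε, t', W, V, h1, h2, h3, h4⟩ := exists_tail_transp (u := u) cY ht
  have hb' := (isStar_arrDual X Y θ u).star_mem hb
  obtain ⟨φ, hφ⟩ := blkT_eq (opL_mem hb')
  have e : opL Y (arrDual X Y θ u b) * block (θ i) (θ i) 1 = opL Y (arrDual X Y θ u b) := by
    rw [hφ, block_mul_block]; rfl
  -- Transposing `ρ(b) V` puts the first letter last; cyclicity of the supertrace moves `b^*` back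
  -- to the front, with the same sign as the one of the transposed product.
  have h5 := opStr_transp (transp_mul (opL_mem_transp hb) h4)
  dsimp only at h5
  rw [map_zsmul, ← opStr_mul_comm (opL_mem hb') (transp_mem_blkT h4).2] at h5
  have h6 : hkr Y cY (psi X Y θ u (t b)) =
      factScale k Q (opStr Y (hkrOp Y cY (psi X Y θ u (t b)))) := by
    obtain ⟨ε, j, v, hv, h7⟩ := hψ
    rw [psi]
    rw [revW] at h7
    rw [h7, map_zsmul, hkr_eq _ hv, map_zsmul, map_zsmul, map_zsmul]
  rw [h6, h3 _ _ b hb, ← factScale_gammaHom, ← h5, h2 _ _ b hb, map_zsmul, h1.opW, mul_smul_comm,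
    ← mul_assoc (opL Y _) (block _ _ _), e]

variable (u) in
lemma hkr_psi {w : AllWords k (HArr X)} (hw : w ∈ hochGr X t) :
    hkr Y cY (psi X Y θ u w) = gammaHom k Q (hkr X (dualConns X u cY) w) :=
  loopsSpan_hom_eq (f := (hkr Y cY ∘ₗ psi X Y θ u).toAddMonoidHom)
    (g := ((gammaHom k Q).toLinearMap.restrictScalars k ∘ₗ hkr X (dualConns X u cY)).toAddMonoidHom)
    (fun _ _ _ hv => hkr_psi_isPath cY hv) ((mem_hochGr_iff X).1 hw)

end Strict

/-! ### Contracting homotopies and torsion in Hochschild homology -/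

section Torsion

variable {k Q : Type u} [Field k] [CommRing Q]
variable {H : Type u} [AddCommGroup H] [Module k H] [Module Q H] [SMulCommClass k Q H]
variable {I : Type u}

/-- The additive group generated by the closed paths of length at most `n`. -/
def loopsLT (𝓗 : I → I → ZMod 2 → Submodule Q H) (n : ℕ) (σ : ZMod 2) :
    AddSubgroup (AllWords k H) :=
  AddSubgroup.closure {w | ∃ m < n, ∃ i, IsPath 𝓗 m i i σ w}

variable {part : ZMod 2 → H →ₗ[k] H} {mul : H →ₗ[k] H →ₗ[k] H} {d : H →ₗ[k] H}
  {𝓗 : I → I → ZMod 2 → Submodule Q H} {i j : I} {σ τ : ZMod 2} {n m : ℕ} {w : AllWords k H}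

lemma pathSpan_le_loopsLT (h : m < n) : pathSpan (k := k) 𝓗 m i i σ ≤ loopsLT 𝓗 n σ :=
  AddSubgroup.closure_mono fun _ hw => ⟨m, h, i, hw⟩

lemma loopsLT_mono (h : m ≤ n) : loopsLT (k := k) 𝓗 m σ ≤ loopsLT 𝓗 n σ :=
  AddSubgroup.closure_mono fun _ ⟨l, hl, i, hw⟩ => ⟨l, hl.trans_le h, i, hw⟩

lemma loopsLT_le_loopsSpan : loopsLT (k := k) 𝓗 n σ ≤ loopsSpan 𝓗 σ :=
  AddSubgroup.closure_mono fun _ ⟨l, _, i, hw⟩ => ⟨l, i, hw⟩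

lemma exists_mem_loopsLT (hw : w ∈ loopsSpan 𝓗 σ) : ∃ n, w ∈ loopsLT 𝓗 n σ := by
  induction hw using AddSubgroup.closure_induction with
  | zero => exact ⟨0, zero_mem _⟩
  | neg a _ ha => exact ⟨ha.choose, neg_mem ha.choose_spec⟩
  | add a b _ _ ha hb =>
    obtain ⟨n, ha⟩ := ha
    obtain ⟨m, hb⟩ := hb
    exact ⟨max n m, add_mem (loopsLT_mono (le_max_left _ _) ha) (loopsLT_mono (le_max_right _ _) hb)⟩
  | mem w hw =>
    obtain ⟨n, i, hw⟩ := hw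
    exact ⟨n + 1, AddSubgroup.subset_closure ⟨n, n.lt_succ_self, i, hw⟩⟩

variable {e : H} {η : I → H} {q : Q}

lemma mapFirstW_congr {φ ψ : H →ₗ[k] H} (h : ∀ {j p a}, a ∈ 𝓗 i j p → φ a = ψ a)
    (hw : w ∈ pathsSpan 𝓗 i j σ) : mapFirstW φ w = mapFirstW ψ w := by
  refine pathsSpan_hom_eq (f := (mapFirstW φ).toAddMonoidHom) (g := (mapFirstW ψ).toAddMonoidHom)
    (fun n v hv => ?_) hw
  change mapFirstW φ v = mapFirstW ψ v
  clear hw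
  induction hv with
  | base ha hσ => rw [mapFirstW_zero, mapFirstW_zero, h ha]
  | snoc hv hx hτ ih => rw [mapFirstW_appendW, mapFirstW_appendW, ih h]

lemma mapFirstW_eq_smul {φ : H →ₗ[k] H} (h : ∀ {j p a}, a ∈ 𝓗 i j p → φ a = q • a)
    (hw : w ∈ pathsSpan 𝓗 i j σ) : mapFirstW φ w = q • w := by
  refine pathsSpan_hom_eq (f := (mapFirstW φ).toAddMonoidHom)
    (g := DistribSMul.toAddMonoidHom _ q) (fun n v hv => ?_) hw
  change mapFirstW φ v = q • v
  clear hw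
  induction hv with
  | base ha hσ =>
    rw [mapFirstW_zero, smul_allWord, h ha]
    simp only [Fin.fin_one_eq_zero, if_true]
  | snoc hv hx hτ ih => rw [mapFirstW_appendW, ih h, appendW_smul]

namespace IsDG

/-- Left multiplication by contracting homotopies of the objects is a contracting homotopy of the
Hochschild complex, up to shorter words. -/
lemma homotopy_sub_mem (h : IsDG part mul d 𝓗) (hη : ∀ i, η i ∈ 𝓗 i i 1)
    (he : ∀ {i j p a}, a ∈ 𝓗 i j p → mul e a = mul (η i) a)
    (hd : ∀ {i j p a}, a ∈ 𝓗 i j p → mul (d (η i)) a = q • a) (hw : IsPath 𝓗 n i i σ w) :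
    wordB part mul d (mapFirstW (mul e) w) + mapFirstW (mul e) (wordB part mul d w) - q • w ∈
      loopsLT 𝓗 n σ := by
  have h1 : ∀ {i j σ w}, w ∈ pathsSpan 𝓗 i j σ →
      mapFirstW (mul e) w = mapFirstW (mul (η i)) w := fun hw => mapFirstW_congr he hw
  -- For `b'` alone, left multiplication by an odd `η` with `d η = q` is an exact homotopy to
  -- multiplication by `q`, by the Leibniz rule `linW_left`. Only the cyclic terms remain, and they
  -- shorten the word.
  have h2 : wordB part mul d (mapFirstW (mul e) w) + mapFirstW (mul e) (wordB part mul d w) - q • w =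
      cycW part mul (mapFirstW (mul e) w) + mapFirstW (mul e) (cycW part mul w) := by
    rw [wordB_eq_linW_add, LinearMap.add_apply, LinearMap.add_apply, map_add, h1 hw.mem',
      h.linW_left (hη i) hw.mem', mapFirstW_eq_smul hd hw.mem', h1 (h.linW_mem hw.mem' rfl), sgn_one]
    module
  rw [h2]
  cases hw with
  | base ha hσ => rw [mapFirstW_zero, cycW_zero, cycW_zero, map_zero, add_zero]; exact zero_mem _
  | snoc hv hx hτ =>
    rename_i n j σ p v x
    have h3 := h.left_mem (hη i) hv.mem rfl
    rw [mapFirstW_appendW, h1 hv.mem', h.cycW_append hx h3, h.cycW_append hx hv.mem, map_neg,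
      map_zsmul]
    have h4 := h.left_mem hx hv.mem rfl
    rw [h1 (pathSpan_le _ h4)]
    refine add_mem (neg_mem (zsmul_mem (pathSpan_le_loopsLT n.lt_succ_self
      (h.left_mem hx h3 ?_)) _)) (neg_mem (zsmul_mem (pathSpan_le_loopsLT n.lt_succ_self
      (h.left_mem (hη j) h4 ?_)) _))
    · rw [hτ]; ring
    · rw [hτ]; ring

lemma mapFirstW_mem_loopsSpan (h : IsDG part mul d 𝓗) (hη : ∀ i, η i ∈ 𝓗 i i 1)
    (he : ∀ {i j p a}, a ∈ 𝓗 i j p → mul e a = mul (η i) a) (hw : w ∈ loopsSpan 𝓗 σ) :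
    mapFirstW (mul e) w ∈ loopsSpan 𝓗 (σ + 1) := by
  refine loopsSpan_hom_mem (f := mapFirstW (mul e)) (fun n i v hv => ?_) hw
  rw [mapFirstW_congr he hv.mem']
  exact pathsSpan_le_loopsSpan (pathSpan_le _ (h.left_mem (hη i) hv.mem rfl))

/-- If all objects are contractible up to multiplication by `q`, then the homology of the Hochschild
complex is `q`-power torsion. -/
lemma exists_wordB_eq (h : IsDG part mul d 𝓗) (hη : ∀ i, η i ∈ 𝓗 i i 1)
    (he : ∀ {i j p a}, a ∈ 𝓗 i j p → mul e a = mul (η i) a)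
    (hd : ∀ {i j p a}, a ∈ 𝓗 i j p → mul (d (η i)) a = q • a) (hw : w ∈ loopsLT 𝓗 n σ)
    (hb : wordB part mul d w = 0) :
    ∃ N, ∃ v ∈ loopsSpan 𝓗 (σ + 1), wordB part mul d v = q ^ N • w := by
  induction n generalizing w with
  | zero =>
    have : w = 0 := by
      have e : loopsLT (k := k) 𝓗 0 σ = ⊥ := by
        rw [loopsLT]
        convert AddSubgroup.closure_empty
        simp
      rwa [e, AddSubgroup.mem_bot] at hw
    exact ⟨0, 0, zero_mem _, by rw [map_zero, this, smul_zero]⟩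
  | succ n ih =>
    have hL := loopsLT_le_loopsSpan hw
    have hE := h.mapFirstW_mem_loopsSpan hη he hL
    have h1 : wordB part mul d (mapFirstW (mul e) w) + mapFirstW (mul e) (wordB part mul d w) -
        q • w ∈ loopsLT 𝓗 n σ := by
      refine (AddSubgroup.closure_le ((loopsLT 𝓗 n σ).comap
        (wordB part mul d ∘ₗ mapFirstW (mul e) + mapFirstW (mul e) ∘ₗ wordB part mul d -
          DistribSMul.toLinearMap k _ q).toAddMonoidHom)).2 ?_ hw
      rintro v ⟨m, hm, i, hv⟩
      exact loopsLT_mono (Nat.lt_succ_iff.1 hm) (h.homotopy_sub_mem hη he hd hv)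
    rw [hb, map_zero, add_zero] at h1
    have hbb : ∀ {τ} {v : AllWords k H}, v ∈ loopsSpan 𝓗 τ →
        wordB part mul d (wordB part mul d v) = 0 := fun hv =>
      loopsSpan_hom_eq (f := (wordB part mul d ∘ₗ wordB part mul d).toAddMonoidHom) (g := 0)
        (fun n i v hv => h.wordB_wordB hv.mem') hv
    have hbs : ∀ {τ} {v : AllWords k H} (r : Q), v ∈ loopsSpan 𝓗 τ →
        wordB part mul d (r • v) = r • wordB part mul d v := fun r hv =>
      loopsSpan_hom_eq (f := (wordB part mul d ∘ₗ DistribSMul.toLinearMap k _ r).toAddMonoidHom)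
        (g := (DistribSMul.toLinearMap k _ r ∘ₗ wordB part mul d).toAddMonoidHom)
        (fun n i v hv => h.wordB_smul hv.mem' r) hv
    -- For a cycle `w`, the element `b(e w) - q w` is a cycle consisting of shorter words. If `q^N`
    -- times it is the boundary of `v`, then `q^{N+1} w` is the boundary of `q^N e w - v`.
    obtain ⟨N, v, hv, hN⟩ := ih h1 (by rw [map_sub, hbb hE, hbs q hL, hb, smul_zero, sub_zero])
    refine ⟨N + 1, q ^ N • mapFirstW (mul e) w - v, sub_mem (smul_mem_loopsSpan _ hE) hv, ?_⟩
    rw [map_sub, hbs _ hE, hN, smul_sub, sub_sub_cancel, smul_smul, pow_succ]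

end IsDG

open Classical in
/-- The arrows between objects in `S`. -/
def restrArrows (𝓗 : I → I → ZMod 2 → Submodule Q H) (S : Set I) (i j : I) (p : ZMod 2) :
    Submodule Q H := if i ∈ S ∧ j ∈ S then 𝓗 i j p else ⊥

lemma mem_restrArrows {S : Set I} {p : ZMod 2} {a : H} :
    a ∈ restrArrows 𝓗 S i j p ↔ a ∈ 𝓗 i j p ∧ (i ∈ S ∧ j ∈ S ∨ a = 0) := by
  rw [restrArrows]
  split_ifs with h
  · simp [h]
  · rw [Submodule.mem_bot]
    refine ⟨?_, fun h' => h'.2.resolve_left h⟩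
    rintro rfl
    exact ⟨zero_mem _, Or.inr rfl⟩

lemma IsDG.restr (h : IsDG part mul d 𝓗) (S : Set I) : IsDG part mul d (restrArrows 𝓗 S) where
  part_mem ha := h.part_mem (mem_restrArrows.1 ha).1
  d_mem ha := by
    obtain ⟨ha, h'⟩ := mem_restrArrows.1 ha
    exact mem_restrArrows.2 ⟨h.d_mem ha, h'.imp_right fun h => by rw [h, map_zero]⟩
  mul_mem ha hb := by
    obtain ⟨ha, ha'⟩ := mem_restrArrows.1 ha
    obtain ⟨hb, hb'⟩ := mem_restrArrows.1 hb
    refine mem_restrArrows.2 ⟨h.mul_mem ha hb, ?_⟩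
    rcases ha' with ha' | rfl
    · rcases hb' with hb' | rfl
      · exact Or.inl ⟨ha'.1, hb'.2⟩
      · exact Or.inr (map_zero _)
    · exact Or.inr (by rw [map_zero, LinearMap.zero_apply])
  d_d ha := h.d_d (mem_restrArrows.1 ha).1
  leibniz ha hb := h.leibniz (mem_restrArrows.1 ha).1 (mem_restrArrows.1 hb).1
  assoc ha hb hc := h.assoc (mem_restrArrows.1 ha).1 (mem_restrArrows.1 hb).1 (mem_restrArrows.1 hc).1
  d_smul := h.d_smul
  mul_smul_left := h.mul_smul_left
  mul_smul_right := h.mul_smul_right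

lemma restrArrows_mono {S T : Set I} (h : S ⊆ T) {p : ZMod 2} {a : H}
    (ha : a ∈ restrArrows 𝓗 S i j p) : a ∈ restrArrows 𝓗 T i j p := by
  obtain ⟨ha, h'⟩ := mem_restrArrows.1 ha
  exact mem_restrArrows.2 ⟨ha, h'.imp_left fun h' => ⟨h h'.1, h h'.2⟩⟩

lemma IsPath.mono {𝓗' : I → I → ZMod 2 → Submodule Q H}
    (h : ∀ {i j p a}, a ∈ 𝓗 i j p → a ∈ 𝓗' i j p) (hw : IsPath 𝓗 n i j σ w) :
    IsPath 𝓗' n i j σ w := by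
  induction hw with
  | base ha hσ => exact .base (h ha) hσ
  | snoc hv hx hτ ih => exact .snoc ih (h hx) hτ

lemma loopsSpan_mono {𝓗' : I → I → ZMod 2 → Submodule Q H}
    (h : ∀ {i j p a}, a ∈ 𝓗 i j p → a ∈ 𝓗' i j p) :
    loopsSpan (k := k) 𝓗 σ ≤ loopsSpan 𝓗' σ :=
  AddSubgroup.closure_mono fun _ ⟨n, i, hw⟩ => ⟨n, i, hw.mono h⟩

lemma IsPath.exists_restr (hw : IsPath 𝓗 n i j σ w) :
    ∃ S : Finset I, i ∈ S ∧ j ∈ S ∧ IsPath (restrArrows 𝓗 S) n i j σ w := by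
  classical
  induction hw with
  | @base i j p σ a ha hσ =>
    exact ⟨{i, j}, by simp, by simp, .base (mem_restrArrows.2 ⟨ha, Or.inl (by simp)⟩) hσ⟩
  | @snoc n i j l σ q τ w x hv hx hτ ih =>
    obtain ⟨S, hi, hj, hS⟩ := ih
    refine ⟨insert l S, by simp [hi], by simp, .snoc (hS.mono (restrArrows_mono (by simp)))
      (mem_restrArrows.2 ⟨hx, Or.inl ?_⟩) hτ⟩
    simp [hj]

lemma exists_mem_loopsSpan_restr (hw : w ∈ loopsSpan 𝓗 σ) :
    ∃ S : Finset I, w ∈ loopsSpan (restrArrows 𝓗 S) σ := by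
  classical
  induction hw using AddSubgroup.closure_induction with
  | zero => exact ⟨∅, zero_mem _⟩
  | neg a _ ha => exact ⟨ha.choose, neg_mem ha.choose_spec⟩
  | add a b _ _ ha hb =>
    obtain ⟨S, ha⟩ := ha
    obtain ⟨T, hb⟩ := hb
    exact ⟨S ∪ T, add_mem (loopsSpan_mono (restrArrows_mono (by simp)) ha)
      (loopsSpan_mono (restrArrows_mono (by simp)) hb)⟩
  | mem w hw =>
    obtain ⟨n, i, hw⟩ := hw
    obtain ⟨S, -, -, h⟩ := hw.exists_restr
    exact ⟨S, h.mem_loopsSpan⟩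

end Torsion

/-! ### Supports and the ideal of null-homotopic multiplications -/

section Annihilator

variable {k Q : Type u} [Field k] [CommRing Q] [Algebra k Q] {f : Q}

namespace MatFac

/-- The ideal of the elements of `Q` by which the multiplication on `A` is homotopic to zero. -/
def homotopyIdeal (A : MatFac k f) : Ideal Q where
  carrier := {q | ∃ h, IsHomog A A 1 h ∧ A.δ ∘ₗ h + h ∘ₗ A.δ = q • LinearMap.id}
  zero_mem' := ⟨0, (homog A A 1).zero_mem, by simp⟩
  add_mem' := by
    rintro a b ⟨h, h1, h2⟩ ⟨h', h1', h2'⟩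
    refine ⟨h + h', (homog A A 1).add_mem h1 h1', ?_⟩
    rw [add_smul, ← h2, ← h2', LinearMap.comp_add, LinearMap.add_comp]
    abel
  smul_mem' := by
    rintro c a ⟨h, h1, h2⟩
    refine ⟨c • h, (homog A A 1).smul_mem c h1, ?_⟩
    rw [smul_eq_mul, mul_smul, ← h2, LinearMap.comp_smul, LinearMap.smul_comp, smul_add]

/-- Both `δ h + h δ` and multiplication by `q` can be compared parity by parity, and only the odd
part of `h` contributes to the even part of `δ h + h δ`. So an arbitrary homotopy may be replaced by
its odd part. -/
lemma mem_homotopyIdeal {A : MatFac k f} {q : Q} (h : A.P →ₗ[Q] A.P)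
    (hq : A.δ ∘ₗ h + h ∘ₗ A.δ = q • LinearMap.id) : q ∈ A.homotopyIdeal := by
  refine ⟨homPart A A 1 h, isHomog_homPart 1 h, ?_⟩
  have e : ∀ r, ∀ x ∈ A.gr r, homPart A A 1 h x = A.proj (r + 1) (h x) := by
    intro r x hx
    change (∑ t : ZMod 2, A.proj (t + 1) ∘ₗ h ∘ₗ A.proj t) x = _
    rw [LinearMap.sum_apply, Finset.sum_eq_single r]
    · rw [LinearMap.comp_apply, LinearMap.comp_apply, A.proj_of_mem hx, if_pos rfl]
    · intro t _ ht
      rw [LinearMap.comp_apply, LinearMap.comp_apply, A.proj_of_mem hx, if_neg ht, map_zero, map_zero]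
    · simp
  have h2 : ∀ r, ∀ x ∈ A.gr r,
      (A.δ ∘ₗ homPart A A 1 h + homPart A A 1 h ∘ₗ A.δ) x = q • x := by
    intro r x hx
    have h11 : r + 1 + 1 = r := by
      rw [add_assoc, show (1 : ZMod 2) + 1 = 0 from rfl, add_zero]
    have h3 := LinearMap.congr_fun (IsHomog.comp_proj A.δ_odd (r + 1)) (h x)
    rw [LinearMap.comp_apply, LinearMap.comp_apply, h11] at h3
    rw [LinearMap.add_apply, LinearMap.comp_apply, LinearMap.comp_apply, e r x hx,
      e (r + 1) _ (A.δ_odd r x hx), h11, h3, ← map_add]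
    have h4 := LinearMap.congr_fun hq x
    rw [LinearMap.add_apply, LinearMap.comp_apply, LinearMap.comp_apply] at h4
    rw [h4, LinearMap.smul_apply, LinearMap.id_apply, map_smul, A.proj_of_mem hx, if_pos rfl]
  refine LinearMap.ext fun x => ?_
  rw [← A.sum_proj x, map_add, h2 0 _ (A.proj_mem 0 x), h2 1 _ (A.proj_mem 1 x), ← smul_add]
  rfl

/-- If `A` is contractible at `𝔭`, then its homotopy ideal is not contained in `𝔭`. -/
lemma ContractibleAt.exists_mem {A : MatFac k f} {p : PrimeSpectrum Q} (h : A.ContractibleAt p) :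
    ∃ q ∈ A.homotopyIdeal, q ∉ p.asIdeal := by
  obtain ⟨h, -, hh⟩ := h
  have : Module.FinitePresentation Q A.P := Module.finitePresentation_of_projective Q A.P
  -- Since `P` is finitely presented, a multiple `s h` of the local contraction comes from an
  -- endomorphism `h0` of `P`. Its oddness is restored by `mem_homotopyIdeal`.
  obtain ⟨h0, s, hs⟩ := Module.FinitePresentation.exists_lift_of_isLocalizedModule p.asIdeal.primeCompl
    (LocalizedModule.mkLinearMap p.asIdeal.primeCompl A.P)
    (h.restrictScalars Q ∘ₗ LocalizedModule.mkLinearMap p.asIdeal.primeCompl A.P)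
  have hs' : ∀ x, LocalizedModule.mk (h0 x) (1 : p.asIdeal.primeCompl) =
      s.1 • h (LocalizedModule.mk x 1) :=
    fun x => LinearMap.congr_fun hs x
  have hδ : ∀ x, LocalizedModule.map p.asIdeal.primeCompl A.δ (LocalizedModule.mk x 1) =
      LocalizedModule.mk (A.δ x) (1 : p.asIdeal.primeCompl) := fun x => LocalizedModule.map_mk _ _ _ _
  have key : LocalizedModule.mkLinearMap p.asIdeal.primeCompl A.P ∘ₗ (A.δ ∘ₗ h0 + h0 ∘ₗ A.δ) =
      LocalizedModule.mkLinearMap p.asIdeal.primeCompl A.P ∘ₗ (s.1 • LinearMap.id) := by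
    refine LinearMap.ext fun x => ?_
    simp only [LinearMap.comp_apply, LinearMap.add_apply, map_add, LinearMap.smul_apply, map_smul,
      LinearMap.id_apply]
    have h1 := hh (LocalizedModule.mk x 1)
    rw [hδ] at h1
    change LocalizedModule.mk (A.δ (h0 x)) (1 : p.asIdeal.primeCompl) +
        LocalizedModule.mk (h0 (A.δ x)) (1 : p.asIdeal.primeCompl) =
      s.1 • LocalizedModule.mk x (1 : p.asIdeal.primeCompl)
    have h2 : LocalizedModule.mk (A.δ (h0 x)) (1 : p.asIdeal.primeCompl) =
        s.1 • LocalizedModule.map p.asIdeal.primeCompl A.δ (h (LocalizedModule.mk x 1)) := by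
      rw [← hδ, hs']
      exact ((LocalizedModule.map p.asIdeal.primeCompl A.δ).restrictScalars Q).map_smul s.1 _
    rw [h2, hs', ← smul_add, add_comm, h1]
  -- The identity `δ h0 + h0 δ = s` holds after localization. Since `P` is finite, it holds on `P`
  -- after multiplication by a single `t` outside the prime.
  obtain ⟨t, ht⟩ := Module.Finite.exists_smul_of_comp_eq_of_isLocalizedModule p.asIdeal.primeCompl
    (LocalizedModule.mkLinearMap p.asIdeal.primeCompl A.P) _ _ key
  refine ⟨t.1 * s.1, mem_homotopyIdeal (t.1 • h0) ?_, (t * s).2⟩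
  rw [mul_smul, LinearMap.comp_smul, LinearMap.smul_comp, ← smul_add]
  exact ht

/-- A prime that contains the homotopy ideal lies in the support, hence in `Z`, and therefore
contains `g`. The radical is the intersection of these primes. -/
lemma mem_radical_homotopyIdeal {A : MatFac k f} {gs : List Q}
    (h : A.supp ⊆ PrimeSpectrum.zeroLocus {g | g ∈ gs}) {g : Q} (hg : g ∈ gs) :
    g ∈ A.homotopyIdeal.radical := by
  rw [Ideal.radical_eq_sInf, Submodule.mem_sInf]
  rintro 𝔭 ⟨h1, h2⟩
  have h3 : (⟨𝔭, h2⟩ : PrimeSpectrum Q) ∈ A.supp := by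
    intro hc
    obtain ⟨q, hq, hq'⟩ := hc.exists_mem
    exact hq' (h1 hq)
  exact h h3 hg

end MatFac

variable {I : Type u} (X : I → MatFac k f)

lemma transport_of_ne {M : I → Type u} [∀ i, AddCommGroup (M i)] [∀ i, Module Q (M i)] {i j : I}
    (h : i ≠ j) : transport (Q := Q) M i j = 0 := by
  classical
  refine LinearMap.ext fun x => ?_
  simp only [transport, LinearMap.comp_apply, DFinsupp.lapply_apply, DFinsupp.lsingle_apply,
    LinearMap.zero_apply]
  exact DFinsupp.single_eq_of_ne h.symm

/-- The homology of the Hochschild complex is supported in the closed set. -/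
lemma exists_hochB_eq {gs : List Q}
    (hX : ∀ i, (X i).supp ⊆ PrimeSpectrum.zeroLocus {g | g ∈ gs}) {g : Q} (hg : g ∈ gs) {j : ZMod 2}
    {w : AllWords k (HArr X)} (hw : w ∈ hochGr X j) (hb : hochB X w = 0) :
    ∃ N, ∃ v ∈ hochGr X (j + 1), hochB X v = g ^ N • w := by
  classical
  -- A chain involves only finitely many objects. Restricting to these makes a common power of `g`
  -- null-homotopic on all of them, and makes the sum of their homotopies an element of the category
  -- algebra.
  obtain ⟨S, hS⟩ := exists_mem_loopsSpan_restr ((mem_hochGr_iff X).1 hw)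
  have h1 : ∀ i, ∃ n, g ^ n ∈ (X i).homotopyIdeal := fun i =>
    MatFac.mem_radical_homotopyIdeal (hX i) hg
  choose n hn using h1
  have h2 : ∀ i ∈ S, ∃ h, MatFac.IsHomog (X i) (X i) 1 h ∧
      (X i).δ ∘ₗ h + h ∘ₗ (X i).δ = g ^ (S.sup n) • LinearMap.id := fun i hi =>
    (X i).homotopyIdeal.pow_mem_of_pow_mem (hn i) (Finset.le_sup hi)
  choose! h h3 h4 using h2
  obtain ⟨m, hm⟩ := exists_mem_loopsLT hS
  have hG := (isDG_arrows X).restr (S : Set I)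
  obtain ⟨N, v, hv, hN⟩ := hG.exists_wordB_eq
    (e := ∑ i ∈ S, arr (fun i => (X i).P) i i (h i))
    (η := fun i => if i ∈ S then arr (fun i => (X i).P) i i (h i) else 0) (q := g ^ S.sup n)
    (fun i => by
      split_ifs with hi
      · exact mem_restrArrows.2 ⟨arr_mem_arrows (h3 i hi), Or.inl ⟨hi, hi⟩⟩
      · exact zero_mem _)
    (by
      intro i j p a ha
      obtain ⟨⟨α, hα, rfl⟩, ha⟩ := mem_restrArrows.1 ha
      rcases ha with ⟨hi, -⟩ | ha
      · rw [if_pos (Finset.mem_coe.1 hi), map_sum, LinearMap.sum_apply,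
          Finset.sum_eq_single_of_mem i (Finset.mem_coe.1 hi)]
        intro l _ hl
        rw [arrMul_arr, transport_of_ne hl.symm, LinearMap.zero_comp, LinearMap.comp_zero, arr_zero]
      · rw [ha, map_zero, map_zero])
    (by
      intro i j p a ha
      obtain ⟨⟨α, hα, rfl⟩, ha⟩ := mem_restrArrows.1 ha
      rcases ha with ⟨hi, -⟩ | ha
      · rw [if_pos (Finset.mem_coe.1 hi), arrD_arr, MatFac.homD_of_isHomog (h3 i hi),
          arrMul_arr_self, ← arr_smul', sgn_one, neg_one_smul, sub_neg_eq_add, h4 i hi,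
          LinearMap.smul_comp, LinearMap.id_comp]
      · rw [ha, map_zero, smul_zero])
    hm hb
  refine ⟨S.sup n * N, v, (mem_hochGr_iff X).2 (loopsSpan_mono
    (fun ha => (mem_restrArrows.1 ha).1) hv), ?_⟩
  rw [pow_mul]
  exact hN

end Annihilator

/-! ### The Čech augmentation is a quasi-isomorphism on torsion homology -/

section QuasiIsomorphisms

variable {Q : Type u} [CommRing Q]

lemma add_one_add_one (j : ZMod 2) : j + 1 + 1 = j := by
  rw [add_assoc, CharTwo.add_self_eq_zero, add_zero]

/-- A morphism out of a free module, on the underlying set of the source of a given map. -/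
lemma exists_lift_of_forall {A B C : ModuleCat.{u} Q} (P : A → B → C → Prop)
    (h : ∀ a, ∃ b c, P a b c) : ∃ (A' : ModuleCat.{u} Q) (π : A' ⟶ A) (β : A' ⟶ B) (γ : A' ⟶ C),
      Epi π ∧ ∀ D : ModuleCat.{u} Q, ∀ (u : A ⟶ D) (v : B ⟶ D) (w : C ⟶ D),
        (∀ a b c, P a b c → u.hom a = v.hom b + w.hom c) → π ≫ u = β ≫ v + γ ≫ w := by
  choose b c h using h
  refine ⟨ModuleCat.of Q (A →₀ Q), ModuleCat.ofHom (Finsupp.linearCombination Q id),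
    ModuleCat.ofHom (Finsupp.linearCombination Q b),
    ModuleCat.ofHom (Finsupp.linearCombination Q c), ?_, ?_⟩
  · rw [ModuleCat.epi_iff_surjective]
    exact fun a => ⟨Finsupp.single a 1, by simp⟩
  · intro D u v w H
    ext a
    simpa using H a _ _ (h a)

/-- A map of `ℤ/2`-graded complexes that is bijective on homology, in terms of elements. -/
lemma quasiIso_of_forall {K L : Cplx Q} (φ : K ⟶ L)
    (hinj : ∀ j (x : K.X (j + 1)) (y : L.X j), (K.d (j + 1) (j + 1 + 1)).hom x = 0 →
      (φ.f (j + 1)).hom x = (L.d j (j + 1)).hom y → ∃ z, x = (K.d j (j + 1)).hom z)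
    (hsurj : ∀ j (y : L.X (j + 1)), (L.d (j + 1) (j + 1 + 1)).hom y = 0 →
      ∃ x z, (K.d (j + 1) (j + 1 + 1)).hom x = 0 ∧
        y = (φ.f (j + 1)).hom x + (L.d j (j + 1)).hom z) : QuasiIso φ := by
  rw [quasiIso_iff]
  suffices h : ∀ j, QuasiIsoAt φ (j + 1) by
    intro j
    rw [← add_one_add_one j]
    exact h _
  intro j
  rw [quasiIsoAt_iff_isIso_homologyMap]
  have hp : (ComplexShape.up (ZMod 2)).prev (j + 1) = j := by simp
  have hn : (ComplexShape.up (ZMod 2)).next (j + 1) = j + 1 + 1 := by simp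
  have h1 : Mono (HomologicalComplex.homologyMap φ (j + 1)) := by
    rw [HomologicalComplex.mono_homologyMap_iff_up_to_refinements φ _ _ _ hp hn]
    intro A x hx y hy
    obtain ⟨A', π, β, γ, hπ, H⟩ := exists_lift_of_forall (A := A) (B := K.X j) (C := K.X j)
      (fun a b c => x.hom a = (K.d j (j + 1)).hom b ∧ c = 0) (fun a => by
        obtain ⟨z, hz⟩ := hinj j (x.hom a) (y.hom a)
          (congrArg (fun F => ModuleCat.Hom.hom F a) hx)
          (congrArg (fun F => ModuleCat.Hom.hom F a) hy)
        exact ⟨z, 0, hz, rfl⟩)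
    refine ⟨A', π, hπ, β, ?_⟩
    rw [H _ x (K.d j (j + 1)) 0 (fun a b c h => by rw [h.1]; simp)]
    simp
  have h2 : Epi (HomologicalComplex.homologyMap φ (j + 1)) := by
    rw [HomologicalComplex.epi_homologyMap_iff_up_to_refinements φ _ _ _ hp hn]
    intro A y hy
    obtain ⟨A', π, β, γ, hπ, H⟩ := exists_lift_of_forall (A := A) (B := K.X (j + 1)) (C := L.X j)
      (fun a b c => (K.d (j + 1) (j + 1 + 1)).hom b = 0 ∧
        y.hom a = (φ.f (j + 1)).hom b + (L.d j (j + 1)).hom c) (fun a =>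
          hsurj j (y.hom a) (congrArg (fun F => ModuleCat.Hom.hom F a) hy))
    refine ⟨A', π, hπ, β, ?_, γ, H _ y _ _ fun a b c h => h.2⟩
    have h3 := H _ 0 (K.d (j + 1) (j + 1 + 1)) 0 (fun a b c h => by rw [h.1]; simp)
    simpa using h3.symm
  exact isIso_of_mono_of_epi _

/-- A quasi-isomorphism is injective on homology, in terms of elements. -/
lemma exists_eq_d_of_quasiIso {K L : Cplx Q} (φ : K ⟶ L) [QuasiIso φ] {j : ZMod 2}
    {x : K.X (j + 1)} {y : L.X j} (hx : (K.d (j + 1) (j + 1 + 1)).hom x = 0)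
    (hy : (φ.f (j + 1)).hom x = (L.d j (j + 1)).hom y) : ∃ z, x = (K.d j (j + 1)).hom z := by
  have hp : (ComplexShape.up (ZMod 2)).prev (j + 1) = j := by simp
  have hn : (ComplexShape.up (ZMod 2)).next (j + 1) = j + 1 + 1 := by simp
  have h1 : IsIso (HomologicalComplex.homologyMap φ (j + 1)) := inferInstance
  have h2 : Mono (HomologicalComplex.homologyMap φ (j + 1)) := inferInstance
  rw [HomologicalComplex.mono_homologyMap_iff_up_to_refinements φ _ _ _ hp hn] at h2
  obtain ⟨A', π, hπ, z, hz⟩ := h2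
    (A := ModuleCat.of Q (ULift.{u} Q))
    (ModuleCat.ofHom ((LinearMap.toSpanSingleton Q _ x) ∘ₗ ULift.moduleEquiv.toLinearMap))
    (by ext; simp [hx])
    (ModuleCat.ofHom ((LinearMap.toSpanSingleton Q _ y) ∘ₗ ULift.moduleEquiv.toLinearMap))
    (by ext; simp [hy])
  rw [ModuleCat.epi_iff_surjective] at hπ
  obtain ⟨a, ha⟩ := hπ (ULift.up 1)
  refine ⟨z.hom a, ?_⟩
  have h3 := congrArg (fun F => ModuleCat.Hom.hom F a) hz
  have h4 : π.hom a = ULift.up 1 := ha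
  simpa [h4] using h3

/-- The homology of `K` is `g`-power torsion. -/
def HasTorsionHomology (g : Q) (K : Cplx Q) : Prop :=
  ∀ (j : ZMod 2) (x : K.X (j + 1)), (K.d (j + 1) (j + 1 + 1)).hom x = 0 →
    ∃ (N : ℕ) (y : K.X j), (K.d j (j + 1)).hom y = g ^ N • x

lemma HasTorsionHomology.of_quasiIso {g : Q} {K L : Cplx Q} (h : HasTorsionHomology g L)
    (φ : K ⟶ L) [QuasiIso φ] : HasTorsionHomology g K := by
  intro j x hx
  obtain ⟨N, y, hy⟩ := h j ((φ.f (j + 1)).hom x) (by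
    have h1 := congrArg (fun F => ModuleCat.Hom.hom F x) (φ.comm (j + 1) (j + 1 + 1))
    refine h1.trans ?_
    rw [ModuleCat.hom_comp, LinearMap.comp_apply, hx, map_zero])
  obtain ⟨z, hz⟩ := exists_eq_d_of_quasiIso φ (x := g ^ N • x) (y := y)
    (by rw [map_smul, hx, smul_zero]) (by rw [map_smul, hy])
  exact ⟨N, z, hz.symm⟩

variable (g : Q)

lemma exists_pow_smul_eq_one_tmul {M : Type u} [AddCommGroup M] [Module Q M]
    (y : Localization.Away g ⊗[Q] M) : ∃ (n : ℕ) (c : M), g ^ n • y = 1 ⊗ₜ c := by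
  have : IsLocalizedModule (Submonoid.powers g) (TensorProduct.mk Q (Localization.Away g) M 1) :=
    (isLocalizedModule_iff_isBaseChange (Submonoid.powers g) (Localization.Away g) _).2
      (TensorProduct.isBaseChange Q M (Localization.Away g))
  obtain ⟨⟨c, ⟨s, n, rfl⟩⟩, h⟩ := IsLocalizedModule.surj (Submonoid.powers g)
    (TensorProduct.mk Q (Localization.Away g) M 1) y
  exact ⟨n, c, h⟩

lemma exists_pow_smul_eq_zero {M : Type u} [AddCommGroup M] [Module Q M] {c : M}
    (h : (1 : Localization.Away g) ⊗ₜ[Q] c = 0) : ∃ n : ℕ, g ^ n • c = 0 := by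
  have : IsLocalizedModule (Submonoid.powers g) (TensorProduct.mk Q (Localization.Away g) M 1) :=
    (isLocalizedModule_iff_isBaseChange (Submonoid.powers g) (Localization.Away g) _).2
      (TensorProduct.isBaseChange Q M (Localization.Away g))
  obtain ⟨⟨s, n, rfl⟩, h⟩ := (IsLocalizedModule.eq_zero_iff (Submonoid.powers g)
    (TensorProduct.mk Q (Localization.Away g) M 1)).1 h
  exact ⟨n, h⟩

/-- Take `a = g^{-N}`. The point is that `a` does not depend on the elements to which it is applied.
-/
lemma exists_tmul_eq {M : Type u} [AddCommGroup M] [Module Q M] (N : ℕ) :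
    ∃ a : Localization.Away g, ∀ (y : Localization.Away g ⊗[Q] M) (c : M),
      g ^ N • y = 1 ⊗ₜ c → a ⊗ₜ c = y := by
  obtain ⟨a, ha⟩ := ((IsLocalization.Away.algebraMap_isUnit (S := Localization.Away g) g).pow
    N).exists_left_inv
  refine ⟨a, fun y c h => ?_⟩
  have h1 : a • ((1 : Localization.Away g) ⊗ₜ[Q] c) = a ⊗ₜ c := by
    rw [TensorProduct.smul_tmul', smul_eq_mul, mul_one]
  rw [← h1, ← h, ← algebraMap_smul (Localization.Away g) (g ^ N) y, smul_smul, map_pow, ha,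
    one_smul]

lemma cechOneObj_d (K : Cplx Q) (j : ZMod 2) : (cechOneObj g K).d j (j + 1) = cechD g K j := by
  dsimp only [cechOneObj]
  rw [CochainComplex.of_d]

/-- The augmentation of `(Q → Q[1/g]) ⊗ K` is a quasi-isomorphism if the homology of `K` is
`g`-power torsion. -/
lemma quasiIso_cechOneAug {K : Cplx Q} (h : HasTorsionHomology g K) :
    QuasiIso (cechOneAug g K) := by
  have e : ∀ i : ZMod 2, i = i + 1 + 1 := fun i => (add_one_add_one i).symm
  have hι : ∀ (j : ZMod 2) (z : K.X j), (K.XIsoOfEq (e (j + 1))).hom.hom ((K.d j (j + 1)).hom z) =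
      (K.d (j + 1 + 1) (j + 1 + 1 + 1)).hom ((K.XIsoOfEq (e j)).hom.hom z) := by
    intro j z
    have h1 : K.d j (j + 1) ≫ (K.XIsoOfEq (e (j + 1))).hom =
        (K.XIsoOfEq (e j)).hom ≫ K.d (j + 1 + 1) (j + 1 + 1 + 1) := by
      rw [K.d_comp_XIsoOfEq_hom, K.XIsoOfEq_hom_comp_d]
    exact congrArg (fun F => ModuleCat.Hom.hom F z) h1
  refine quasiIso_of_forall (K := cechOneObj g K) (cechOneAug g K) ?_ ?_
  · rintro j ⟨x, y⟩ z hx hz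
    rw [cechOneObj_d] at hx
    have hx2 := (cechD_snd g K (j + 1) (e _) (x, y)).symm.trans (congrArg Prod.snd hx)
    have hz' : x = (K.d j (j + 1)).hom z := hz
    subst hz'
    -- Subtracting the boundary of `(z, 0)` leaves a cycle `(0, y')`, and `Q[1/g] ⊗ K` is acyclic by
    -- torsion. Explicitly, `g^n y' = 1 ⊗ c`, then `g^m c` is a cycle, and `g^{N+m} c` is the
    -- boundary of some `v`.
    set y' : Localization.Away g ⊗[Q] K.X (j + 1 + 1) :=
      y - 1 ⊗ₜ (K.XIsoOfEq (e j)).hom.hom z with hy'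
    have h1 : LinearMap.lTensor (Localization.Away g) (K.d (j + 1 + 1) (j + 1 + 1 + 1)).hom y' = 0 := by
      rw [hy', map_sub, LinearMap.lTensor_tmul, ← hι, ← neg_eq_zero, neg_sub]
      exact hx2
    obtain ⟨n, c, hc⟩ := exists_pow_smul_eq_one_tmul g y'
    obtain ⟨m, hm⟩ := exists_pow_smul_eq_zero g (c := (K.d (j + 1 + 1) (j + 1 + 1 + 1)).hom c) (by
      rw [← LinearMap.lTensor_tmul, ← hc, map_smul, h1, smul_zero])
    obtain ⟨N, v, hv⟩ := h (j + 1) (g ^ m • c) (by rw [map_smul, hm])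
    obtain ⟨a, ha⟩ := exists_tmul_eq g (M := K.X (j + 1 + 1)) (N + m + n)
    -- Here `a = g^{-(N+m+n)}`. The minus sign compensates the one in the second component of the
    -- Čech differential.
    refine ⟨(z, -(a ⊗ₜ v)), ?_⟩
    rw [cechOneObj_d]
    refine Prod.ext rfl ?_
    refine Eq.trans ?_ (cechD_snd g K j (e _) _).symm
    dsimp only
    rw [map_neg, LinearMap.lTensor_tmul, hv, ha y', hy']
    · abel
    · rw [smul_smul, TensorProduct.tmul_smul, ← hc, smul_smul, ← pow_add, ← pow_add]
  · intro j x hx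
    obtain ⟨N, z, hz⟩ := h j x hx
    obtain ⟨a, ha⟩ := exists_tmul_eq g (M := K.X (j + 1 + 1 + 1)) N
    -- To lift the cycle `x`, its image `1 ⊗ x` must be a boundary in `Q[1/g] ⊗ K`. From `d z = g^N
    -- x` one gets `1 ⊗ x = (id ⊗ d)(g^{-N} ⊗ z)`.
    refine ⟨(x, a ⊗ₜ (K.XIsoOfEq (e j)).hom.hom z), 0, ?_, by rw [map_zero, add_zero]; rfl⟩
    rw [cechOneObj_d]
    refine Prod.ext hx ?_
    refine (cechD_snd g K (j + 1) (e _) _).trans ?_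
    dsimp only
    rw [LinearMap.lTensor_tmul, ← hι, hz, map_smul,
      ha (1 ⊗ₜ (K.XIsoOfEq (e (j + 1))).hom.hom x), sub_self]
    · rfl
    · rw [TensorProduct.tmul_smul]

/-- The augmentation `𝒞(g₁, …, g_m) ⊗ K → K` is a quasi-isomorphism if the homology of `K` is
`g_i`-power torsion for all `i`. -/
lemma quasiIso_cechAug {gs : List Q} {K : Cplx Q} (h : ∀ g ∈ gs, HasTorsionHomology g K) :
    QuasiIso (cechAug gs K) := by
  induction gs with
  | nil => exact inferInstanceAs (QuasiIso (𝟙 K))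
  | cons g gs ih =>
    have h1 := ih fun g hg => h g (List.mem_cons_of_mem _ hg)
    have h2 := quasiIso_cechOneAug g ((h g List.mem_cons_self).of_quasiIso (cechAug gs K))
    exact quasiIso_comp (cechOneAug g ((cech gs).obj K)) (cechAug gs K)

end QuasiIsomorphisms

/-! ### Naturality of the augmentation, and homotopies under the Čech functor -/

section Homotopies

variable {Q : Type u} [CommRing Q]

lemma cechOneAug_naturality (g : Q) {K L : Cplx Q} (φ : K ⟶ L) :
    (cechOne g).map φ ≫ cechOneAug g L = cechOneAug g K ≫ φ := by
  ext j x
  rfl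

lemma cechAug_naturality (gs : List Q) {K L : Cplx Q} (φ : K ⟶ L) :
    (cech gs).map φ ≫ cechAug gs L = cechAug gs K ≫ φ := by
  induction gs with
  | nil => exact (Category.comp_id φ).trans (Category.id_comp φ).symm
  | cons g gs ih =>
    change (cechOne g).map ((cech gs).map φ) ≫ cechOneAug g _ ≫ cechAug gs L =
      (cechOneAug g _ ≫ cechAug gs K) ≫ φ
    rw [← Category.assoc, cechOneAug_naturality, Category.assoc, ih, Category.assoc]

end Homotopies

lemma cplx_d {k Q M : Type u} [CommRing k] [CommRing Q] [AddCommGroup M] [Module k M] [Module Q M]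
    {𝓜 : ZMod 2 → Submodule Q M} {d : M →ₗ[k] M} (h : IsDifferential 𝓜 d) {j : ZMod 2} (x : 𝓜 j) :
    (((cplx 𝓜 d h).d j (j + 1)).hom x : 𝓜 (j + 1)).1 = d x.1 := by
  dsimp only [cplx]
  rw [CochainComplex.of_d]
  rfl

section HH

variable {k Q : Type u} [Field k] [CommRing Q] [Algebra k Q] {f : Q}
variable {I : Type u} (X : I → MatFac k f)

lemma hasTorsionHomology_HH (h : IsDifferential (hochGr X) (hochB X)) {gs : List Q}
    (hX : ∀ i, (X i).supp ⊆ PrimeSpectrum.zeroLocus {g | g ∈ gs}) {g : Q} (hg : g ∈ gs) :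
    HasTorsionHomology g (HH X h) := by
  rintro j ⟨x, hx⟩ hb
  obtain ⟨N, v, hv, e⟩ := exists_hochB_eq X hX hg hx
    ((cplx_d h (⟨x, hx⟩ : hochGr X (j + 1))).symm.trans (congrArg Subtype.val hb))
  rw [add_one_add_one] at hv
  exact ⟨N, ⟨v, hv⟩, Subtype.ext ((cplx_d h (⟨v, hv⟩ : hochGr X j)).trans e)⟩

end HH

section Homotopies

variable {Q : Type u} [CommRing Q]

/-- The maps of `ℤ/2`-graded complexes `φ` and `ψ` are homotopic. -/
def AreHomotopic {K L : Cplx Q} (φ ψ : K ⟶ L) : Prop :=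
  ∃ h : ∀ j, K.X (j + 1) ⟶ L.X j, ∀ j,
    φ.f (j + 1) = K.d (j + 1) (j + 1 + 1) ≫ h (j + 1) + h j ≫ L.d j (j + 1) + ψ.f (j + 1)

lemma AreHomotopic.toD_map_eq {K L : Cplx Q} {φ ψ : K ⟶ L} (h : AreHomotopic φ ψ) :
    (toD Q).map φ = (toD Q).map ψ := by
  obtain ⟨h, hh⟩ := h
  have hF : (ComplexShape.up (ZMod 2)).QFactorsThroughHomotopy (ModuleCat.{u} Q) :=
    ComplexShape.QFactorsThroughHomotopy_of_exists_prev _ (fun j => ⟨j + 1, add_one_add_one j⟩) _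
  have H : Homotopy φ ψ :=
    { hom := fun i j => if e : j + 1 = i then (K.XIsoOfEq e.symm).hom ≫ h j else 0
      zero := fun i j hij => dif_neg hij
      comm := by
        intro i
        obtain ⟨j, rfl⟩ : ∃ j, i = j + 1 := ⟨i + 1, (add_one_add_one i).symm⟩
        rw [dNext_eq _ (show (ComplexShape.up (ZMod 2)).Rel (j + 1) (j + 1 + 1) from rfl),
          prevD_eq _ (show (ComplexShape.up (ZMod 2)).Rel j (j + 1) from rfl), dif_pos rfl,
          dif_pos rfl, hh]
        simp }
  exact HomologicalComplexUpToQuasiIso.Q_map_eq_of_homotopy H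

/-- The homotopy acts by `h` on `K` and by `-id ⊗ h` on the shifted summand, where the differential
is `-id ⊗ d`. The terms mixing the two summands cancel because `h` commutes with the localization
map. -/
lemma AreHomotopic.cechOne {K L : Cplx Q} {φ ψ : K ⟶ L} (h : AreHomotopic φ ψ) (g : Q) :
    AreHomotopic ((cechOne g).map φ) ((HKR.cechOne g).map ψ) := by
  obtain ⟨h, hh⟩ := h
  have e : ∀ i : ZMod 2, i = i + 1 + 1 := fun i => (add_one_add_one i).symm
  have hι : ∀ (j j' : ZMod 2) (hj : j = j') (hj' : j + 1 = j' + 1) (x : K.X (j + 1)),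
      (L.XIsoOfEq hj).hom.hom ((h j).hom x) = (h j').hom ((K.XIsoOfEq hj').hom.hom x) := by
    rintro j _ rfl - x
    rfl
  refine ⟨fun j => ModuleCat.ofHom (LinearMap.prodMap (h j).hom (-(locMap g (h (j + 1))).hom)),
    fun j => ?_⟩
  have hK : ((HKR.cechOne g).obj K).d (j + 1) (j + 1 + 1) = cechD g K (j + 1) := cechOneObj_d g K _
  have hL : ((HKR.cechOne g).obj L).d j (j + 1) = cechD g L j := cechOneObj_d g L j
  rw [hK, hL]
  refine ModuleCat.hom_ext (LinearMap.ext fun x => Prod.ext ?_ ?_)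
  · exact congrArg (fun F => ModuleCat.Hom.hom F x.1) (hh j)
  · have h1 := congrArg (fun F => LinearMap.lTensor (Localization.Away g) (ModuleCat.Hom.hom F) x.2)
      (hh (j + 1))
    simp only [ModuleCat.hom_add, ModuleCat.hom_comp, LinearMap.lTensor_add,
      LinearMap.lTensor_comp, LinearMap.add_apply, LinearMap.comp_apply] at h1
    have h2 := hι j _ (e j) (e (j + 1)) x.1
    change LinearMap.lTensor (Localization.Away g) (φ.f (j + 1 + 1)).hom x.2 =
      -LinearMap.lTensor (Localization.Away g) (h (j + 1 + 1)).hom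
        (1 ⊗ₜ (K.XIsoOfEq (e (j + 1))).hom.hom x.1 -
          LinearMap.lTensor _ (K.d (j + 1 + 1) (j + 1 + 1 + 1)).hom x.2) +
      (1 ⊗ₜ (L.XIsoOfEq (e j)).hom.hom ((h j).hom x.1) -
        LinearMap.lTensor _ (L.d (j + 1) (j + 1 + 1)).hom
          (-LinearMap.lTensor (Localization.Away g) (h (j + 1)).hom x.2)) +
      LinearMap.lTensor (Localization.Away g) (ψ.f (j + 1 + 1)).hom x.2
    rw [h1, h2, map_sub, map_neg, LinearMap.lTensor_tmul]
    abel

lemma AreHomotopic.cech {K L : Cplx Q} {φ ψ : K ⟶ L} (h : AreHomotopic φ ψ) (gs : List Q) :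
    AreHomotopic ((cech gs).map φ) ((HKR.cech gs).map ψ) := by
  induction gs with
  | nil => exact h
  | cons g gs ih => exact ih.cechOne g

/-- A strictly commutative square of complexes gives a commutative square of maps with supports,
since the augmentation is natural and invertible in `D(Q)` for the two sources. -/
lemma inv_cechAug_comp_eq {gs : List Q} {A B F G : Cplx Q} {p : A ⟶ B} {a : A ⟶ F} {b : B ⟶ G}
    {c : F ⟶ G} (h : a ≫ c = p ≫ b) [IsIso ((toD Q).map (cechAug gs A))]
    [IsIso ((toD Q).map (cechAug gs B))] :
    (inv ((toD Q).map (cechAug gs A)) ≫ (toD Q).map ((HKR.cech gs).map a)) ≫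
        (toD Q).map ((HKR.cech gs).map c) =
      (toD Q).map p ≫ inv ((toD Q).map (cechAug gs B)) ≫ (toD Q).map ((HKR.cech gs).map b) := by
  have e : (toD Q).map ((HKR.cech gs).map p) ≫ (toD Q).map (cechAug gs B) =
      (toD Q).map (cechAug gs A) ≫ (toD Q).map p := by
    rw [← Functor.map_comp, cechAug_naturality, Functor.map_comp]
  rw [Category.assoc, ← Functor.map_comp, ← Functor.map_comp, h, Functor.map_comp,
    Functor.map_comp, IsIso.inv_comp_eq, ← Category.assoc _ ((toD Q).map p), ← e, Category.assoc,
    IsIso.hom_inv_id_assoc]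

end Homotopies

/-! ### Independence of the connections, and the theorem -/

section HKRMap

variable {k Q : Type u} [Field k] [CharZero k] [CommRing Q] [Algebra k Q]
  [Module.Finite Q Ω[Q⁄k]] {f : Q} {I : Type u} (X : I → MatFac k f)

/-- Up to homotopy, the HKR map does not depend on the connections. -/
lemma areHomotopic_hkrMap (c₀ c₁ : ∀ i, (X i).Connection)
    (h : IsDifferential (hochGr X) (hochB X)) (h₀ : IsHKRChainMap X c₀) (h₁ : IsHKRChainMap X c₁) :
    AreHomotopic (hkrMap X c₀ h h₀) (hkrMap X c₁ h h₁) := by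
  -- The factor `sgn (j + 1)` absorbs the sign in `hkrHtpy_hochB`. Since it alternates with the
  -- degree, it also turns the difference `H b - d H` into the sum required of a homotopy.
  refine ⟨fun j => ModuleCat.ofHom
    { toFun := fun x : hochGr X (j + 1) => (⟨sgn (j + 1) • hkrHtpy c₀ c₁ x.1, by
          have := hkrHtpy_mem X c₀ c₁ x.2
          rw [add_one_add_one] at this
          exact zsmul_mem this _⟩ : formsGr k Q j)
      map_add' := fun x y => Subtype.ext (by simp)
      map_smul' := fun q x => Subtype.ext (by
        simp [hkrHtpy_smul X c₀ c₁ x.2]) }, fun j => ?_⟩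
  refine ModuleCat.hom_ext (LinearMap.ext fun x => Subtype.ext ?_)
  obtain ⟨x, hx⟩ := x
  have h1 := hkrHtpy_hochB X c₀ c₁ hx
  have h2 := cplx_d h (⟨x, hx⟩ : hochGr X (j + 1))
  change hkr X c₀ x = sgn (j + 1 + 1) • hkrHtpy c₀ c₁ (_ : hochGr X (j + 1 + 1)).1 +
    (((formsCplx k (-f)).d j (j + 1)).hom _ : formsGr k Q (j + 1)).1 + hkr X c₁ x
  refine Eq.trans ?_ (congrArg₂ (fun a b => sgn (j + 1 + 1) • hkrHtpy c₀ c₁ a + b + hkr X c₁ x)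
    h2.symm (cplx_d (formsD_isDifferential (-f)) _).symm)
  dsimp only
  have h3 : formsD (k := k) (-f) (sgn (j + 1) • hkrHtpy c₀ c₁ x) =
    sgn (j + 1) • formsD (-f) (hkrHtpy c₀ c₁ x) := map_zsmul _ _ _
  refine Eq.trans ?_ (congrArg (fun b => sgn (j + 1 + 1) • hkrHtpy c₀ c₁ (hochB X x) + b +
    hkr X c₁ x) h3.symm)
  rw [h1]
  rcases parity_cases j with rfl | rfl <;>
    simp [sgn, show (1 : ZMod 2) + 1 = 0 from rfl]

end HKRMap

/-- The HKR maps with supports are compatible with duality. -/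
theorem hkrZ_comp_gamma {k Q : Type u} [Field k] [CharZero k] [CommRing Q] [Algebra k Q]
    [Algebra.EssFiniteType k Q] {f : Q} {gs : List Q} {I J : Type u} {X : I → MatFac k f}
    {Y : J → MatFac k (-f)} (hX : ∀ i, (X i).supp ⊆ PrimeSpectrum.zeroLocus {g | g ∈ gs})
    (hY : ∀ j, (Y j).supp ⊆ PrimeSpectrum.zeroLocus {g | g ∈ gs})
    (cX : ∀ i, (X i).Connection) (cY : ∀ j, (Y j).Connection)
    (σ : I → J) (u : ∀ i, MatFac.Iso (X i).dual (Y (σ i))) :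
    ∃ (bX : IsDifferential (hochGr X) (hochB X))
      (bY : IsDifferential (hochGr Y) (hochB Y))
      (hΨ : IsChainMap (hochGr X) (hochB X) (hochGr Y) (hochB Y)
        (psi X Y σ u))
      (eX : IsHKRChainMap X cX) (eY : IsHKRChainMap Y cY)
      (sX : QuasiIso (cechAug gs (HH X bX)))
      (sY : QuasiIso (cechAug gs (HH Y bY))),
      hkrZ X cX gs bX eX sX ≫ (toD Q).map ((cech gs).map (gamma k (-f))) =
        (toD Q).map (cplxMap bX bY (psi X Y σ u) hΨ) ≫ hkrZ Y cY gs bY eY sY := by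
  have : Module.Finite Q Ω[Q⁄k] := KaehlerDifferential.finite k Q
  have bX := hochB_isDifferential X
  have bY := hochB_isDifferential Y
  have hΨ := psi_isChainMap X Y σ u
  have eX := isHKRChainMap X cX
  have eY := isHKRChainMap Y cY
  have sX : QuasiIso (cechAug gs (HH X bX)) :=
    quasiIso_cechAug fun g hg => hasTorsionHomology_HH X bX hX hg
  have sY : QuasiIso (cechAug gs (HH Y bY)) :=
    quasiIso_cechAug fun g hg => hasTorsionHomology_HH Y bY hY hg
  refine ⟨bX, bY, hΨ, eX, eY, sX, sY, ?_⟩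
  -- The given connections on the objects `X i` are replaced by the duals of those on the objects `Y
  -- j`. In `D(Q)` this does not change the HKR map, and for the dual connections the square of
  -- complexes commutes strictly.
  have eT := isHKRChainMap X (dualConns X u cY)
  have h1 := ((areHomotopic_hkrMap X cX (dualConns X u cY) bX eX eT).cech gs).toD_map_eq
  have h2 : hkrMap X (dualConns X u cY) bX eT ≫ gamma k (-f) =
      cplxMap bX bY (psi X Y σ u) hΨ ≫ hkrMap Y cY bY eY := by
    ext j x
    exact Subtype.ext (hkr_psi u cY x.2).symm
  have iX : IsIso ((toD Q).map (cechAug gs (HH X bX))) :=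
    (HomologicalComplexUpToQuasiIso.isIso_Q_map_iff_mem_quasiIso _).2
      ((HomologicalComplex.mem_quasiIso_iff _).2 sX)
  have iY : IsIso ((toD Q).map (cechAug gs (HH Y bY))) :=
    (HomologicalComplexUpToQuasiIso.isIso_Q_map_iff_mem_quasiIso _).2
      ((HomologicalComplex.mem_quasiIso_iff _).2 sY)
  have h3 := inv_cechAug_comp_eq (gs := gs) (A := HH X bX) (B := HH Y bY) h2
  rw [← h1] at h3
  exact h3

end HKR

end

theorem mainTheorem6 {k Q : Type u} [Field k] [CharZero k] [CommRing Q] [Algebra k Q]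
    [Algebra.EssFiniteType k Q] [Algebra.FormallySmooth k Q] (f : Q)
    (Z : Set (PrimeSpectrum Q)) (gs : List Q) (hZ : Z = PrimeSpectrum.zeroLocus {g | g ∈ gs})
    {I J : Type u} (X : I → HKR.MatFac k f) (Y : J → HKR.MatFac k (-f))
    (hX : HKR.IsModel Z X) (hY : HKR.IsModel Z Y)
    (cX : ∀ i, (X i).Connection) (cY : ∀ j, (Y j).Connection)
    (σ : I → J) (u : ∀ i, HKR.MatFac.Iso (X i).dual (Y (σ i))) :
    ∃ (bX : HKR.IsDifferential (HKR.hochGr X) (HKR.hochB X))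
      (bY : HKR.IsDifferential (HKR.hochGr Y) (HKR.hochB Y))
      (hΨ : HKR.IsChainMap (HKR.hochGr X) (HKR.hochB X) (HKR.hochGr Y) (HKR.hochB Y)
        (HKR.psi X Y σ u))
      (eX : HKR.IsHKRChainMap X cX) (eY : HKR.IsHKRChainMap Y cY)
      (sX : QuasiIso (HKR.cechAug gs (HKR.HH X bX)))
      (sY : QuasiIso (HKR.cechAug gs (HKR.HH Y bY))),
      HKR.hkrZ X cX gs bX eX sX ≫ (HKR.toD Q).map ((HKR.cech gs).map (HKR.gamma k (-f))) =
        (HKR.toD Q).map (HKR.cplxMap bX bY (HKR.psi X Y σ u) hΨ) ≫ HKR.hkrZ Y cY gs bY eY sY := by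
  subst hZ
  exact HKR.hkrZ_comp_gamma hX.supp_subset hY.supp_subset cX cY σ u
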